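/- Algorithms are deterministic random access machines (finite programs with registers, random access memory, arithmetic on natural numbers, conditionals and loops) with logarithmic cost: an elementary step costs one plus the number of bits of the numbers and addresses it handles. Inputs are given in memory as sequences of natural numbers. A path decomposition of a graph $G=(V,E)$ is a sequence of bags $B_1,\dots,B_t\subseteq V$ such that every vertex lies in some bag, both endpoints of every edge lie in a common bag, and for every vertex the indices of the bags containing it form an interval; its width is $\max_j |B_j|-1$. The primal graph of a CNF formula has the variables as vertices, two distinct variables being adjacent if they occur together in a clause. The PP-SETH is the following hypothesis: for no $\varepsilon>0$ is there an algorithm that takes as input a 3-CNF formula (clauses with at most three literals) and a path decomposition of its primal graph, of width $\mathrm{pw}\ge 0$, and decides whether the formula is satisfiable in time $(2-\varepsilon)^{\mathrm{pw}}\cdot N^{O(1)}$, where $N$ is the size of the instance (number of variables plus number of clauses plus number of bags). An instance of List Coloring consists of a graph $G$ on $n$ vertices, a finite list $L(v)$ of colors for each vertex $v$, and a path decomposition of $G$; the question is whether $G$ has a proper coloring in which every vertex $v$ receives a color of $L(v)$. Fix an integer $d\ge 1$ and consider only instances in which the colors are natural numbers less than $n^d$ and the path decomposition has at most $n^d$ bags.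 Theorem. The following statements are equivalent: (1) The PP-SETH is false. (2) There exist a real $\varepsilon>0$, an integer $p>4$ and an algorithm that solves List Coloring on all instances with $n$ vertices and a path decomposition of width $p$ in time $O(n^{p-4-\varepsilon})$. (3) There exist a real $\varepsilon>0$, an integer $p_0>0$ and one algorithm that, for all $p>p_0$, solves List Coloring on all instances with $n$ vertices and a path decomposition of width $p$ in time $O(n^{(1-\varepsilon)p})$, with an implied constant that does not depend on $p$. -/

import Mathlib

/-! ## Random access machines with logarithmic cost -/

/-- Arithmetic operations on natural numbers (truncated subtraction; division rounds down,
and division by zero returns zero). -/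
inductive ArithOp where
  | add
  | sub
  | mul
  | div

def ArithOp.eval : ArithOp → ℕ → ℕ → ℕ
  | .add, x, y => x + y
  | .sub, x, y => x - y
  | .mul, x, y => x * y
  | .div, x, y => x / y

/-- A program of a random access machine, with structured control flow. The machine has
registers and a random access memory, both holding natural numbers. The numbers `d`, `a`, `b`
name registers; a program is a finite object and mentions finitely many registers. -/
inductive RAMProg where
  /-- `R[d] := k` -/
  | const (d k : ℕ)
  /-- `R[d] := R[a] op R[b]` -/
  | arith (op : ArithOp) (d a b : ℕ)
  /-- `R[d] := M[R[a]]` -/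
  | load (d a : ℕ)
  /-- `M[R[a]] := R[b]` -/
  | store (a b : ℕ)
  /-- run one program after the other -/
  | seq (P Q : RAMProg)
  /-- if `R[a] ≠ 0` then the first program else the second one -/
  | cond (a : ℕ) (P Q : RAMProg)
  /-- while `R[a] ≠ 0` repeat the program -/
  | loop (a : ℕ) (P : RAMProg)

structure RAMState where
  reg : ℕ → ℕ
  mem : ℕ → ℕ

def RAMState.setReg (s : RAMState) (d v : ℕ) : RAMState :=
  { s with reg := Function.update s.reg d v }

def RAMState.setMem (s : RAMState) (a v : ℕ) : RAMState :=
  { s with mem := Function.update s.mem a v }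

/-- `RAMExec P s t s'`: the program `P`, started in the state `s`, halts in the state `s'`
after time `t`. Every elementary step costs one plus the number of bits of the numbers and
memory addresses that it handles (logarithmic cost). -/
inductive RAMExec : RAMProg → RAMState → ℕ → RAMState → Prop where
  | const (s : RAMState) (d k : ℕ) :
      RAMExec (.const d k) s (1 + Nat.size k) (s.setReg d k)
  | arith (s : RAMState) (op : ArithOp) (d a b : ℕ) :
      RAMExec (.arith op d a b) s (1 + Nat.size (s.reg a) + Nat.size (s.reg b))
        (s.setReg d (op.eval (s.reg a) (s.reg b)))
  | load (s : RAMState) (d a : ℕ) :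
      RAMExec (.load d a) s (1 + Nat.size (s.reg a) + Nat.size (s.mem (s.reg a)))
        (s.setReg d (s.mem (s.reg a)))
  | store (s : RAMState) (a b : ℕ) :
      RAMExec (.store a b) s (1 + Nat.size (s.reg a) + Nat.size (s.reg b))
        (s.setMem (s.reg a) (s.reg b))
  | seq {P Q : RAMProg} {s s' s'' : RAMState} {t t' : ℕ} :
      RAMExec P s t s' → RAMExec Q s' t' s'' → RAMExec (.seq P Q) s (t + t') s''
  | cond_true {a : ℕ} {P Q : RAMProg} {s s' : RAMState} {t : ℕ} :
      s.reg a ≠ 0 → RAMExec P s t s' →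
        RAMExec (.cond a P Q) s (1 + Nat.size (s.reg a) + t) s'
  | cond_false {a : ℕ} {P Q : RAMProg} {s s' : RAMState} {t : ℕ} :
      s.reg a = 0 → RAMExec Q s t s' →
        RAMExec (.cond a P Q) s (1 + t) s'
  | loop_true {a : ℕ} {P : RAMProg} {s s' s'' : RAMState} {t t' : ℕ} :
      s.reg a ≠ 0 → RAMExec P s t s' → RAMExec (.loop a P) s' t' s'' →
        RAMExec (.loop a P) s (1 + Nat.size (s.reg a) + t + t') s''
  | loop_false {a : ℕ} {P : RAMProg} {s : RAMState} :
      s.reg a = 0 → RAMExec (.loop a P) s 1 s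

/-- The initial state on an input word: the `i`-th entry of the word is in memory cell `i`,
all other memory cells and all registers are zero. -/
def RAMState.init (w : List ℕ) : RAMState where
  reg := fun _ => 0
  mem := fun i => w.getD i 0

/-- On the input `w`, the program halts within time `T`, and it accepts (register `0` is
nonzero at the end) if and only if `answer` holds. -/
def RAMProg.DecidesWithin (P : RAMProg) (w : List ℕ) (answer : Prop) (T : ℝ) : Prop :=
  ∃ (t : ℕ) (s : RAMState),
    RAMExec P (RAMState.init w) t s ∧ (t : ℝ) ≤ T ∧ (s.reg 0 ≠ 0 ↔ answer)

/-! ## Path decompositions -/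

/-- The sequence of bags `B` is a path decomposition of the graph `G`. -/
def IsPathDecomposition {V : Type*} (G : SimpleGraph V) (B : List (Finset V)) : Prop :=
  (∀ v : V, ∃ b ∈ B, v ∈ b) ∧
  (∀ u v : V, G.Adj u v → ∃ b ∈ B, u ∈ b ∧ v ∈ b) ∧
  (∀ i j k : Fin B.length, i ≤ j → j ≤ k → ∀ v : V,
    v ∈ B.get i → v ∈ B.get k → v ∈ B.get j)

/-- The maximum size of a bag is `w + 1`. -/
def HasWidth {V : Type*} (B : List (Finset V)) (w : ℕ) : Prop :=
  (∀ b ∈ B, b.card ≤ w + 1) ∧ ∃ b ∈ B, b.card = w + 1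

/-- The bags, written as lists of vertices, become finite sets of vertices. -/
def bagSets {n : ℕ} (B : List (List (Fin n))) : List (Finset (Fin n)) :=
  B.map List.toFinset

/-- A sequence of bags as a word: the number of bags, then for each bag its size and
its elements. -/
def encodeBags {n : ℕ} (B : List (List (Fin n))) : List ℕ :=
  B.length :: B.flatMap (fun b => b.length :: b.map (fun v => (v : ℕ)))

/-! ## 3-SAT with a path decomposition of the primal graph -/

/-- The literal `(x, true)` is `x`, the literal `(x, false)` is its negation. -/
abbrev Literal (n : ℕ) : Type := Fin n × Bool

abbrev Clause (n : ℕ) : Type := List (Literal n)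

/-- Two distinct variables are adjacent if they appear together in some clause. -/
def primalGraph {n : ℕ} (φ : List (Clause n)) : SimpleGraph (Fin n) :=
  SimpleGraph.fromRel fun x y => ∃ c ∈ φ, x ∈ c.map Prod.fst ∧ y ∈ c.map Prod.fst

/-- A 3-CNF formula together with a path decomposition of its primal graph. -/
structure ThreeSATInstance where
  numVars : ℕ
  clauses : List (Clause numVars)
  bags : List (List (Fin numVars))
  clauses_length : ∀ c ∈ clauses, c.length ≤ 3
  bags_nodup : ∀ b ∈ bags, b.Nodup
  isPathDecomposition : IsPathDecomposition (primalGraph clauses) (bagSets bags)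

namespace ThreeSATInstance

def Satisfiable (I : ThreeSATInstance) : Prop :=
  ∃ α : Fin I.numVars → Bool, ∀ c ∈ I.clauses, ∃ l ∈ c, α l.1 = l.2

/-- The input word: numbers of variables and clauses, then for each clause its length and its
literals (`2 x + 1` for the variable `x`, and `2 x` for its negation), then the bags. -/
def encode (I : ThreeSATInstance) : List ℕ :=
  [I.numVars, I.clauses.length] ++
  I.clauses.flatMap (fun c =>
    c.length :: c.map (fun l => 2 * (l.1 : ℕ) + (if l.2 then 1 else 0))) ++
  encodeBags I.bags

/-- The size of an instance: number of variables plus number of clauses plus number of bags. -/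
def size (I : ThreeSATInstance) : ℕ :=
  I.numVars + I.clauses.length + I.bags.length

end ThreeSATInstance

/-- The primal pathwidth strong exponential time hypothesis: for no `ε > 0` is there an
algorithm that decides 3-SAT in time `(2 - ε) ^ pw * N ^ O(1)`, where `pw` is the width of the
path decomposition of the primal graph that is given with the formula, and `N` is the size of
the instance. -/
def PPSETH : Prop :=
  ∀ ε : ℝ, 0 < ε →
    ¬ ∃ (P : RAMProg) (C : ℝ) (c : ℕ),
      ∀ (I : ThreeSATInstance) (pw : ℕ), HasWidth (bagSets I.bags) pw →
        P.DecidesWithin I.encode I.Satisfiable (C * (2 - ε) ^ pw * (I.size : ℝ) ^ c)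

/-! ## List Coloring with a path decomposition -/

/-- A graph with a list of available colors for each vertex and a path decomposition of the
graph. Every edge is listed once, with its smaller endpoint first. -/
structure ListColoringInstance where
  numVertices : ℕ
  edges : List (Fin numVertices × Fin numVertices)
  colors : Fin numVertices → List ℕ
  bags : List (List (Fin numVertices))
  edges_lt : ∀ e ∈ edges, e.1 < e.2
  edges_nodup : edges.Nodup
  colors_nodup : ∀ v, (colors v).Nodup
  bags_nodup : ∀ b ∈ bags, b.Nodup
  isPathDecomposition :
    IsPathDecomposition (SimpleGraph.fromRel fun u v => (u, v) ∈ edges) (bagSets bags)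

namespace ListColoringInstance

def graph (I : ListColoringInstance) : SimpleGraph (Fin I.numVertices) :=
  SimpleGraph.fromRel fun u v => (u, v) ∈ I.edges

/-- There is a proper coloring that gives each vertex a color of its list. -/
def Colorable (I : ListColoringInstance) : Prop :=
  ∃ f : Fin I.numVertices → ℕ,
    (∀ v, f v ∈ I.colors v) ∧ ∀ u v, I.graph.Adj u v → f u ≠ f v

/-- The input word: numbers of vertices and edges, the endpoints of the edges, for each vertex
the size of its list and its list, then the bags. -/
def encode (I : ListColoringInstance) : List ℕ :=
  [I.numVertices, I.edges.length] ++
  I.edges.flatMap (fun e => [(e.1 : ℕ), (e.2 : ℕ)]) ++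
  (List.finRange I.numVertices).flatMap (fun v => (I.colors v).length :: I.colors v) ++
  encodeBags I.bags

/-- With `n` the number of vertices, the colors are numbers below `n ^ d`, and there are at
most `n ^ d` bags. Thus the input has size polynomial in `n`, without which no running time
that depends on `n` alone would make sense. -/
def PolySize (I : ListColoringInstance) (d : ℕ) : Prop :=
  (∀ v, ∀ c ∈ I.colors v, c < I.numVertices ^ d) ∧ I.bags.length ≤ I.numVertices ^ d

end ListColoringInstance

/-!
The two nontrivial implications are reductions between List Coloring and 3-SAT, both of which
preserve the pathwidth up to the right factor.

From List Coloring to 3-SAT (`ColData.exists_reduction`, `listColoring_of_not_PPSETH`): only the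
first `n` colors of each list matter, because a vertex with at least `n` colors can be colored last
(`ColData.Valid.exists_lt`). The position of the color of a vertex is spelled by `L = ⌈log₂ n⌉`
variables. For every bag, every pair of its vertices and every pair of positions that is not
allowed, a clause of length `2 L` excludes this pair; it is split into clauses of length three by
auxiliary variables, of which each bag needs only two at a time (`ColData.Valid.satisfiable_iff`).
The width becomes `(p + 1) L + 1`, so an algorithm with base `2 - ε` takes time
`n ^ (γ (p + 1) + O(1))` with `γ < 1`, and for large `p` the term `O(1)` does no harm.

An algorithm for all large `p` gives one for a single `p`, namely for a `p` with `ε p ≥ 5`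
(`exists_width_of_forall_width`).

From 3-SAT to List Coloring of width `p = k + 4` (`SatData.exists_reduction`,
`not_PPSETH_of_two_le`): each bag is divided into `k` groups of `b ≈ pw / k` variables, and the
assignments of a group become the `q = 2 ^ b` colors of one vertex. The groups of all bags form a
single sequence. If the variables of a bag are ordered by their first occurrence, then from one bag
to the next a variable only moves towards the front (`SatData.Valid.rank_succ_le`). Therefore the
two vertices that contain its value in consecutive bags lie in a window of `k + 1` vertices of the
sequence, and so do the vertices of the variables of a clause. Everything that has to be said is a
disjunction of at most three literals on bits of vertices of a window
(`SatData.Valid.solvable_iff`). Such a constraint is expressed by three vertices, one for each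
literal, and by `3 q + 1` test vertices, of which a bag contains one at a time
(`WindowData.colorable_iff`). So the bags have `(k + 1) + 3 + 1` vertices, the number of vertices is
`q` times a polynomial, and time `n ^ (k - ε)` is about `2 ^ (pw (1 - ε / k))`. The reduction takes
time `q` times a polynomial, which is below `n ^ (k - ε)` if `k ≥ 2`. If `k = 1`, then the assumed
algorithm would be sublinear. There is none, as it could not read all the lists
(`ListColoringInstance.not_sublinear`).

The reductions are programs of a random access machine. They are written in a small language of
arithmetic expressions with bounded sums (`RAM.Ex`) and of commands that append numbers to the word
in memory (`RAM.Cmd`). The input remains in place, and the output is appended to it. The language is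
compiled once and for all to machine programs, with a time bound that is proportional to the length
of the output (`RAM.Cmd.comp_spec`). Finally the output is moved to the beginning of the memory,
where it becomes the input of the given algorithm (`decidesWithin_comp`).
-/

/-! ### Running programs with a time bound -/

namespace RAM

/-- The program `P`, started in `s`, halts in `s'` within time `B`. -/
def Run (P : RAMProg) (s : RAMState) (B : ℕ) (s' : RAMState) : Prop :=
  ∃ t ≤ B, RAMExec P s t s'

@[simp] lemma setReg_reg (s : RAMState) (d v r : ℕ) :
    (s.setReg d v).reg r = if r = d then v else s.reg r := by
  simp [RAMState.setReg, Function.update_apply]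

@[simp] lemma setReg_mem (s : RAMState) (d v : ℕ) : (s.setReg d v).mem = s.mem := rfl

@[simp] lemma setMem_mem (s : RAMState) (d v r : ℕ) :
    (s.setMem d v).mem r = if r = d then v else s.mem r := by
  simp [RAMState.setMem, Function.update_apply]

@[simp] lemma setMem_reg (s : RAMState) (d v : ℕ) : (s.setMem d v).reg = s.reg := rfl

lemma Run.mono {P : RAMProg} {s s' : RAMState} {B B' : ℕ} (h : Run P s B s') (hB : B ≤ B') :
    Run P s B' s' := by
  obtain ⟨t, ht, he⟩ := h
  exact ⟨t, ht.trans hB, he⟩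

lemma Run.seq {P Q : RAMProg} {s s' s'' : RAMState} {B B' : ℕ} (h : Run P s B s')
    (h' : Run Q s' B' s'') : Run (.seq P Q) s (B + B') s'' := by
  obtain ⟨t, ht, he⟩ := h
  obtain ⟨t', ht', he'⟩ := h'
  exact ⟨t + t', by omega, .seq he he'⟩

lemma Run.const (s : RAMState) (d k : ℕ) : Run (.const d k) s (1 + Nat.size k) (s.setReg d k) :=
  ⟨_, le_rfl, .const s d k⟩

lemma Run.arith (s : RAMState) (op : ArithOp) (d a b : ℕ) :
    Run (.arith op d a b) s (1 + Nat.size (s.reg a) + Nat.size (s.reg b))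
      (s.setReg d (op.eval (s.reg a) (s.reg b))) :=
  ⟨_, le_rfl, .arith s op d a b⟩

lemma Run.load (s : RAMState) (d a : ℕ) :
    Run (.load d a) s (1 + Nat.size (s.reg a) + Nat.size (s.mem (s.reg a)))
      (s.setReg d (s.mem (s.reg a))) :=
  ⟨_, le_rfl, .load s d a⟩

lemma Run.store (s : RAMState) (a b : ℕ) :
    Run (.store a b) s (1 + Nat.size (s.reg a) + Nat.size (s.reg b))
      (s.setMem (s.reg a) (s.reg b)) :=
  ⟨_, le_rfl, .store s a b⟩

/-- A loop whose counter goes down from `N` to `0`, with an invariant indexed by the number of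
completed rounds. -/
lemma Run.countLoop {a : ℕ} {P : RAMProg} {N : ℕ} (Inv : ℕ → RAMState → Prop) (B : ℕ → ℕ)
    (hstep : ∀ i < N, ∀ s, Inv i s → s.reg a = N - i →
      ∃ s', Run P s (B i) s' ∧ Inv (i + 1) s' ∧ s'.reg a = N - (i + 1))
    {s : RAMState} (h0 : Inv 0 s) (hN : s.reg a = N) :
    ∃ s', Run (.loop a P) s ((∑ i ∈ Finset.range N, (1 + Nat.size N + B i)) + 1) s' ∧
      Inv N s' ∧ s'.reg a = 0 := by
  suffices H : ∀ m i, i + m = N → ∀ s, Inv i s → s.reg a = N - i →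
      ∃ s', Run (.loop a P) s ((∑ i ∈ Finset.Ico i N, (1 + Nat.size N + B i)) + 1) s' ∧
        Inv N s' ∧ s'.reg a = 0 by
    simpa using H N 0 (by simp) s h0 (by simpa using hN)
  intro m
  induction m with
  | zero =>
    intro i hi s hI hs
    have hiN : i = N := by omega
    subst hiN
    refine ⟨s, ⟨1, by simp, .loop_false (by simpa using hs)⟩, hI, by simpa using hs⟩
  | succ m ih =>
    intro i hi s hI hs
    obtain ⟨s1, ⟨t1, ht1, he1⟩, hI1, hr1⟩ := hstep i (by omega) s hI hs
    obtain ⟨s2, ⟨t2, ht2, he2⟩, hI2, hr2⟩ := ih (i + 1) (by omega) s1 hI1 hr1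
    refine ⟨s2, ⟨1 + Nat.size (s.reg a) + t1 + t2, ?_, .loop_true ?_ he1 he2⟩, hI2, hr2⟩
    · rw [Finset.sum_eq_sum_Ico_succ_bot (by omega : i < N)]
      have : Nat.size (s.reg a) ≤ Nat.size N := Nat.size_le_size (by omega)
      omega
    · omega

end RAM

/-! ### A language of expressions with bounded sums -/

namespace RAM

/-- Arithmetic expressions over variables and a memory that holds a finite word. -/
inductive Ex where
  | c (k : ℕ)
  | v (x : ℕ)
  /-- the length of the word in memory -/
  | lim
  | op (o : ArithOp) (a b : Ex)
  /-- the entry of the word at a given position (zero beyond its end) -/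
  | mem (a : Ex)
  /-- `∑ x < n, e` -/
  | sum (x : ℕ) (n e : Ex)

namespace Ex

/-- The value of an expression for the values `ρ` of the variables and the word `w`. -/
def eval (ρ : ℕ → ℕ) (w : List ℕ) : Ex → ℕ
  | c k => k
  | v x => ρ x
  | lim => w.length
  | op o a b => o.eval (a.eval ρ w) (b.eval ρ w)
  | mem a => w.getD (a.eval ρ w) 0
  | sum x n e => ∑ i ∈ Finset.range (n.eval ρ w), e.eval (Function.update ρ x i) w

/-- The program that evaluates an expression into the register `j`. The variable `x` lives in
the register `σ x`, and the registers from `j` on are free. Register `1` holds the length of the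
word and register `2` holds zero. -/
def comp (σ : ℕ → ℕ) (j : ℕ) : Ex → RAMProg
  | c k => .const j k
  | v x => .arith .add j (σ x) 2
  | lim => .arith .add j 1 2
  | op o a b => .seq (a.comp σ j) (.seq (b.comp σ (j + 1)) (.arith o j j (j + 1)))
  | mem a => .seq (a.comp σ j) (.seq (.arith .sub (j + 1) 1 j)
      (.cond (j + 1) (.load j j) (.const j 0)))
  | sum x n e => .seq (n.comp σ j) (.seq (.const (j + 1) 0) (.seq (.const (j + 2) 0)
      (.seq (.loop j (.seq (e.comp (Function.update σ x (j + 2)) (j + 3))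
          (.seq (.arith .add (j + 1) (j + 1) (j + 3)) (.seq (.const (j + 3) 1)
            (.seq (.arith .add (j + 2) (j + 2) (j + 3)) (.arith .sub j j (j + 3)))))))
        (.arith .add j (j + 1) 2))))

/-- A bound on the value of an expression, if `V` bounds the variables, the length of the word
and its entries. -/
def vb : Ex → ℕ → ℕ
  | c k, _ => k
  | v _, V => V
  | lim, V => V
  | op .add a b, V => a.vb V + b.vb V
  | op .sub a _, V => a.vb V
  | op .mul a b, V => a.vb V * b.vb V
  | op .div a _, V => a.vb V
  | mem _, V => V
  | sum _ n e, V => n.vb V * e.vb (V + n.vb V)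

/-- A bound on the evaluation time of an expression, if `V` bounds the variables, the length of
the word and its entries. -/
def ct : Ex → ℕ → ℕ
  | c k, _ => 1 + Nat.size k
  | v _, V => 1 + Nat.size V
  | lim, V => 1 + Nat.size V
  | op _ a b, V => a.ct V + b.ct V + (1 + Nat.size (a.vb V) + Nat.size (b.vb V))
  | mem a, V => a.ct V + (3 + 3 * Nat.size V + 2 * Nat.size (a.vb V))
  | sum x n e, V => n.ct V + n.vb V * (e.ct (V + n.vb V) + (11 + Nat.size ((sum x n e).vb V) +
      Nat.size (e.vb (V + n.vb V)) + 3 * Nat.size (n.vb V))) + 4 + Nat.size ((sum x n e).vb V)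

end Ex

/-- The number `V` bounds the variables, the length of the word and its entries. -/
structure Bounds (V : ℕ) (ρ : ℕ → ℕ) (w : List ℕ) : Prop where
  var : ∀ x, ρ x ≤ V
  entry : ∀ a, w.getD a 0 ≤ V
  length : w.length ≤ V

lemma Bounds.mono {V V' : ℕ} {ρ : ℕ → ℕ} {w : List ℕ} (h : Bounds V ρ w) (hV : V ≤ V') :
    Bounds V' ρ w :=
  ⟨fun x => (h.var x).trans hV, fun a => (h.entry a).trans hV, h.length.trans hV⟩

lemma Bounds.bind {V n i : ℕ} {ρ : ℕ → ℕ} {w : List ℕ} (h : Bounds V ρ w) (hi : i ≤ n) (x : ℕ) :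
    Bounds (V + n) (Function.update ρ x i) w := by
  refine ⟨fun y => ?_, fun a => (h.entry a).trans (by omega), h.length.trans (by omega)⟩
  have := h.var y
  rw [Function.update_apply]
  split_ifs <;> omega

lemma Ex.eval_le_vb (e : Ex) : ∀ {V : ℕ} {ρ : ℕ → ℕ} {w : List ℕ}, Bounds V ρ w →
    e.eval ρ w ≤ e.vb V := by
  induction e with
  | c k => intro V ρ w h; exact le_rfl
  | v x => intro V ρ w h; exact h.var x
  | lim => intro V ρ w h; exact h.length
  | op o a b iha ihb =>
    intro V ρ w h
    have ha := iha h
    have hb := ihb h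
    cases o
    · exact Nat.add_le_add ha hb
    · exact (Nat.sub_le _ _).trans ha
    · exact Nat.mul_le_mul ha hb
    · exact (Nat.div_le_self _ _).trans ha
  | mem a iha => intro V ρ w h; exact h.entry _
  | sum x n e ihn ihe =>
    intro V ρ w h
    have hn := ihn h
    calc ∑ i ∈ Finset.range (n.eval ρ w), e.eval (Function.update ρ x i) w
        ≤ ∑ i ∈ Finset.range (n.eval ρ w), e.vb (V + n.vb V) := by
          refine Finset.sum_le_sum fun i hi => ihe (h.bind ?_ x)
          have := Finset.mem_range.1 hi
          omega
      _ = n.eval ρ w * e.vb (V + n.vb V) := by simp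
      _ ≤ _ := Nat.mul_le_mul_right _ hn

/-- The state `s` holds the variables `ρ` in the registers given by `σ`, all below `j`, and the
word `w` in memory. Memory beyond the word is arbitrary. -/
structure Sees (σ : ℕ → ℕ) (j : ℕ) (ρ : ℕ → ℕ) (w : List ℕ) (s : RAMState) : Prop where
  three_le : 3 ≤ j
  lt : ∀ x, σ x < j
  pos : ∀ x, 1 ≤ σ x
  var : ∀ x, s.reg (σ x) = ρ x
  lim : s.reg 1 = w.length
  zero : s.reg 2 = 0
  mem : ∀ a < w.length, s.mem a = w.getD a 0

lemma Sees.of_eq {σ : ℕ → ℕ} {j j' : ℕ} {ρ : ℕ → ℕ} {w : List ℕ} {s s' : RAMState}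
    (h : Sees σ j ρ w s) (hj : j ≤ j') (hr : ∀ r, 1 ≤ r → r < j → s'.reg r = s.reg r)
    (hm : ∀ a < w.length, s'.mem a = s.mem a) : Sees σ j' ρ w s' := by
  have h3 := h.three_le
  refine ⟨by omega, fun x => (h.lt x).trans_le hj, h.pos, fun x => ?_, ?_, ?_, fun a ha => ?_⟩
  · rw [hr _ (h.pos x) (h.lt x), h.var]
  · rw [hr _ le_rfl (by omega), h.lim]
  · rw [hr _ (by omega) (by omega), h.zero]
  · rw [hm a ha, h.mem a ha]

lemma Sees.bind {σ : ℕ → ℕ} {j j' r i : ℕ} {ρ : ℕ → ℕ} {w : List ℕ} {s : RAMState}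
    (h : Sees σ j ρ w s) (hj : j ≤ r) (hr : r < j') (x : ℕ) (hi : s.reg r = i) :
    Sees (Function.update σ x r) j' (Function.update ρ x i) w s := by
  have h3 := h.three_le
  refine ⟨by omega, fun y => ?_, fun y => ?_, fun y => ?_, h.lim, h.zero, h.mem⟩
  · have := h.lt y
    rw [Function.update_apply]; split_ifs <;> omega
  · have := h.pos y
    rw [Function.update_apply]; split_ifs <;> omega
  · have := h.var y
    rw [Function.update_apply, Function.update_apply]; split_ifs <;> simp_all

lemma size_le {a b : ℕ} (h : a ≤ b) : Nat.size a ≤ Nat.size b := Nat.size_le_size h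

/-- The compiled program computes the value of the expression within the stated time, and it changes
neither the memory nor the registers below `j`. -/
lemma Ex.comp_spec (e : Ex) : ∀ {σ : ℕ → ℕ} {j V : ℕ} {ρ : ℕ → ℕ} {w : List ℕ} {s : RAMState},
    Sees σ j ρ w s → Bounds V ρ w →
    ∃ s', Run (e.comp σ j) s (e.ct V) s' ∧ s'.mem = s.mem ∧ (∀ r < j, s'.reg r = s.reg r) ∧
      s'.reg j = e.eval ρ w := by
  induction e with
  | c k =>
    intro σ j V ρ w s hs hb
    exact ⟨_, Run.const s j k, rfl, fun r hr => by simp [hr.ne], by simp [eval]⟩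
  | v x =>
    intro σ j V ρ w s hs hb
    refine ⟨_, (Run.arith s .add j (σ x) 2).mono ?_, rfl, fun r hr => by simp [hr.ne], ?_⟩
    · have := size_le (hb.var x)
      simp only [hs.var, hs.zero, Nat.size_zero, ct]
      omega
    · simp [eval, ArithOp.eval, hs.var, hs.zero]
  | lim =>
    intro σ j V ρ w s hs hb
    refine ⟨_, (Run.arith s .add j 1 2).mono ?_, rfl, fun r hr => by simp [hr.ne], ?_⟩
    · have := size_le hb.length
      simp only [hs.lim, hs.zero, Nat.size_zero, ct]
      omega
    · simp [eval, ArithOp.eval, hs.lim, hs.zero]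
  | op o a b iha ihb =>
    intro σ j V ρ w s hs hb
    obtain ⟨s1, h1, m1, p1, r1⟩ := iha hs hb
    have hs1 : Sees σ (j + 1) ρ w s1 := hs.of_eq (by omega) (fun r _ hr => p1 r hr) (by simp [m1])
    obtain ⟨s2, h2, m2, p2, r2⟩ := ihb hs1 hb
    refine ⟨_, (h1.seq (h2.seq (Run.arith s2 o j j (j + 1)))).mono ?_, by simp [m1, m2], ?_, ?_⟩
    · have ha := size_le (a.eval_le_vb hb)
      have hb := size_le (b.eval_le_vb hb)
      rw [p2 j (by omega), r1, r2, ct]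
      omega
    · intro r hr
      have : r ≠ j := by omega
      simp [this, p2 r (by omega), p1 r hr]
    · simp [eval, p2 j (by omega), r1, r2]
  | mem a iha =>
    intro σ j V ρ w s hs hb
    obtain ⟨s1, h1, m1, p1, r1⟩ := iha hs hb
    have hs1 : Sees σ (j + 1) ρ w s1 := hs.of_eq (by omega) (fun r _ hr => p1 r hr) (by simp [m1])
    have h2 := Run.arith s1 .sub (j + 1) 1 j
    set s2 := s1.setReg (j + 1) (ArithOp.sub.eval (s1.reg 1) (s1.reg j)) with hs2
    have hl := size_le hb.length
    have ha := size_le (a.eval_le_vb hb)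
    have r2 : s2.reg (j + 1) = w.length - a.eval ρ w := by
      simp [hs2, ArithOp.eval, hs1.lim, r1]
    have r2' : s2.reg j = a.eval ρ w := by simp [hs2, r1]
    have hsz : Nat.size (w.length - a.eval ρ w) ≤ Nat.size V :=
      size_le ((Nat.sub_le _ _).trans hb.length)
    have p2 : ∀ r < j, s2.reg r = s.reg r := by
      intro r hr
      have : r ≠ j + 1 := by omega
      simp [hs2, this, p1 r hr]
    by_cases hlt : a.eval ρ w < w.length
    · obtain ⟨t, ht, he⟩ := Run.load s2 j j
      refine ⟨_, (h1.seq (h2.seq ⟨_, le_rfl, .cond_true (by omega) he⟩)).mono ?_, ?_, ?_, ?_⟩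
      · have hm : s2.mem (a.eval ρ w) = w.getD (a.eval ρ w) 0 := by
          have := hs1.mem _ hlt
          simpa [hs2] using this
        have hmV := size_le (hb.entry (a.eval ρ w))
        rw [r2', hm] at ht
        rw [r2, r1, hs1.lim, ct]
        omega
      · simp [hs2, m1]
      · intro r hr
        simp [hr.ne, p2 r hr]
      · have hm : s2.mem (a.eval ρ w) = w.getD (a.eval ρ w) 0 := by
          have := hs1.mem _ hlt
          simpa [hs2] using this
        simp [r2', hm, eval]
    · obtain ⟨t, ht, he⟩ := Run.const s2 j 0
      refine ⟨_, (h1.seq (h2.seq ⟨_, le_rfl, .cond_false (by omega) he⟩)).mono ?_, ?_, ?_, ?_⟩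
      · rw [r1, hs1.lim, ct]
        simp only [Nat.size_zero] at ht
        omega
      · simp [hs2, m1]
      · intro r hr
        simp [hr.ne, p2 r hr]
      · have : w.length ≤ a.eval ρ w := by omega
        simp [eval, List.getElem?_eq_none this]
  | sum x n e ihn ihe =>
    intro σ j V ρ w s hs hb
    obtain ⟨s1, h1, m1, p1, r1⟩ := ihn hs hb
    have hnv := n.eval_le_vb hb
    set N := n.eval ρ w with hN
    have h2 := Run.const s1 (j + 1) 0
    set s2 := s1.setReg (j + 1) 0 with hs2
    have h3 := Run.const s2 (j + 2) 0
    set s3 := s2.setReg (j + 2) 0 with hs3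
    set S : ℕ → ℕ := fun i => ∑ i' ∈ Finset.range i, e.eval (Function.update ρ x i') w with hS
    set W := e.vb (V + n.vb V) with hW
    have hval : ∀ i < N, e.eval (Function.update ρ x i) w ≤ W := fun i hi =>
      e.eval_le_vb (hb.bind (by omega) x)
    have hSle : ∀ i ≤ N, S i ≤ n.vb V * W := by
      intro i hi
      calc S i ≤ ∑ i' ∈ Finset.range i, W :=
            Finset.sum_le_sum fun i' hi' => hval i' (by have := Finset.mem_range.1 hi'; omega)
        _ = i * W := by simp
        _ ≤ _ := Nat.mul_le_mul_right _ (by omega)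
    let Inv : ℕ → RAMState → Prop := fun i t =>
      t.mem = s.mem ∧ (∀ r < j, t.reg r = s.reg r) ∧ t.reg (j + 1) = S i ∧ t.reg (j + 2) = i
    have hloop := Run.countLoop (a := j) (N := N) (s := s3)
      (P := .seq (e.comp (Function.update σ x (j + 2)) (j + 3))
          (.seq (.arith .add (j + 1) (j + 1) (j + 3)) (.seq (.const (j + 3) 1)
            (.seq (.arith .add (j + 2) (j + 2) (j + 3)) (.arith .sub j j (j + 3))))))
      Inv (fun _ => e.ct (V + n.vb V) + (10 + Nat.size (n.vb V * W) + Nat.size W +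
        2 * Nat.size (n.vb V)))
      (by
        rintro i hi t ⟨tm, tp, tS, ti⟩ tN
        have ht : Sees (Function.update σ x (j + 2)) (j + 3) (Function.update ρ x i) w t :=
          (hs.of_eq le_rfl (fun r _ hr => tp r hr) (by simp [tm])).bind (by omega) (by omega) x ti
        obtain ⟨u1, k1, um1, up1, ur1⟩ := ihe ht (hb.bind (n := n.vb V) (by omega) x)
        have k2 := Run.arith u1 .add (j + 1) (j + 1) (j + 3)
        set u2 := u1.setReg (j + 1) _ with hu2
        have k3 := Run.const u2 (j + 3) 1
        set u3 := u2.setReg (j + 3) 1 with hu3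
        have k4 := Run.arith u3 .add (j + 2) (j + 2) (j + 3)
        set u4 := u3.setReg (j + 2) _ with hu4
        have k5 := Run.arith u4 .sub j j (j + 3)
        set u5 := u4.setReg j _ with hu5
        have q1 : u1.reg (j + 1) = S i := by rw [up1 _ (by omega), tS]
        have q2 : u3.reg (j + 2) = i := by
          simp [hu3, hu2, up1 (j + 2) (by omega), ti]
        have q3 : u4.reg j = N - i := by
          simp [hu4, hu3, hu2, up1 j (by omega), tN]
        have q4 : u3.reg (j + 3) = 1 := by simp [hu3]
        have q5 : u4.reg (j + 3) = 1 := by simp [hu4, q4]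
        refine ⟨u5, (k1.seq (k2.seq (k3.seq (k4.seq k5)))).mono ?_, ⟨?_, ?_, ?_, ?_⟩, ?_⟩
        · rw [q1, q2, q3, q4, q5, ur1]
          have z1 := size_le (hval i hi)
          have z2 := size_le (hSle i hi.le)
          have z3 : Nat.size i ≤ Nat.size (n.vb V) := size_le (by omega)
          have z4 : Nat.size (N - i) ≤ Nat.size (n.vb V) := size_le (by omega)
          have z5 : Nat.size 1 = 1 := Nat.size_one
          omega
        · simp [hu5, hu4, hu3, hu2, um1, tm]
        · intro r hr
          have e1 : r ≠ j := by omega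
          have e2 : r ≠ j + 1 := by omega
          have e3 : r ≠ j + 2 := by omega
          have e4 : r ≠ j + 3 := by omega
          simp [hu5, hu4, hu3, hu2, e1, e2, e3, e4, up1 r (by omega), tp r hr]
        · simp [hu5, hu4, hu3, hu2, ArithOp.eval, q1, ur1, hS, Finset.sum_range_succ]
        · simp [hu5, hu4, ArithOp.eval, q2, q4]
        · simp only [hu5, setReg_reg, if_true, ArithOp.eval, q3, q5]
          omega)
      (by
        refine ⟨by simp [hs3, hs2, m1], fun r hr => ?_, by simp [hs3, hs2, hS], by simp [hs3]⟩
        have e2 : r ≠ j + 1 := by omega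
        have e3 : r ≠ j + 2 := by omega
        simp [hs3, hs2, e2, e3, p1 r hr])
      (by simp [hs3, hs2, r1])
    obtain ⟨s4, h4, ⟨m4, p4, S4, i4⟩, r4⟩ := hloop
    have h5 := Run.arith s4 .add j (j + 1) 2
    have z4 : s4.reg 2 = 0 := by rw [p4 2 (by have := hs.three_le; omega), hs.zero]
    refine ⟨_, (h1.seq (h2.seq (h3.seq (h4.seq h5)))).mono ?_, ?_, ?_, ?_⟩
    · rw [S4, z4]
      have z1 := size_le (hSle N le_rfl)
      have z2 : Nat.size N ≤ Nat.size (n.vb V) := size_le hnv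
      simp only [Finset.sum_const, Finset.card_range, smul_eq_mul, Nat.size_zero, ct, vb, ← hW]
      have : N * (1 + N.size + (e.ct (V + n.vb V) + (10 + (n.vb V * W).size + W.size +
            2 * (n.vb V).size))) ≤ n.vb V * (e.ct (V + n.vb V) + (11 + (n.vb V * W).size +
              W.size + 3 * (n.vb V).size)) :=
        Nat.mul_le_mul hnv (by omega)
      omega
    · simp [m4]
    · intro r hr
      simp [hr.ne, p4 r hr]
    · simp [ArithOp.eval, S4, z4, eval, hS, hN]

end RAM

/-! ### Commands that append to the word in memory -/

namespace RAM

/-- Commands that append entries to the word in memory. All expressions are evaluated for the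
word as it was when the command started. -/
inductive Cmd where
  | emit (e : Ex)
  | seq (a b : Cmd)
  /-- for all `x < n` in increasing order -/
  | for' (x : ℕ) (n : Ex) (a : Cmd)
  /-- with `x` bound to the value of `e` -/
  | bind (x : ℕ) (e : Ex) (a : Cmd)

namespace Cmd

/-- The entries that a command appends. -/
def out (ρ : ℕ → ℕ) (w : List ℕ) : Cmd → List ℕ
  | emit e => [e.eval ρ w]
  | seq a b => a.out ρ w ++ b.out ρ w
  | for' x n a => (List.range (n.eval ρ w)).flatMap fun i => a.out (Function.update ρ x i) w
  | bind x e a => a.out (Function.update ρ x (e.eval ρ w)) w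

/-- The program of a command, with the conventions of `Ex.comp`. Register `0` holds the current
length of the word in memory. -/
def comp (σ : ℕ → ℕ) (j : ℕ) : Cmd → RAMProg
  | emit e => .seq (e.comp σ j) (.seq (.store 0 j) (.seq (.const (j + 1) 1)
      (.arith .add 0 0 (j + 1))))
  | seq a b => .seq (a.comp σ j) (b.comp σ j)
  | for' x n a => .seq (n.comp σ j) (.seq (.const (j + 1) 0)
      (.loop j (.seq (a.comp (Function.update σ x (j + 1)) (j + 2)) (.seq (.const (j + 2) 1)
        (.seq (.arith .add (j + 1) (j + 1) (j + 2)) (.arith .sub j j (j + 2)))))))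
  | bind x e a => .seq (e.comp σ j) (a.comp (Function.update σ x j) (j + 1))

/-- Whether it is syntactically clear that the command appends something. -/
def Emits : Cmd → Prop
  | emit _ => True
  | seq a b => a.Emits ∨ b.Emits
  | for' _ _ _ => False
  | bind _ _ a => a.Emits

/-- Every round of every loop appends something. For such commands the number of steps is
proportional to the length of the output. -/
def Productive : Cmd → Prop
  | emit _ => True
  | seq a b => a.Productive ∧ b.Productive
  | for' _ _ a => a.Emits ∧ a.Productive
  | bind _ _ a => a.Productive

/-- A bound on the running time of a productive command per entry of the output. -/
def ct : Cmd → ℕ → ℕ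
  | emit e, V => e.ct V + 5 + 2 * Nat.size V + Nat.size (e.vb V)
  | seq a b, V => a.ct V + b.ct V
  | for' _ n a, V => n.ct V + 2 * a.ct (V + n.vb V) + 12 + 3 * Nat.size (n.vb V)
  | bind _ e a, V => e.ct V + a.ct (V + e.vb V)

lemma Emits.out_ne_nil {a : Cmd} : a.Emits → ∀ ρ w, 1 ≤ (a.out ρ w).length := by
  induction a with
  | emit e => intro _ ρ w; simp [out]
  | seq a b iha ihb =>
    rintro (h | h) ρ w
    · have := iha h ρ w; simp only [out, List.length_append]; omega
    · have := ihb h ρ w; simp only [out, List.length_append]; omega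
  | for' x n a _ => intro h; exact h.elim
  | bind x e a ih => intro h ρ w; exact ih h _ _

end Cmd

/-- The memory holds exactly the word `m`, and register `0` its length. -/
structure Holds (m : List ℕ) (s : RAMState) : Prop where
  mem : ∀ a, s.mem a = m.getD a 0
  len : s.reg 0 = m.length

lemma getD_prefix {w m : List ℕ} (h : w <+: m) {a : ℕ} (ha : a < w.length) :
    m.getD a 0 = w.getD a 0 := by
  obtain ⟨t, rfl⟩ := h
  simp [List.getElem?_append_left ha]

lemma Holds.append {m : List ℕ} {s s' : RAMState} {v : ℕ} (h : Holds m s)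
    (hm : s'.mem = (s.setMem m.length v).mem) (hr : s'.reg 0 = m.length + 1) :
    Holds (m ++ [v]) s' := by
  refine ⟨fun a => ?_, by simpa using hr⟩
  rw [hm, setMem_mem, h.mem]
  split_ifs with ha
  · simp [ha]
  · rcases lt_or_gt_of_ne ha with ha' | ha'
    · simp [List.getElem?_append_left ha']
    · rw [List.getD_eq_default _ _ ha'.le, List.getD_eq_default _ _ (by simpa using ha')]

lemma Sees.of_holds {σ : ℕ → ℕ} {j j' : ℕ} {ρ : ℕ → ℕ} {w m : List ℕ} {s s' : RAMState}
    (h : Sees σ j ρ w s) (hj : j ≤ j') (hr : ∀ r, 1 ≤ r → r < j → s'.reg r = s.reg r)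
    (hm : w <+: m) (hs : Holds m s') : Sees σ j' ρ w s' :=
  h.of_eq hj hr fun a ha => by rw [hs.mem, h.mem a ha, getD_prefix hm ha]

lemma Holds.of_mem_eq {m : List ℕ} {s s' : RAMState} (h : Holds m s) (hm : s'.mem = s.mem)
    (hr : s'.reg 0 = s.reg 0) : Holds m s' :=
  ⟨fun a => by rw [hm, h.mem], by rw [hr, h.len]⟩

/-- The compiled program of a productive command appends the output of the command to the word `m`
that is in memory. The expressions are evaluated for the prefix `w` of `m`, which was the word when
the command started. The time is proportional to the length of the output. -/
lemma Cmd.comp_spec (c : Cmd) : ∀ {σ : ℕ → ℕ} {j V : ℕ} {ρ : ℕ → ℕ} {w m : List ℕ}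
    {s : RAMState}, Sees σ j ρ w s → Bounds V ρ w → w <+: m → Holds m s → c.Productive →
    (m ++ c.out ρ w).length ≤ V →
    ∃ s', Run (c.comp σ j) s ((1 + (c.out ρ w).length) * c.ct V) s' ∧
      Holds (m ++ c.out ρ w) s' ∧ ∀ r, 1 ≤ r → r < j → s'.reg r = s.reg r := by
  induction c with
  | emit e =>
    intro σ j V ρ w m s hs hb hwm hm _ hV
    obtain ⟨s1, h1, m1, p1, r1⟩ := e.comp_spec hs hb
    have h3 := hs.three_le
    have h2 := Run.store s1 0 j
    have l1 : s1.reg 0 = m.length := by rw [p1 0 (by omega), hm.len]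
    set s2 := s1.setMem (s1.reg 0) (s1.reg j) with hs2
    have h3 := Run.const s2 (j + 1) 1
    set s3 := s2.setReg (j + 1) 1 with hs3
    have h4 := Run.arith s3 .add 0 0 (j + 1)
    have q0 : s3.reg 0 = m.length := by simp [hs3, hs2, l1]
    have q1 : s3.reg (j + 1) = 1 := by simp [hs3]
    have hlV : Nat.size m.length ≤ Nat.size V := size_le (by
      rw [List.length_append] at hV; omega)
    have hev := size_le (e.eval_le_vb hb)
    refine ⟨_, (h1.seq (h2.seq (h3.seq h4))).mono ?_, ?_, ?_⟩
    · rw [q0, q1, l1, r1, Nat.size_one]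
      simp only [out, List.length_singleton, ct]
      omega
    · refine hm.append (v := e.eval ρ w) ?_ ?_
      · funext a
        simp [hs3, hs2, l1, r1, m1]
      · simp [ArithOp.eval, q0, q1]
    · intro r hr0 hr
      have e1 : r ≠ 0 := by omega
      have e2 : r ≠ j + 1 := by omega
      simp [hs3, hs2, e1, e2, p1 r hr]
  | seq a b iha ihb =>
    intro σ j V ρ w m s hs hb hwm hm hp hV
    simp only [out] at hV ⊢
    rw [← List.append_assoc] at hV ⊢
    obtain ⟨s1, h1, m1, p1⟩ := iha hs hb hwm hm hp.1
      (by rw [List.length_append] at hV; omega)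
    have hwm' : w <+: m ++ a.out ρ w := hwm.trans (List.prefix_append _ _)
    obtain ⟨s2, h2, m2, p2⟩ := ihb (hs.of_holds le_rfl p1 hwm' m1) hb hwm' m1 hp.2 hV
    refine ⟨s2, (h1.seq h2).mono ?_, m2, fun r h0 hr => by rw [p2 r h0 hr, p1 r h0 hr]⟩
    rw [List.length_append, ct]
    nlinarith [Nat.zero_le ((a.out ρ w).length * b.ct V), Nat.zero_le ((b.out ρ w).length * a.ct V)]
  | bind x e a ih =>
    intro σ j V ρ w m s hs hb hwm hm hp hV
    obtain ⟨s1, h1, m1, p1, r1⟩ := e.comp_spec hs hb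
    have h3 := hs.three_le
    have hm1 : Holds m s1 := hm.of_mem_eq m1 (p1 0 (by omega))
    obtain ⟨s2, h2, m2, p2⟩ := ih
      ((hs.of_holds le_rfl (fun r _ hr => p1 r hr) hwm hm1).bind le_rfl (Nat.lt_succ_self j) x r1)
      (hb.bind (e.eval_le_vb hb) x) hwm hm1 hp (le_trans hV (by omega))
    refine ⟨s2, (h1.seq h2).mono ?_, m2,
      fun r h0 hr => by rw [p2 r h0 (by omega), p1 r hr]⟩
    simp only [ct, out]
    nlinarith [Nat.zero_le ((a.out (Function.update ρ x (e.eval ρ w)) w).length * e.ct V)]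
  | for' x n a ih =>
    intro σ j V ρ w m s hs hb hwm hm hp hV
    obtain ⟨s1, h1, m1, p1, r1⟩ := n.comp_spec hs hb
    have h3 := hs.three_le
    have hnv := n.eval_le_vb hb
    simp only [out] at hV ⊢
    set N := n.eval ρ w with hN
    have h2 := Run.const s1 (j + 1) 0
    set s2 := s1.setReg (j + 1) 0 with hs2
    let o : ℕ → List ℕ := fun i => a.out (Function.update ρ x i) w
    let O : ℕ → List ℕ := fun i => (List.range i).flatMap o
    have hO : ∀ i, O (i + 1) = O i ++ o i := fun i => by
      simp [O, List.range_succ, List.flatMap_append]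
    have hOmono : ∀ i ≤ N, (O i).length ≤ (O N).length := by
      have h : ∀ d i, (O i).length ≤ (O (i + d)).length := by
        intro d i
        induction d with
        | zero => exact le_rfl
        | succ d ihd => rw [← add_assoc, hO, List.length_append]; omega
      intro i hi
      have := h (N - i) i
      rwa [Nat.add_sub_cancel' hi] at this
    have hV' : (m ++ O N).length ≤ V := hV
    let Inv : ℕ → RAMState → Prop := fun i t =>
      Holds (m ++ O i) t ∧ (∀ r, 1 ≤ r → r < j → t.reg r = s.reg r) ∧ t.reg (j + 1) = i
    have hloop := Run.countLoop (a := j) (N := N) (s := s2)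
      (P := .seq (a.comp (Function.update σ x (j + 1)) (j + 2)) (.seq (.const (j + 2) 1)
        (.seq (.arith .add (j + 1) (j + 1) (j + 2)) (.arith .sub j j (j + 2)))))
      Inv (fun i => (1 + (o i).length) * a.ct (V + n.vb V) + 6 + 2 * Nat.size (n.vb V))
      (by
        rintro i hi t ⟨tm, tp, ti⟩ tN
        have hwi : w <+: m ++ O i := hwm.trans (List.prefix_append _ _)
        have ht : Sees (Function.update σ x (j + 1)) (j + 2) (Function.update ρ x i) w t :=
          (hs.of_holds le_rfl tp hwi tm).bind (by omega) (by omega) x ti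
        obtain ⟨u1, k1, um1, up1⟩ := ih ht (hb.bind (n := n.vb V) (by omega) x) hwi tm hp.2 (by
          have := hOmono (i + 1) hi
          rw [hO, List.length_append] at this
          simp only [List.length_append] at hV' this ⊢
          change m.length + (O i).length + (o i).length ≤ _
          omega)
        have k2 := Run.const u1 (j + 2) 1
        set u2 := u1.setReg (j + 2) 1 with hu2
        have k3 := Run.arith u2 .add (j + 1) (j + 1) (j + 2)
        set u3 := u2.setReg (j + 1) _ with hu3
        have k4 := Run.arith u3 .sub j j (j + 2)
        set u4 := u3.setReg j _ with hu4
        have q1 : u2.reg (j + 1) = i := by simp [hu2, up1 (j + 1), ti]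
        have q2 : u2.reg (j + 2) = 1 := by simp [hu2]
        have q3 : u3.reg (j + 2) = 1 := by simp [hu3, q2]
        have q4 : u3.reg j = N - i := by
          simp [hu3, hu2, up1 j (by omega) (by omega), tN]
        refine ⟨u4, (k1.seq (k2.seq (k3.seq k4))).mono ?_, ⟨?_, ?_, ?_⟩, ?_⟩
        · rw [q1, q2, q3, q4, Nat.size_one]
          have z3 : Nat.size i ≤ Nat.size (n.vb V) := size_le (by omega)
          have z4 : Nat.size (N - i) ≤ Nat.size (n.vb V) := size_le (by omega)
          change (1 + (o i).length) * _ + _ ≤ _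
          omega
        · rw [hO, ← List.append_assoc]
          refine um1.of_mem_eq (by simp [hu4, hu3, hu2]) ?_
          have e1 : 0 ≠ j := by omega
          simp [hu4, hu3, hu2, e1]
        · intro r h0 hr
          have e1 : r ≠ j := by omega
          have e2 : r ≠ j + 1 := by omega
          have e3 : r ≠ j + 2 := by omega
          simp [hu4, hu3, hu2, e1, e2, e3, up1 r h0 (by omega), tp r h0 hr]
        · simp [hu4, hu3, ArithOp.eval, q1, q2]
        · simp only [hu4, setReg_reg, if_true, ArithOp.eval, q4, q3]
          omega)
      (by
        refine ⟨?_, fun r h0 hr => ?_, by simp [hs2]⟩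
        · simp only [O, List.range_zero, List.flatMap_nil, List.append_nil]
          refine hm.of_mem_eq (by simp [hs2, m1]) ?_
          simp [hs2, p1 0 (by omega)]
        · have e2 : r ≠ j + 1 := by omega
          simp [hs2, e2, p1 r hr])
      (by simp [hs2, r1])
    obtain ⟨s3, h3', ⟨m3, p3, -⟩, -⟩ := hloop
    refine ⟨s3, (h1.seq (h2.seq h3')).mono ?_, m3, p3⟩
    change _ ≤ (1 + (O N).length) * _
    have hsum : ∀ K ≤ N, ∑ i ∈ Finset.range K, (1 + Nat.size N +
        ((1 + (o i).length) * a.ct (V + n.vb V) + 6 + 2 * Nat.size (n.vb V))) ≤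
        (O K).length * (2 * a.ct (V + n.vb V) + 7 + 3 * Nat.size (n.vb V)) := by
      intro K hK
      induction K with
      | zero => simp
      | succ K ihK =>
        rw [Finset.sum_range_succ, hO, List.length_append, add_mul (O K).length]
        have h1 : 1 ≤ (o K).length := hp.1.out_ne_nil _ _
        have h2 : Nat.size N ≤ Nat.size (n.vb V) := size_le hnv
        have := ihK (by omega)
        have h3 : (1 + (o K).length) * a.ct (V + n.vb V) ≤
            (o K).length * (2 * a.ct (V + n.vb V)) := by nlinarith
        have h4 : 7 + 3 * Nat.size (n.vb V) ≤ (o K).length * (7 + 3 * Nat.size (n.vb V)) :=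
          Nat.le_mul_of_pos_left _ h1
        have h5 : (o K).length * (2 * a.ct (V + n.vb V) + 7 + 3 * Nat.size (n.vb V)) =
            (o K).length * (2 * a.ct (V + n.vb V)) +
              (o K).length * (7 + 3 * Nat.size (n.vb V)) := by ring
        omega
    have hsumN := hsum N le_rfl
    simp only [ct, Nat.size_zero]
    have : (O N).length * (2 * a.ct (V + n.vb V) + 7 + 3 * Nat.size (n.vb V)) ≤
        (O N).length * (n.ct V + 2 * a.ct (V + n.vb V) + 12 + 3 * Nat.size (n.vb V)) :=
      Nat.mul_le_mul_left _ (by omega)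
    rw [add_mul, one_mul]
    omega

end RAM

/-! ### Growth of values and running times -/

namespace RAM

/-- At most polynomial growth. -/
def PolyBounded (f : ℕ → ℕ) : Prop := ∃ D, ∀ V, f V ≤ (V + 2) ^ D

/-- At most logarithmic growth. -/
def LogBounded (f : ℕ → ℕ) : Prop := ∃ D, ∀ V, f V ≤ D * (1 + Nat.size V)

lemma PolyBounded.mono {f g : ℕ → ℕ} (hg : PolyBounded g) (h : ∀ V, f V ≤ g V) :
    PolyBounded f := by
  obtain ⟨D, hD⟩ := hg
  exact ⟨D, fun V => (h V).trans (hD V)⟩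

lemma PolyBounded.const (k : ℕ) : PolyBounded fun _ => k :=
  ⟨k, fun V => (Nat.lt_two_pow_self).le.trans (Nat.pow_le_pow_left (by omega) k)⟩

lemma PolyBounded.id : PolyBounded fun V => V := ⟨1, fun V => by simp⟩

lemma PolyBounded.add {f g : ℕ → ℕ} (hf : PolyBounded f) (hg : PolyBounded g) :
    PolyBounded fun V => f V + g V := by
  obtain ⟨D, hD⟩ := hf
  obtain ⟨E, hE⟩ := hg
  refine ⟨D + E + 1, fun V => ?_⟩
  have h1 : (V + 2) ^ D ≤ (V + 2) ^ (D + E) := Nat.pow_le_pow_right (by omega) (by omega)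
  have h2 : (V + 2) ^ E ≤ (V + 2) ^ (D + E) := Nat.pow_le_pow_right (by omega) (by omega)
  calc f V + g V ≤ (V + 2) ^ (D + E) * 2 := by have := hD V; have := hE V; omega
    _ ≤ (V + 2) ^ (D + E) * (V + 2) := Nat.mul_le_mul_left _ (by omega)
    _ = _ := (pow_succ _ _).symm

lemma PolyBounded.mul {f g : ℕ → ℕ} (hf : PolyBounded f) (hg : PolyBounded g) :
    PolyBounded fun V => f V * g V := by
  obtain ⟨D, hD⟩ := hf
  obtain ⟨E, hE⟩ := hg
  exact ⟨D + E, fun V => by rw [pow_add]; exact Nat.mul_le_mul (hD V) (hE V)⟩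

lemma PolyBounded.comp {f g : ℕ → ℕ} (hf : PolyBounded f) (hg : PolyBounded g) :
    PolyBounded fun V => f (g V) := by
  obtain ⟨D, hD⟩ := hf
  obtain ⟨E, hE⟩ := hg
  refine ⟨(E + 2) * D, fun V => (hD _).trans ?_⟩
  rw [pow_mul]
  refine Nat.pow_le_pow_left ?_ D
  have h1 : 1 ≤ (V + 2) ^ E := Nat.one_le_pow _ _ (by omega)
  have h2 : 2 ^ 2 ≤ (V + 2) ^ 2 := Nat.pow_le_pow_left (by omega) 2
  have := hE V
  rw [pow_add]
  nlinarith

lemma size_le_self (n : ℕ) : Nat.size n ≤ n := Nat.size_le.2 Nat.lt_two_pow_self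

lemma PolyBounded.size {f : ℕ → ℕ} (hf : PolyBounded f) : PolyBounded fun V => Nat.size (f V) :=
  hf.mono fun V => size_le_self (f V)

lemma LogBounded.mono {f g : ℕ → ℕ} (hg : LogBounded g) (h : ∀ V, f V ≤ g V) :
    LogBounded f := by
  obtain ⟨D, hD⟩ := hg
  exact ⟨D, fun V => (h V).trans (hD V)⟩

lemma LogBounded.const (k : ℕ) : LogBounded fun _ => k :=
  ⟨k, fun V => by nlinarith [Nat.zero_le (k * Nat.size V)]⟩

lemma LogBounded.add {f g : ℕ → ℕ} (hf : LogBounded f) (hg : LogBounded g) :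
    LogBounded fun V => f V + g V := by
  obtain ⟨D, hD⟩ := hf
  obtain ⟨E, hE⟩ := hg
  exact ⟨D + E, fun V => by rw [add_mul]; exact Nat.add_le_add (hD V) (hE V)⟩

lemma LogBounded.const_mul {f : ℕ → ℕ} (k : ℕ) (hf : LogBounded f) :
    LogBounded fun V => k * f V := by
  obtain ⟨D, hD⟩ := hf
  exact ⟨k * D, fun V => by rw [mul_assoc]; exact Nat.mul_le_mul_left _ (hD V)⟩

lemma PolyBounded.logBounded_size {f : ℕ → ℕ} (hf : PolyBounded f) :
    LogBounded fun V => Nat.size (f V) := by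
  obtain ⟨D, hD⟩ := hf
  refine ⟨2 * D + 1, fun V => Nat.size_le.2 ?_⟩
  have h1 : V + 2 ≤ 2 ^ (Nat.size V + 2) := by
    have := Nat.lt_size_self V
    rw [pow_add]
    omega
  calc f V ≤ (V + 2) ^ D := hD V
    _ ≤ (2 ^ (Nat.size V + 2)) ^ D := Nat.pow_le_pow_left h1 D
    _ = 2 ^ ((Nat.size V + 2) * D) := (pow_mul _ _ _).symm
    _ < 2 ^ ((2 * D + 1) * (1 + Nat.size V)) := by
      refine Nat.pow_lt_pow_right (by norm_num) ?_
      nlinarith [Nat.zero_le (D * Nat.size V)]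

lemma LogBounded.comp {f g : ℕ → ℕ} (hf : LogBounded f) (hg : PolyBounded g) :
    LogBounded fun V => f (g V) := by
  obtain ⟨D, hD⟩ := hf
  exact (((LogBounded.const 1).add hg.logBounded_size).const_mul D).mono fun V => hD _

namespace Ex

/-- Expressions without sums, which are evaluated in logarithmic time. -/
def SumFree : Ex → Prop
  | c _ => True
  | v _ => True
  | lim => True
  | op _ a b => a.SumFree ∧ b.SumFree
  | mem a => a.SumFree
  | sum _ _ _ => False

lemma polyBounded_vb (e : Ex) : PolyBounded e.vb := by
  induction e with
  | c k => exact .const k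
  | v x => exact .id
  | lim => exact .id
  | op o a b iha ihb =>
    cases o
    · exact iha.add ihb
    · exact iha
    · exact iha.mul ihb
    · exact iha
  | mem a _ => exact .id
  | sum x n e ihn ihe => exact ihn.mul (ihe.comp (PolyBounded.id.add ihn))

lemma polyBounded_ct (e : Ex) : PolyBounded e.ct := by
  induction e with
  | c k => exact .const _
  | v x => exact (PolyBounded.const 1).add PolyBounded.id.size
  | lim => exact (PolyBounded.const 1).add PolyBounded.id.size
  | op o a b iha ihb =>
    exact (iha.add ihb).add (((PolyBounded.const 1).add a.polyBounded_vb.size).add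
      b.polyBounded_vb.size)
  | mem a iha =>
    exact iha.add (((PolyBounded.const 3).add ((PolyBounded.const 3).mul PolyBounded.id.size)).add
      ((PolyBounded.const 2).mul a.polyBounded_vb.size))
  | sum x n e ihn ihe =>
    have hV := PolyBounded.id.add n.polyBounded_vb
    exact ((ihn.add (n.polyBounded_vb.mul ((ihe.comp hV).add
      ((((PolyBounded.const 11).add (sum x n e).polyBounded_vb.size).add
        (e.polyBounded_vb.comp hV).size).add
          ((PolyBounded.const 3).mul n.polyBounded_vb.size))))).add (PolyBounded.const 4)).add
      (sum x n e).polyBounded_vb.size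

lemma SumFree.logBounded_ct {e : Ex} : e.SumFree → LogBounded e.ct := by
  induction e with
  | c k => intro _; exact .const _
  | v x => intro _; exact (LogBounded.const 1).add PolyBounded.id.logBounded_size
  | lim => intro _; exact (LogBounded.const 1).add PolyBounded.id.logBounded_size
  | op o a b iha ihb =>
    intro h
    exact ((iha h.1).add (ihb h.2)).add (((LogBounded.const 1).add
      a.polyBounded_vb.logBounded_size).add b.polyBounded_vb.logBounded_size)
  | mem a iha =>
    intro h
    exact (iha h).add (((LogBounded.const 3).add (PolyBounded.id.logBounded_size.const_mul 3)).add
      (a.polyBounded_vb.logBounded_size.const_mul 2))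
  | sum x n e _ _ => intro h; exact h.elim

end Ex

namespace Cmd

/-- Commands all of whose expressions are free of sums. -/
def SumFree : Cmd → Prop
  | emit e => e.SumFree
  | seq a b => a.SumFree ∧ b.SumFree
  | for' _ n a => n.SumFree ∧ a.SumFree
  | bind _ e a => e.SumFree ∧ a.SumFree

/-- A bound on the length of the output. -/
def lb : Cmd → ℕ → ℕ
  | emit _, _ => 1
  | seq a b, V => a.lb V + b.lb V
  | for' _ n a, V => n.vb V * a.lb (V + n.vb V)
  | bind _ e a, V => a.lb (V + e.vb V)

/-- A bound on the entries of the output. -/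
def ob : Cmd → ℕ → ℕ
  | emit e, V => e.vb V
  | seq a b, V => a.ob V + b.ob V
  | for' _ n a, V => a.ob (V + n.vb V)
  | bind _ e a, V => a.ob (V + e.vb V)

lemma length_flatMap_range_le {N B : ℕ} {g : ℕ → List ℕ} (h : ∀ i < N, (g i).length ≤ B) :
    ((List.range N).flatMap g).length ≤ N * B := by
  induction N with
  | zero => simp
  | succ N ih =>
    have h1 := ih fun i hi => h i (by omega)
    have h2 := h N (by omega)
    rw [List.range_succ, List.flatMap_append, List.length_append, List.flatMap_singleton, add_mul]
    omega

lemma length_out_le (a : Cmd) : ∀ {V : ℕ} {ρ : ℕ → ℕ} {w : List ℕ}, Bounds V ρ w →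
    (a.out ρ w).length ≤ a.lb V := by
  induction a with
  | emit e => intro V ρ w _; exact le_rfl
  | seq a b iha ihb =>
    intro V ρ w h
    rw [out, List.length_append]
    exact Nat.add_le_add (iha h) (ihb h)
  | for' x n a ih =>
    intro V ρ w h
    have hn := n.eval_le_vb h
    exact (length_flatMap_range_le fun i hi => ih (h.bind (n := n.vb V) (by omega) x)).trans
      (Nat.mul_le_mul_right _ hn)
  | bind x e a ih => intro V ρ w h; exact ih (h.bind (e.eval_le_vb h) x)

lemma out_le_ob (a : Cmd) : ∀ {V : ℕ} {ρ : ℕ → ℕ} {w : List ℕ}, Bounds V ρ w →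
    ∀ y ∈ a.out ρ w, y ≤ a.ob V := by
  induction a with
  | emit e =>
    intro V ρ w h y hy
    rw [List.mem_singleton.1 hy]
    exact e.eval_le_vb h
  | seq a b iha ihb =>
    intro V ρ w h y hy
    rcases List.mem_append.1 hy with hy | hy
    · exact (iha h y hy).trans (Nat.le_add_right _ _)
    · exact (ihb h y hy).trans (Nat.le_add_left _ _)
  | for' x n a ih =>
    intro V ρ w h y hy
    obtain ⟨i, hi, hy⟩ := List.mem_flatMap.1 hy
    have hn := n.eval_le_vb h
    have := List.mem_range.1 hi
    exact ih (h.bind (n := n.vb V) (by omega) x) y hy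
  | bind x e a ih => intro V ρ w h; exact ih (h.bind (e.eval_le_vb h) x)

lemma polyBounded_lb (a : Cmd) : PolyBounded a.lb := by
  induction a with
  | emit e => exact .const 1
  | seq a b iha ihb => exact iha.add ihb
  | for' x n a ih => exact n.polyBounded_vb.mul (ih.comp (PolyBounded.id.add n.polyBounded_vb))
  | bind x e a ih => exact ih.comp (PolyBounded.id.add e.polyBounded_vb)

lemma polyBounded_ob (a : Cmd) : PolyBounded a.ob := by
  induction a with
  | emit e => exact e.polyBounded_vb
  | seq a b iha ihb => exact iha.add ihb
  | for' x n a ih => exact ih.comp (PolyBounded.id.add n.polyBounded_vb)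
  | bind x e a ih => exact ih.comp (PolyBounded.id.add e.polyBounded_vb)

lemma polyBounded_ct (a : Cmd) : PolyBounded a.ct := by
  induction a with
  | emit e =>
    exact ((e.polyBounded_ct.add (.const 5)).add ((PolyBounded.const 2).mul
      PolyBounded.id.size)).add e.polyBounded_vb.size
  | seq a b iha ihb => exact iha.add ihb
  | for' x n a ih =>
    exact ((n.polyBounded_ct.add ((PolyBounded.const 2).mul
      (ih.comp (PolyBounded.id.add n.polyBounded_vb)))).add (.const 12)).add
        ((PolyBounded.const 3).mul n.polyBounded_vb.size)
  | bind x e a ih => exact e.polyBounded_ct.add (ih.comp (PolyBounded.id.add e.polyBounded_vb))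

lemma SumFree.logBounded_ct {a : Cmd} : a.SumFree → LogBounded a.ct := by
  induction a with
  | emit e =>
    intro h
    exact (((Ex.SumFree.logBounded_ct h).add (.const 5)).add
      (PolyBounded.id.logBounded_size.const_mul 2)).add e.polyBounded_vb.logBounded_size
  | seq a b iha ihb => intro h; exact (iha h.1).add (ihb h.2)
  | for' x n a ih =>
    intro h
    exact ((h.1.logBounded_ct.add
      (((ih h.2).comp (PolyBounded.id.add n.polyBounded_vb)).const_mul 2)).add (.const 12)).add
        (n.polyBounded_vb.logBounded_size.const_mul 3)
  | bind x e a ih =>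
    intro h
    exact h.1.logBounded_ct.add ((ih h.2).comp (PolyBounded.id.add e.polyBounded_vb))

end Cmd

end RAM

/-! ### Programs built from commands -/

namespace RAM

/-- The register of a global variable. There are forty of them. -/
def glob (x : ℕ) : ℕ := if x < 40 then x + 3 else 2

/-- The state `s` holds the word `w`, its length in register `0`, and the global variables
`ρ`. -/
structure Rep (ρ : ℕ → ℕ) (w : List ℕ) (s : RAMState) : Prop where
  holds : Holds w s
  var : ∀ x, s.reg (glob x) = ρ x
  zero : s.reg 2 = 0

/-- Within time `T` the program leads from variables `ρ` and word `w` to `ρ'` and `w'`. -/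
def Tr (P : RAMProg) (ρ : ℕ → ℕ) (w : List ℕ) (T : ℕ) (ρ' : ℕ → ℕ) (w' : List ℕ) : Prop :=
  ∀ s, Rep ρ w s → ∃ s', Run P s T s' ∧ Rep ρ' w' s'

lemma Tr.seq {P Q : RAMProg} {ρ ρ' ρ'' : ℕ → ℕ} {w w' w'' : List ℕ} {T T' : ℕ}
    (h : Tr P ρ w T ρ' w') (h' : Tr Q ρ' w' T' ρ'' w'') :
    Tr (.seq P Q) ρ w (T + T') ρ'' w'' := by
  intro s hs
  obtain ⟨s1, h1, r1⟩ := h s hs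
  obtain ⟨s2, h2, r2⟩ := h' s1 r1
  exact ⟨s2, h1.seq h2, r2⟩

lemma Tr.mono {P : RAMProg} {ρ ρ' : ℕ → ℕ} {w w' : List ℕ} {T T' : ℕ} (h : Tr P ρ w T ρ' w')
    (hT : T ≤ T') : Tr P ρ w T' ρ' w' := by
  intro s hs
  obtain ⟨s1, h1, r1⟩ := h s hs
  exact ⟨s1, h1.mono hT, r1⟩

lemma glob_lt (x : ℕ) : glob x < 60 := by unfold glob; split_ifs <;> omega

lemma one_lt_glob (x : ℕ) : 2 ≤ glob x := by unfold glob; split_ifs <;> omega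

/-- Copies the length of the word into register `1`. -/
def setLim : RAMProg := .arith .add 1 0 2

lemma Rep.setLim {ρ : ℕ → ℕ} {w : List ℕ} {s : RAMState} (h : Rep ρ w s) {V : ℕ}
    (hV : w.length ≤ V) : ∃ s', Run setLim s (1 + Nat.size V) s' ∧ Rep ρ w s' ∧
      Sees glob 60 ρ w s' := by
  have h1 := Run.arith s .add 1 0 2
  have hr : Rep ρ w (s.setReg 1 (ArithOp.add.eval (s.reg 0) (s.reg 2))) := by
    refine ⟨h.holds.of_mem_eq rfl (by simp), fun x => ?_, by simp [h.zero]⟩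
    have : glob x ≠ 1 := by have := one_lt_glob x; omega
    simp [this, h.var]
  refine ⟨_, h1.mono ?_, hr, ⟨by norm_num, glob_lt, fun x => ?_, hr.var, ?_, hr.zero,
    fun a _ => hr.holds.mem a⟩⟩
  · have := size_le hV
    simp only [h.holds.len, h.zero, Nat.size_zero]
    omega
  · have := one_lt_glob x; omega
  · simp [ArithOp.eval, h.holds.len, h.zero]

lemma Rep.of_eq {ρ : ℕ → ℕ} {w w' : List ℕ} {s s' : RAMState} (h : Rep ρ w s)
    (h' : Holds w' s') (hr : ∀ r, 1 < r → r < 60 → s'.reg r = s.reg r) : Rep ρ w' s' :=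
  ⟨h', fun x => by rw [hr _ (one_lt_glob x) (glob_lt x), h.var],
    by rw [hr 2 (by norm_num) (by norm_num), h.zero]⟩

/-- Runs a command on the current word. -/
def pass (c : Cmd) : RAMProg := .seq setLim (c.comp glob 60)

lemma Tr.pass {c : Cmd} {V : ℕ} {ρ : ℕ → ℕ} {w : List ℕ} (hb : Bounds V ρ w)
    (hc : c.Productive) (hV : (w ++ c.out ρ w).length ≤ V) :
    Tr (pass c) ρ w ((1 + (c.out ρ w).length) * (c.ct V + 1 + Nat.size V)) ρ
      (w ++ c.out ρ w) := by
  intro s hs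
  obtain ⟨s1, h1, r1, v1⟩ := hs.setLim hb.length
  obtain ⟨s2, h2, m2, p2⟩ := c.comp_spec v1 hb (List.prefix_refl w) r1.holds hc hV
  refine ⟨s2, (h1.seq h2).mono ?_, r1.of_eq m2 fun r h0 hr => p2 r (by omega) hr⟩
  have : 1 + V.size ≤ (1 + (c.out ρ w).length) * (1 + V.size) :=
    Nat.le_mul_of_pos_left _ (by omega)
  rw [add_assoc (c.ct V), mul_add]
  omega

/-- Sets a global variable. -/
def assign (x : ℕ) (e : Ex) : RAMProg :=
  .seq setLim (.seq (e.comp glob 60) (.arith .add (x + 3) 60 2))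

lemma Tr.assign {x : ℕ} (hx : x < 40) {e : Ex} {V : ℕ} {ρ : ℕ → ℕ} {w : List ℕ}
    (hb : Bounds V ρ w) :
    Tr (assign x e) ρ w (e.ct V + 2 + Nat.size V + Nat.size (e.vb V))
      (Function.update ρ x (e.eval ρ w)) w := by
  intro s hs
  obtain ⟨s1, h1, r1, v1⟩ := hs.setLim hb.length
  obtain ⟨s2, h2, m2, p2, e2⟩ := e.comp_spec v1 hb
  have h3 := Run.arith s2 .add (x + 3) 60 2
  have z2 : s2.reg 2 = 0 := by rw [p2 2 (by norm_num), r1.zero]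
  refine ⟨_, (h1.seq (h2.seq h3)).mono ?_, ⟨?_, fun y => ?_, by simp [z2]⟩⟩
  · have := size_le (e.eval_le_vb hb)
    rw [e2, z2, Nat.size_zero]
    omega
  · exact r1.holds.of_mem_eq (by simp [m2]) (by simp [p2 0])
  · have hg : glob y = x + 3 ↔ y = x := by unfold glob; split_ifs <;> omega
    by_cases hy : y = x
    · simp [hy, glob, hx, ArithOp.eval, e2, z2]
    · simp [hy, hg, p2 _ (glob_lt y), r1.var]

/-- Appends the values of `e` for all `x < n`; each evaluation sees the entries that were
appended before. -/
def emitAll (x : ℕ) (n e : Ex) : RAMProg :=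
  .seq setLim (.seq (n.comp glob 60) (.seq (.const 61 0) (.loop 60 (.seq setLim
    (.seq ((Cmd.emit e).comp (Function.update glob x 61) 62) (.seq (.const 62 1)
      (.seq (.arith .add 61 61 62) (.arith .sub 60 60 62))))))))

/-- The running time of `emitAll` per round. -/
def emitAllCt (n e : Ex) (V : ℕ) : ℕ :=
  n.ct V + 2 * (Cmd.emit e).ct (V + n.vb V) + 9 + Nat.size V + 3 * Nat.size (n.vb V)

/-- The word grows by one entry per round, and `f i` is the value of `e` in round `i`. -/
lemma Tr.emitAll {x : ℕ} {n e : Ex} {V N : ℕ} {ρ : ℕ → ℕ} {w : List ℕ} {f : ℕ → ℕ}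
    (hN : n.eval ρ w = N) (hb : Bounds V ρ (w ++ (List.range N).map f))
    (hf : ∀ i < N, e.eval (Function.update ρ x i) (w ++ (List.range i).map f) = f i) :
    Tr (emitAll x n e) ρ w ((1 + N) * emitAllCt n e V) ρ (w ++ (List.range N).map f) := by
  intro s hs
  let W : ℕ → List ℕ := fun i => w ++ (List.range i).map f
  have hWpre : ∀ i ≤ N, W i <+: W N := by
    intro i hi
    refine (List.prefix_append_right_inj _).2 ?_
    obtain ⟨d, rfl⟩ := Nat.exists_eq_add_of_le hi
    rw [List.range_add, List.map_append]
    exact List.prefix_append _ _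
  have hWlen : ∀ i, (W i).length = w.length + i := by simp [W]
  have hbW : ∀ i ≤ N, Bounds V ρ (W i) := by
    intro i hi
    refine ⟨hb.var, fun a => ?_, (hWpre i hi).length_le.trans hb.length⟩
    rcases lt_or_ge a (W i).length with ha | ha
    · rw [← getD_prefix (hWpre i hi) ha]; exact hb.entry a
    · rw [List.getD_eq_default _ _ ha]; exact Nat.zero_le _
  have hb0 : Bounds V ρ w := by simpa [W] using hbW 0 (Nat.zero_le _)
  have hlV : w.length + N ≤ V := by have := hb.length; simpa using this
  have hnv : N ≤ n.vb V := hN ▸ n.eval_le_vb hb0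
  obtain ⟨s1, h1, r1, v1⟩ := hs.setLim hb0.length
  obtain ⟨s2, h2, m2, p2, e2⟩ := n.comp_spec v1 hb0
  have h3 := Run.const s2 61 0
  set s3 := s2.setReg 61 0 with hs3
  let Inv : ℕ → RAMState → Prop := fun i t => Rep ρ (W i) t ∧ t.reg 61 = i
  obtain ⟨s4, h4, ⟨r4, -⟩, -⟩ := Run.countLoop (a := 60) (N := N) (s := s3)
    (P := .seq setLim
      (.seq ((Cmd.emit e).comp (Function.update glob x 61) 62) (.seq (.const 62 1)
        (.seq (.arith .add 61 61 62) (.arith .sub 60 60 62)))))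
    Inv (fun _ => Nat.size V + 2 * (Cmd.emit e).ct (V + n.vb V) + 7 + 2 * Nat.size (n.vb V))
    (by
      rintro i hi t ⟨tr, ti⟩ tN
      have k1 := Run.arith t .add 1 0 2
      set u1 := t.setReg 1 _ with hu1
      have ur1 : Rep ρ (W i) u1 := by
        refine tr.of_eq (tr.holds.of_mem_eq rfl (by simp [hu1])) fun r h1 _ => ?_
        have : r ≠ 1 := by omega
        simp [hu1, this]
      have us1 : Sees glob 61 ρ (W i) u1 := by
        refine ⟨by norm_num, fun y => ?_, fun y => ?_, ur1.var, ?_, ur1.zero,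
          fun a _ => ur1.holds.mem a⟩
        · have := glob_lt y; omega
        · have := one_lt_glob y; omega
        · simp [hu1, ArithOp.eval, tr.holds.len, tr.zero]
      have us1' := us1.bind (r := 61) (j' := 62) (i := i) le_rfl (by norm_num) x
        (by simp [hu1, ti])
      have hout : (Cmd.emit e).out (Function.update ρ x i) (W i) = [f i] := by
        simp [Cmd.out, W, hf i hi]
      obtain ⟨u2, k2, um2, up2⟩ := (Cmd.emit e).comp_spec us1'
        ((hbW i hi.le).bind (n := n.vb V) (by omega) x) (List.prefix_refl _) ur1.holds trivial
        (by rw [hout, List.length_append, hWlen]; simp only [List.length_singleton]; omega)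
      rw [hout] at k2 um2
      have hWi : W i ++ [f i] = W (i + 1) := by simp [W, List.range_succ]
      rw [hWi] at um2
      have k3 := Run.const u2 62 1
      set u3 := u2.setReg 62 1 with hu3
      have k4 := Run.arith u3 .add 61 61 62
      set u4 := u3.setReg 61 _ with hu4
      have k5 := Run.arith u4 .sub 60 60 62
      set u5 := u4.setReg 60 _ with hu5
      have q1 : u3.reg 61 = i := by simp [hu3, up2 61, hu1, ti]
      have q2 : u3.reg 62 = 1 := by simp [hu3]
      have q3 : u4.reg 62 = 1 := by simp [hu4, q2]
      have q4 : u4.reg 60 = N - i := by simp [hu4, hu3, up2 60, hu1, tN]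
      refine ⟨u5, (k1.seq (k2.seq (k3.seq (k4.seq k5)))).mono ?_, ⟨?_, ?_⟩, ?_⟩
      · rw [q1, q2, q3, q4, Nat.size_one, tr.holds.len, tr.zero, Nat.size_zero]
        have z1 : Nat.size (W i).length ≤ Nat.size V := size_le (hbW i hi.le).length
        have z3 : Nat.size i ≤ Nat.size (n.vb V) := size_le (by omega)
        have z4 : Nat.size (N - i) ≤ Nat.size (n.vb V) := size_le (by omega)
        simp only [List.length_singleton]
        omega
      · refine ur1.of_eq (um2.of_mem_eq (by simp [hu5, hu4, hu3]) (by simp [hu5, hu4, hu3])) ?_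
        intro r h0 hr
        have e1 : r ≠ 60 := by omega
        have e2 : r ≠ 61 := by omega
        have e3 : r ≠ 62 := by omega
        simp [hu5, hu4, hu3, e1, e2, e3, up2 r (by omega) (by omega)]
      · simp [hu5, hu4, ArithOp.eval, q1, q2]
      · simp only [hu5, setReg_reg, if_true, ArithOp.eval, q4, q3]
        omega)
    (by
      refine ⟨?_, by simp [hs3]⟩
      have : W 0 = w := by simp [W]
      rw [this]
      refine r1.of_eq (r1.holds.of_mem_eq (by simp [hs3, m2]) (by simp [hs3, p2])) ?_
      intro r h0 hr
      have e2 : r ≠ 61 := by omega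
      simp [hs3, e2, p2 r hr])
    (by simp [hs3, e2, hN])
  refine ⟨s4, (h1.seq (h2.seq (h3.seq h4))).mono ?_, r4⟩
  have z : Nat.size N ≤ Nat.size (n.vb V) := size_le hnv
  simp only [Finset.sum_const, Finset.card_range, smul_eq_mul, Nat.size_zero, emitAllCt]
  rw [add_mul, one_mul]
  have : N * (1 + N.size + (V.size + 2 * (Cmd.emit e).ct (V + n.vb V) + 7 + 2 * (n.vb V).size)) ≤
      N * (n.ct V + 2 * (Cmd.emit e).ct (V + n.vb V) + 9 + V.size + 3 * (n.vb V).size) :=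
    Nat.mul_le_mul_left _ (by omega)
  omega

lemma polyBounded_emitAllCt (n e : Ex) : PolyBounded (emitAllCt n e) :=
  (((n.polyBounded_ct.add ((PolyBounded.const 2).mul ((Cmd.polyBounded_ct _).comp
    (PolyBounded.id.add n.polyBounded_vb)))).add (.const 9)).add PolyBounded.id.size).add
      ((PolyBounded.const 3).mul n.polyBounded_vb.size)

lemma logBounded_emitAllCt {n e : Ex} (hn : n.SumFree) (he : e.SumFree) :
    LogBounded (emitAllCt n e) :=
  (((hn.logBounded_ct.add (((Cmd.SumFree.logBounded_ct (a := .emit e) he).comp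
    (PolyBounded.id.add n.polyBounded_vb)).const_mul 2)).add (.const 9)).add
      PolyBounded.id.logBounded_size).add (n.polyBounded_vb.logBounded_size.const_mul 3)

end RAM

/-! ### Using one program as a subroutine of another -/

namespace RAM

/-- All registers from this one on are left alone by the program. -/
def regBound : RAMProg → ℕ
  | .const d _ => d + 1
  | .arith _ d _ _ => d + 1
  | .load d _ => d + 1
  | .store _ _ => 0
  | .seq P Q => max (regBound P) (regBound Q)
  | .cond _ P Q => max (regBound P) (regBound Q)
  | .loop _ P => regBound P

/-- A program does not change the registers that it does not mention. -/
lemma reg_eq_of_regBound_le {P : RAMProg} {s s' : RAMState} {t : ℕ} (h : RAMExec P s t s') :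
    ∀ r, regBound P ≤ r → s'.reg r = s.reg r := by
  induction h with
  | const s d k => intro r hr; simp only [regBound] at hr; simp [show r ≠ d by omega]
  | arith s op d a b => intro r hr; simp only [regBound] at hr; simp [show r ≠ d by omega]
  | load s d a => intro r hr; simp only [regBound] at hr; simp [show r ≠ d by omega]
  | store s a b => intro r _; rfl
  | seq _ _ ih1 ih2 =>
    intro r hr
    simp only [regBound] at hr
    rw [ih2 r (by omega), ih1 r (by omega)]
  | cond_true _ _ ih => intro r hr; simp only [regBound] at hr; exact ih r (by omega)
  | cond_false _ _ ih => intro r hr; simp only [regBound] at hr; exact ih r (by omega)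
  | loop_true _ _ _ ih1 ih2 => intro r hr; rw [ih2 r hr, ih1 r hr]
  | loop_false _ => intro r _; rfl

/-- Sets the first `n` registers to zero. -/
def clearRegs : ℕ → RAMProg
  | 0 => .const 0 0
  | n + 1 => .seq (clearRegs n) (.const n 0)

lemma run_clearRegs (n : ℕ) (s : RAMState) :
    ∃ s', Run (clearRegs n) s (n + 1) s' ∧ s'.mem = s.mem ∧ (∀ r < n, s'.reg r = 0) ∧
      ∀ r, s.reg r = 0 → s'.reg r = 0 := by
  induction n with
  | zero =>
    refine ⟨_, (Run.const s 0 0).mono (by simp), rfl, by simp, fun r hr => ?_⟩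
    by_cases h : r = 0 <;> simp [h, hr]
  | succ n ih =>
    obtain ⟨s1, h1, m1, p1, q1⟩ := ih
    refine ⟨_, h1.seq ((Run.const s1 n 0).mono (by simp : _ ≤ 1)), m1, fun r hr => ?_,
      fun r hr => ?_⟩
    · by_cases h : r = n
      · simp [h]
      · simp [h, p1 r (by omega)]
    · by_cases h : r = n
      · simp [h]
      · simp [h, q1 r hr]

/-- Moves the part of the word that starts at the address in register `A` to the beginning of
the memory, and clears the rest of the memory. -/
def moveDown (A : ℕ) : RAMProg :=
  .seq (.arith .sub 60 0 A) (.seq (.const 61 0) (.seq (.const 62 1) (.seq (.arith .add 63 A 2)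
    (.seq (.loop 60 (.seq (.load 64 63) (.seq (.store 61 64) (.seq (.arith .add 61 61 62)
      (.seq (.arith .add 63 63 62) (.arith .sub 60 60 62))))))
    (.seq (.arith .add 60 A 2) (.loop 60 (.seq (.store 61 2) (.seq (.arith .add 61 61 62)
      (.arith .sub 60 60 62)))))))))

lemma run_moveDown {A V : ℕ} (hA3 : 3 ≤ A) (hA : A < 60) {p o : List ℕ} {s : RAMState}
    (hs : Holds (p ++ o) s) (hz : s.reg 2 = 0) (hp : s.reg A = p.length)
    (hl : (p ++ o).length ≤ V) (he : ∀ a, (p ++ o).getD a 0 ≤ V) :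
    ∃ s', Run (moveDown A) s ((1 + (p ++ o).length) * (40 + 20 * Nat.size V)) s' ∧
      ∀ a, s'.mem a = o.getD a 0 := by
  have hlen : (p ++ o).length = p.length + o.length := List.length_append
  have hzo : ∀ a, a ≤ V → Nat.size a ≤ Nat.size V := fun a ha => size_le ha
  have h1 := Run.arith s .sub 60 0 A
  set s1 := s.setReg 60 _ with hs1
  have h2 := Run.const s1 61 0
  set s2 := s1.setReg 61 0 with hs2
  have h3 := Run.const s2 62 1
  set s3 := s2.setReg 62 1 with hs3
  have h4 := Run.arith s3 .add 63 A 2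
  set s4 := s3.setReg 63 _ with hs4
  have n0 : A ≠ 60 := by omega
  have n1 : A ≠ 61 := by omega
  have n2 : A ≠ 62 := by omega
  have n3 : A ≠ 63 := by omega
  have n4 : A ≠ 64 := by omega
  have A3 : s3.reg A = p.length := by simp [hs3, hs2, hs1, n0, n1, n2, hp]
  have Z3 : s3.reg 2 = 0 := by simp [hs3, hs2, hs1, hz]
  obtain ⟨s5, h5, ⟨m5, i5, o5, -, A5, Z5⟩, -⟩ := Run.countLoop (a := 60) (N := o.length) (s := s4)
    (P := .seq (.load 64 63) (.seq (.store 61 64) (.seq (.arith .add 61 61 62)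
      (.seq (.arith .add 63 63 62) (.arith .sub 60 60 62)))))
    (fun i t => (∀ a, t.mem a = if a < i then o.getD a 0 else (p ++ o).getD a 0) ∧
      t.reg 61 = i ∧ t.reg 62 = 1 ∧ t.reg 63 = p.length + i ∧ t.reg A = p.length ∧ t.reg 2 = 0)
    (fun _ => 12 + 8 * Nat.size V)
    (by
      rintro i hi t ⟨tm, t1, t2, t3, tA, tz⟩ tN
      have k1 := Run.load t 64 63
      have hval : t.mem (t.reg 63) = o.getD i 0 := by
        rw [t3, tm, if_neg (by omega)]
        simp [List.getElem?_append_right]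
      set u1 := t.setReg 64 _ with hu1
      have k2 := Run.store u1 61 64
      set u2 := u1.setMem _ _ with hu2
      have k3 := Run.arith u2 .add 61 61 62
      set u3 := u2.setReg 61 _ with hu3
      have k4 := Run.arith u3 .add 63 63 62
      set u4 := u3.setReg 63 _ with hu4
      have k5 := Run.arith u4 .sub 60 60 62
      have a1 : u1.reg 61 = i := by simp [hu1, t1]
      have a2 : u1.reg 64 = o.getD i 0 := by simp only [hu1, setReg_reg, if_true, hval]
      have a3 : u2.reg 61 = i := by simp [hu2, a1]
      have a4 : u2.reg 62 = 1 := by simp [hu2, hu1, t2]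
      have a5 : u3.reg 63 = p.length + i := by simp [hu3, hu2, hu1, t3]
      have a6 : u3.reg 62 = 1 := by simp [hu3, a4]
      have a7 : u4.reg 62 = 1 := by simp [hu4, a6]
      have a8 : u4.reg 60 = o.length - i := by simp [hu4, hu3, hu2, hu1, tN]
      have hoi : o.getD i 0 ≤ V := by
        have := he (p.length + i)
        simpa [List.getElem?_append_right] using this
      refine ⟨_, (k1.seq (k2.seq (k3.seq (k4.seq k5)))).mono ?_, ⟨fun a => ?_, ?_, ?_, ?_, ?_, ?_⟩,
        ?_⟩
      · rw [hval, a1, a2, a3, a4, a5, a6, a7, a8, t3, Nat.size_one]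
        have z1 := hzo _ hoi
        have z2 := hzo i (by omega)
        have z3 := hzo (p.length + i) (by omega)
        have z4 := hzo (o.length - i) (by omega)
        omega
      · have : (u4.setReg 60 (ArithOp.sub.eval (u4.reg 60) (u4.reg 62))).mem a =
            if a = i then o.getD i 0 else t.mem a := by
          have hm1 : u1.mem = t.mem := rfl
          simp only [setReg_mem, hu4, hu3, hu2, setMem_mem, a1, a2, hm1]
        rw [this, tm]
        by_cases hai : a = i
        · simp [hai]
        · by_cases ha : a < i
          · simp [hai, ha, show a < i + 1 by omega]
          · simp [hai, ha, show ¬ a < i + 1 by omega]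
      · simp [hu4, hu3, ArithOp.eval, a3, a4]
      · simp [a7]
      · simp [hu4, ArithOp.eval, a5, a6, add_assoc]
      · simp [hu4, hu3, hu2, hu1, n0, n1, n3, n4, tA]
      · simp [hu4, hu3, hu2, hu1, tz]
      · simp only [setReg_reg, if_true, ArithOp.eval, a7, a8]; omega)
    (by
      refine ⟨fun a => by simp [hs4, hs3, hs2, hs1, hs.mem], by simp [hs4, hs3, hs2],
        by simp [hs4, hs3], ?_, ?_, ?_⟩
      · simp [hs4, ArithOp.eval, A3, Z3]
      · simp [hs4, n3, A3]
      · simp [hs4, Z3])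
    (by simp [hs4, hs3, hs2, hs1, ArithOp.eval, hs.len, hp])
  have h6 := Run.arith s5 .add 60 A 2
  set s6 := s5.setReg 60 _ with hs6
  obtain ⟨s7, h7, ⟨m7, -⟩, -⟩ := Run.countLoop (a := 60) (N := p.length) (s := s6)
    (P := .seq (.store 61 2) (.seq (.arith .add 61 61 62) (.arith .sub 60 60 62)))
    (fun i t => (∀ a, t.mem a = if a < o.length then o.getD a 0 else
        if a < o.length + i then 0 else (p ++ o).getD a 0) ∧
      t.reg 61 = o.length + i ∧ t.reg 62 = 1 ∧ t.reg 2 = 0)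
    (fun _ => 12 + 8 * Nat.size V)
    (by
      rintro i hi t ⟨tm, t1, t2, tz⟩ tN
      have k1 := Run.store t 61 2
      set u1 := t.setMem _ _ with hu1
      have k2 := Run.arith u1 .add 61 61 62
      set u2 := u1.setReg 61 _ with hu2
      have k3 := Run.arith u2 .sub 60 60 62
      have a1 : u1.reg 61 = o.length + i := by simp [hu1, t1]
      have a2 : u1.reg 62 = 1 := by simp [hu1, t2]
      have a3 : u2.reg 62 = 1 := by simp [hu2, a2]
      have a4 : u2.reg 60 = p.length - i := by simp [hu2, hu1, tN]
      refine ⟨_, (k1.seq (k2.seq k3)).mono ?_, ⟨fun a => ?_, ?_, ?_, ?_⟩, ?_⟩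
      · rw [a1, a2, a3, a4, t1, tz, Nat.size_one, Nat.size_zero]
        have z3 := hzo (o.length + i) (by omega)
        have z4 := hzo (p.length - i) (by omega)
        omega
      · have : (u2.setReg 60 (ArithOp.sub.eval (u2.reg 60) (u2.reg 62))).mem a =
            if a = o.length + i then 0 else t.mem a := by
          simp only [setReg_mem, hu2, hu1, setMem_mem, t1, tz]
        rw [this, tm]
        by_cases hai : a = o.length + i
        · simp [hai]
        · by_cases ha : a < o.length + i
          · simp [hai, ha, show a < o.length + (i + 1) by omega]
          · simp [hai, ha, show ¬ a < o.length + (i + 1) by omega, show ¬ a < o.length by omega]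
      · simp [hu2, ArithOp.eval, a1, a2, add_assoc]
      · simp [a3]
      · simp [hu2, hu1, tz]
      · simp only [setReg_reg, if_true, ArithOp.eval, a3, a4]; omega)
    (by
      refine ⟨fun a => ?_, by simp [hs6, i5], by simp [hs6, o5], by simp [hs6, Z5]⟩
      by_cases ha : a < o.length <;> simp [hs6, m5, ha])
    (by simp [hs6, ArithOp.eval, A5, Z5])
  refine ⟨s7, (h1.seq (h2.seq (h3.seq (h4.seq (h5.seq (h6.seq h7)))))).mono ?_, fun a => ?_⟩
  · rw [hs.len, hp, A3, Z3, A5, Z5, Nat.size_one, Nat.size_zero]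
    have z1 := hzo _ hl
    have z2 := hzo p.length (by omega)
    have z3 := hzo o.length (by omega)
    simp only [Finset.sum_const, Finset.card_range, smul_eq_mul]
    have b1 : o.length * (1 + o.length.size + (12 + 8 * V.size)) ≤
        o.length * (40 + 20 * V.size) := Nat.mul_le_mul_left _ (by omega)
    have b2 : p.length * (1 + p.length.size + (12 + 8 * V.size)) ≤
        p.length * (40 + 20 * V.size) := Nat.mul_le_mul_left _ (by omega)
    rw [hlen, add_mul, add_mul, one_mul]
    rw [hlen] at z1
    omega
  · rw [m7]
    by_cases h1 : a < o.length
    · simp [h1]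
    · by_cases h2 : a < o.length + p.length
      · simp [h1, h2]
      · rw [if_neg h1, if_neg h2, List.getD_eq_default _ _ (by rw [hlen]; omega),
          List.getD_eq_default _ _ (by omega)]

/-- Whatever a program `R` has appended to its input from the address in the global variable `x`
on can be used as the input of another program `P`. -/
theorem decidesWithin_comp (R P : RAMProg) {x : ℕ} (hx : x < 40) : ∃ (Q : RAMProg) (K : ℕ),
    ∀ (w p o : List ℕ) (s : RAMState) (ρ : ℕ → ℕ) (T₁ V : ℕ) (T : ℝ) (answer : Prop),
      Run R (RAMState.init w) T₁ s → Rep ρ (p ++ o) s → ρ x = p.length →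
      (p ++ o).length ≤ V → (∀ a, (p ++ o).getD a 0 ≤ V) → P.DecidesWithin o answer T →
      Q.DecidesWithin w answer
        ((T₁ + (1 + (p ++ o).length) * (K * (1 + Nat.size V)) : ℕ) + T) := by
  set M := RAMProg.seq R (moveDown (x + 3)) with hM
  -- The output is moved to the beginning of the memory and all registers in use are cleared, which
  -- restores the initial state on the word `o`.
  refine ⟨.seq (.seq M (clearRegs (regBound M))) P, 40 + regBound M + 1,
    fun w p o s ρ T₁ V T answer hR hs hx' hl he hP => ?_⟩
  obtain ⟨t, s', hP, htT, hans⟩ := hP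
  have hg : glob x = x + 3 := by simp [glob, hx]
  obtain ⟨s1, h1, m1⟩ := run_moveDown (A := x + 3) (V := V) (by omega) (by omega) hs.holds hs.zero
    (by rw [← hg, hs.var, hx']) hl he
  obtain ⟨t1, ht1, e1⟩ := hR.seq h1
  obtain ⟨s2, ⟨t2, ht2, e2⟩, m2, p2, q2⟩ := run_clearRegs (regBound M) s1
  have hs2 : s2 = RAMState.init o := by
    have hmem : s2.mem = (RAMState.init o).mem := by
      funext a; rw [m2, m1]; rfl
    have hreg : s2.reg = (RAMState.init o).reg := by
      funext r
      change s2.reg r = 0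
      rcases lt_or_ge r (regBound M) with hr | hr
      · exact p2 r hr
      · exact q2 r (reg_eq_of_regBound_le e1 r hr)
    cases s2
    cases h : RAMState.init o
    simp_all
  rw [hs2] at e2
  refine ⟨t1 + t2 + t, s', .seq (.seq e1 e2) hP, ?_, hans⟩
  have hb : t1 + t2 ≤ T₁ + (1 + (p ++ o).length) * ((40 + regBound M + 1) * (1 + Nat.size V)) := by
    have c1 : (1 + (p ++ o).length) * (40 + 20 * V.size) + (regBound M + 1) ≤
        (1 + (p ++ o).length) * ((40 + regBound M + 1) * (1 + Nat.size V)) := by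
      have d1 : regBound M + 1 ≤ (1 + (p ++ o).length) * (regBound M + 1) :=
        Nat.le_mul_of_pos_left _ (by omega)
      calc _ ≤ (1 + (p ++ o).length) * (40 + 20 * V.size) +
            (1 + (p ++ o).length) * (regBound M + 1) := Nat.add_le_add_left d1 _
        _ = (1 + (p ++ o).length) * (40 + 20 * V.size + (regBound M + 1)) := by ring
        _ ≤ _ := Nat.mul_le_mul_left _ (by nlinarith [Nat.zero_le (regBound M * V.size)])
    omega
  have hb' : ((t1 + t2 : ℕ) : ℝ) ≤
      ((T₁ + (1 + (p ++ o).length) * ((40 + regBound M + 1) * (1 + Nat.size V)) : ℕ) : ℝ) :=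
    Nat.cast_le.2 hb
  rw [Nat.cast_add (t1 + t2)]
  linarith

/-! ### Words with blocks of variable length -/

/-- A sequence of lists as a word, each list preceded by its length. -/
def blocks (LL : List (List ℕ)) : List ℕ := LL.flatMap fun l => l.length :: l

/-- The position of the `i`-th block in a word that contains the blocks from position `a` on. -/
def blockPos (a : ℕ) (LL : List (List ℕ)) (i : ℕ) : ℕ := a + (blocks (LL.take i)).length

@[simp] lemma blockPos_zero (a : ℕ) (LL : List (List ℕ)) : blockPos a LL 0 = a := by
  simp [blockPos, blocks]

lemma blockPos_length (a : ℕ) (LL : List (List ℕ)) :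
    blockPos a LL LL.length = a + (blocks LL).length := by
  simp [blockPos]

lemma blockPos_le (a : ℕ) (LL : List (List ℕ)) (i : ℕ) :
    blockPos a LL i ≤ a + (blocks LL).length := by
  have h : blocks LL = blocks (LL.take i) ++ blocks (LL.drop i) := by
    rw [blocks, blocks, blocks, ← List.flatMap_append, List.take_append_drop]
  rw [blockPos, h, List.length_append]
  omega

lemma blockPos_succ (a : ℕ) {LL : List (List ℕ)} {i : ℕ} (hi : i < LL.length) :
    blockPos a LL (i + 1) = blockPos a LL i + 1 + (LL.getD i []).length := by
  rw [blockPos, blockPos, List.take_succ_eq_append_getElem hi, blocks, blocks,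
    List.flatMap_append, List.length_append]
  simp [hi]
  omega

lemma exists_block {p LL q} {i : ℕ} (hi : i < LL.length) :
    ∃ u v : List ℕ, u.length = blockPos p.length LL i ∧
      p ++ blocks LL ++ q = u ++ ((LL.getD i []).length :: (LL.getD i [] ++ v)) := by
  refine ⟨p ++ blocks (LL.take i), blocks (LL.drop (i + 1)) ++ q, by simp [blockPos], ?_⟩
  have h : blocks LL = blocks (LL.take i) ++ blocks (LL.drop i) := by
    rw [blocks, blocks, blocks, ← List.flatMap_append, List.take_append_drop]
  have hc : ∀ l L, blocks (l :: L) = l.length :: (l ++ blocks L) := fun l L => by simp [blocks]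
  rw [h, List.drop_eq_getElem_cons hi, hc]
  simp [hi]

lemma getD_blockPos (p q : List ℕ) {LL : List (List ℕ)} {i : ℕ} (hi : i < LL.length) :
    (p ++ blocks LL ++ q).getD (blockPos p.length LL i) 0 = (LL.getD i []).length := by
  obtain ⟨u, v, hu, h⟩ := exists_block (p := p) (q := q) hi
  rw [h, ← hu]
  simp

lemma getD_blockPos_add (p q : List ℕ) {LL : List (List ℕ)} {i h : ℕ} (hi : i < LL.length)
    (hh : h < (LL.getD i []).length) :
    (p ++ blocks LL ++ q).getD (blockPos p.length LL i + 1 + h) 0 = (LL.getD i []).getD h 0 := by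
  obtain ⟨u, v, hu, e⟩ := exists_block (p := p) (q := q) hi
  rw [e, ← hu, add_assoc, List.getD_append_right _ _ _ _ (by omega)]
  rw [Nat.add_sub_cancel_left, add_comm 1 h]
  simp only [List.getD_cons_succ]
  rw [List.getD_append _ _ _ _ hh]

lemma blockPos_lt {p q : List ℕ} {LL : List (List ℕ)} {i : ℕ} (hi : i < LL.length) :
    blockPos p.length LL i < (p ++ blocks LL ++ q).length := by
  obtain ⟨u, v, hu, e⟩ := exists_block (p := p) (q := q) hi
  rw [e, ← hu]
  simp

/-- Moves register `61` over as many blocks as register `60` says. -/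
def skipBlocks : RAMProg :=
  .loop 60 (.seq (.load 62 61) (.seq (.arith .add 61 61 62) (.seq (.const 62 1)
    (.seq (.arith .add 61 61 62) (.arith .sub 60 60 62)))))

lemma run_skipBlocks {p q : List ℕ} {LL : List (List ℕ)} {s : RAMState} {V : ℕ}
    (hm : ∀ a, s.mem a = (p ++ blocks LL ++ q).getD a 0) (h60 : s.reg 60 = LL.length)
    (h61 : s.reg 61 = p.length) (hV : (p ++ blocks LL ++ q).length ≤ V) :
    ∃ s', Run skipBlocks s ((1 + LL.length) * (20 + 20 * Nat.size V)) s' ∧ s'.mem = s.mem ∧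
      s'.reg 61 = p.length + (blocks LL).length ∧ ∀ r < 60, s'.reg r = s.reg r := by
  have hlenV : p.length + (blocks LL).length + q.length ≤ V := by
    simpa [List.length_append, add_assoc] using hV
  have hLL : LL.length ≤ V := by
    have : ∀ i ≤ LL.length, i ≤ blockPos p.length LL i := by
      intro i hi
      induction i with
      | zero => exact Nat.zero_le _
      | succ i ih => rw [blockPos_succ _ hi]; have := ih (by omega); omega
    have := this _ le_rfl
    rw [blockPos_length] at this
    omega
  obtain ⟨s', h, ⟨m, r61, pr⟩, -⟩ := Run.countLoop (a := 60) (N := LL.length) (s := s)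
    (P := .seq (.load 62 61) (.seq (.arith .add 61 61 62) (.seq (.const 62 1)
      (.seq (.arith .add 61 61 62) (.arith .sub 60 60 62)))))
    (fun i t => t.mem = s.mem ∧ t.reg 61 = blockPos p.length LL i ∧ ∀ r < 60, t.reg r = s.reg r)
    (fun _ => 10 + 10 * Nat.size V)
    (by
      rintro i hi t ⟨tm, t1, tp⟩ tN
      have k1 := Run.load t 62 61
      have hval : t.mem (t.reg 61) = (LL.getD i []).length := by
        rw [tm, t1, hm, getD_blockPos p q hi]
      set u1 := t.setReg 62 _ with hu1
      have k2 := Run.arith u1 .add 61 61 62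
      set u2 := u1.setReg 61 _ with hu2
      have k3 := Run.const u2 62 1
      set u3 := u2.setReg 62 1 with hu3
      have k4 := Run.arith u3 .add 61 61 62
      set u4 := u3.setReg 61 _ with hu4
      have k5 := Run.arith u4 .sub 60 60 62
      have a1 : u1.reg 61 = blockPos p.length LL i := by simp [hu1, t1]
      have a2 : u1.reg 62 = (LL.getD i []).length := by
        simp only [hu1, setReg_reg, if_true, hval]
      have a3 : u3.reg 61 = blockPos p.length LL i + (LL.getD i []).length := by
        simp only [hu3, hu2, setReg_reg, if_true, ArithOp.eval, a1, a2]
        simp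
      have a4 : u3.reg 62 = 1 := by simp [hu3]
      have a5 : u4.reg 62 = 1 := by simp [hu4, a4]
      have a6 : u4.reg 60 = LL.length - i := by simp [hu4, hu3, hu2, hu1, tN]
      have hb := blockPos_le p.length LL (i + 1)
      rw [blockPos_succ _ hi] at hb
      refine ⟨_, (k1.seq (k2.seq (k3.seq (k4.seq k5)))).mono ?_, ⟨?_, ?_, ?_⟩, ?_⟩
      · rw [hval, a1, a2, a3, a4, a5, a6, t1, Nat.size_one]
        have z1 : Nat.size (LL.getD i []).length ≤ Nat.size V := size_le (by omega)
        have z2 : Nat.size (blockPos p.length LL i) ≤ Nat.size V := size_le (by omega)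
        have z3 : Nat.size (blockPos p.length LL i + (LL.getD i []).length) ≤ Nat.size V :=
          size_le (by omega)
        have z4 : Nat.size (LL.length - i) ≤ Nat.size V := size_le (by omega)
        omega
      · simp [hu4, hu3, hu2, hu1, tm]
      · have : (u4.setReg 60 (ArithOp.sub.eval (u4.reg 60) (u4.reg 62))).reg 61 =
            u3.reg 61 + u3.reg 62 := by simp [hu4, ArithOp.eval]
        rw [this, a3, a4, blockPos_succ _ hi]
        omega
      · intro r hr
        have e1 : r ≠ 60 := by omega
        have e2 : r ≠ 61 := by omega
        have e3 : r ≠ 62 := by omega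
        simp [hu4, hu3, hu2, hu1, e1, e2, e3, tp r hr]
      · simp only [setReg_reg, if_true, ArithOp.eval, a5, a6]; omega)
    ⟨rfl, by simp [h61], fun _ _ => rfl⟩ h60
  refine ⟨s', h.mono ?_, m, by rw [r61, blockPos_length], pr⟩
  have z := size_le hLL
  simp only [Finset.sum_const, Finset.card_range, smul_eq_mul]
  have : LL.length * (1 + LL.length.size + (10 + 10 * V.size)) ≤
      LL.length * (20 + 20 * V.size) := Nat.mul_le_mul_left _ (by omega)
  rw [add_mul, one_mul]
  omega

/-- Finds the length of an input that consists of a prefix and two sequences of blocks. The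
program `A` has to find the number of blocks of the first sequence and its position. -/
def readLength (A : RAMProg) : RAMProg :=
  .seq A (.seq skipBlocks (.seq (.load 60 61) (.seq (.const 62 1) (.seq (.arith .add 61 61 62)
    (.seq skipBlocks (.arith .add 0 61 2))))))

/-- The word of two sequences of blocks after a prefix. -/
def twoBlocks (p : List ℕ) (L₁ L₂ : List (List ℕ)) : List ℕ :=
  p ++ blocks L₁ ++ (L₂.length :: blocks L₂)

lemma run_readLength {A : RAMProg} {p : List ℕ} {L₁ L₂ : List (List ℕ)} {T V : ℕ} {s : RAMState}
    (hA : Run A (RAMState.init (twoBlocks p L₁ L₂)) T s)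
    (hm : s.mem = (RAMState.init (twoBlocks p L₁ L₂)).mem)
    (hr : ∀ r < 60, s.reg r = 0) (h60 : s.reg 60 = L₁.length) (h61 : s.reg 61 = p.length)
    (hV : (twoBlocks p L₁ L₂).length ≤ V) (hV1 : L₁.length ≤ V) (hV2 : L₂.length ≤ V) :
    ∃ s', Run (readLength A) (RAMState.init (twoBlocks p L₁ L₂))
      (T + (1 + V) * (100 + 100 * Nat.size V)) s' ∧
      Rep (fun _ => 0) (twoBlocks p L₁ L₂) s' := by
  set w := twoBlocks p L₁ L₂ with hw
  have hmw : ∀ a, s.mem a = w.getD a 0 := fun a => by rw [hm]; rfl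
  obtain ⟨s1, h1, m1, r1, p1⟩ := run_skipBlocks (q := L₂.length :: blocks L₂) hmw h60 h61 hV
  have h2 := Run.load s1 60 61
  have hv : s1.mem (s1.reg 61) = L₂.length := by
    rw [m1, hmw, r1, hw, twoBlocks]
    simp
  set s2 := s1.setReg 60 _ with hs2
  have h3 := Run.const s2 62 1
  set s3 := s2.setReg 62 1 with hs3
  have h4 := Run.arith s3 .add 61 61 62
  set s4 := s3.setReg 61 _ with hs4
  have hw2 : w = (p ++ blocks L₁ ++ [L₂.length]) ++ blocks L₂ ++ [] := by
    simp [hw, twoBlocks]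
  have a1 : s3.reg 61 = p.length + (blocks L₁).length := by simp [hs3, hs2, r1]
  have a2 : s3.reg 62 = 1 := by simp [hs3]
  obtain ⟨s5, h5, m5, r5, p5⟩ := run_skipBlocks (s := s4) (p := p ++ blocks L₁ ++ [L₂.length])
    (q := []) (LL := L₂) (V := V)
    (fun a => by rw [← hw2, ← hmw]; simp [hs4, hs3, hs2, m1])
    (by
      have : s4.reg 60 = s1.mem (s1.reg 61) := by simp [hs4, hs3, hs2]
      rw [this, hv])
    (by
      have : s4.reg 61 = s3.reg 61 + s3.reg 62 := by simp [hs4, ArithOp.eval]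
      rw [this, a1, a2]
      simp [add_assoc])
    (by rw [← hw2]; exact hV)
  have h6 := Run.arith s5 .add 0 61 2
  have hreg : ∀ r < 60, s5.reg r = 0 := by
    intro r hlt
    have e1 : r ≠ 60 := by omega
    have e2 : r ≠ 61 := by omega
    have e3 : r ≠ 62 := by omega
    rw [p5 r hlt]
    simp [hs4, hs3, hs2, e1, e2, e3, p1 r hlt, hr r hlt]
  have hlen : s5.reg 61 = w.length := by rw [r5, hw2]; simp; omega
  have hl1 : p.length + (blocks L₁).length ≤ V := by
    have := hV
    rw [hw, twoBlocks] at this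
    simp only [List.length_append] at this
    omega
  refine ⟨_, (hA.seq (h1.seq (h2.seq (h3.seq (h4.seq (h5.seq h6)))))).mono ?_,
    ⟨⟨fun a => ?_, ?_⟩, fun x => ?_, ?_⟩⟩
  · rw [hv, r1, a1, a2, hlen, hreg 2 (by norm_num), Nat.size_one, Nat.size_zero]
    have z1 := size_le hl1
    have z2 := size_le hV2
    have z3 := size_le hV
    have b1 : (1 + L₁.length) * (20 + 20 * V.size) ≤ (1 + V) * (20 + 20 * V.size) :=
      Nat.mul_le_mul_right _ (by omega)
    have b2 : (1 + L₂.length) * (20 + 20 * V.size) ≤ (1 + V) * (20 + 20 * V.size) :=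
      Nat.mul_le_mul_right _ (by omega)
    have b3 : 60 + 60 * V.size ≤ (1 + V) * (60 + 60 * V.size) :=
      Nat.le_mul_of_pos_left _ (by omega)
    have b4 : (1 + V) * (100 + 100 * V.size) = (1 + V) * (20 + 20 * V.size) +
      (1 + V) * (20 + 20 * V.size) + (1 + V) * (60 + 60 * V.size) := by ring
    omega
  · rw [setReg_mem, m5]
    simp [hs4, hs3, hs2, m1, hmw]
  · simp [ArithOp.eval, hlen, hreg]
  · have h1 := one_lt_glob x
    have h2 : glob x ≠ 0 := by omega
    simp [h2, hreg _ (glob_lt x)]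
  · simp [hreg]

end RAM

/-! ### Derived expressions -/

namespace RAM

namespace Ex

abbrev add (a b : Ex) : Ex := .op .add a b
abbrev sub (a b : Ex) : Ex := .op .sub a b
abbrev mul (a b : Ex) : Ex := .op .mul a b
abbrev div (a b : Ex) : Ex := .op .div a b

/-- The remainder of a division. -/
def mod (a b : Ex) : Ex := a.sub ((a.div b).mul b)

/-- One if `a < b`, otherwise zero. -/
def lt (a b : Ex) : Ex := (c 1).sub ((c 1).sub (b.sub a))

/-- One if `a = b`, otherwise zero. -/
def eq (a b : Ex) : Ex := (c 1).sub ((a.sub b).add (b.sub a))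

/-- The expression `a` if `t` is not zero, otherwise `b`. -/
def ite (t a b : Ex) : Ex :=
  (((c 1).sub ((c 1).sub t)).mul a).add (((c 1).sub t).mul b)

variable (ρ : ℕ → ℕ) (w : List ℕ)

@[simp] lemma eval_c (k : ℕ) : (c k).eval ρ w = k := rfl
@[simp] lemma eval_v (x : ℕ) : (v x).eval ρ w = ρ x := rfl
@[simp] lemma eval_lim : lim.eval ρ w = w.length := rfl
@[simp] lemma eval_mem (a : Ex) : (mem a).eval ρ w = w.getD (a.eval ρ w) 0 := rfl
@[simp] lemma eval_add (a b : Ex) : (a.add b).eval ρ w = a.eval ρ w + b.eval ρ w := rfl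
@[simp] lemma eval_sub (a b : Ex) : (a.sub b).eval ρ w = a.eval ρ w - b.eval ρ w := rfl
@[simp] lemma eval_mul (a b : Ex) : (a.mul b).eval ρ w = a.eval ρ w * b.eval ρ w := rfl
@[simp] lemma eval_div (a b : Ex) : (a.div b).eval ρ w = a.eval ρ w / b.eval ρ w := rfl
@[simp] lemma eval_sum (x : ℕ) (n e : Ex) : (sum x n e).eval ρ w =
    ∑ i ∈ Finset.range (n.eval ρ w), e.eval (Function.update ρ x i) w := rfl

@[simp] lemma eval_mod (a b : Ex) : (a.mod b).eval ρ w = a.eval ρ w % b.eval ρ w := by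
  have := Nat.div_add_mod' (a.eval ρ w) (b.eval ρ w)
  simp only [mod, eval_sub, eval_mul, eval_div]
  omega

@[simp] lemma eval_lt (a b : Ex) :
    (a.lt b).eval ρ w = if a.eval ρ w < b.eval ρ w then 1 else 0 := by
  simp only [lt, eval_sub, eval_c]
  split_ifs <;> omega

@[simp] lemma eval_eq (a b : Ex) :
    (a.eq b).eval ρ w = if a.eval ρ w = b.eval ρ w then 1 else 0 := by
  simp only [eq, eval_sub, eval_c, eval_add]
  split_ifs <;> omega

@[simp] lemma eval_ite (t a b : Ex) :
    (t.ite a b).eval ρ w = if t.eval ρ w = 0 then b.eval ρ w else a.eval ρ w := by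
  simp only [ite, eval_sub, eval_c, eval_add, eval_mul]
  split_ifs with h
  · simp [h]
  · have h1 : 1 - t.eval ρ w = 0 := by omega
    simp [h1]

end Ex

namespace Cmd

/-- Appends the values of several expressions. -/
def emits : Ex → List Ex → Cmd
  | e, [] => emit e
  | e, e' :: l => seq (emit e) (emits e' l)

@[simp] lemma out_emits (ρ : ℕ → ℕ) (w : List ℕ) (e : Ex) (l : List Ex) :
    (emits e l).out ρ w = (e :: l).map fun e => e.eval ρ w := by
  induction l generalizing e with
  | nil => rfl
  | cons e' l ih => simp [emits, out, ih]

lemma emits_emits (e : Ex) (l : List Ex) : (emits e l).Emits := by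
  cases l
  · trivial
  · exact Or.inl trivial

lemma productive_emits (e : Ex) (l : List Ex) : (emits e l).Productive := by
  induction l generalizing e with
  | nil => trivial
  | cons e' l ih => exact ⟨trivial, ih e'⟩

end Cmd

/-! ### Tables of block positions -/

lemma getD_le_iff {w : List ℕ} {V : ℕ} : (∀ a, w.getD a 0 ≤ V) ↔ ∀ y ∈ w, y ≤ V := by
  constructor
  · intro h y hy
    obtain ⟨i, hi, rfl⟩ := List.mem_iff_getElem.1 hy
    simpa [hi] using h i
  · intro h a
    rcases lt_or_ge a w.length with ha | ha
    · rw [List.getD_eq_getElem _ _ ha]; exact h _ (List.getElem_mem ha)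
    · rw [List.getD_eq_default _ _ ha]; exact Nat.zero_le _

lemma Bounds.append {V : ℕ} {ρ : ℕ → ℕ} {w u : List ℕ} (h : Bounds V ρ w)
    (hu : ∀ y ∈ u, y ≤ V) (hl : (w ++ u).length ≤ V) : Bounds V ρ (w ++ u) := by
  refine ⟨h.var, getD_le_iff.2 fun y hy => ?_, hl⟩
  rcases List.mem_append.1 hy with hy | hy
  · exact getD_le_iff.1 h.entry y hy
  · exact hu y hy

lemma Bounds.update {V i : ℕ} {ρ : ℕ → ℕ} {w : List ℕ} (h : Bounds V ρ w) (hi : i ≤ V) (x : ℕ) :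
    Bounds V (Function.update ρ x i) w := by
  refine ⟨fun y => ?_, h.entry, h.length⟩
  rw [Function.update_apply]
  split_ifs
  · exact hi
  · exact h.var y

/-- The next block position from the last entry of the word. -/
def nextBlock : Ex :=
  ((Ex.mem (Ex.lim.sub (.c 1))).add (.c 1)).add (.mem (.mem (Ex.lim.sub (.c 1))))

/-- Appends the table of the positions of `n` blocks from position `a` on. -/
def blockTable (a n : Ex) : RAMProg := .seq (pass (.emit a)) (emitAll 40 n nextBlock)

/-- The table of block positions, including the position of the end. -/
def blockPositions (a : ℕ) (LL : List (List ℕ)) : List ℕ :=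
  (List.range (LL.length + 1)).map (blockPos a LL)

lemma blockPositions_eq (a : ℕ) (LL : List (List ℕ)) : blockPositions a LL =
    [a] ++ (List.range LL.length).map fun i => blockPos a LL (i + 1) := by
  rw [blockPositions, List.range_succ_eq_map]
  simp [Function.comp_def]

lemma getD_blockPositions {a i : ℕ} {LL : List (List ℕ)} (hi : i ≤ LL.length) :
    (blockPositions a LL).getD i 0 = blockPos a LL i := by
  rw [blockPositions, List.getD_eq_getElem _ _ (by simp; omega)]
  simp

@[simp] lemma length_blockPositions (a : ℕ) (LL : List (List ℕ)) :
    (blockPositions a LL).length = LL.length + 1 := by simp [blockPositions]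

lemma tr_blockTable (a n : Ex) : ∃ τ, PolyBounded τ ∧ ∀ (p q : List ℕ) (LL : List (List ℕ))
    (r : List ℕ) (ρ : ℕ → ℕ) (V : ℕ),
    Bounds V ρ (p ++ blocks LL ++ q ++ r ++ blockPositions p.length LL) →
    a.eval ρ (p ++ blocks LL ++ q ++ r) = p.length →
    (∀ u, n.eval ρ (p ++ blocks LL ++ q ++ r ++ u) = LL.length) →
    Tr (blockTable a n) ρ (p ++ blocks LL ++ q ++ r) (τ V) ρ
      (p ++ blocks LL ++ q ++ r ++ blockPositions p.length LL) := by
  refine ⟨fun V => (1 + 1) * ((Cmd.emit a).ct V + 1 + Nat.size V) +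
    (1 + V) * emitAllCt n nextBlock V, ?_, ?_⟩
  · exact ((PolyBounded.const _).mul (((Cmd.polyBounded_ct _).add (.const 1)).add
      PolyBounded.id.size)).add (((PolyBounded.const 1).add .id).mul (polyBounded_emitAllCt _ _))
  · intro p q LL r ρ V hb ha hn
    set w := p ++ blocks LL ++ q ++ r with hw
    rw [blockPositions_eq, ← List.append_assoc] at hb ⊢
    have hlen := hb.length
    simp only [List.length_append, List.length_singleton, List.length_map,
      List.length_range] at hlen
    have hbw : Bounds V ρ w := by
      refine ⟨hb.var, fun i => ?_, by omega⟩
      have := getD_le_iff.1 hb.entry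
      exact getD_le_iff.2 (fun y hy => this y (by simp [hy])) i
    have hbw1 : Bounds V ρ (w ++ [p.length]) := by
      refine ⟨hb.var, fun i => ?_, by simp; omega⟩
      have := getD_le_iff.1 hb.entry
      exact getD_le_iff.2 (fun y hy => this y (List.mem_append_left _ hy)) i
    have h1 : Tr (pass (.emit a)) ρ w ((1 + 1) * ((Cmd.emit a).ct V + 1 + Nat.size V)) ρ
        (w ++ [p.length]) := by
      have := Tr.pass (c := .emit a) hbw trivial (by simp [Cmd.out]; omega)
      simpa only [Cmd.out, ha, List.length_singleton] using this
    have h2 : Tr (emitAll 40 n nextBlock) ρ (w ++ [p.length])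
        ((1 + LL.length) * emitAllCt n nextBlock V) ρ _ :=
      Tr.emitAll (hn [p.length]) hb (by
        intro i hi
        have hlast : (w ++ [p.length] ++ (List.range i).map fun i =>
            blockPos p.length LL (i + 1)).getD (w.length + i) 0 = blockPos p.length LL i := by
          cases i with
          | zero => simp
          | succ i =>
            rw [List.getD_append_right _ _ _ _ (by simp)]
            have : w.length + (i + 1) - (w.length + 1) = i := by omega
            simp [this]
        have hpre : p ++ blocks LL ++ q <+: (w ++ [p.length] ++ (List.range i).map fun i =>
            blockPos p.length LL (i + 1)) := by
          rw [hw]; simp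
        have hl : (w ++ [p.length] ++ (List.range i).map fun i =>
            blockPos p.length LL (i + 1)).length - 1 = w.length + i := by simp
        simp only [nextBlock, Ex.eval_add, Ex.eval_mem, Ex.eval_sub, Ex.eval_lim, Ex.eval_c, hl,
          hlast]
        rw [getD_prefix hpre (blockPos_lt hi), getD_blockPos p q hi, blockPos_succ _ hi])
    refine (h1.seq h2).mono ?_
    have : (1 + LL.length) * emitAllCt n nextBlock V ≤ (1 + V) * emitAllCt n nextBlock V :=
      Nat.mul_le_mul_right _ (by omega)
    dsimp only
    omega

/-- Reads a word of two sequences of blocks and appends the tables of block positions. The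
expressions `a` and `n` give the position and the number of the blocks of the first sequence.
Afterwards the global variables `0` and `1` are the positions of the tables, and `2` and `3` are
the numbers of blocks of the second and of the first sequence. -/
def setup (A : RAMProg) (a n : Ex) : RAMProg :=
  .seq (readLength A) (.seq (assign 3 n) (.seq (assign 0 .lim) (.seq (blockTable a (.v 3))
    (.seq (assign 4 (.mem ((Ex.v 0).add (.v 3)))) (.seq (assign 2 (.mem (.v 4)))
      (.seq (assign 1 .lim) (blockTable ((Ex.v 4).add (.c 1)) (.v 2))))))))

/-- The word that `setup` leaves. -/
def setupWord (p : List ℕ) (L₁ L₂ : List (List ℕ)) : List ℕ :=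
  twoBlocks p L₁ L₂ ++ blockPositions p.length L₁ ++
    blockPositions (p.length + (blocks L₁).length + 1) L₂

lemma length_le_blocks (LL : List (List ℕ)) : LL.length ≤ (blocks LL).length := by
  induction LL with
  | nil => simp
  | cons l LL ih =>
    simp only [blocks, List.flatMap_cons, List.length_append, List.length_cons] at ih ⊢
    omega

lemma blockPos_le_length (p : List ℕ) (L₁ L₂ : List (List ℕ)) :
    (∀ i, blockPos p.length L₁ i ≤ (twoBlocks p L₁ L₂).length) ∧
    (∀ i, blockPos (p.length + (blocks L₁).length + 1) L₂ i ≤ (twoBlocks p L₁ L₂).length) := by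
  constructor <;> intro i <;> refine (blockPos_le _ _ i).trans ?_ <;>
    simp only [twoBlocks, List.length_append, List.length_cons] <;> omega

theorem run_setup (a n : Ex) : ∃ τ, PolyBounded τ ∧ ∀ (A : RAMProg) (p : List ℕ)
    (L₁ L₂ : List (List ℕ)) (T V : ℕ) (s : RAMState),
    Run A (RAMState.init (twoBlocks p L₁ L₂)) T s →
    s.mem = (RAMState.init (twoBlocks p L₁ L₂)).mem → (∀ r < 60, s.reg r = 0) →
    s.reg 60 = L₁.length → s.reg 61 = p.length →
    (twoBlocks p L₁ L₂).length ≤ V → (∀ y ∈ twoBlocks p L₁ L₂, y ≤ V) →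
    (∀ ρ, a.eval ρ (twoBlocks p L₁ L₂) = p.length) →
    (∀ ρ, n.eval ρ (twoBlocks p L₁ L₂) = L₁.length) →
    ∃ s' ρ, Run (setup A a n) (RAMState.init (twoBlocks p L₁ L₂)) (T + τ V) s' ∧
      Rep ρ (setupWord p L₁ L₂) s' ∧ Bounds (3 * V + 2) ρ (setupWord p L₁ L₂) ∧
      ρ 0 = (twoBlocks p L₁ L₂).length ∧
      ρ 1 = (twoBlocks p L₁ L₂).length + (L₁.length + 1) ∧ ρ 2 = L₂.length ∧ ρ 3 = L₁.length := by
  obtain ⟨τ₁, hτ₁, H₁⟩ := tr_blockTable a (.v 3)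
  obtain ⟨τ₂, hτ₂, H₂⟩ := tr_blockTable ((Ex.v 4).add (.c 1)) (.v 2)
  let as : Ex → ℕ → ℕ := fun e V => e.ct V + 2 + Nat.size V + Nat.size (e.vb V)
  have has : ∀ e, PolyBounded (as e) := fun e =>
    ((e.polyBounded_ct.add (.const 2)).add PolyBounded.id.size).add e.polyBounded_vb.size
  have hV3 : PolyBounded fun V => 3 * V + 2 := ((PolyBounded.const 3).mul .id).add (.const 2)
  let e4 : Ex := .mem ((Ex.v 0).add (.v 3))
  refine ⟨fun V => (1 + V) * (100 + 100 * Nat.size V) + (as n (3 * V + 2) +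
    (as .lim (3 * V + 2) + (τ₁ (3 * V + 2) + (as e4 (3 * V + 2) + (as (.mem (.v 4)) (3 * V + 2) +
      (as .lim (3 * V + 2) + τ₂ (3 * V + 2))))))), ?_, ?_⟩
  · exact (((PolyBounded.const 1).add .id).mul ((PolyBounded.const 100).add
      ((PolyBounded.const 100).mul PolyBounded.id.size))).add (((has n).comp hV3).add
      (((has .lim).comp hV3).add ((hτ₁.comp hV3).add (((has e4).comp hV3).add
        (((has (.mem (.v 4))).comp hV3).add (((has .lim).comp hV3).add (hτ₂.comp hV3)))))))
  · intro A p L₁ L₂ T V s hA hm hr h60 h61 hl hy ha hn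
    set w := twoBlocks p L₁ L₂ with hw
    set V' := 3 * V + 2 with hV'
    have hl1 : L₁.length + 1 + L₂.length ≤ w.length := by
      have h1 := length_le_blocks L₁
      have h2 := length_le_blocks L₂
      simp only [hw, twoBlocks, List.length_append, List.length_cons]
      omega
    have hpl : p.length + (blocks L₁).length < w.length := by
      simp only [hw, twoBlocks, List.length_append, List.length_cons]
      omega
    obtain ⟨s1, r1, R1⟩ := run_readLength hA hm hr h60 h61 hl (by omega) (by omega)
    -- the variables and words after each step
    let ρ₁ : ℕ → ℕ := Function.update (fun _ => 0) 3 L₁.length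
    let ρ₂ : ℕ → ℕ := Function.update ρ₁ 0 w.length
    let ρ₃ : ℕ → ℕ := Function.update ρ₂ 4 (p.length + (blocks L₁).length)
    let ρ₄ : ℕ → ℕ := Function.update ρ₃ 2 L₂.length
    let w₁ := w ++ blockPositions p.length L₁
    let ρ₅ : ℕ → ℕ := Function.update ρ₄ 1 w₁.length
    have b0 : Bounds V' (fun _ => 0) w := ⟨fun _ => Nat.zero_le _,
      getD_le_iff.2 fun y hy' => (hy y hy').trans (by omega), by omega⟩
    have b1 : Bounds V' ρ₁ w := b0.update (by omega) 3
    have b2 : Bounds V' ρ₂ w := b1.update (by omega) 0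
    have hbp : (∀ i, blockPos p.length L₁ i ≤ w.length) ∧
        (∀ i, blockPos (p.length + (blocks L₁).length + 1) L₂ i ≤ w.length) :=
      blockPos_le_length p L₁ L₂
    have b2' : Bounds V' ρ₂ w₁ := by
      refine b2.append (fun y hy' => ?_) ?_
      · obtain ⟨i, -, rfl⟩ := List.mem_map.1 hy'
        have := hbp.1 i
        omega
      · rw [List.length_append, length_blockPositions]; omega
    have b3 : Bounds V' ρ₃ w₁ := b2'.update (by omega) 4
    have b4 : Bounds V' ρ₄ w₁ := b3.update (by omega) 2
    have b5 : Bounds V' ρ₅ w₁ := b4.update b4.length 1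
    have b5' : Bounds V' ρ₅ (setupWord p L₁ L₂) := by
      refine b5.append (fun y hy' => ?_) ?_
      · obtain ⟨i, -, rfl⟩ := List.mem_map.1 hy'
        have := hbp.2 i
        omega
      · rw [List.length_append, List.length_append, length_blockPositions,
          length_blockPositions]; omega
    have t1 : Tr (assign 3 n) (fun _ => 0) w (as n V') ρ₁ w := by
      have := Tr.assign (x := 3) (by norm_num) (e := n) b0
      rwa [hn] at this
    have t2 : Tr (assign 0 .lim) ρ₁ w (as .lim V') ρ₂ w :=
      Tr.assign (x := 0) (by norm_num) (e := .lim) b1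
    have t3 : Tr (blockTable a (.v 3)) ρ₂ w (τ₁ V') ρ₂ w₁ := by
      have := H₁ p (L₂.length :: blocks L₂) L₁ [] ρ₂ V'
      simp only [List.append_nil] at this
      exact this b2' (ha _) (fun u => by simp [ρ₂, ρ₁])
    have e4v : e4.eval ρ₂ w₁ = p.length + (blocks L₁).length := by
      simp only [e4, Ex.eval_mem, Ex.eval_add, Ex.eval_v]
      have : ρ₂ 0 + ρ₂ 3 = w.length + L₁.length := by simp [ρ₂, ρ₁]
      rw [this, List.getD_append_right _ _ _ _ (by omega), Nat.add_sub_cancel_left,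
        getD_blockPositions le_rfl, blockPos_length]
    have t4 : Tr (assign 4 e4) ρ₂ w₁ (as e4 V') ρ₃ w₁ := by
      have := Tr.assign (x := 4) (by norm_num) (e := e4) b2'
      rwa [e4v] at this
    have t5 : Tr (assign 2 (.mem (.v 4))) ρ₃ w₁ (as (.mem (.v 4)) V') ρ₄ w₁ := by
      have := Tr.assign (x := 2) (by norm_num) (e := .mem (.v 4)) b3
      have e : (Ex.mem (.v 4)).eval ρ₃ w₁ = L₂.length := by
        have : ρ₃ 4 = p.length + (blocks L₁).length := by simp [ρ₃]
        rw [Ex.eval_mem, Ex.eval_v, this, List.getD_append _ _ _ _ hpl, hw, twoBlocks]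
        simp
      rwa [e] at this
    have t6 : Tr (assign 1 .lim) ρ₄ w₁ (as .lim V') ρ₅ w₁ :=
      Tr.assign (x := 1) (by norm_num) (e := .lim) b4
    have hw2 : w = (p ++ blocks L₁ ++ [L₂.length]) ++ blocks L₂ ++ [] := by simp [hw, twoBlocks]
    have hlen2 : (p ++ blocks L₁ ++ [L₂.length]).length = p.length + (blocks L₁).length + 1 := by
      simp [add_assoc]
    have t7 : Tr (blockTable ((Ex.v 4).add (.c 1)) (.v 2)) ρ₅ w₁ (τ₂ V') ρ₅
        (setupWord p L₁ L₂) := by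
      have := H₂ (p ++ blocks L₁ ++ [L₂.length]) [] L₂ (blockPositions p.length L₁) ρ₅ V'
      rw [← hw2, hlen2] at this
      exact this b5' (by simp [ρ₅, ρ₄, ρ₃]) (fun u => by simp [ρ₅, ρ₄])
    obtain ⟨s', r', R'⟩ := (t1.seq (t2.seq (t3.seq (t4.seq (t5.seq (t6.seq t7)))))) s1 R1
    refine ⟨s', ρ₅, (r1.seq r').mono (by simp only [hV']; omega), R', b5', by simp [ρ₅, ρ₄, ρ₃, ρ₂], ?_,
      by simp [ρ₅, ρ₄], by simp [ρ₅, ρ₄, ρ₃, ρ₂, ρ₁]⟩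
    simp [ρ₅, w₁]

/-- The tables give access to the blocks of the input. -/
lemma getD_setupWord {p : List ℕ} {L₁ L₂ : List (List ℕ)} {w : List ℕ}
    (h : setupWord p L₁ L₂ <+: w) :
    (∀ a < (twoBlocks p L₁ L₂).length, w.getD a 0 = (twoBlocks p L₁ L₂).getD a 0) ∧
    (∀ i < L₁.length,
      w.getD (w.getD ((twoBlocks p L₁ L₂).length + i) 0) 0 = (L₁.getD i []).length) ∧
    (∀ i < L₁.length, ∀ k < (L₁.getD i []).length,
      w.getD (w.getD ((twoBlocks p L₁ L₂).length + i) 0 + 1 + k) 0 = (L₁.getD i []).getD k 0) ∧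
    (∀ i < L₂.length,
      w.getD (w.getD ((twoBlocks p L₁ L₂).length + (L₁.length + 1) + i) 0) 0 =
        (L₂.getD i []).length) ∧
    (∀ i < L₂.length, ∀ k < (L₂.getD i []).length,
      w.getD (w.getD ((twoBlocks p L₁ L₂).length + (L₁.length + 1) + i) 0 + 1 + k) 0 =
        (L₂.getD i []).getD k 0) := by
  set u := twoBlocks p L₁ L₂ with hu
  have hlen : (setupWord p L₁ L₂).length = u.length + (L₁.length + 1) + (L₂.length + 1) := by
    simp [setupWord, hu]; ring
  have h0 : ∀ a < u.length, w.getD a 0 = u.getD a 0 := by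
    intro a ha
    rw [getD_prefix h (by omega), setupWord, List.append_assoc, List.getD_append _ _ _ _ ha]
  have h1 : ∀ i < L₁.length, w.getD (u.length + i) 0 = blockPos p.length L₁ i := by
    intro i hi
    rw [getD_prefix h (by omega), setupWord, List.append_assoc,
      List.getD_append_right _ _ _ _ (by rw [← hu]; omega), ← hu, Nat.add_sub_cancel_left,
      List.getD_append _ _ _ _ (by simp; omega), getD_blockPositions hi.le]
  have h2 : ∀ i < L₂.length, w.getD (u.length + (L₁.length + 1) + i) 0 =
      blockPos (p.length + (blocks L₁).length + 1) L₂ i := by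
    intro i hi
    have hl : (twoBlocks p L₁ L₂ ++ blockPositions p.length L₁).length =
      u.length + (L₁.length + 1) := by simp [hu]
    rw [getD_prefix h (by omega), setupWord, List.getD_append_right _ _ _ _ (by omega), hl,
      Nat.add_sub_cancel_left, getD_blockPositions hi.le]
  have hw2 : u = (p ++ blocks L₁ ++ [L₂.length]) ++ blocks L₂ ++ [] := by simp [hu, twoBlocks]
  have hlen2 : (p ++ blocks L₁ ++ [L₂.length]).length = p.length + (blocks L₁).length + 1 := by
    simp [add_assoc]
  have hlt : ∀ a, u.getD a 0 ≠ 0 → w.getD a 0 = u.getD a 0 := by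
    intro a ha
    refine h0 a ?_
    by_contra hc
    exact ha (List.getD_eq_default _ _ (by omega))
  have hin1 : ∀ i < L₁.length, ∀ k ≤ (L₁.getD i []).length,
      blockPos p.length L₁ i + k < u.length := by
    intro i hi k hk
    have h3 := (blockPos_le_length p L₁ L₂).1
    have h4 := blockPos_le p.length L₁ (i + 1)
    rw [blockPos_succ _ hi] at h4
    have : p.length + (blocks L₁).length < u.length := by
      simp only [hu, twoBlocks, List.length_append, List.length_cons]; omega
    omega
  have hin2 : ∀ i < L₂.length, ∀ k ≤ (L₂.getD i []).length,
      blockPos (p.length + (blocks L₁).length + 1) L₂ i + k < u.length := by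
    intro i hi k hk
    have h4 := blockPos_le (p.length + (blocks L₁).length + 1) L₂ (i + 1)
    rw [blockPos_succ _ hi] at h4
    have : p.length + (blocks L₁).length + 1 + (blocks L₂).length = u.length := by
      simp only [hu, twoBlocks, List.length_append, List.length_cons]; omega
    omega
  refine ⟨h0, fun i hi => ?_, fun i hi k hk => ?_, fun i hi => ?_, fun i hi k hk => ?_⟩
  · rw [h1 i hi, h0 _ (by simpa using hin1 i hi 0 (Nat.zero_le _))]
    exact getD_blockPos p _ hi
  · rw [h1 i hi, h0 _ (by have := hin1 i hi (1 + k) (by omega); omega)]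
    exact getD_blockPos_add p _ hi hk
  · rw [h2 i hi, h0 _ (by simpa using hin2 i hi 0 (Nat.zero_le _)), ← hlen2, hw2]
    exact getD_blockPos _ _ hi
  · rw [h2 i hi, h0 _ (by have := hin2 i hi (1 + k) (by omega); omega), ← hlen2, hw2]
    exact getD_blockPos_add _ _ hi hk

end RAM

/-! ### Instances given by lists of natural numbers -/

/-- The entries of a list of numbers that are below `n`. -/
def toFin (n : ℕ) (l : List ℕ) : List (Fin n) :=
  l.filterMap fun x => if h : x < n then some ⟨x, h⟩ else none

lemma mem_toFin {n : ℕ} {l : List ℕ} {v : Fin n} : v ∈ toFin n l ↔ (v : ℕ) ∈ l := by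
  simp only [toFin, List.mem_filterMap]
  constructor
  · rintro ⟨x, hx, h⟩
    split_ifs at h with hlt
    · rw [← Option.some_inj.1 h]; exact hx
  · intro h
    exact ⟨v, h, by simp⟩

lemma map_val_toFin {n : ℕ} {l : List ℕ} (h : ∀ x ∈ l, x < n) :
    (toFin n l).map (fun v : Fin n => (v : ℕ)) = l := by
  induction l with
  | nil => rfl
  | cons x l ih =>
    have hx : x < n := h x (by simp)
    have : toFin n (x :: l) = ⟨x, hx⟩ :: toFin n l := by simp [toFin, hx]
    rw [this, List.map_cons, ih fun y hy => h y (by simp [hy])]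

lemma nodup_toFin {n : ℕ} {l : List ℕ} (h : l.Nodup) : (toFin n l).Nodup := by
  refine h.filterMap fun a b c ha hb => ?_
  simp only [Option.mem_def] at ha hb
  split_ifs at ha hb with h1 h2
  have h1 := congrArg Fin.val (Option.some_inj.1 ha)
  have h2 := congrArg Fin.val (Option.some_inj.1 hb)
  simp only at h1 h2
  omega

lemma length_toFin {n : ℕ} {l : List ℕ} (h : ∀ x ∈ l, x < n) : (toFin n l).length = l.length := by
  rw [← List.length_map (f := fun v : Fin n => (v : ℕ)), map_val_toFin h]

/-- The bags `bag 0, …, bag (F - 1)` as lists of vertices. -/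
def rawBags (n F : ℕ) (bag : ℕ → List ℕ) : List (List (Fin n)) :=
  (List.range F).map fun f => toFin n (bag f)

/-- A sequence of `F` bags in which every number below `n` occurs, in consecutive bags only. -/
structure RawBags (n F : ℕ) (bag : ℕ → List ℕ) : Prop where
  lt : ∀ f < F, ∀ x ∈ bag f, x < n
  nodup : ∀ f < F, (bag f).Nodup
  cover : ∀ x < n, ∃ f < F, x ∈ bag f
  interval : ∀ i j k, i ≤ j → j ≤ k → k < F → ∀ x, x ∈ bag i → x ∈ bag k → x ∈ bag j

lemma RawBags.isPathDecomposition {n F : ℕ} {bag : ℕ → List ℕ} (h : RawBags n F bag)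
    (G : SimpleGraph (Fin n))
    (hG : ∀ u v, G.Adj u v → ∃ f < F, (u : ℕ) ∈ bag f ∧ (v : ℕ) ∈ bag f) :
    IsPathDecomposition G (bagSets (rawBags n F bag)) := by
  have hmem : ∀ f < F, (toFin n (bag f)).toFinset ∈ bagSets (rawBags n F bag) := by
    intro f hf
    simp only [bagSets, rawBags, List.map_map, List.mem_map, List.mem_range]
    exact ⟨f, hf, rfl⟩
  have hlen : (bagSets (rawBags n F bag)).length = F := by simp [bagSets, rawBags]
  have hget : ∀ i : Fin (bagSets (rawBags n F bag)).length, ∀ v,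
      v ∈ (bagSets (rawBags n F bag)).get i ↔ (v : ℕ) ∈ bag i := by
    rintro ⟨i, hi⟩ v
    have : (bagSets (rawBags n F bag)).get ⟨i, hi⟩ = (toFin n (bag i)).toFinset := by
      simp [bagSets, rawBags]
    rw [this, List.mem_toFinset, mem_toFin]
  refine ⟨fun v => ?_, fun u v huv => ?_, fun i j k hij hjk v hi hk => ?_⟩
  · obtain ⟨f, hf, hv⟩ := h.cover v v.2
    exact ⟨_, hmem f hf, by simpa [mem_toFin] using hv⟩
  · obtain ⟨f, hf, hu, hv⟩ := hG u v huv
    exact ⟨_, hmem f hf, by simpa [mem_toFin] using hu, by simpa [mem_toFin] using hv⟩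
  · rw [hget] at hi hk ⊢
    exact h.interval i j k hij hjk (by have := k.2; omega) v hi hk

lemma RawBags.hasWidth {n F : ℕ} {bag : ℕ → List ℕ} (h : RawBags n F bag) {w : ℕ}
    (hle : ∀ f < F, (bag f).length ≤ w + 1) (hex : ∃ f < F, (bag f).length = w + 1) :
    HasWidth (bagSets (rawBags n F bag)) w := by
  have hcard : ∀ f < F, (toFin n (bag f)).toFinset.card = (bag f).length := fun f hf => by
    rw [List.toFinset_card_of_nodup (nodup_toFin (h.nodup f hf)), length_toFin (h.lt f hf)]
  simp only [HasWidth, bagSets, rawBags, List.map_map, List.mem_map, List.mem_range,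
    Function.comp_apply, forall_exists_index, and_imp, forall_apply_eq_imp_iff₂]
  refine ⟨fun f hf => (hcard f hf).trans_le (hle f hf), ?_⟩
  obtain ⟨f, hf, hw⟩ := hex
  exact ⟨_, ⟨f, hf, rfl⟩, (hcard f hf).trans hw⟩

lemma encodeBags_eq_flatMap {n : ℕ} (B : List (List (Fin n))) :
    encodeBags B = B.length :: B.flatMap fun b => b.length :: b.map Fin.val := by
  simp [encodeBags, List.map_eq_flatMap]

lemma RawBags.encodeBags {n F : ℕ} {bag : ℕ → List ℕ} (h : RawBags n F bag) :
    encodeBags (rawBags n F bag) =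
      F :: (List.range F).flatMap fun f => (bag f).length :: bag f := by
  simp only [encodeBags_eq_flatMap, rawBags, List.length_map, List.length_range, List.flatMap_map]
  congr 1
  refine List.flatMap_congr fun f hf => ?_
  rw [List.mem_range] at hf
  rw [length_toFin (h.lt f hf)]
  exact congrArg _ (map_val_toFin (h.lt f hf))

/-- A 3-CNF formula with a path decomposition from lists of numbers. -/
theorem exists_threeSATInstance {nv m F : ℕ} {cl : ℕ → List (ℕ × Bool)} {bag : ℕ → List ℕ}
    (hb : RawBags nv F bag) (hcl : ∀ f < m, (cl f).length ≤ 3)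
    (hclb : ∀ c < m, ∃ f < F, ∀ l ∈ cl c, l.1 ∈ bag f) :
    ∃ I : ThreeSATInstance,
      I.encode = [nv, m] ++ ((List.range m).flatMap fun f => (cl f).length ::
          (cl f).map fun l => 2 * l.1 + if l.2 then 1 else 0) ++
        (F :: (List.range F).flatMap fun f => (bag f).length :: bag f) ∧
      (I.Satisfiable ↔ ∃ α : ℕ → Bool, ∀ f < m, ∃ l ∈ cl f, α l.1 = l.2) ∧
      I.size = nv + m + F ∧
      ∀ w, (∀ f < F, (bag f).length ≤ w + 1) → (∃ f < F, (bag f).length = w + 1) →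
        HasWidth (bagSets I.bags) w := by
  have hlt : ∀ f < m, ∀ l ∈ cl f, l.1 < nv := by
    intro f hf l hl
    obtain ⟨g, hg, h⟩ := hclb f hf
    exact hb.lt g hg _ (h l hl)
  let conv : List (ℕ × Bool) → Clause nv := fun c =>
    c.filterMap fun l => if h : l.1 < nv then some (⟨l.1, h⟩, l.2) else none
  have hmem : ∀ c (l : Literal nv), l ∈ conv c ↔ ((l.1 : ℕ), l.2) ∈ c := by
    intro c l
    simp only [conv, List.mem_filterMap]
    constructor
    · rintro ⟨x, hx, h⟩
      split_ifs at h with hlt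
      · rw [← Option.some_inj.1 h]; exact hx
    · intro h
      exact ⟨_, h, by simp⟩
  have hmap : ∀ c : List (ℕ × Bool), (∀ l ∈ c, l.1 < nv) →
      (conv c).map (fun l => ((l.1 : ℕ), l.2)) = c := by
    intro c
    induction c with
    | nil => intro _; rfl
    | cons x c ih =>
      intro h
      have hx : x.1 < nv := h x (by simp)
      have : conv (x :: c) = (⟨x.1, hx⟩, x.2) :: conv c := by simp [conv, hx]
      rw [this, List.map_cons, ih fun y hy => h y (by simp [hy])]
  have hlen : ∀ c : List (ℕ × Bool), (∀ l ∈ c, l.1 < nv) → (conv c).length = c.length := by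
    intro c h
    rw [← List.length_map (f := fun l : Literal nv => ((l.1 : ℕ), l.2)), hmap c h]
  let φ : List (Clause nv) := (List.range m).map fun f => conv (cl f)
  have hφ : ∀ c, c ∈ φ ↔ ∃ f < m, conv (cl f) = c := by
    intro c; simp [φ]
  refine ⟨⟨nv, φ, rawBags nv F bag, ?_, ?_, hb.isPathDecomposition _ ?_⟩, ?_, ?_, ?_,
    fun w h1 h2 => hb.hasWidth h1 h2⟩
  · intro c hc
    obtain ⟨f, hf, rfl⟩ := (hφ c).1 hc
    rw [hlen _ (hlt f hf)]
    exact hcl f hf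
  · intro b hbm
    obtain ⟨f, hf, rfl⟩ := List.mem_map.1 hbm
    exact nodup_toFin (hb.nodup f (List.mem_range.1 hf))
  · intro u v huv
    have key : ∀ u v : Fin nv, (∃ c ∈ φ, u ∈ c.map Prod.fst ∧ v ∈ c.map Prod.fst) →
        ∃ f < F, (u : ℕ) ∈ bag f ∧ (v : ℕ) ∈ bag f := by
      rintro u v ⟨c, hc, hu, hv⟩
      obtain ⟨f, hf, rfl⟩ := (hφ c).1 hc
      obtain ⟨g, hg, h⟩ := hclb f hf
      obtain ⟨l, hl, rfl⟩ := List.mem_map.1 hu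
      obtain ⟨l', hl', rfl⟩ := List.mem_map.1 hv
      exact ⟨g, hg, h _ ((hmem _ _).1 hl), h _ ((hmem _ _).1 hl')⟩
    rcases huv with ⟨-, h | h⟩
    · exact key u v h
    · obtain ⟨f, hf, h1, h2⟩ := key v u h
      exact ⟨f, hf, h2, h1⟩
  · simp only [ThreeSATInstance.encode, hb.encodeBags]
    congr 1
    simp only [φ, List.length_map, List.length_range, List.flatMap_map]
    congr 1
    refine List.flatMap_congr fun f hf => ?_
    rw [List.mem_range] at hf
    rw [hlen _ (hlt f hf)]
    conv_rhs => rw [← hmap _ (hlt f hf)]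
    rw [List.length_map, List.map_map, hlen _ (hlt f hf)]
    rfl
  · constructor
    · rintro ⟨α, hα⟩
      refine ⟨fun x => if h : x < nv then α ⟨x, h⟩ else false, fun f hf => ?_⟩
      obtain ⟨l, hl, h⟩ := hα _ ((hφ _).2 ⟨f, hf, rfl⟩)
      refine ⟨_, (hmem _ _).1 hl, ?_⟩
      simpa using h
    · rintro ⟨α, hα⟩
      refine ⟨fun x => α x, fun c hc => ?_⟩
      obtain ⟨f, hf, rfl⟩ := (hφ c).1 hc
      obtain ⟨l, hl, h⟩ := hα f hf
      exact ⟨(⟨l.1, hlt f hf l hl⟩, l.2), (hmem _ _).2 hl, h⟩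
  · simp [ThreeSATInstance.size, φ, rawBags]

/-- A list coloring instance from lists of numbers. -/
theorem exists_listColoringInstance {n F : ℕ} {edges : List (ℕ × ℕ)} {colors bag : ℕ → List ℕ}
    (hb : RawBags n F bag) (hlt : ∀ e ∈ edges, e.1 < e.2) (hnd : edges.Nodup)
    (hc : ∀ v < n, (colors v).Nodup)
    (heb : ∀ e ∈ edges, ∃ f < F, e.1 ∈ bag f ∧ e.2 ∈ bag f) :
    ∃ I : ListColoringInstance,
      I.encode = [n, edges.length] ++ (edges.flatMap fun e => [e.1, e.2]) ++
        ((List.range n).flatMap fun v => (colors v).length :: colors v) ++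
        (F :: (List.range F).flatMap fun f => (bag f).length :: bag f) ∧
      (I.Colorable ↔ ∃ f : ℕ → ℕ, (∀ v < n, f v ∈ colors v) ∧ ∀ e ∈ edges, f e.1 ≠ f e.2) ∧
      I.numVertices = n ∧
      (∀ d, (∀ v < n, ∀ c ∈ colors v, c < n ^ d) → F ≤ n ^ d → I.PolySize d) ∧
      ∀ w, (∀ f < F, (bag f).length ≤ w + 1) → (∃ f < F, (bag f).length = w + 1) →
        HasWidth (bagSets I.bags) w := by
  have hen : ∀ e ∈ edges, e.1 < n ∧ e.2 < n := by
    intro e he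
    obtain ⟨f, hf, h1, h2⟩ := heb e he
    exact ⟨hb.lt f hf _ h1, hb.lt f hf _ h2⟩
  let conv : List (ℕ × ℕ) → List (Fin n × Fin n) := fun E => E.filterMap fun e =>
    if h : e.1 < n ∧ e.2 < n then some (⟨e.1, h.1⟩, ⟨e.2, h.2⟩) else none
  have hmem : ∀ E (e : Fin n × Fin n), e ∈ conv E ↔ ((e.1 : ℕ), (e.2 : ℕ)) ∈ E := by
    intro E e
    simp only [conv, List.mem_filterMap]
    constructor
    · rintro ⟨x, hx, h⟩
      split_ifs at h with hlt
      · rw [← Option.some_inj.1 h]; exact hx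
    · intro h
      exact ⟨_, h, by simp⟩
  have hmap : ∀ E : List (ℕ × ℕ), (∀ e ∈ E, e.1 < n ∧ e.2 < n) →
      (conv E).map (fun e => ((e.1 : ℕ), (e.2 : ℕ))) = E := by
    intro E
    induction E with
    | nil => intro _; rfl
    | cons x E ih =>
      intro h
      have hx : x.1 < n ∧ x.2 < n := h x (by simp)
      have : conv (x :: E) = (⟨x.1, hx.1⟩, ⟨x.2, hx.2⟩) :: conv E := by simp [conv, hx]
      rw [this, List.map_cons, ih fun y hy => h y (by simp [hy])]
  have hmapE := hmap edges hen
  have hadj : ∀ u v : Fin n, (SimpleGraph.fromRel fun u v => (u, v) ∈ conv edges).Adj u v ↔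
      ((u : ℕ), (v : ℕ)) ∈ edges ∨ ((v : ℕ), (u : ℕ)) ∈ edges := by
    intro u v
    simp only [SimpleGraph.fromRel_adj, hmem]
    constructor
    · exact fun h => h.2
    · intro h
      refine ⟨?_, h⟩
      rintro rfl
      rcases h with h | h <;> exact absurd (hlt _ h) (lt_irrefl _)
  refine ⟨⟨n, conv edges, fun v => colors v, rawBags n F bag, ?_, ?_, fun v => hc v v.2, ?_,
    hb.isPathDecomposition _ ?_⟩, ?_, ?_, rfl, ?_, fun w h1 h2 => hb.hasWidth h1 h2⟩
  · intro e he
    exact hlt _ ((hmem _ _).1 he)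
  · exact List.Nodup.of_map (f := fun e : Fin n × Fin n => ((e.1 : ℕ), (e.2 : ℕ)))
      (by rw [hmapE]; exact hnd)
  · intro b hbm
    obtain ⟨f, hf, rfl⟩ := List.mem_map.1 hbm
    exact nodup_toFin (hb.nodup f (List.mem_range.1 hf))
  · intro u v huv
    rcases (hadj u v).1 huv with h | h
    · exact heb _ h
    · obtain ⟨f, hf, h1, h2⟩ := heb _ h
      exact ⟨f, hf, h2, h1⟩
  · simp only [ListColoringInstance.encode, hb.encodeBags]
    congr 1
    have h1 : (conv edges).length = edges.length := by
      conv_rhs => rw [← hmapE, List.length_map]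
    have h2 : ((conv edges).flatMap fun e => [(e.1 : ℕ), (e.2 : ℕ)]) =
        edges.flatMap fun e => [e.1, e.2] := by
      conv_rhs => rw [← hmapE, List.flatMap_map]
    have h3 : ((List.finRange n).flatMap fun v : Fin n => (colors v).length :: colors v) =
        (List.range n).flatMap fun v => (colors v).length :: colors v := by
      rw [← List.map_coe_finRange_eq_range, List.flatMap_map]
    rw [h1, h2, h3]
  · constructor
    · rintro ⟨f, hf, hE⟩
      refine ⟨fun x => if h : x < n then f ⟨x, h⟩ else 0, fun v hv => by simpa [hv] using hf ⟨v, hv⟩,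
        fun e he => ?_⟩
      obtain ⟨h1, h2⟩ := hen e he
      simp only [h1, h2, dif_pos]
      exact hE _ _ ((hadj _ _).2 (Or.inl he))
    · rintro ⟨f, hf, hE⟩
      refine ⟨fun v => f v, fun v => hf v v.2, fun u v huv => ?_⟩
      rcases (hadj u v).1 huv with h | h
      · exact hE _ h
      · exact (hE _ h).symm
  · intro d h1 h2
    exact ⟨fun v c hcv => h1 v v.2 c hcv, by simpa [rawBags] using h2⟩

/-! ### Bags as lists of numbers -/

/-- Bags of vertices as lists of numbers. -/
def natBags {n : ℕ} (B : List (List (Fin n))) : List (List ℕ) :=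
  B.map fun b => b.map fun v : Fin n => (v : ℕ)

lemma encodeBags_eq {n : ℕ} (B : List (List (Fin n))) :
    encodeBags B = (natBags B).length :: RAM.blocks (natBags B) := by
  simp [encodeBags_eq_flatMap, natBags, RAM.blocks, List.flatMap_map]

lemma mem_natBags_getD {n : ℕ} {B : List (List (Fin n))} {t : ℕ} (ht : t < B.length) {x : ℕ} :
    x ∈ (natBags B).getD t [] ↔ ∃ h : x < n, (⟨x, h⟩ : Fin n) ∈ B[t] := by
  simp only [natBags, List.getD_eq_getElem?_getD, List.getElem?_map, ht, List.getElem?_eq_getElem,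
    Option.map_some, Option.getD_some, List.mem_map]
  constructor
  · rintro ⟨v, hv, rfl⟩
    exact ⟨v.2, hv⟩
  · rintro ⟨h, hv⟩
    exact ⟨_, hv, rfl⟩

lemma length_natBags_getD {n : ℕ} {B : List (List (Fin n))} {t : ℕ} (ht : t < B.length) :
    ((natBags B).getD t []).length = B[t].length := by
  simp [natBags, ht]

/-- The bags of a path decomposition, as lists of numbers. -/
lemma IsPathDecomposition.rawBags {n : ℕ} {G : SimpleGraph (Fin n)} {B : List (List (Fin n))}
    (h : IsPathDecomposition G (bagSets B)) (hn : ∀ b ∈ B, b.Nodup) :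
    RawBags n B.length (fun t => (natBags B).getD t []) ∧
    ∀ u v : Fin n, G.Adj u v → ∃ t < B.length, (u : ℕ) ∈ (natBags B).getD t [] ∧
      (v : ℕ) ∈ (natBags B).getD t [] := by
  have hex : ∀ b ∈ bagSets B, ∃ t, ∃ ht : t < B.length, b = B[t].toFinset := by
    intro b hb
    obtain ⟨l, hl, rfl⟩ := List.mem_map.1 hb
    obtain ⟨t, ht, rfl⟩ := List.mem_iff_getElem.1 hl
    exact ⟨t, ht, rfl⟩
  obtain ⟨h1, h2, h3⟩ := h
  refine ⟨⟨fun t ht x hx => ((mem_natBags_getD ht).1 hx).1, fun t ht => ?_, fun x hx => ?_,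
    fun i j k hij hjk hk x hi hk' => ?_⟩, fun u v huv => ?_⟩
  · simp only [natBags, List.getD_eq_getElem?_getD, List.getElem?_map, ht,
      List.getElem?_eq_getElem, Option.map_some, Option.getD_some]
    exact (hn _ (List.getElem_mem ht)).map Fin.val_injective
  · obtain ⟨b, hb, hv⟩ := h1 ⟨x, hx⟩
    obtain ⟨t, ht, rfl⟩ := hex b hb
    exact ⟨t, ht, (mem_natBags_getD ht).2 ⟨hx, by simpa using hv⟩⟩
  · have hi' : i < B.length := by omega
    have hj' : j < B.length := by omega
    obtain ⟨hx, hi⟩ := (mem_natBags_getD hi').1 hi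
    obtain ⟨_, hk2⟩ := (mem_natBags_getD hk).1 hk'
    have hl : (bagSets B).length = B.length := by simp [bagSets]
    have := h3 ⟨i, by omega⟩ ⟨j, by omega⟩ ⟨k, by omega⟩ hij hjk ⟨x, hx⟩
      (by simpa [bagSets] using hi) (by simpa [bagSets] using hk2)
    exact (mem_natBags_getD hj').2 ⟨hx, by simpa [bagSets] using this⟩
  · obtain ⟨b, hb, hu, hv⟩ := h2 u v huv
    obtain ⟨t, ht, rfl⟩ := hex b hb
    exact ⟨t, ht, (mem_natBags_getD ht).2 ⟨u.2, by simpa using hu⟩,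
      (mem_natBags_getD ht).2 ⟨v.2, by simpa using hv⟩⟩

lemma HasWidth.raw {n : ℕ} {B : List (List (Fin n))} {w : ℕ} (h : HasWidth (bagSets B) w)
    (hn : ∀ b ∈ B, b.Nodup) :
    (∀ t < B.length, ((natBags B).getD t []).length ≤ w + 1) ∧
      ∃ t < B.length, ((natBags B).getD t []).length = w + 1 := by
  have hcard : ∀ t (ht : t < B.length),
      ((natBags B).getD t []).length = B[t].toFinset.card := fun t ht => by
    rw [length_natBags_getD ht, List.toFinset_card_of_nodup (hn _ (List.getElem_mem ht))]
  obtain ⟨h1, b, hb, h2⟩ := h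
  refine ⟨fun t ht => ?_, ?_⟩
  · rw [hcard t ht]
    exact h1 _ (List.mem_map.2 ⟨_, List.getElem_mem ht, rfl⟩)
  · obtain ⟨l, hl, rfl⟩ := List.mem_map.1 hb
    obtain ⟨t, ht, rfl⟩ := List.mem_iff_getElem.1 hl
    exact ⟨t, ht, (hcard t ht).trans h2⟩

/-! ### From list coloring to satisfiability -/

/-- A list coloring instance with bags, as functions on natural numbers: `n` vertices, `m` edges
from `eu e` to `ev e`, lists `col v 0, …, col v (len v - 1)` of colors, and `T` bags
`bg t 0, …, bg t (bl t - 1)`. -/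
structure ColData where
  n : ℕ
  m : ℕ
  T : ℕ
  eu : ℕ → ℕ
  ev : ℕ → ℕ
  len : ℕ → ℕ
  col : ℕ → ℕ → ℕ
  bl : ℕ → ℕ
  bg : ℕ → ℕ → ℕ

lemma mul_add_div_of_lt (a : ℕ) {L r : ℕ} (h : r < L) : (a * L + r) / L = a := by
  rw [mul_comm, Nat.mul_add_div (by omega), Nat.div_eq_of_lt h, add_zero]

lemma mul_add_mod_of_lt (a : ℕ) {L r : ℕ} (h : r < L) : (a * L + r) % L = r := by
  rw [mul_comm, Nat.mul_add_mod, Nat.mod_eq_of_lt h]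

lemma div_lt_of_lt_mul_right {a b c : ℕ} (h : a < b * c) : a / c < b :=
  Nat.div_lt_of_lt_mul (by rwa [mul_comm] at h)

namespace ColData

variable (D : ColData)

/-- The bags form a path decomposition, there are no loops, and no list has a repeated color. -/
structure Valid : Prop where
  bags : RawBags D.n D.T fun t => (List.range (D.bl t)).map (D.bg t)
  edge : ∀ e < D.m, ∃ t < D.T, (∃ x < D.bl t, D.bg t x = D.eu e) ∧ ∃ y < D.bl t, D.bg t y = D.ev e
  ne : ∀ e < D.m, D.eu e ≠ D.ev e
  col_inj : ∀ v < D.n, ∀ i < D.len v, ∀ j < D.len v, D.col v i = D.col v j → i = j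

/-- There is a proper coloring; `f v` is the position of the color of `v` in its list. -/
def Colorable : Prop :=
  ∃ f : ℕ → ℕ, (∀ v < D.n, f v < D.len v) ∧
    ∀ e < D.m, D.col (D.eu e) (f (D.eu e)) ≠ D.col (D.ev e) (f (D.ev e))

variable {D}

lemma Valid.mem_lt (h : D.Valid) {t x : ℕ} (ht : t < D.T) (hx : x < D.bl t) : D.bg t x < D.n :=
  h.bags.lt t ht _ (List.mem_map.2 ⟨x, List.mem_range.2 hx, rfl⟩)

lemma Valid.bg_inj (h : D.Valid) {t x y : ℕ} (ht : t < D.T) (hx : x < D.bl t) (hy : y < D.bl t)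
    (hxy : D.bg t x = D.bg t y) : x = y :=
  List.inj_on_of_nodup_map (h.bags.nodup t ht) (List.mem_range.2 hx) (List.mem_range.2 hy) hxy

lemma Valid.bl_le (h : D.Valid) {t : ℕ} (ht : t < D.T) : D.bl t ≤ D.n := by
  have h1 : Set.InjOn (D.bg t) (Finset.range (D.bl t)) := by
    intro x hx y hy hxy
    exact h.bg_inj ht (by simpa using hx) (by simpa using hy) hxy
  have := Finset.card_le_card_of_injOn (s := Finset.range (D.bl t)) (t := Finset.range D.n)
    (D.bg t) (fun x hx => by
      simpa using h.mem_lt ht (by simpa using hx)) h1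
  simpa using this

lemma Valid.exists_mem (h : D.Valid) {v : ℕ} (hv : v < D.n) :
    ∃ t < D.T, ∃ x < D.bl t, D.bg t x = v := by
  obtain ⟨t, ht, hx⟩ := h.bags.cover v hv
  obtain ⟨x, hx', hv⟩ := List.mem_map.1 hx
  exact ⟨t, ht, x, List.mem_range.1 hx', hv⟩

lemma Valid.eu_lt (h : D.Valid) {e : ℕ} (he : e < D.m) : D.eu e < D.n ∧ D.ev e < D.n := by
  obtain ⟨t, ht, ⟨x, hx, h1⟩, y, hy, h2⟩ := h.edge e he
  exact ⟨h1 ▸ h.mem_lt ht hx, h2 ▸ h.mem_lt ht hy⟩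

/-- A vertex whose list has at least `n` colors can be colored last, with one of the first `n`
colors of its list. Hence only the first `n` colors of every list matter. -/
lemma Valid.exists_lt (h : D.Valid) (hc : D.Colorable) :
    ∃ f : ℕ → ℕ, (∀ v < D.n, f v < D.len v ∧ f v < D.n) ∧
      ∀ e < D.m, D.col (D.eu e) (f (D.eu e)) ≠ D.col (D.ev e) (f (D.ev e)) := by
  suffices H : ∀ s ≤ D.n, ∃ f : ℕ → ℕ, (∀ v < D.n, f v < D.len v) ∧ (∀ v < s, f v < D.n) ∧
      ∀ e < D.m, D.col (D.eu e) (f (D.eu e)) ≠ D.col (D.ev e) (f (D.ev e)) by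
    obtain ⟨f, h1, h2, h3⟩ := H D.n le_rfl
    exact ⟨f, fun v hv => ⟨h1 v hv, h2 v hv⟩, h3⟩
  intro s
  induction s with
  | zero =>
    intro _
    obtain ⟨f, h1, h2⟩ := hc
    exact ⟨f, h1, by simp, h2⟩
  | succ s ih =>
    intro hs
    obtain ⟨f, h1, h2, h3⟩ := ih (by omega)
    by_cases hfs : f s < D.n
    · refine ⟨f, h1, fun v hv => ?_, h3⟩
      rcases Nat.lt_succ_iff_lt_or_eq.1 hv with hv | rfl
      · exact h2 v hv
      · exact hfs
    -- the other vertices use at most `n - 1` of the first `n` colors of the vertex `s`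
    obtain ⟨i, hi, hiu⟩ : ∃ i < D.n, ∀ u < D.n, u ≠ s → D.col s i ≠ D.col u (f u) := by
      by_contra hcon
      push Not at hcon
      choose! u hu hus hcol using hcon
      have hls := h1 s (by omega)
      have := Finset.card_le_card_of_injOn (s := Finset.range D.n)
        (t := (Finset.range D.n).erase s) u (fun i hi => by
          have hi := Finset.mem_range.1 hi
          simpa using ⟨hu i hi, hus i hi⟩) (by
          intro i hi j hj hij
          have hi : i < D.n := by simpa using hi
          have hj : j < D.n := by simpa using hj
          refine h.col_inj s (by omega) i (by omega) j (by omega) ?_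
          rw [hcol i hi, hcol j hj, hij])
      rw [Finset.card_erase_of_mem (by simpa using (by omega : s < D.n)), Finset.card_range] at this
      omega
    refine ⟨Function.update f s i, fun v hv => ?_, fun v hv => ?_, fun e he => ?_⟩
    · by_cases hvs : v = s
      · subst hvs; have := h1 v hv; simp; omega
      · simpa [hvs] using h1 v hv
    · by_cases hvs : v = s
      · subst hvs; simpa using hi
      · simpa [hvs] using h2 v (by omega)
    · have hne := h.ne e he
      obtain ⟨hu, hv⟩ := h.eu_lt he
      by_cases hes : D.eu e = s
      · have hvs : D.ev e ≠ s := by rw [← hes]; exact hne.symm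
        simpa [hes, hvs] using hiu _ hv hvs
      · by_cases hvs : D.ev e = s
        · simpa [hes, hvs] using (hiu _ hu hes).symm
        · simpa [hes, hvs] using h3 e he

variable (D) (L : ℕ)

/-! The formula has `L` variables for each vertex, which spell the position of its color. For each
choice `g` of a bag, two of its vertices and two positions, a sequence of `2 L` clauses excludes
the choice if it is bad. The choice is a number in mixed radix, with the digits `pt` (the bag), `px`
and `py` (places in the bag), `pi` and `pj` (positions of colors); the bag is the leading digit, so
that the bags of the clauses follow the order of the given bags. -/

/-- The position of the color of the second vertex of a choice. -/
def pj (g : ℕ) : ℕ := g % 2 ^ L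
/-- The position of the color of the first vertex of a choice. -/
def pi (g : ℕ) : ℕ := g / 2 ^ L % 2 ^ L
/-- The place of the second vertex of a choice in the bag. -/
def py (g : ℕ) : ℕ := g / 2 ^ L / 2 ^ L % D.n
/-- The place of the first vertex of a choice in the bag. -/
def px (g : ℕ) : ℕ := g / 2 ^ L / 2 ^ L / D.n % D.n
/-- The bag of a choice. -/
def pt (g : ℕ) : ℕ := g / 2 ^ L / 2 ^ L / D.n / D.n

/-- The first vertex of a choice. -/
def pu (g : ℕ) : ℕ := D.bg (D.pt L g) (D.px L g)

/-- The second vertex of a choice. -/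
def pv (g : ℕ) : ℕ := D.bg (D.pt L g) (D.py L g)

/-- The choice has to be excluded: the position of the first vertex is too large, or the vertices
are adjacent and have the same color. -/
def Bad (g : ℕ) : Prop :=
  D.px L g < D.bl (D.pt L g) ∧ D.py L g < D.bl (D.pt L g) ∧
    (D.len (D.pu L g) ≤ pi L g ∨ D.n ≤ pi L g ∨
      ((∃ e < D.m, D.eu e = D.pu L g ∧ D.ev e = D.pv L g) ∧
        D.col (D.pu L g) (pi L g) = D.col (D.pv L g) (pj L g)))

/-- The literal that says that a bit differs from the choice. -/
def lit (g h : ℕ) : ℕ × Bool :=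
  if h < L then (D.pu L g * L + h, decide (pi L g / 2 ^ h % 2 = 0))
  else (D.pv L g * L + (h - L), decide (pj L g / 2 ^ (h - L) % 2 = 0))

/-- The number of clauses. -/
def numF : ℕ := D.T * D.n * D.n * 2 ^ L * 2 ^ L * (2 * L)

open Classical in
/-- The clauses; the auxiliary variable `n L + f` says that the first `f % (2 L)` literals of
the choice `f / (2 L)` are false. The clauses of choices that are not bad are tautologies. -/
noncomputable def cl (f : ℕ) : List (ℕ × Bool) :=
  if D.Bad L (f / (2 * L)) then
    [if f % (2 * L) = 0 then D.lit L (f / (2 * L)) (f % (2 * L)) else (D.n * L + f, false),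
      D.lit L (f / (2 * L)) (f % (2 * L)),
      if f % (2 * L) + 1 < 2 * L then (D.n * L + f + 1, true)
        else D.lit L (f / (2 * L)) (f % (2 * L))]
  else [(D.n * L + f, false), (D.n * L + f, true), (D.n * L + f, true)]

/-- The bag of a clause: the variables of all vertices of a bag of the graph, and two consecutive
auxiliary variables. -/
def bag (f : ℕ) : List ℕ :=
  (List.range (D.bl (D.pt L (f / (2 * L))) * L)).map
    (fun z => D.bg (D.pt L (f / (2 * L))) (z / L) * L + z % L) ++ [D.n * L + f, D.n * L + f + 1]

variable {D} {L}

lemma div_lt_numF {f : ℕ} (hf : f < D.numF L) : D.pt L (f / (2 * L)) < D.T := by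
  have h1 : f / (2 * L) < D.T * D.n * D.n * 2 ^ L * 2 ^ L :=
    div_lt_of_lt_mul_right hf
  have h2 : f / (2 * L) / 2 ^ L < D.T * D.n * D.n * 2 ^ L :=
    div_lt_of_lt_mul_right h1
  have h3 : f / (2 * L) / 2 ^ L / 2 ^ L < D.T * D.n * D.n :=
    div_lt_of_lt_mul_right h2
  have h4 : f / (2 * L) / 2 ^ L / 2 ^ L / D.n < D.T * D.n :=
    div_lt_of_lt_mul_right h3
  exact div_lt_of_lt_mul_right h4

lemma exists_choice {t x y i j : ℕ} (ht : t < D.T) (hx : x < D.n) (hy : y < D.n) (hi : i < 2 ^ L)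
    (hj : j < 2 ^ L) : ∃ g, (∀ h < 2 * L, 2 * L * g + h < D.numF L) ∧ D.pt L g = t ∧
      D.px L g = x ∧ D.py L g = y ∧ pi L g = i ∧ pj L g = j := by
  refine ⟨2 ^ L * (2 ^ L * (D.n * (D.n * t + x) + y) + i) + j, fun h hh => ?_, ?_⟩
  · have a1 : D.n * t + x < D.T * D.n := by nlinarith
    have a2 : D.n * (D.n * t + x) + y < D.T * D.n * D.n := by nlinarith
    have a3 : 2 ^ L * (D.n * (D.n * t + x) + y) + i < D.T * D.n * D.n * 2 ^ L := by nlinarith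
    have a4 : 2 ^ L * (2 ^ L * (D.n * (D.n * t + x) + y) + i) + j <
        D.T * D.n * D.n * 2 ^ L * 2 ^ L := by nlinarith
    rw [numF]
    nlinarith
  · have hQ : 0 < 2 ^ L := by positivity
    have hn : 0 < D.n := by omega
    have b : ∀ Q a r : ℕ, r < Q → (Q * a + r) / Q = a ∧ (Q * a + r) % Q = r := by
      intro Q a r hr
      constructor
      · rw [Nat.mul_add_div (by omega), Nat.div_eq_of_lt hr, add_zero]
      · rw [Nat.mul_add_mod, Nat.mod_eq_of_lt hr]
    simp only [pt, px, py, pi, pj, (b _ _ _ hj).1, (b _ _ _ hj).2, (b _ _ _ hi).1, (b _ _ _ hi).2,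
      (b _ _ _ hy).1, (b _ _ _ hy).2, (b _ _ _ hx).1, (b _ _ _ hx).2, and_self]

lemma mem_bag {f z : ℕ} (hL : 0 < L) (hz : z < D.n * L) : z ∈ D.bag L f ↔
    ∃ x < D.bl (D.pt L (f / (2 * L))), D.bg (D.pt L (f / (2 * L))) x = z / L := by
  simp only [bag, List.mem_append, List.mem_map, List.mem_range, List.mem_cons, List.not_mem_nil]
  constructor
  · rintro (⟨y, hy, rfl⟩ | h)
    · refine ⟨y / L, div_lt_of_lt_mul_right ‹_›, ?_⟩
      rw [mul_add_div_of_lt _ (Nat.mod_lt _ hL)]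
    · simp only [or_false] at h
      omega
  · rintro ⟨x, hx, h⟩
    left
    have hzL := Nat.mod_lt z hL
    refine ⟨L * x + z % L, by nlinarith, ?_⟩
    rw [Nat.mul_add_div hL, Nat.div_eq_of_lt hzL, add_zero, Nat.mul_add_mod,
      Nat.mod_eq_of_lt hzL, h, mul_comm, Nat.div_add_mod]

lemma Valid.lt_of_mem_bag (h : D.Valid) (hL : 0 < L) {f z : ℕ} (hf : f < D.numF L)
    (hz : z ∈ D.bag L f) : z < D.n * L ∨ z = D.n * L + f ∨ z = D.n * L + f + 1 := by
  simp only [bag, List.mem_append, List.mem_map, List.mem_range, List.mem_cons,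
    List.not_mem_nil, or_false] at hz
  refine hz.imp_left ?_
  rintro ⟨y, hy, rfl⟩
  have h1 := h.mem_lt (div_lt_numF hf) (x := y / L) (div_lt_of_lt_mul_right ‹_›)
  have h2 := Nat.mod_lt y hL
  nlinarith

lemma Valid.rawBags (h : D.Valid) (hL : 0 < L) (hn : 0 < D.n) :
    RawBags (D.n * L + D.numF L + 1) (D.numF L) (D.bag L) := by
  refine ⟨fun f hf z hz => ?_, fun f hf => ?_, fun z hz => ?_, fun i j k hij hjk hk z hi hk' => ?_⟩
  · rcases h.lt_of_mem_bag hL hf hz with h | h | h <;> omega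
  · have hT := div_lt_numF hf
    refine List.Nodup.append ?_ (by simp) ?_
    · refine List.Nodup.map_on ?_ List.nodup_range
      intro a ha b hb hab
      have ha := List.mem_range.1 ha
      have hb := List.mem_range.1 hb
      have h1 := congrArg (· / L) hab
      have h2 := congrArg (· % L) hab
      simp only [mul_add_div_of_lt _ (Nat.mod_lt _ hL),
        mul_add_mod_of_lt _ (Nat.mod_lt _ hL)] at h1 h2
      have h3 := h.bg_inj hT (x := a / L) (y := b / L) (div_lt_of_lt_mul_right ‹_›)
        (div_lt_of_lt_mul_right ‹_›) h1
      rw [← Nat.div_add_mod a L, ← Nat.div_add_mod b L, h2, h3]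
    · intro z hz1 hz2
      obtain ⟨y, hy, rfl⟩ := List.mem_map.1 hz1
      have hy := List.mem_range.1 hy
      have h1 := h.mem_lt hT (x := y / L) (div_lt_of_lt_mul_right ‹_›)
      have h2 := Nat.mod_lt y hL
      have h3 : D.bg (D.pt L (f / (2 * L))) (y / L) * L + y % L < D.n * L := by nlinarith
      simp only [List.mem_cons, List.not_mem_nil, or_false] at hz2
      omega
  · have hQ : 0 < 2 ^ L := by positivity
    rcases lt_or_ge z (D.n * L) with hz' | hz'
    · obtain ⟨t, ht, x, hx, hxz⟩ := h.exists_mem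
        (div_lt_of_lt_mul_right ‹_› : z / L < D.n)
      obtain ⟨g, hg, h1, -⟩ := exists_choice (L := L) ht hn hn hQ hQ
      refine ⟨2 * L * g + 0, hg 0 (by omega), (mem_bag hL hz').2 ⟨x, ?_⟩⟩
      rw [add_zero, Nat.mul_div_cancel_left _ (by omega), h1]
      exact ⟨hx, hxz⟩
    · have hF : 0 < D.numF L := by
        obtain ⟨t, ht, -⟩ := h.exists_mem hn
        obtain ⟨g, hg, -⟩ := exists_choice (L := L) ht hn hn hQ hQ
        have := hg 0 (by omega)
        omega
      rcases lt_or_ge z (D.n * L + D.numF L) with hz2 | hz2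
      · refine ⟨z - D.n * L, by omega, ?_⟩
        simp only [bag, List.mem_append, List.mem_cons]
        omega
      · refine ⟨D.numF L - 1, by omega, ?_⟩
        simp only [bag, List.mem_append, List.mem_cons]
        omega
  · have hmono : ∀ a b, a ≤ b → D.pt L (a / (2 * L)) ≤ D.pt L (b / (2 * L)) := fun a b hab => by
      unfold pt
      gcongr
    rcases lt_or_ge z (D.n * L) with hz' | hz'
    · rw [mem_bag hL hz'] at hi hk' ⊢
      have hmem : ∀ t, (∃ x < D.bl t, D.bg t x = z / L) ↔
          z / L ∈ (List.range (D.bl t)).map (D.bg t) := by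
        intro t; simp
      rw [hmem] at hi hk' ⊢
      exact h.bags.interval _ _ _ (hmono i j hij) (hmono j k hjk) (div_lt_numF hk) _ hi hk'
    · have h1 := h.lt_of_mem_bag hL (by omega) hi
      have h2 := h.lt_of_mem_bag hL hk hk'
      have h3 : z = D.n * L + j ∨ z = D.n * L + j + 1 := by omega
      simp only [bag, List.mem_append, List.mem_cons]
      omega

lemma lit_mem_bag (hv : D.Valid) (hL : 0 < L) {f h : ℕ} (hf : f < D.numF L) (hh : h < 2 * L)
    (hb : D.Bad L (f / (2 * L))) : (D.lit L (f / (2 * L)) h).1 ∈ D.bag L f := by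
  have hT := div_lt_numF hf
  obtain ⟨hx, hy, -⟩ := hb
  have key : ∀ x < D.bl (D.pt L (f / (2 * L))), ∀ h' < L,
      D.bg (D.pt L (f / (2 * L))) x * L + h' ∈ D.bag L f := by
    intro x hx h' hh'
    have h1 := hv.mem_lt hT hx
    rw [mem_bag hL (by nlinarith)]
    refine ⟨x, hx, ?_⟩
    rw [mul_add_div_of_lt _ hh']
  unfold lit
  split_ifs with h1
  · exact key _ hx _ h1
  · exact key _ hy _ (by omega)

lemma cl_mem_bag (hv : D.Valid) (hL : 0 < L) {f : ℕ} (hf : f < D.numF L) :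
    ∀ l ∈ D.cl L f, l.1 ∈ D.bag L f := by
  have hh := Nat.mod_lt f (by omega : 0 < 2 * L)
  have y0 : D.n * L + f ∈ D.bag L f := by simp [bag]
  have y1 : D.n * L + f + 1 ∈ D.bag L f := by simp [bag]
  intro l hl
  unfold cl at hl
  split_ifs at hl with hb h1 h2 h3 <;>
    simp only [List.mem_cons, List.not_mem_nil, or_false] at hl <;>
    rcases hl with rfl | rfl | rfl <;>
    first
      | exact y0
      | exact y1
      | exact lit_mem_bag hv hL hf hh hb

lemma testBit_eq (i h : ℕ) : decide (i / 2 ^ h % 2 = 0) = !i.testBit h := by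
  rw [Nat.testBit_eq_decide_div_mod_eq]
  rcases Nat.mod_two_eq_zero_or_one (i / 2 ^ h) with h | h <;> simp [h]

/-- All literals of a choice are false if and only if the bits spell the choice. -/
lemma lit_false_iff (hL : 0 < L) {α : ℕ → Bool} {p : ℕ → ℕ} (hp : ∀ v h, h < L →
    α (v * L + h) = (p v).testBit h) {g : ℕ} (hu : p (D.pu L g) < 2 ^ L)
    (hv : p (D.pv L g) < 2 ^ L) :
    (∀ h < 2 * L, α (D.lit L g h).1 ≠ (D.lit L g h).2) ↔
      p (D.pu L g) = pi L g ∧ p (D.pv L g) = pj L g := by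
  have hQ : 0 < 2 ^ L := by positivity
  have hi : pi L g < 2 ^ L := Nat.mod_lt _ hQ
  have hj : pj L g < 2 ^ L := Nat.mod_lt _ hQ
  have hext : ∀ a b, a < 2 ^ L → b < 2 ^ L → (∀ h < L, a.testBit h = b.testBit h) → a = b := by
    intro a b ha hb hab
    refine Nat.eq_of_testBit_eq fun h => ?_
    rcases lt_or_ge h L with hh | hh
    · exact hab h hh
    · rw [Nat.testBit_lt_two_pow (ha.trans_le (Nat.pow_le_pow_right (by norm_num) hh)),
        Nat.testBit_lt_two_pow (hb.trans_le (Nat.pow_le_pow_right (by norm_num) hh))]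
  constructor
  · intro h
    refine ⟨hext _ _ hu hi fun k hk => ?_, hext _ _ hv hj fun k hk => ?_⟩
    · have := h k (by omega)
      rw [lit, if_pos hk, hp _ _ hk] at this
      simpa only [testBit_eq, ne_eq, Bool.not_eq_eq_eq_not, Bool.not_not, Bool.eq_not_iff,
        not_not] using this
    · have := h (L + k) (by omega)
      rw [lit, if_neg (by omega), Nat.add_sub_cancel_left, hp _ _ hk] at this
      simpa only [testBit_eq, ne_eq, Bool.not_eq_eq_eq_not, Bool.not_not, Bool.eq_not_iff,
        not_not] using this
  · rintro ⟨h1, h2⟩ h hh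
    unfold lit
    split_ifs with hk
    · simp only [hp _ _ hk, h1, testBit_eq]
      simp
    · simp only [hp _ _ (by omega : h - L < L), h2, testBit_eq]
      simp

/-- The formula is satisfiable if and only if the graph is colorable. -/
theorem Valid.satisfiable_iff (hv : D.Valid) (hL : 0 < L) (hn : D.n ≤ 2 ^ L) :
    (∃ α : ℕ → Bool, ∀ f < D.numF L, ∃ l ∈ D.cl L f, α l.1 = l.2) ↔ D.Colorable := by
  have hdm : ∀ g h, h < 2 * L → (2 * L * g + h) / (2 * L) = g ∧ (2 * L * g + h) % (2 * L) = h := by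
    intro g h hh
    constructor
    · rw [Nat.mul_add_div (by omega), Nat.div_eq_of_lt hh, add_zero]
    · rw [Nat.mul_add_mod, Nat.mod_eq_of_lt hh]
  constructor
  · rintro ⟨α, hα⟩
    -- the position of the color of `v` is spelled by its bits
    let p : ℕ → ℕ := fun v => Nat.ofBits fun h : Fin L => α (v * L + h)
    have hp : ∀ v h, h < L → α (v * L + h) = (p v).testBit h := by
      intro v h hh
      rw [Nat.testBit_ofBits_lt _ _ hh]
    have hpQ : ∀ v, p v < 2 ^ L := fun v => Nat.ofBits_lt_two_pow _
    have key : ∀ t < D.T, ∀ x < D.bl t, ∀ y < D.bl t,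
        p (D.bg t x) < D.len (D.bg t x) ∧ p (D.bg t x) < D.n ∧
        ((∃ e < D.m, D.eu e = D.bg t x ∧ D.ev e = D.bg t y) →
          D.col (D.bg t x) (p (D.bg t x)) ≠ D.col (D.bg t y) (p (D.bg t y))) := by
      intro t ht x hx y hy
      have hbl := hv.bl_le ht
      obtain ⟨g, hg, rfl, rfl, rfl, hi, hj⟩ := exists_choice (L := L) ht (hx.trans_le hbl)
        (hy.trans_le hbl) (hpQ (D.bg t x)) (hpQ (D.bg t y))
      have hnb : ¬ D.Bad L g := by
        intro hb
        have hfalse := (lit_false_iff hL hp (hpQ (D.pu L g)) (hpQ (D.pv L g))).2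
          ⟨hi.symm, hj.symm⟩
        -- if the bits spelled a bad choice, all its auxiliary variables would be true, one after
        -- the other, and the last clause of the choice would be false
        have hchain : ∀ h, h + 1 < 2 * L → α (D.n * L + (2 * L * g + h) + 1) = true := by
          intro h
          induction h with
          | zero =>
            intro hh
            obtain ⟨l, hl, hal⟩ := hα _ (hg 0 (by omega))
            have := hfalse 0 (by omega)
            rw [cl, (hdm g 0 (by omega)).1, (hdm g 0 (by omega)).2, if_pos hb, if_pos rfl,
              if_pos hh] at hl
            simp only [List.mem_cons, List.not_mem_nil, or_false] at hl
            rcases hl with rfl | rfl | rfl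
            · exact absurd hal this
            · exact absurd hal this
            · exact hal
          | succ h ih =>
            intro hh
            have hprev := ih (by omega)
            obtain ⟨l, hl, hal⟩ := hα _ (hg (h + 1) (by omega))
            have := hfalse (h + 1) (by omega)
            rw [cl, (hdm g (h + 1) (by omega)).1, (hdm g (h + 1) (by omega)).2, if_pos hb,
              if_neg (by omega), if_pos hh] at hl
            simp only [List.mem_cons, List.not_mem_nil, or_false] at hl
            rcases hl with rfl | rfl | rfl
            · simp only [add_assoc] at hprev hal
              rw [hprev] at hal
              exact absurd hal (by simp)
            · exact absurd hal this
            · exact hal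
        obtain ⟨l, hl, hal⟩ := hα _ (hg (2 * L - 1) (by omega))
        have := hfalse (2 * L - 1) (by omega)
        have hprev := hchain (2 * L - 2) (by omega)
        have e1 : D.n * L + (2 * L * g + (2 * L - 2)) + 1 = D.n * L + (2 * L * g + (2 * L - 1)) := by
          omega
        rw [e1] at hprev
        rw [cl, (hdm g _ (by omega)).1, (hdm g _ (by omega)).2, if_pos hb,
          if_neg (by omega), if_neg (by omega)] at hl
        simp only [List.mem_cons, List.not_mem_nil, or_false] at hl
        rcases hl with rfl | rfl | rfl
        · rw [hprev] at hal
          exact absurd hal (by simp)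
        · exact absurd hal this
        · exact absurd hal this
      simp only [Bad, not_and, not_or, not_le] at hnb
      obtain ⟨h1, h2, h3⟩ := hnb hx hy
      rw [hi] at h1 h2 h3
      rw [hj] at h3
      refine ⟨h1, h2, fun he => ?_⟩
      exact h3 he
    refine ⟨p, fun v hvn => ?_, fun e he => ?_⟩
    · obtain ⟨t, ht, x, hx, rfl⟩ := hv.exists_mem hvn
      exact (key t ht x hx x hx).1
    · obtain ⟨t, ht, ⟨x, hx, h1⟩, y, hy, h2⟩ := hv.edge e he
      have := (key t ht x hx y hy).2.2 ⟨e, he, h1.symm, h2.symm⟩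
      rwa [h1, h2] at this
  · intro hc
    obtain ⟨p, hp1, hp2⟩ := hv.exists_lt hc
    -- the bits spell the coloring, and the auxiliary variables have the value that they stand for
    let β : ℕ → Bool := fun z => (p (z / L)).testBit (z % L)
    classical
    let α : ℕ → Bool := fun z => if z < D.n * L then β z else
      decide (∀ h < (z - D.n * L) % (2 * L),
        β (D.lit L ((z - D.n * L) / (2 * L)) h).1 ≠ (D.lit L ((z - D.n * L) / (2 * L)) h).2)
    have hβ : ∀ v h, h < L → β (v * L + h) = (p v).testBit h := by
      intro v h hh
      simp only [β]
      rw [mul_add_div_of_lt _ hh, mul_add_mod_of_lt _ hh]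
    refine ⟨α, fun f hf => ?_⟩
    have hT := div_lt_numF hf
    have hh := Nat.mod_lt f (by omega : 0 < 2 * L)
    have hαy : ∀ f', α (D.n * L + f') = decide (∀ h < f' % (2 * L),
        β (D.lit L (f' / (2 * L)) h).1 ≠ (D.lit L (f' / (2 * L)) h).2) := by
      intro f'
      simp [α]
    by_cases hb : D.Bad L (f / (2 * L))
    · rw [cl, if_pos hb]
      have hulit : ∀ h < 2 * L, α (D.lit L (f / (2 * L)) h).1 = β (D.lit L (f / (2 * L)) h).1 := by
        intro h hh
        have : (D.lit L (f / (2 * L)) h).1 < D.n * L := by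
          have h1 := hv.mem_lt hT hb.1
          have h2 := hv.mem_lt hT hb.2.1
          unfold lit
          split_ifs
          · change D.bg _ _ * L + h < _
            nlinarith
          · change D.bg _ _ * L + (h - L) < _
            have : h - L < L := by omega
            nlinarith
        simp only [α, if_pos this]
      by_cases hl : α (D.lit L (f / (2 * L)) (f % (2 * L))).1 =
          (D.lit L (f / (2 * L)) (f % (2 * L))).2
      · exact ⟨_, by simp, hl⟩
      by_cases hy : ∀ h < f % (2 * L),
          β (D.lit L (f / (2 * L)) h).1 ≠ (D.lit L (f / (2 * L)) h).2
      · have hall : ∀ h < f % (2 * L) + 1,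
            β (D.lit L (f / (2 * L)) h).1 ≠ (D.lit L (f / (2 * L)) h).2 := by
          intro h hlt
          rcases Nat.lt_succ_iff_lt_or_eq.1 hlt with hlt | rfl
          · exact hy h hlt
          · rwa [← hulit _ hh]
        by_cases hlast : f % (2 * L) + 1 < 2 * L
        · refine ⟨(D.n * L + f + 1, true), by simp [hlast], ?_⟩
          have e1 : f + 1 = 2 * L * (f / (2 * L)) + (f % (2 * L) + 1) := by
            have := Nat.div_add_mod f (2 * L)
            omega
          simp only
          rw [add_assoc, hαy, decide_eq_true_iff]
          rw [e1, (hdm _ _ hlast).1, (hdm _ _ hlast).2]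
          exact hall
        · exfalso
          have heq : f % (2 * L) + 1 = 2 * L := by omega
          rw [heq] at hall
          have hu := hv.mem_lt hT hb.1
          have hw := hv.mem_lt hT hb.2.1
          have := (lit_false_iff hL hβ ((hp1 _ hu).2.trans_le hn)
            ((hp1 _ hw).2.trans_le hn)).1 hall
          rw [pu, pv] at this
          obtain ⟨h1, h2⟩ := this
          obtain ⟨-, -, h3⟩ := hb
          rw [← h1, ← h2] at h3
          rcases h3 with h3 | h3 | ⟨⟨e, he, h4, h5⟩, h6⟩
          · exact absurd (hp1 _ hu).1 (not_lt.2 h3)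
          · exact absurd (hp1 _ hu).2 (not_lt.2 h3)
          · have := hp2 e he
            rw [h4, h5] at this
            exact this h6
      · have h0 : f % (2 * L) ≠ 0 := by
          intro h0
          exact hy fun h hlt => by omega
        refine ⟨(D.n * L + f, false), by simp [h0], ?_⟩
        simp only
        rw [hαy, decide_eq_false_iff_not]
        exact hy
    · rw [cl, if_neg hb]
      cases h : α (D.n * L + f)
      · exact ⟨(D.n * L + f, false), by simp, h⟩
      · exact ⟨(D.n * L + f, true), by simp, h⟩

lemma length_bag (f : ℕ) : (D.bag L f).length = D.bl (D.pt L (f / (2 * L))) * L + 2 := by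
  simp [bag]

lemma length_cl (f : ℕ) : (D.cl L f).length = 3 := by
  unfold cl
  split_ifs <;> rfl

end ColData

/-! ### The program that produces the formula -/

open RAM

namespace ColData

/-- The data of a list coloring instance, read from a word with tables of block positions as
they are left by `RAM.setup`. -/
def ofWord (ρ : ℕ → ℕ) (w : List ℕ) : ColData where
  n := ρ 3
  m := w.getD 1 0
  T := ρ 2
  eu e := w.getD (2 + 2 * e) 0
  ev e := w.getD (3 + 2 * e) 0
  len v := w.getD (w.getD (ρ 0 + v) 0) 0
  col v i := w.getD (w.getD (ρ 0 + v) 0 + 1 + i) 0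
  bl t := w.getD (w.getD (ρ 1 + t) 0) 0
  bg t x := w.getD (w.getD (ρ 1 + t) 0 + 1 + x) 0

/-- The number that encodes a literal. -/
def code (l : ℕ × Bool) : ℕ := 2 * l.1 + if l.2 then 1 else 0

namespace Prog

open Ex

/-! Global variables: `5` the table of powers of two, `6` the number `L` of bits per vertex, `8`
the number `2 ^ L`, `9` the number of clauses. Local variables: `40` the clause `f`, `41` and `42`
its position `h` in the choice `g`, `43` to `47` the components `j, i, y, x, t` of the choice, `48`
and `49` its vertices, `50` whether it is bad, `51` the code of the literal. -/

/-- The size of the list of the vertex `u`; for a formula, the length of the clause `u`. -/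
def lenE (u : Ex) : Ex := mem (mem ((v 0).add u))
/-- The `i`-th color of the list of `u`; for a formula, the `i`-th literal of the clause `u`. -/
def colE (u i : Ex) : Ex := mem (((mem ((v 0).add u)).add (c 1)).add i)
/-- The size of the bag `t`. -/
def blE (t : Ex) : Ex := mem (mem ((v 1).add t))
/-- The `x`-th element of the bag `t`. -/
def bgE (t x : Ex) : Ex := mem (((mem ((v 1).add t)).add (c 1)).add x)
/-- The number of clauses of a choice. -/
def twoL : Ex := (c 2).mul (v 6)
/-- The auxiliary variable of the clause `f`. -/
def auxE : Ex := ((v 3).mul (v 6)).add (v 40)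

/-- The number of edges from the first to the second vertex of the choice. -/
def adjE : Ex := sum 52 (mem (c 1))
  (((mem ((c 2).add ((c 2).mul (v 52)))).eq (v 48)).mul
    ((mem ((c 3).add ((c 2).mul (v 52)))).eq (v 49)))

/-- Nonzero if and only if the choice is bad. -/
def badE : Ex :=
  (((v 46).lt (blE (v 47))).mul ((v 45).lt (blE (v 47)))).mul
    (((((lenE (v 48)).lt ((v 44).add (c 1))).add ((v 3).lt ((v 44).add (c 1))))).add
      (adjE.mul ((colE (v 48) (v 44)).eq (colE (v 49) (v 43)))))

/-- The code of the literal that says that a bit differs from the choice. -/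
def litE : Ex :=
  ((c 2).mul (ite ((v 41).lt (v 6)) (((v 48).mul (v 6)).add (v 41))
    (((v 49).mul (v 6)).add ((v 41).sub (v 6))))).add
  ((((ite ((v 41).lt (v 6)) (v 44) (v 43)).div
    (mem ((v 5).add (ite ((v 41).lt (v 6)) (v 41) ((v 41).sub (v 6)))))).mod (c 2)).eq (c 0))

/-- Appends the clause `f`, with its length. -/
def clauseCmd : Cmd :=
  .bind 41 ((v 40).mod twoL) (.bind 42 ((v 40).div twoL) (.bind 43 ((v 42).mod (v 8))
  (.bind 44 (((v 42).div (v 8)).mod (v 8))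
  (.bind 45 ((((v 42).div (v 8)).div (v 8)).mod (v 3))
  (.bind 46 (((((v 42).div (v 8)).div (v 8)).div (v 3)).mod (v 3))
  (.bind 47 (((((v 42).div (v 8)).div (v 8)).div (v 3)).div (v 3))
  (.bind 48 (bgE (v 47) (v 46)) (.bind 49 (bgE (v 47) (v 45))
  (.bind 50 badE (.bind 51 litE
  (.emits (c 3) [
    ite (v 50) (ite ((v 41).eq (c 0)) (v 51) ((c 2).mul auxE)) ((c 2).mul auxE),
    ite (v 50) (v 51) (((c 2).mul auxE).add (c 1)),
    ite (v 50) (ite (((v 41).add (c 1)).lt twoL) (((c 2).mul (auxE.add (c 1))).add (c 1)) (v 51))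
      (((c 2).mul auxE).add (c 1))])))))))))))

/-- Appends the bag of the clause `f`, with its size. -/
def bagCmd : Cmd :=
  .bind 47 ((((((v 40).div twoL).div (v 8)).div (v 8)).div (v 3)).div (v 3))
  (.seq (.emit (((blE (v 47)).mul (v 6)).add (c 2)))
  (.seq (.for' 41 ((blE (v 47)).mul (v 6))
    (.emit (((bgE (v 47) ((v 41).div (v 6))).mul (v 6)).add ((v 41).mod (v 6)))))
  (.emits auxE [auxE.add (c 1)])))

/-- Appends the formula and its path decomposition. -/
def formulaCmd : Cmd :=
  .seq (.emits ((((v 3).mul (v 6)).add (v 9)).add (c 1)) [v 9])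
  (.seq (.for' 40 (v 9) clauseCmd) (.seq (.emit (v 9)) (.for' 40 (v 9) bagCmd)))

lemma productive_formulaCmd : formulaCmd.Productive :=
  ⟨Cmd.productive_emits _ _, ⟨Cmd.emits_emits _ _, Cmd.productive_emits _ _⟩, trivial,
    Or.inl trivial, trivial, ⟨trivial, trivial⟩, Cmd.productive_emits _ _⟩

lemma sum_indicator_eq_zero_iff {m : ℕ} {P : ℕ → Prop} [DecidablePred P] :
    (∑ e ∈ Finset.range m, if P e then 1 else 0) = 0 ↔ ¬ ∃ e < m, P e := by
  simp

variable {ρ : ℕ → ℕ} {w : List ℕ} {L : ℕ}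

lemma eval_adjE (σ : ℕ → ℕ) : adjE.eval σ w = 0 ↔ ¬ ∃ e < w.getD 1 0,
    w.getD (2 + 2 * e) 0 = σ 48 ∧ w.getD (3 + 2 * e) 0 = σ 49 := by
  rw [← sum_indicator_eq_zero_iff]
  simp [adjE, ← ite_and]
  tauto

lemma eval_badE (σ : ℕ → ℕ) : badE.eval σ w ≠ 0 ↔
    σ 46 < (ofWord σ w).bl (σ 47) ∧ σ 45 < (ofWord σ w).bl (σ 47) ∧
      ((ofWord σ w).len (σ 48) ≤ σ 44 ∨ σ 3 ≤ σ 44 ∨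
        ((∃ e < w.getD 1 0, w.getD (2 + 2 * e) 0 = σ 48 ∧ w.getD (3 + 2 * e) 0 = σ 49) ∧
          (ofWord σ w).col (σ 48) (σ 44) = (ofWord σ w).col (σ 49) (σ 43))) := by
  have := eval_adjE (w := w) σ
  by_cases h : ∃ e < w.getD 1 0, w.getD (2 + 2 * e) 0 = σ 48 ∧ w.getD (3 + 2 * e) 0 = σ 49
  · have h' : adjE.eval σ w ≠ 0 := fun h2 => this.1 h2 h
    simp only [h, true_and]
    simp [badE, blE, lenE, colE, ofWord, h', and_assoc]
    simp only [← not_lt]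
    tauto
  · have h' : adjE.eval σ w = 0 := this.2 h
    simp only [h, false_and]
    simp [badE, blE, lenE, ofWord, h']
    simp only [← not_lt]
    tauto

lemma eval_litE (σ : ℕ → ℕ) : litE.eval σ w =
    if σ 41 < σ 6 then 2 * (σ 48 * σ 6 + σ 41) +
        (if σ 44 / w.getD (σ 5 + σ 41) 0 % 2 = 0 then 1 else 0)
      else 2 * (σ 49 * σ 6 + (σ 41 - σ 6)) +
        (if σ 43 / w.getD (σ 5 + (σ 41 - σ 6)) 0 % 2 = 0 then 1 else 0) := by
  by_cases h : σ 41 < σ 6 <;> simp [litE, h]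

/-- The command computes the digits of the choice and then the three literals of the clause. -/
lemma out_clauseCmd (hL : ρ 6 = L) (hQ : ρ 8 = 2 ^ L) (hpow : ∀ h < L, w.getD (ρ 5 + h) 0 = 2 ^ h)
    (h0 : 0 < L) (f : ℕ) : clauseCmd.out (Function.update ρ 40 f) w =
      3 :: ((ofWord ρ w).cl L f).map code := by
  have hh := Nat.mod_lt f (by omega : 0 < 2 * L)
  set D := ofWord ρ w with hD
  let ρ' : ℕ → ℕ := Function.update (Function.update (Function.update (Function.update
    (Function.update (Function.update (Function.update (Function.update (Function.update
    (Function.update ρ 40 f) 41 (f % (2 * L))) 42 (f / (2 * L))) 43 (pj L (f / (2 * L))))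
    44 (pi L (f / (2 * L)))) 45 (D.py L (f / (2 * L)))) 46 (D.px L (f / (2 * L))))
    47 (D.pt L (f / (2 * L)))) 48 (D.pu L (f / (2 * L)))) 49 (D.pv L (f / (2 * L)))
  have hbad : badE.eval ρ' w ≠ 0 ↔ D.Bad L (f / (2 * L)) := eval_badE ρ'
  have hlit : ∀ k, litE.eval (Function.update ρ' 50 k) w =
      code (D.lit L (f / (2 * L)) (f % (2 * L))) := by
    intro k
    rw [eval_litE]
    simp only [ρ', Function.update_apply, Nat.reduceEqDiff, reduceIte, hL, lit, code]
    by_cases hc : f % (2 * L) < L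
    · simp [hc, hpow _ hc, -List.getD_eq_getElem?_getD]
    · simp [hc, hpow (f % (2 * L) - L) (by omega), -List.getD_eq_getElem?_getD]
  have hrun : clauseCmd.out (Function.update ρ 40 f) w = (Cmd.emits (c 3) [
    ite (v 50) (ite ((v 41).eq (c 0)) (v 51) ((c 2).mul auxE)) ((c 2).mul auxE),
    ite (v 50) (v 51) (((c 2).mul auxE).add (c 1)),
    ite (v 50) (ite (((v 41).add (c 1)).lt twoL) (((c 2).mul (auxE.add (c 1))).add (c 1)) (v 51))
      (((c 2).mul auxE).add (c 1))]).out (Function.update (Function.update ρ' 50 (badE.eval ρ' w))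
        51 (code (D.lit L (f / (2 * L)) (f % (2 * L))))) w := by
    have ev : ∀ {x k : ℕ} {e : Ex} {c c' : Cmd} {σ σ' : ℕ → ℕ}, e.eval σ w = k →
        c.out (Function.update σ x k) w = c'.out σ' w → (Cmd.bind x e c).out σ w = c'.out σ' w := by
      rintro x k e c c' σ σ' rfl h
      exact h
    refine ev (k := f % (2 * L)) (by simp [twoL, hL]) ?_
    refine ev (k := f / (2 * L)) (by simp [twoL, hL]) ?_
    refine ev (k := pj L (f / (2 * L))) (by simp [pj, hQ]) ?_
    refine ev (k := pi L (f / (2 * L))) (by simp [pi, hQ]) ?_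
    refine ev (k := D.py L (f / (2 * L))) (by simp [py, hQ, hD, ofWord]) ?_
    refine ev (k := D.px L (f / (2 * L))) (by simp [px, hQ, hD, ofWord]) ?_
    refine ev (k := D.pt L (f / (2 * L))) (by simp [pt, hQ, hD, ofWord]) ?_
    refine ev (k := D.pu L (f / (2 * L))) (by simp [bgE, pu, hD, ofWord]) ?_
    refine ev (k := D.pv L (f / (2 * L))) (by simp [bgE, pv, hD, ofWord]) ?_
    refine ev (k := badE.eval ρ' w) rfl ?_
    exact ev (hlit _) rfl
  rw [hrun, Cmd.out_emits]
  have hDn : D.n = ρ 3 := rfl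
  clear hlit hrun
  generalize badE.eval ρ' w = k at *
  by_cases hb : D.Bad L (f / (2 * L))
  · have hk := hbad.2 hb
    simp only [cl, if_pos hb]
    by_cases h1 : f % (2 * L) = 0 <;> by_cases h2 : f % (2 * L) + 1 < 2 * L <;>
    simp [ρ', hk, auxE, twoL, hL, code, h1, h2, hDn, (by omega : 1 < 2 * L)]
  · have hk : k = 0 := not_not.1 (mt hbad.1 hb)
    simp [cl, hb, ρ', hk, auxE, hL, code, hDn]

lemma out_bagCmd (hL : ρ 6 = L) (hQ : ρ 8 = 2 ^ L) (f : ℕ) :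
    bagCmd.out (Function.update ρ 40 f) w =
      ((ofWord ρ w).bag L f).length :: (ofWord ρ w).bag L f := by
  rw [length_bag]
  simp [bagCmd, Cmd.out, auxE, twoL, hL, hQ, bag, blE, bgE, ofWord, pt, Cmd.out_emits,
    ← List.map_eq_flatMap]

lemma out_formulaCmd (hL : ρ 6 = L) (hQ : ρ 8 = 2 ^ L)
    (hpow : ∀ h < L, w.getD (ρ 5 + h) 0 = 2 ^ h) (h9 : ρ 9 = (ofWord ρ w).numF L)
    (h0 : 0 < L) : formulaCmd.out ρ w =
    [(ofWord ρ w).n * L + (ofWord ρ w).numF L + 1, (ofWord ρ w).numF L] ++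
    (List.range ((ofWord ρ w).numF L)).flatMap
      (fun f => ((ofWord ρ w).cl L f).length :: ((ofWord ρ w).cl L f).map code) ++
    ((ofWord ρ w).numF L :: (List.range ((ofWord ρ w).numF L)).flatMap
      fun f => ((ofWord ρ w).bag L f).length :: (ofWord ρ w).bag L f) := by
  simp only [formulaCmd, Cmd.out, out_clauseCmd hL hQ hpow h0, out_bagCmd hL hQ, length_cl]
  have hDn : (ofWord ρ w).n = ρ 3 := rfl
  simp [hL, h9, hDn]

end Prog

end ColData

/-! ### Programs that run in polynomial time -/

namespace RAM

/-- Whenever the relation `R` holds, the program leads from variables `ρ` and word `w` to `ρ'` and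
`w'`, and both its running time and the resulting numbers are bounded by a polynomial in a bound
on the given ones. -/
def Does (P : RAMProg) (R : (ℕ → ℕ) → List ℕ → (ℕ → ℕ) → List ℕ → Prop) : Prop :=
  ∃ τ, PolyBounded τ ∧ ∀ V ρ w ρ' w', Bounds V ρ w → R ρ w ρ' w' →
    Tr P ρ w (τ V) ρ' w' ∧ Bounds (τ V) ρ' w'

lemma Does.seq {P Q : RAMProg} {R S : (ℕ → ℕ) → List ℕ → (ℕ → ℕ) → List ℕ → Prop}
    (hP : Does P R) (hQ : Does Q S) :
    Does (.seq P Q) fun ρ w ρ' w' => ∃ ρ₁ w₁, R ρ w ρ₁ w₁ ∧ S ρ₁ w₁ ρ' w' := by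
  obtain ⟨τ, hτ, H⟩ := hP
  obtain ⟨σ, hσ, K⟩ := hQ
  refine ⟨fun V => τ V + σ (τ V), hτ.add (hσ.comp hτ), ?_⟩
  rintro V ρ w ρ' w' hb ⟨ρ₁, w₁, h1, h2⟩
  beta_reduce
  obtain ⟨t1, b1⟩ := H V ρ w ρ₁ w₁ hb h1
  obtain ⟨t2, b2⟩ := K _ ρ₁ w₁ ρ' w' b1 h2
  exact ⟨t1.seq t2, b2.mono (by omega)⟩

lemma does_assign {x : ℕ} (hx : x < 40) (e : Ex) :
    Does (assign x e) fun ρ w ρ' w' => ρ' = Function.update ρ x (e.eval ρ w) ∧ w' = w := by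
  refine ⟨fun V => V + e.vb V + (e.ct V + 2 + Nat.size V + Nat.size (e.vb V)),
    (PolyBounded.id.add e.polyBounded_vb).add (((e.polyBounded_ct.add (.const 2)).add
      PolyBounded.id.size).add e.polyBounded_vb.size), ?_⟩
  rintro V ρ w ρ' w' hb ⟨rfl, rfl⟩
  beta_reduce
  refine ⟨(Tr.assign hx hb).mono (by omega), (hb.mono (by omega)).update ?_ x⟩
  have := e.eval_le_vb hb
  omega

lemma bounds_out {c : Cmd} {V : ℕ} {ρ : ℕ → ℕ} {w : List ℕ} (hb : Bounds V ρ w) :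
    Bounds (V + c.lb V + c.ob V) ρ (w ++ c.out ρ w) := by
  refine (hb.mono (by omega)).append (fun y hy => ?_) ?_
  · have := c.out_le_ob hb y hy
    omega
  · have := c.length_out_le hb
    have := hb.length
    rw [List.length_append]
    omega

lemma does_pass {c : Cmd} (hc : c.Productive) :
    Does (pass c) fun ρ w ρ' w' => ρ' = ρ ∧ w' = w ++ c.out ρ w := by
  have hB : PolyBounded fun V => V + c.lb V + c.ob V :=
    (PolyBounded.id.add c.polyBounded_lb).add c.polyBounded_ob
  refine ⟨fun V => (V + c.lb V + c.ob V) + (1 + c.lb V) * (c.ct (V + c.lb V + c.ob V) + 1 +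
    Nat.size (V + c.lb V + c.ob V)), hB.add (((PolyBounded.const 1).add c.polyBounded_lb).mul
      (((c.polyBounded_ct.comp hB).add (.const 1)).add hB.size)), ?_⟩
  rintro V ρ w ρ' w' hb ⟨rfl, rfl⟩
  beta_reduce
  have hb' := bounds_out (c := c) hb
  refine ⟨(Tr.pass (hb.mono (by omega)) hc hb'.length).mono ?_, hb'.mono (by omega)⟩
  have := Nat.mul_le_mul_right (c.ct (V + c.lb V + c.ob V) + 1 + Nat.size (V + c.lb V + c.ob V))
    (Nat.add_le_add_left (c.length_out_le hb) 1)
  omega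

/-- The entries are bounded by the value of the expression `b`. -/
lemma does_emitAll (x : ℕ) (n e b : Ex) :
    Does (emitAll x n e) fun ρ w ρ' w' => ρ' = ρ ∧ ∃ f : ℕ → ℕ,
      w' = w ++ (List.range (n.eval ρ w)).map f ∧ ∀ i < n.eval ρ w, f i ≤ b.eval ρ w ∧
        e.eval (Function.update ρ x i) (w ++ (List.range i).map f) = f i := by
  have hB : PolyBounded fun V => V + n.vb V + b.vb V :=
    (PolyBounded.id.add n.polyBounded_vb).add b.polyBounded_vb
  refine ⟨fun V => (V + n.vb V + b.vb V) + (1 + n.vb V) * emitAllCt n e (V + n.vb V + b.vb V),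
    hB.add (((PolyBounded.const 1).add n.polyBounded_vb).mul
      ((polyBounded_emitAllCt n e).comp hB)), ?_⟩
  rintro V ρ w ρ' w' hb ⟨rfl, f, rfl, hf⟩
  beta_reduce
  have hn := n.eval_le_vb hb
  have hbv := b.eval_le_vb hb
  have hb' : Bounds (V + n.vb V + b.vb V) ρ' (w ++ (List.range (n.eval ρ' w)).map f) := by
    refine (hb.mono (by omega)).append (fun y hy => ?_) ?_
    · obtain ⟨i, hi, rfl⟩ := List.mem_map.1 hy
      have := (hf i (List.mem_range.1 hi)).1
      omega
    · have := hb.length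
      simp only [List.length_append, List.length_map, List.length_range]
      omega
  refine ⟨(Tr.emitAll rfl hb' fun i hi => (hf i hi).2).mono ?_, hb'.mono (by omega)⟩
  have := Nat.mul_le_mul_right (emitAllCt n e (V + n.vb V + b.vb V))
    (Nat.add_le_add_left hn 1)
  omega

end RAM

/-! ### The instance in memory -/

lemma RawBags.congr {n F : ℕ} {b b' : ℕ → List ℕ} (h : RawBags n F b) (hb : ∀ f < F, b' f = b f) :
    RawBags n F b' := by
  refine ⟨fun f hf => ?_, fun f hf => ?_, fun x hx => ?_, fun i j k hij hjk hk x hi hk' => ?_⟩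
  · rw [hb f hf]; exact h.lt f hf
  · rw [hb f hf]; exact h.nodup f hf
  · obtain ⟨f, hf, hx⟩ := h.cover x hx
    exact ⟨f, hf, (hb f hf).symm ▸ hx⟩
  · rw [hb _ (by omega)] at hi hk' ⊢
    exact h.interval i j k hij hjk hk x hi hk'

lemma getD_flatMap_pair {α : Type*} (a b : α → ℕ) (l : List α) (i : ℕ) (hi : i < l.length) :
    (l.flatMap fun e => [a e, b e]).getD (2 * i) 0 = a l[i] ∧
      (l.flatMap fun e => [a e, b e]).getD (2 * i + 1) 0 = b l[i] := by
  induction l generalizing i with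
  | nil => simp at hi
  | cons x l ih =>
    cases i with
    | zero => simp
    | succ i =>
      have := ih i (by simpa using hi)
      simpa [mul_add] using this

namespace ListColoringInstance

variable (I : ListColoringInstance)

/-- The part of the input word before the lists. -/
def header : List ℕ := [I.numVertices, I.edges.length] ++
  I.edges.flatMap fun e => [Fin.val e.1, Fin.val e.2]

/-- The lists of colors in the order of the vertices. -/
def colorLists : List (List ℕ) := (List.finRange I.numVertices).map I.colors

@[simp] lemma length_colorLists : I.colorLists.length = I.numVertices := by simp [colorLists]

@[simp] lemma length_header : I.header.length = 2 + 2 * I.edges.length := by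
  simp [header, List.length_flatMap, mul_comm]
  omega

lemma encode_eq : I.encode = twoBlocks I.header I.colorLists (natBags I.bags) := by
  simp [encode, twoBlocks, header, colorLists, blocks, encodeBags_eq, List.flatMap_map]

lemma getD_colorLists (v : Fin I.numVertices) : I.colorLists.getD v [] = I.colors v := by
  simp [colorLists]

end ListColoringInstance

namespace ColData

open ListColoringInstance

/-- The data that are read from the word with tables are those of the instance. -/
theorem ofWord_spec {I : ListColoringInstance} {ρ : ℕ → ℕ} {w : List ℕ}
    (hw : setupWord I.header I.colorLists (natBags I.bags) <+: w) (h0 : ρ 0 = I.encode.length)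
    (h1 : ρ 1 = I.encode.length + (I.numVertices + 1)) (h2 : ρ 2 = I.bags.length)
    (h3 : ρ 3 = I.numVertices) :
    (ofWord ρ w).Valid ∧ ((ofWord ρ w).Colorable ↔ I.Colorable) ∧
      ∀ t (ht : t < I.bags.length), (ofWord ρ w).bl t = I.bags[t].length := by
  obtain ⟨g0, g1, g2, g3, g4⟩ := getD_setupWord hw
  rw [← I.encode_eq, length_colorLists] at *
  have hnb : (natBags I.bags).length = I.bags.length := by simp [natBags]
  rw [hnb] at g3 g4
  rw [← h1] at g3 g4
  rw [← h0] at g1 g2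
  set D := ofWord ρ w with hD
  have hlen : 2 + 2 * I.edges.length < I.encode.length := by
    rw [encode_eq, twoBlocks]
    simp
  have hm : D.m = I.edges.length := by
    change w.getD 1 0 = _
    rw [g0 1 (by omega)]
    simp [encode]
  have hedge : ∀ e (he : e < I.edges.length), D.eu e = I.edges[e].1 ∧ D.ev e = I.edges[e].2 := by
    intro e he
    have hg := getD_flatMap_pair (fun e : Fin I.numVertices × Fin I.numVertices => Fin.val e.1)
      (fun e => Fin.val e.2) I.edges e he
    have key : ∀ i < 2 * I.edges.length, w.getD (2 + i) 0 =
        (I.edges.flatMap fun e => [Fin.val e.1, Fin.val e.2]).getD i 0 := by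
      intro i hi
      rw [g0 _ (by omega), encode_eq, twoBlocks, List.append_assoc,
        List.getD_append _ _ _ _ (by simp; omega), header, List.getD_append_right _ _ _ _ (by simp)]
      simp
    refine ⟨(key _ (by omega)).trans hg.1, ?_⟩
    have : 3 + 2 * e = 2 + (2 * e + 1) := by ring
    change w.getD (3 + 2 * e) 0 = _
    rw [this]
    exact (key _ (by omega)).trans hg.2
  have hlenv : ∀ v : Fin I.numVertices, D.len v = (I.colors v).length := by
    intro v
    rw [← getD_colorLists]
    exact g1 v v.2
  have hcol : ∀ (v : Fin I.numVertices) i (hi : i < (I.colors v).length),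
      D.col v i = (I.colors v)[i] := by
    intro v i hi
    have := g2 v v.2 i (by rwa [getD_colorLists])
    rw [getD_colorLists, List.getD_eq_getElem _ _ hi] at this
    exact this
  have hbl : ∀ t (ht : t < I.bags.length), D.bl t = I.bags[t].length := by
    intro t ht
    rw [← length_natBags_getD ht]
    exact g3 t ht
  have hbg : ∀ t < I.bags.length, (List.range (D.bl t)).map (D.bg t) =
      (natBags I.bags).getD t [] := by
    intro t ht
    refine List.ext_getElem (by simp [hbl t ht, ht, natBags]) ?_
    intro x hx hx'
    rw [List.getElem_map, List.getElem_range, ← List.getD_eq_getElem _ 0 hx']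
    exact g4 t ht x hx'
  obtain ⟨hraw, hE⟩ := I.isPathDecomposition.rawBags I.bags_nodup
  have eN : D.n = I.numVertices := h3
  have eT : D.T = I.bags.length := h2
  have hraw' : RawBags D.n D.T fun t => (List.range (D.bl t)).map (D.bg t) := by
    rw [eN, eT]
    exact hraw.congr hbg
  have hmem : ∀ t < I.bags.length, ∀ z, (∃ x < D.bl t, D.bg t x = z) ↔
      z ∈ (natBags I.bags).getD t [] := by
    intro t ht z
    rw [← hbg t ht]
    simp
  refine ⟨⟨hraw', fun e he => ?_, fun e he => ?_, fun v hv i hi j hj hij => ?_⟩, ?_, hbl⟩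
  · rw [hm] at he
    obtain ⟨e1, e2⟩ := hedge e he
    have hlt := I.edges_lt _ (List.getElem_mem he)
    obtain ⟨t, ht, hu, hv⟩ := hE I.edges[e].1 I.edges[e].2 (by
      rw [SimpleGraph.fromRel_adj]
      exact ⟨hlt.ne, Or.inl (List.getElem_mem he)⟩)
    refine ⟨t, eT ▸ ht, ?_⟩
    rw [hmem t ht, hmem t ht, e1, e2]
    exact ⟨hu, hv⟩
  · rw [hm] at he
    obtain ⟨e1, e2⟩ := hedge e he
    rw [e1, e2]
    have hlt := I.edges_lt _ (List.getElem_mem he)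
    exact fun h => hlt.ne (Fin.ext h)
  · have hv' : v < I.numVertices := eN ▸ hv
    have hl := hlenv ⟨v, hv'⟩
    have hi' : i < (I.colors ⟨v, hv'⟩).length := hl ▸ hi
    have hj' : j < (I.colors ⟨v, hv'⟩).length := hl ▸ hj
    have a1 := hcol ⟨v, hv'⟩ i hi'
    have a2 := hcol ⟨v, hv'⟩ j hj'
    simp only at a1 a2
    rw [a1, a2] at hij
    exact (I.colors_nodup _).getElem_inj_iff.1 hij
  · constructor
    · rintro ⟨f, hf1, hf2⟩
      have hf1' : ∀ v : Fin I.numVertices, f v < (I.colors v).length := fun v => by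
        rw [← hlenv]; exact hf1 v (eN.symm ▸ v.2)
      have key : ∀ u v, (u, v) ∈ I.edges → (I.colors u)[f u]'(hf1' u) ≠ (I.colors v)[f v]'(hf1' v) := by
        intro u v huv
        obtain ⟨e, he, heq⟩ := List.mem_iff_getElem.1 huv
        have := hf2 e (hm ▸ he)
        rw [(hedge e he).1, (hedge e he).2, heq, hcol u _ (hf1' u), hcol v _ (hf1' v)] at this
        exact this
      refine ⟨fun v => (I.colors v)[f v]'(hf1' v), fun v => List.getElem_mem _, fun u v huv => ?_⟩
      rcases ((SimpleGraph.fromRel_adj _ _ _).1 huv).2 with h | h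
      · exact key u v h
      · exact (key v u h).symm
    · rintro ⟨g, hg1, hg2⟩
      have hex : ∀ v : Fin I.numVertices, ∃ i, ∃ h : i < (I.colors v).length,
          (I.colors v)[i] = g v := fun v => List.mem_iff_getElem.1 (hg1 v)
      choose f hf hfg using hex
      refine ⟨fun v => if h : v < I.numVertices then f ⟨v, h⟩ else 0, fun v hv => ?_,
        fun e he => ?_⟩
      · have hv' : v < I.numVertices := eN ▸ hv
        have := hlenv ⟨v, hv'⟩
        simp only at this
        beta_reduce
        rw [dif_pos hv', this]
        exact hf _
      · have he' : e < I.edges.length := hm ▸ he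
        beta_reduce
        rw [(hedge e he').1, (hedge e he').2, dif_pos (Fin.is_lt _), dif_pos (Fin.is_lt _),
          hcol _ _ (hf _), hcol _ _ (hf _), hfg, hfg]
        refine hg2 _ _ ((SimpleGraph.fromRel_adj _ _ _).2
          ⟨(I.edges_lt _ (List.getElem_mem he')).ne, Or.inl ?_⟩)
        exact List.getElem_mem he'

end ColData

/-! ### The reduction from list coloring to satisfiability -/

namespace ColData

open Ex

namespace Prog

/-- The last entry of the word. -/
def last : Ex := mem (lim.sub (c 1))

/-- The number of clauses. -/
def numFE : Ex :=
  ((((((v 2).mul (v 3)).mul (v 3)).mul (v 8)).mul (v 8)).mul twoL)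

/-- Appends a table of powers of two, computes the number of bits per vertex, and appends the
formula. -/
def main : RAMProg :=
  .seq (assign 5 lim) (.seq (pass (.emit (c 1)))
  (.seq (emitAll 40 (v 3) (ite (last.lt (v 3)) ((c 2).mul last) last))
  (.seq (assign 6 (sum 40 (v 3) ((mem ((v 5).add (v 40))).lt (v 3))))
  (.seq (assign 8 (mem ((v 5).add (v 3)))) (.seq (assign 7 lim) (.seq (assign 9 numFE)
  (pass formulaCmd)))))))

/-- Loads the number of vertices and the length of the header. -/
def head : RAMProg :=
  .seq (.load 60 0) (.seq (.const 62 1) (.seq (.load 63 62) (.seq (.const 61 2)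
    (.seq (.arith .mul 63 63 61) (.arith .add 61 61 63)))))

lemma run_head (w : List ℕ) {V : ℕ} (h : ∀ y ∈ w, y ≤ V) : ∃ s,
    Run head (RAMState.init w) (30 + 10 * Nat.size V) s ∧ s.mem = (RAMState.init w).mem ∧
      (∀ r < 60, s.reg r = 0) ∧ s.reg 60 = w.getD 0 0 ∧ s.reg 61 = 2 + 2 * w.getD 1 0 := by
  have h0 := getD_le_iff.2 h
  have s0 := size_le (h0 0)
  have s1 := size_le (h0 1)
  have s2 : Nat.size (w.getD 1 0 * 2) ≤ Nat.size V + 1 := by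
    rw [Nat.size_le, pow_succ]
    have := Nat.lt_size_self V
    have := h0 1
    omega
  have e1 : Nat.size 1 = 1 := by decide
  have e2 : Nat.size 2 = 2 := by decide
  refine ⟨_, ((Run.load _ 60 0).seq ((Run.const _ 62 1).seq ((Run.load _ 63 62).seq
    ((Run.const _ 61 2).seq ((Run.arith _ .mul 63 63 61).seq (Run.arith _ .add 61 61 63)))))).mono
      ?_, rfl, fun r hr => ?_, ?_, ?_⟩
  · simp [RAMState.init, ArithOp.eval, e1, e2, -List.getD_eq_getElem?_getD]
    omega
  · have a : r ≠ 60 := by omega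
    have b : r ≠ 61 := by omega
    have c : r ≠ 62 := by omega
    have d : r ≠ 63 := by omega
    simp [a, b, c, d, RAMState.init]
  · simp [RAMState.init]
  · simp [RAMState.init, ArithOp.eval, mul_comm]

/-- Doubling until `n` is reached produces the powers of two up to `2 ^ L`, where `L` is the
logarithm of `n`, rounded up. -/
lemma powers_step {n L i : ℕ} (h1 : n ≤ 2 ^ L) (h2 : ∀ i < L, 2 ^ i < n) :
    (if 2 ^ min i L < n then 2 * 2 ^ min i L else 2 ^ min i L) = 2 ^ min (i + 1) L := by
  rcases lt_or_ge i L with h | h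
  · rw [min_eq_left h.le, min_eq_left (by omega), if_pos (h2 i h), pow_succ, mul_comm]
  · rw [min_eq_right h, min_eq_right (by omega), if_neg (by omega)]

lemma sum_lt_eq {L n : ℕ} (h : L ≤ n) :
    (∑ i ∈ Finset.range n, if i < L then 1 else 0) = L := by
  rw [← Finset.sum_filter, Finset.sum_const, smul_eq_mul, mul_one]
  have : (Finset.range n).filter (· < L) = Finset.range L := by
    ext i
    simp only [Finset.mem_filter, Finset.mem_range]
    omega
  rw [this, Finset.card_range]

end Prog

/-- The word that encodes the formula, without the bags that come after it. -/
noncomputable def formulaWord (D : ColData) (L : ℕ) : List ℕ :=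
  [D.n * L + D.numF L + 1, D.numF L] ++
    (List.range (D.numF L)).flatMap (fun f => (D.cl L f).length :: (D.cl L f).map code) ++
    (D.numF L :: (List.range (D.numF L)).flatMap fun f => (D.bag L f).length :: D.bag L f)

namespace Prog

set_option maxHeartbeats 400000 in
/-- After the tables, the formula with `Nat.clog 2 n` bits per vertex is appended. The number of
bits is the number of powers of two below `n` in a table of the powers that stops growing at
`n`. -/
lemma main_spec : ∃ τ, PolyBounded τ ∧ ∀ V ρ w, Bounds V ρ w → 2 ≤ ρ 3 →
    ∃ ρ' p, w <+: p ∧ (∀ x < 4, ρ' x = ρ x) ∧ ρ' 7 = p.length ∧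
      Tr main ρ w (τ V) ρ' (p ++ (ofWord ρ' p).formulaWord (Nat.clog 2 (ρ 3))) ∧
      Bounds (τ V) ρ' (p ++ (ofWord ρ' p).formulaWord (Nat.clog 2 (ρ 3))) := by
  obtain ⟨τ, hτ, H⟩ := (does_assign (x := 5) (by norm_num) lim).seq
    ((does_pass (c := .emit (c 1)) trivial).seq
    ((does_emitAll 40 (v 3) (ite (last.lt (v 3)) ((c 2).mul last) last) ((c 2).mul (v 3))).seq
    ((does_assign (x := 6) (by norm_num)
      (sum 40 (v 3) ((mem ((v 5).add (v 40))).lt (v 3)))).seq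
    ((does_assign (x := 8) (by norm_num) (mem ((v 5).add (v 3)))).seq
    ((does_assign (x := 7) (by norm_num) lim).seq
    ((does_assign (x := 9) (by norm_num) numFE).seq (does_pass productive_formulaCmd)))))))
  refine ⟨τ, hτ, fun V ρ w hb hn => ?_⟩
  set n := ρ 3 with hn3
  set L := Nat.clog 2 n with hL
  have hnL : n ≤ 2 ^ L := Nat.le_pow_clog (by norm_num) n
  have hLn : ∀ i < L, 2 ^ i < n := fun i hi => (Nat.lt_clog_iff_pow_lt (by norm_num)).1 hi
  have hL0 : 0 < L := Nat.clog_pos (by norm_num) hn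
  have hLle : L ≤ n := Nat.clog_le_of_le_pow Nat.lt_two_pow_self.le
  let f : ℕ → ℕ := fun i => 2 ^ min (i + 1) L
  let p : List ℕ := w ++ [1] ++ (List.range n).map f
  have hlast : ∀ i ≤ n, p.getD (w.length + i) 0 = 2 ^ min i L := by
    intro i hi
    cases i with
    | zero => simp [p]
    | succ i =>
      have hi' : i < n := hi
      simp only [p]
      rw [List.getD_append_right _ _ _ _ (by simp)]
      have : w.length + (i + 1) - (w ++ [1]).length = i := by simp; omega
      rw [this, List.getD_eq_getElem _ _ (by simpa using hi')]
      simp [f]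
  have hpre : ∀ i ≤ n, w ++ [1] ++ (List.range i).map f <+: p := by
    intro i hi
    refine (List.prefix_append_right_inj _).2 ?_
    obtain ⟨d, hd⟩ := Nat.exists_eq_add_of_le hi
    rw [hd, List.range_add, List.map_append]
    exact List.prefix_append _ _
  have hflast : ∀ (σ : ℕ → ℕ), ∀ i < n,
      last.eval σ (w ++ [1] ++ (List.range i).map f) = 2 ^ min i L := by
    intro σ i hi
    have hl : (w ++ [1] ++ (List.range i).map f).length = w.length + 1 + i := by simp; omega
    rw [← hlast i hi.le, last, eval_mem, eval_sub, eval_lim, eval_c, hl,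
      getD_prefix (hpre i hi.le) (by omega)]
    congr 1
    omega
  let ρ₁ : ℕ → ℕ := Function.update ρ 5 w.length
  let ρ₂ : ℕ → ℕ := Function.update ρ₁ 6 L
  let ρ₃ : ℕ → ℕ := Function.update ρ₂ 8 (2 ^ L)
  let ρ₄ : ℕ → ℕ := Function.update ρ₃ 7 p.length
  let ρ₅ : ℕ → ℕ := Function.update ρ₄ 9 ((ofWord ρ p).numF L)
  have hpow : ∀ h < L, p.getD (ρ₅ 5 + h) 0 = 2 ^ h := by
    intro h hh
    have : ρ₅ 5 = w.length := by simp [ρ₅, ρ₄, ρ₃, ρ₂, ρ₁]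
    rw [this, hlast h (by omega), min_eq_left hh.le]
  have hsame : ofWord ρ₅ p = ofWord ρ p := rfl
  refine ⟨ρ₅, p, ?_, fun x hx => ?_, by simp [ρ₅, ρ₄], ?_⟩
  · simp only [p, List.append_assoc]
    exact List.prefix_append _ _
  · have h5 : x ≠ 5 := by omega
    have h6 : x ≠ 6 := by omega
    have h7 : x ≠ 7 := by omega
    have h8 : x ≠ 8 := by omega
    have h9 : x ≠ 9 := by omega
    simp [ρ₅, ρ₄, ρ₃, ρ₂, ρ₁, h5, h6, h7, h8, h9]
  · refine H V ρ w ρ₅ _ hb ⟨ρ₁, w, ⟨rfl, rfl⟩, ρ₁, w ++ [1], ⟨rfl, rfl⟩, ρ₁, p, ⟨rfl, f, ?_, ?_⟩,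
      ρ₂, p, ⟨?_, rfl⟩, ρ₃, p, ⟨?_, rfl⟩, ρ₄, p, ⟨rfl, rfl⟩, ρ₅, p, ⟨?_, rfl⟩, rfl, ?_⟩
    · simp [p, ρ₁, n]
    · intro i hi
      have hi : i < n := by simpa [ρ₁] using hi
      have h1 : ρ₁ 3 = n := by simp [ρ₁, n]
      have h2 : Function.update ρ₁ 40 i 3 = n := by simp [ρ₁, n]
      constructor
      · have h3 : 2 ^ min (i + 1) L ≤ 2 ^ L := Nat.pow_le_pow_right (by norm_num) (by omega)
        have h4 : 2 ^ (L - 1) < n := hLn _ (by omega)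
        have h5 : 2 ^ L = 2 ^ (L - 1) * 2 := by rw [← pow_succ]; congr 1; omega
        simp only [eval_mul, eval_c, eval_v, h1, f]
        omega
      · simp only [eval_ite, eval_lt, eval_mul, eval_c, eval_v, hflast _ i hi, h2, f]
        rw [← powers_step hnL hLn]
        by_cases h : 2 ^ min i L < n <;> simp only [h, if_true, if_false, one_ne_zero]
    · have h1 : ρ₁ 3 = n := by simp [ρ₁, n]
      have : (sum 40 (v 3) ((mem ((v 5).add (v 40))).lt (v 3))).eval ρ₁ p = L := by
        rw [eval_sum, eval_v, h1, ← sum_lt_eq hLle]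
        refine Finset.sum_congr rfl fun i hi => ?_
        have hi := Finset.mem_range.1 hi
        have h2 : Function.update ρ₁ 40 i 3 = n := by simp [ρ₁, n]
        have h3 : Function.update ρ₁ 40 i 5 + Function.update ρ₁ 40 i 40 = w.length + i := by
          simp [ρ₁]
        rw [eval_lt, eval_mem, eval_add, eval_v, eval_v, eval_v, h2, h3, hlast i hi.le]
        rcases lt_or_ge i L with h | h
        · rw [min_eq_left h.le, if_pos (hLn i h), if_pos h]
        · rw [min_eq_right h, if_neg (by omega), if_neg (by omega)]
      rw [this]
    · have h1 : ρ₂ 5 + ρ₂ 3 = w.length + n := by simp [ρ₂, ρ₁, n]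
      rw [eval_mem, eval_add, eval_v, eval_v, h1, hlast n le_rfl, min_eq_right hLle]
    · have : numFE.eval ρ₄ p = (ofWord ρ p).numF L := by
        simp [numFE, twoL, numF, ρ₄, ρ₃, ρ₂, ρ₁, ofWord]
      rw [this]
    · rw [out_formulaCmd (L := L) (by simp [ρ₅, ρ₄, ρ₃, ρ₂]) (by simp [ρ₅, ρ₄, ρ₃]) hpow
        (by simp [ρ₅, hsame]) hL0]
      rfl

end Prog

/-- From an instance of list coloring an equivalent formula is computed in polynomial time. -/
theorem exists_reduction : ∃ R τ, PolyBounded τ ∧ ∀ (I : ListColoringInstance) (V : ℕ),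
    2 ≤ I.numVertices → I.encode.length ≤ V → (∀ y ∈ I.encode, y ≤ V) →
    ∃ s ρ p, ∃ J : ThreeSATInstance, Run R (RAMState.init I.encode) (τ V) s ∧
      Rep ρ (p ++ J.encode) s ∧ ρ 7 = p.length ∧ (p ++ J.encode).length ≤ τ V ∧
      (∀ a, (p ++ J.encode).getD a 0 ≤ τ V) ∧ (J.Satisfiable ↔ I.Colorable) ∧ J.size ≤ τ V ∧
      ∀ w, HasWidth (bagSets I.bags) w →
        HasWidth (bagSets J.bags) ((w + 1) * Nat.clog 2 I.numVertices + 1) := by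
  obtain ⟨τ₁, hτ₁, H₁⟩ := run_setup ((c 2).add ((c 2).mul (mem (c 1)))) (mem (c 0))
  obtain ⟨τ₂, hτ₂, H₂⟩ := Prog.main_spec
  have hV3 : PolyBounded fun V => 3 * V + 2 := ((PolyBounded.const 3).mul .id).add (.const 2)
  refine ⟨.seq (setup Prog.head ((c 2).add ((c 2).mul (mem (c 1)))) (mem (c 0))) Prog.main,
    fun V => 30 + 10 * Nat.size V + τ₁ V + 3 * τ₂ (3 * V + 2), ?_, ?_⟩
  · exact (((PolyBounded.const 30).add ((PolyBounded.const 10).mul PolyBounded.id.size)).add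
      hτ₁).add ((PolyBounded.const 3).mul (hτ₂.comp hV3))
  intro I V hn hl hy
  obtain ⟨s, r, hm, hr, h60, h61⟩ := Prog.run_head I.encode hy
  have hlen : 2 + 2 * I.edges.length < I.encode.length := by
    rw [I.encode_eq, twoBlocks]
    simp
  have g0 : I.encode.getD 0 0 = I.numVertices := by simp [ListColoringInstance.encode]
  have g1 : I.encode.getD 1 0 = I.edges.length := by simp [ListColoringInstance.encode]
  rw [g0] at h60
  rw [g1] at h61
  have hE := I.encode_eq
  obtain ⟨s1, ρ, r1, R1, b1, p0, p1, p2, p3⟩ := H₁ Prog.head I.header I.colorLists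
    (natBags I.bags) (30 + 10 * Nat.size V) V s (hE ▸ r) (hE ▸ hm) hr (by simpa using h60)
    (by simpa using h61) (hE ▸ hl) (hE ▸ hy) (fun ρ => by
      rw [← hE, eval_add, eval_mul, eval_mem, eval_c, eval_c, g1, I.length_header])
    (fun ρ => by rw [← hE, eval_mem, eval_c, g0, I.length_colorLists])
  rw [← hE] at r1 p0 p1
  rw [I.length_colorLists] at p1 p3
  have hbl : (natBags I.bags).length = I.bags.length := by simp [natBags]
  rw [hbl] at p2
  obtain ⟨ρ', p, hp, hsame, h7, htr, hbd⟩ := H₂ _ ρ _ b1 (p3 ▸ hn)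
  obtain ⟨s2, r2, R2⟩ := htr s1 R1
  obtain ⟨hval, hcol, hlenb⟩ := ofWord_spec hp ((hsame 0 (by norm_num)).trans p0)
    ((hsame 1 (by norm_num)).trans p1) ((hsame 2 (by norm_num)).trans p2)
    ((hsame 3 (by norm_num)).trans p3)
  have hDn : (ofWord ρ' p).n = I.numVertices := (hsame 3 (by norm_num)).trans p3
  have hDT : (ofWord ρ' p).T = I.bags.length := (hsame 2 (by norm_num)).trans p2
  rw [p3] at R2 hbd
  set D := ofWord ρ' p with hD
  set L := Nat.clog 2 I.numVertices with hL
  have hnL : D.n ≤ 2 ^ L := hDn ▸ Nat.le_pow_clog (by norm_num) _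
  have hL0 : 0 < L := Nat.clog_pos (by norm_num) hn
  have hraw := hval.rawBags hL0 (by omega)
  obtain ⟨J, hJ, hsat, hsize, hw⟩ := exists_threeSATInstance (cl := D.cl L) hraw
    (m := D.numF L) (fun f _ => (length_cl f).le) (fun f hf => ⟨f, hf, cl_mem_bag hval hL0 hf⟩)
  have hword : D.formulaWord L = J.encode := hJ.symm
  rw [hword] at R2 hbd
  have hJsize : J.size ≤ 3 * τ₂ (3 * V + 2) := by
    have e := getD_le_iff.1 hbd.entry
    have e1 : D.n * L + D.numF L + 1 ≤ τ₂ (3 * V + 2) := e _ (by rw [hJ]; simp)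
    omega
  refine ⟨s2, ρ', p, J, (r1.seq r2).mono (by dsimp only; omega), R2, h7,
    hbd.length.trans (by dsimp only; omega), fun a => (hbd.entry a).trans (by dsimp only; omega),
    ?_, hJsize.trans (by dsimp only; omega), ?_⟩
  · rw [hsat, ← hcol]
    exact hval.satisfiable_iff hL0 hnL
  · rintro w ⟨hw1, hw2⟩
    have hcard : ∀ t (ht : t < I.bags.length), I.bags[t].toFinset.card = I.bags[t].length :=
      fun t ht => List.toFinset_card_of_nodup (I.bags_nodup _ (List.getElem_mem ht))
    refine hw _ (fun f hf => ?_) ?_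
    · have ht := div_lt_numF hf
      rw [length_bag, hlenb _ (hDT ▸ ht)]
      have h := hw1 _ (List.mem_map.2 ⟨_, List.getElem_mem (hDT ▸ ht), rfl⟩)
      rw [hcard] at h
      nlinarith
    · obtain ⟨b, hb, hbw⟩ := hw2
      obtain ⟨l, hl, rfl⟩ := List.mem_map.1 hb
      obtain ⟨t, ht, rfl⟩ := List.mem_iff_getElem.1 hl
      rw [hcard] at hbw
      obtain ⟨g, hg, h1, -⟩ := exists_choice (D := D) (L := L) (t := t) (x := 0) (y := 0) (i := 0)
        (j := 0) (hDT ▸ ht) (by omega) (by omega) (by positivity) (by positivity)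
      refine ⟨2 * L * g + 0, hg 0 (by omega), ?_⟩
      rw [length_bag, add_zero, Nat.mul_div_cancel_left _ (by omega), h1, hlenb t ht, hbw]

end ColData

/-! ### Running times -/

lemma RAMExec.pos {P : RAMProg} {s s' : RAMState} {t : ℕ} (h : RAMExec P s t s') : 0 < t := by
  induction h <;> omega

lemma RAMProg.DecidesWithin.mono {P : RAMProg} {w : List ℕ} {A : Prop} {T T' : ℝ}
    (h : P.DecidesWithin w A T) (hT : T ≤ T') : P.DecidesWithin w A T' := by
  obtain ⟨t, s, h1, h2, h3⟩ := h
  exact ⟨t, s, h1, h2.trans hT, h3⟩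

lemma RAMProg.DecidesWithin.congr {P : RAMProg} {w : List ℕ} {A B : Prop} {T : ℝ}
    (h : P.DecidesWithin w A T) (hAB : A ↔ B) : P.DecidesWithin w B T := by
  obtain ⟨t, s, h1, h2, h3⟩ := h
  exact ⟨t, s, h1, h2, h3.trans hAB⟩

lemma RAMProg.DecidesWithin.one_le {P : RAMProg} {w : List ℕ} {A : Prop} {T : ℝ}
    (h : P.DecidesWithin w A T) : 1 ≤ T := by
  obtain ⟨t, s, h1, h2, -⟩ := h
  have : (1 : ℝ) ≤ t := by exact_mod_cast h1.pos
  linarith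

/-- There are formulas with path decompositions of every width. -/
lemma exists_width (w : ℕ) : ∃ I : ThreeSATInstance, HasWidth (bagSets I.bags) w := by
  obtain ⟨I, -, -, -, h⟩ := exists_threeSATInstance (nv := w + 1) (m := 0) (F := 1)
    (cl := fun _ => []) (bag := fun _ => List.range (w + 1))
    ⟨fun f _ x hx => List.mem_range.1 hx, fun _ _ => List.nodup_range,
      fun x hx => ⟨0, one_pos, List.mem_range.2 hx⟩, fun _ _ _ _ _ _ _ _ h => h⟩
    (by simp) (by simp)
  exact ⟨I, h w (by simp) ⟨0, one_pos, by simp⟩⟩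

/-- An algorithm as in the hypothesis has a positive constant and a positive base. -/
lemma pos_of_decides {P : RAMProg} {C ε : ℝ} {c : ℕ}
    (h : ∀ (I : ThreeSATInstance) (pw : ℕ), HasWidth (bagSets I.bags) pw →
      P.DecidesWithin I.encode I.Satisfiable (C * (2 - ε) ^ pw * (I.size : ℝ) ^ c)) :
    0 < C ∧ 0 < 2 - ε := by
  obtain ⟨I, hI⟩ := exists_width 0
  obtain ⟨J, hJ⟩ := exists_width 1
  have h1 := (h I 0 hI).one_le
  have h2 := (h J 1 hJ).one_le
  rw [pow_zero, mul_one] at h1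
  rw [pow_one] at h2
  have hC : 0 < C := by
    by_contra hC
    have := mul_nonpos_of_nonpos_of_nonneg (not_lt.1 hC) (by positivity : 0 ≤ (I.size : ℝ) ^ c)
    linarith
  refine ⟨hC, ?_⟩
  by_contra hε
  have := mul_nonpos_of_nonpos_of_nonneg (mul_nonpos_of_nonneg_of_nonpos hC.le (not_lt.1 hε))
    (by positivity : 0 ≤ (J.size : ℝ) ^ c)
  linarith

/-- The base `β < 2` makes up for rounding `log n` up to an integer, if `n` is large; otherwise
the width, which is less than `n`, is bounded. -/
lemma exists_exponent {β : ℝ} (h1 : 1 ≤ β) (h2 : β < 2) : ∃ γ B : ℝ, 0 ≤ γ ∧ γ < 1 ∧ 0 ≤ B ∧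
    ∀ n p : ℕ, 2 ≤ n → p + 1 ≤ n →
      β ^ ((p + 1) * Nat.clog 2 n + 1) ≤ B * (n : ℝ) ^ (γ * (p + 1)) := by
  set δ := Real.logb 2 β with hδ
  have hβ : β = 2 ^ δ := (Real.rpow_logb (by norm_num) (by norm_num) (by linarith)).symm
  have hδ0 : 0 ≤ δ := Real.logb_nonneg (by norm_num) h1
  have hδ1 : δ < 1 := by
    rw [hδ, Real.logb_lt_iff_lt_rpow (by norm_num) (by linarith), Real.rpow_one]
    exact h2
  obtain ⟨N, hN⟩ := exists_nat_ge ((2 : ℝ) ^ (2 / (1 - δ)))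
  refine ⟨(1 + δ) / 2, 2 ^ ((N + 1) * N + 1), by linarith, by linarith, by positivity,
    fun n p hn hp => ?_⟩
  have hn1 : (1 : ℝ) ≤ n := by exact_mod_cast (by omega : 1 ≤ n)
  rcases lt_or_ge n N with hnN | hnN
  · have e1 : (p + 1) * Nat.clog 2 n + 1 ≤ (N + 1) * N + 1 := by
      have : Nat.clog 2 n ≤ n := Nat.clog_le_of_le_pow Nat.lt_two_pow_self.le
      gcongr <;> omega
    calc β ^ ((p + 1) * Nat.clog 2 n + 1) ≤ 2 ^ ((p + 1) * Nat.clog 2 n + 1) := by gcongr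
      _ ≤ 2 ^ ((N + 1) * N + 1) := pow_le_pow_right₀ (by norm_num) e1
      _ ≤ _ := le_mul_of_one_le_right (by positivity)
        (Real.one_le_rpow hn1 (mul_nonneg (by linarith) (by positivity)))
  · have key : β ^ Nat.clog 2 n ≤ (n : ℝ) ^ ((1 + δ) / 2) := by
      have hL : 0 < Nat.clog 2 n := Nat.clog_pos (by norm_num) hn
      have hlt : (2 : ℝ) ^ (Nat.clog 2 n - 1) ≤ n := by
        have := Nat.pow_pred_clog_lt_self (b := 2) (by norm_num) (by omega : 1 < n)
        exact_mod_cast this.le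
      have hpow : β ^ (Nat.clog 2 n - 1) ≤ (n : ℝ) ^ δ := by
        calc β ^ (Nat.clog 2 n - 1) = ((2 : ℝ) ^ (Nat.clog 2 n - 1)) ^ δ := by
              rw [hβ, ← Real.rpow_natCast, ← Real.rpow_natCast, ← Real.rpow_mul (by norm_num),
                ← Real.rpow_mul (by norm_num), mul_comm]
          _ ≤ (n : ℝ) ^ δ := Real.rpow_le_rpow (by positivity) hlt hδ0
      have h2n : 2 ≤ (n : ℝ) ^ ((1 - δ) / 2) := by
        have : ((2 : ℝ) ^ (2 / (1 - δ))) ^ ((1 - δ) / 2) = 2 := by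
          rw [← Real.rpow_mul (by norm_num)]
          have : 2 / (1 - δ) * ((1 - δ) / 2) = 1 := by
            have : 1 - δ ≠ 0 := by linarith
            field_simp
          rw [this, Real.rpow_one]
        exact this.symm.le.trans
          (Real.rpow_le_rpow (by positivity) (hN.trans (Nat.cast_le.2 hnN)) (by linarith))
      calc β ^ Nat.clog 2 n = β * β ^ (Nat.clog 2 n - 1) := by
            rw [← pow_succ']; congr 1; omega
        _ ≤ (n : ℝ) ^ ((1 - δ) / 2) * (n : ℝ) ^ δ := by gcongr; linarith
        _ = _ := by rw [← Real.rpow_add (by linarith)]; congr 1; ring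
    calc β ^ ((p + 1) * Nat.clog 2 n + 1) = β * (β ^ Nat.clog 2 n) ^ (p + 1) := by
          rw [pow_succ', mul_comm (p + 1), pow_mul]
      _ ≤ 2 ^ ((N + 1) * N + 1) * ((n : ℝ) ^ ((1 + δ) / 2)) ^ (p + 1) := by
          gcongr
          calc β ≤ 2 ^ 1 := by linarith
            _ ≤ 2 ^ ((N + 1) * N + 1) := pow_le_pow_right₀ (by norm_num) (by omega)
      _ = _ := by
          rw [← Real.rpow_mul_natCast (by linarith)]
          push_cast
          rfl

namespace ListColoringInstance

variable {I : ListColoringInstance}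

lemma length_le_of_nodup {n : ℕ} {l : List (Fin n)} (h : l.Nodup) : l.length ≤ n := by
  simpa using h.length_le_card

lemma lt_of_hasWidth {p : ℕ} (h : HasWidth (bagSets I.bags) p) : p + 1 ≤ I.numVertices := by
  obtain ⟨b, -, hb⟩ := h.2
  simpa [hb] using Finset.card_le_univ b

lemma length_flatMap_le {α : Type*} {l : List α} {f : α → List ℕ} {B : ℕ}
    (h : ∀ a ∈ l, (f a).length ≤ B) : (l.flatMap f).length ≤ l.length * B := by
  induction l with
  | nil => simp
  | cons a l ih =>
    have h1 := h a (by simp)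
    have h2 := ih fun b hb => h b (by simp [hb])
    rw [List.flatMap_cons, List.length_append, List.length_cons, add_mul]
    omega

/-- The size of the input is bounded by a power of the number of vertices. -/
lemma PolySize.encode_le {d : ℕ} (hd : 1 ≤ d) (h : I.PolySize d) (hn : 2 ≤ I.numVertices) :
    I.encode.length ≤ I.numVertices ^ (d + 6) ∧ ∀ y ∈ I.encode, y ≤ I.numVertices ^ (d + 6) := by
  obtain ⟨hc, hB⟩ := h
  have hm : I.edges.length ≤ I.numVertices ^ 2 := by
    have := I.edges_nodup.length_le_card
    simpa [sq] using this
  have hcl : ∀ v, (I.colors v).length ≤ I.numVertices ^ d := by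
    intro v
    have := Finset.card_le_card (s := (I.colors v).toFinset) (t := Finset.range (I.numVertices ^ d))
      fun c hcv => Finset.mem_range.2 (hc v c (List.mem_toFinset.1 hcv))
    rwa [List.toFinset_card_of_nodup (I.colors_nodup v), Finset.card_range] at this
  have hbl : ∀ b ∈ I.bags, b.length ≤ I.numVertices := fun b hb =>
    length_le_of_nodup (I.bags_nodup b hb)
  have hpow : ∀ k, k ≤ d + 6 → I.numVertices ^ k ≤ I.numVertices ^ (d + 6) := fun k hk =>
    Nat.pow_le_pow_right (by omega) hk
  have hn1 : I.numVertices ≤ I.numVertices ^ (d + 6) := by simpa using hpow 1 (by omega)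
  have hnd := hpow d (by omega)
  constructor
  · have l1 := length_flatMap_le (l := I.edges)
      (f := fun e => [Fin.val e.1, Fin.val e.2]) (B := 2) (by simp)
    have l2 := length_flatMap_le (l := List.finRange I.numVertices)
      (f := fun v => (I.colors v).length :: I.colors v) (B := I.numVertices ^ d + 1) (by
        intro v _; simpa using hcl v)
    have l3 := length_flatMap_le (l := I.bags)
      (f := fun b => b.length :: b.map Fin.val) (B := I.numVertices + 1) (by
        intro b hb; simpa using hbl b hb)
    rw [List.length_finRange] at l2
    have e1 : I.encode.length = 2 + (I.edges.flatMap fun e => [Fin.val e.1, Fin.val e.2]).length +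
        ((List.finRange I.numVertices).flatMap fun v => (I.colors v).length :: I.colors v).length +
        (1 + (I.bags.flatMap fun b => b.length :: b.map Fin.val).length) := by
      rw [encode, encodeBags_eq_flatMap]
      simp only [List.length_append, List.length_cons, List.length_nil]
      omega
    have l3' := l3.trans (Nat.mul_le_mul_right (I.numVertices + 1) hB)
    have q1 : I.numVertices ≤ I.numVertices ^ (d + 2) := by
      simpa using Nat.pow_le_pow_right (by omega : 0 < I.numVertices) (by omega : 1 ≤ d + 2)
    have q2 : I.numVertices ^ 2 ≤ I.numVertices ^ (d + 2) :=
      Nat.pow_le_pow_right (by omega) (by omega)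
    have q3 : I.numVertices ^ d ≤ I.numVertices ^ (d + 2) :=
      Nat.pow_le_pow_right (by omega) (by omega)
    have q4 : I.numVertices ^ (d + 1) ≤ I.numVertices ^ (d + 2) :=
      Nat.pow_le_pow_right (by omega) (by omega)
    have q0 : 1 ≤ I.numVertices ^ (d + 2) := Nat.one_le_pow _ _ (by omega)
    have q5 : I.numVertices ^ (d + 2) * 16 ≤ I.numVertices ^ (d + 6) := by
      have : 2 ^ 4 ≤ I.numVertices ^ 4 := Nat.pow_le_pow_left hn 4
      rw [show d + 6 = (d + 2) + 4 by ring, pow_add I.numVertices (d + 2)]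
      exact Nat.mul_le_mul_left _ this
    have q6 : I.numVertices * (I.numVertices ^ d + 1) = I.numVertices ^ (d + 1) + I.numVertices := by
      ring
    have q7 : I.numVertices ^ d * (I.numVertices + 1) = I.numVertices ^ (d + 1) + I.numVertices ^ d := by
      ring
    omega
  · intro y hy
    rw [encode, encodeBags_eq_flatMap] at hy
    simp only [List.mem_append, List.mem_cons, List.not_mem_nil, or_false, List.mem_flatMap,
      List.mem_map] at hy
    have h2 := hpow 2 (by omega)
    rcases hy with ((hy | ⟨e, he, hy⟩) | ⟨v, -, hy⟩) | hy | ⟨b, hb, hy⟩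
    · omega
    · have := e.1.2
      have := e.2.2
      omega
    · have := hcl v
      rcases hy with hy | hy
      · omega
      · have := hc v y hy
        omega
    · omega
    · have := hbl b hb
      rcases hy with hy | ⟨v, -, hy⟩
      · omega
      · have := v.2
        omega

end ListColoringInstance

lemma pow_add_le {n D k : ℕ} (hn : 2 ≤ n) : (n ^ k + 2) ^ D ≤ n ^ ((k + 2) * D) := by
  rw [pow_mul]
  refine Nat.pow_le_pow_left ?_ D
  have h1 : 1 ≤ n ^ k := Nat.one_le_pow _ _ (by omega)
  have h2 : 2 ^ 2 ≤ n ^ 2 := Nat.pow_le_pow_left hn 2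
  rw [pow_add]
  nlinarith

/-- Each vertex takes `log n` bits, so the formula has width about `p log n`, and
`(2 - ε) ^ (p log n)` is `n ^ ((1 - η) p)`. The polynomial overhead is absorbed for large `p`. -/
theorem listColoring_of_not_PPSETH {d : ℕ} (hd : 1 ≤ d) (h : ¬ PPSETH) :
    ∃ ε : ℝ, 0 < ε ∧ ∃ p₀ : ℕ, 0 < p₀ ∧ ∃ (P : RAMProg) (C : ℝ),
      ∀ p : ℕ, p₀ < p →
        ∀ I : ListColoringInstance, I.PolySize d → HasWidth (bagSets I.bags) p →
          P.DecidesWithin I.encode I.Colorable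
            (C * (I.numVertices : ℝ) ^ ((1 - ε) * (p : ℝ))) := by
  simp only [PPSETH, not_forall, not_not] at h
  obtain ⟨ε, hε, P, C, c, hP⟩ := h
  obtain ⟨hC, hb⟩ := pos_of_decides hP
  obtain ⟨γ, B, hγ0, hγ1, hB, hγ⟩ := exists_exponent (β := max (2 - ε) 1) (le_max_right _ _)
    (max_lt (by linarith) (by norm_num))
  obtain ⟨R, τ, hτ, hR⟩ := ColData.exists_reduction
  obtain ⟨Q, K, hQ⟩ := decidesWithin_comp R P (x := 7) (by norm_num)
  -- the time for everything but the algorithm for satisfiability is `n ^ E`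
  have hσ : PolyBounded fun V => τ V + (1 + τ V) * (K * (1 + Nat.size (τ V))) :=
    hτ.add (((PolyBounded.const 1).add hτ).mul ((PolyBounded.const K).mul
      ((PolyBounded.const 1).add hτ.size)))
  obtain ⟨D, hD⟩ := hσ
  set E := (d + 6 + 2) * D with hE
  obtain ⟨p₀, hp₀⟩ := exists_nat_ge ((γ + E * (c + 1)) / ((1 - γ) / 2))
  refine ⟨(1 - γ) / 2, by linarith, p₀ + 1, by omega, Q, 1 + C * B, fun p hp I hI hw => ?_⟩
  have hpn := ListColoringInstance.lt_of_hasWidth hw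
  have hn : 2 ≤ I.numVertices := by omega
  set n := I.numVertices with hnn
  obtain ⟨hl, hy⟩ := hI.encode_le hd hn
  obtain ⟨s, ρ, q, J, r, hs, h7, hlen, hent, hsat, hsize, hwJ⟩ := hR I (n ^ (d + 6)) hn hl hy
  have hdec := ((hP J _ (hwJ p hw)).congr hsat)
  refine (hQ _ _ _ s ρ _ _ _ _ r hs h7 hlen hent hdec).mono ?_
  have hVE : ∀ x, x ≤ τ (n ^ (d + 6)) + (1 + τ (n ^ (d + 6))) * (K * (1 + Nat.size (τ (n ^ (d + 6)))))
      → x ≤ n ^ E := fun x hx => hx.trans ((hD _).trans (pow_add_le hn))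
  have hn1 : (1 : ℝ) ≤ n := by exact_mod_cast (by omega : 1 ≤ n)
  have hn0 : (0 : ℝ) < n := by linarith
  have hexp : γ + E * (c + 1) ≤ (1 - γ) / 2 * p := by
    rw [div_le_iff₀ (by linarith)] at hp₀
    have : (p₀ : ℝ) ≤ p := by exact_mod_cast (by omega : p₀ ≤ p)
    nlinarith
  have hEc : (0 : ℝ) ≤ E * c := by positivity
  have t1 : ((τ (n ^ (d + 6)) + (1 + (q ++ J.encode).length) *
      (K * (1 + Nat.size (τ (n ^ (d + 6))))) : ℕ) : ℝ) ≤ (n : ℝ) ^ ((1 - (1 - γ) / 2) * (p : ℝ)) := by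
    have : τ (n ^ (d + 6)) + (1 + (q ++ J.encode).length) *
      (K * (1 + Nat.size (τ (n ^ (d + 6))))) ≤ n ^ E := by
      refine hVE _ ?_
      gcongr
    calc ((τ (n ^ (d + 6)) + (1 + (q ++ J.encode).length) *
        (K * (1 + Nat.size (τ (n ^ (d + 6))))) : ℕ) : ℝ) ≤ ((n ^ E : ℕ) : ℝ) := by exact_mod_cast this
      _ = (n : ℝ) ^ (E : ℝ) := by rw [Real.rpow_natCast]; push_cast; rfl
      _ ≤ _ := by
        refine Real.rpow_le_rpow_of_exponent_le hn1 ?_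
        have : (0 : ℝ) ≤ p := by positivity
        nlinarith
  have t2 : C * (2 - ε) ^ ((p + 1) * Nat.clog 2 n + 1) * (J.size : ℝ) ^ c ≤
      C * B * (n : ℝ) ^ ((1 - (1 - γ) / 2) * (p : ℝ)) := by
    have hJ : (J.size : ℝ) ≤ (n : ℝ) ^ (E : ℝ) := by
      rw [Real.rpow_natCast]
      exact_mod_cast hVE _ (hsize.trans (Nat.le_add_right _ _))
    calc C * (2 - ε) ^ ((p + 1) * Nat.clog 2 n + 1) * (J.size : ℝ) ^ c
        ≤ C * (max (2 - ε) 1) ^ ((p + 1) * Nat.clog 2 n + 1) * ((n : ℝ) ^ (E : ℝ)) ^ c := by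
          gcongr
          exact le_max_left _ _
      _ ≤ C * (B * (n : ℝ) ^ (γ * (p + 1))) * ((n : ℝ) ^ (E : ℝ)) ^ c := by
          gcongr
          exact hγ n p hn hpn
      _ = C * B * (n : ℝ) ^ (γ * (p + 1) + E * c) := by
          rw [← Real.rpow_mul_natCast hn0.le, Real.rpow_add hn0]
          ring
      _ ≤ _ := by
          refine mul_le_mul_of_nonneg_left
            (Real.rpow_le_rpow_of_exponent_le hn1 ?_) (by positivity)
          have : (0 : ℝ) ≤ E := by positivity
          nlinarith
  exact (add_le_add t1 t2).trans_eq (one_add_mul _ _).symm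

/-! ### Window constraints as list coloring -/

/-- Constraints on variables `0, …, Sn + k - 1` with values below `q`. Constraint `c` is a
disjunction of three literals, which depend on variables in the window `c / J, …, c / J + k`:
literal `r` depends on the variable `c / J + δ c r`, and `tr c r a` says whether the value `a` makes
it true. There are `J` constraints for each of `Sn` windows. -/
structure WindowData where
  k : ℕ
  Sn : ℕ
  J : ℕ
  q : ℕ
  δ : ℕ → ℕ → ℕ
  tr : ℕ → ℕ → ℕ → Bool

namespace WindowData

variable (D : WindowData)

/-- The number of variables. -/
def M : ℕ := D.Sn + D.k

/-- The number of constraints. -/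
def Cn : ℕ := D.Sn * D.J

/-- The number of test vertices. -/
def F : ℕ := D.Cn * (3 * D.q + 1)

/-- The number of vertices: the variables, three vertices for each constraint, and the test
vertices. -/
def n : ℕ := D.M + 3 * D.Cn + D.F

/-- The constraint of a test vertex. -/
def fc (f : ℕ) : ℕ := f / (3 * D.q + 1)

/-- The number of a test vertex among those of its constraint. The first `3 q` test vertices
correspond to a literal and a value. -/
def fe (f : ℕ) : ℕ := f % (3 * D.q + 1)

/-- The vertex of a literal. -/
def xv (c r : ℕ) : ℕ := D.M + 3 * c + r

/-- A test vertex. -/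
def wv (f : ℕ) : ℕ := D.M + 3 * D.Cn + f

/-- The neighbors of a test vertex: for `i = 0` the variable of its literal, otherwise the vertices
of the literals of its constraint. The last test vertex of a constraint belongs to no literal; its
neighbor for `i = 0` is given by `δ c 3` and does not matter, as all its colors are at least `q`. -/
def nb (f i : ℕ) : ℕ :=
  if i = 0 then D.fc f / D.J + D.δ (D.fc f) (D.fe f / D.q) else D.xv (D.fc f) (i - 1)

/-- The size of the list of a vertex. -/
def len (v : ℕ) : ℕ :=
  if v < D.M then D.q else if v < D.M + 3 * D.Cn then 2
    else if D.fe (v - (D.M + 3 * D.Cn)) < 3 * D.q then 2 else 3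

/-- The colors of a vertex. The vertex of literal `r` has the colors `q + r` and `q + 3 + r`; the
latter claims that the literal is true. A test vertex for a literal and a value rules out that
this is claimed when the variable has this value and the literal is false. The last test vertex
of a constraint makes sure that a claim is made. -/
def col (v i : ℕ) : ℕ :=
  if v < D.M then i else if v < D.M + 3 * D.Cn then D.q + (v - D.M) % 3 + 3 * i
    else if D.fe (v - (D.M + 3 * D.Cn)) < 3 * D.q then
      if i = 0 then D.fe (v - (D.M + 3 * D.Cn)) % D.q
      else if D.tr (D.fc (v - (D.M + 3 * D.Cn))) (D.fe (v - (D.M + 3 * D.Cn)) / D.q)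
        (D.fe (v - (D.M + 3 * D.Cn)) % D.q) then D.q + 6
      else D.q + 3 + D.fe (v - (D.M + 3 * D.Cn)) / D.q
    else D.q + i

/-- A vertex of the bag of a test vertex. -/
def bagv (f i : ℕ) : ℕ :=
  if i < D.k + 1 then D.fc f / D.J + i else if i < D.k + 4 then D.xv (D.fc f) (i - (D.k + 1))
    else D.wv f

/-- The bag of a test vertex: the window of its constraint, the vertices of the three literals, and
the test vertex itself. This makes `k + 5` vertices. -/
def bag (f : ℕ) : List ℕ := (List.range (D.k + 5)).map (D.bagv f)

/-- The list of a vertex. -/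
def colors (v : ℕ) : List ℕ := (List.range (D.len v)).map (D.col v)

/-- Every test vertex is adjacent to its four neighbors, and there are no other edges. -/
def edges : List (ℕ × ℕ) :=
  (List.range (4 * D.F)).map fun g => (D.nb (g / 4) (g % 4), D.wv (g / 4))

/-- The constraints can be satisfied. -/
def Solvable : Prop :=
  ∃ a : ℕ → ℕ, (∀ s < D.M, a s < D.q) ∧
    ∀ c < D.Cn, ∃ r < 3, D.tr c r (a (c / D.J + D.δ c r)) = true

variable {D}

lemma fc_lt {f : ℕ} (hf : f < D.F) : D.fc f < D.Cn := div_lt_of_lt_mul_right hf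

lemma window_lt {c : ℕ} (hc : c < D.Cn) : c / D.J < D.Sn := div_lt_of_lt_mul_right hc

lemma exists_test {c e : ℕ} (hc : c < D.Cn) (he : e < 3 * D.q + 1) :
    ∃ f < D.F, D.fc f = c ∧ D.fe f = e := by
  refine ⟨c * (3 * D.q + 1) + e, ?_, mul_add_div_of_lt _ he, mul_add_mod_of_lt _ he⟩
  rw [F]
  nlinarith

lemma mem_edges {e : ℕ × ℕ} : e ∈ D.edges ↔ ∃ f < D.F, ∃ i < 4, e = (D.nb f i, D.wv f) := by
  simp only [edges, List.mem_map, List.mem_range]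
  constructor
  · rintro ⟨g, hg, rfl⟩
    exact ⟨g / 4, by omega, g % 4, by omega, rfl⟩
  · rintro ⟨f, hf, i, hi, rfl⟩
    refine ⟨4 * f + i, by omega, ?_⟩
    rw [show (4 * f + i) / 4 = f by omega, show (4 * f + i) % 4 = i by omega]

lemma mem_bag {f v : ℕ} : v ∈ D.bag f ↔ (D.fc f / D.J ≤ v ∧ v ≤ D.fc f / D.J + D.k) ∨
    (∃ r < 3, v = D.xv (D.fc f) r) ∨ v = D.wv f := by
  simp only [bag, List.mem_map, List.mem_range, bagv]
  constructor
  · rintro ⟨i, hi, rfl⟩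
    split_ifs with h1 h2
    · left; omega
    · right; left; exact ⟨_, by omega, rfl⟩
    · right; right; rfl
  · rintro (⟨h1, h2⟩ | ⟨r, hr, rfl⟩ | rfl)
    · refine ⟨v - D.fc f / D.J, by omega, ?_⟩
      rw [if_pos (by omega)]
      omega
    · refine ⟨D.k + 1 + r, by omega, ?_⟩
      rw [if_neg (by omega), if_pos (by omega), Nat.add_sub_cancel_left]
    · refine ⟨D.k + 4, by omega, ?_⟩
      rw [if_neg (by omega), if_neg (by omega)]

lemma nb_mem_bag (hδ : ∀ c < D.Cn, ∀ r, D.δ c r ≤ D.k) {f i : ℕ} (hf : f < D.F) (hi : i < 4) :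
    D.nb f i ∈ D.bag f := by
  rw [mem_bag, nb]
  split_ifs with h
  · have := hδ _ (fc_lt hf) (D.fe f / D.q)
    left
    omega
  · exact Or.inr (Or.inl ⟨i - 1, by omega, rfl⟩)

lemma nb_lt (hδ : ∀ c < D.Cn, ∀ r, D.δ c r ≤ D.k) {f i : ℕ} (hf : f < D.F) (hi : i < 4) :
    D.nb f i < D.M + 3 * D.Cn := by
  have h1 := fc_lt hf
  have h2 := window_lt h1
  rw [nb]
  split_ifs with h
  · have := hδ _ (fc_lt hf) (D.fe f / D.q)
    rw [M]
    omega
  · rw [xv]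
    omega

lemma rawBags (hJ : 0 < D.J) (hS : 0 < D.Sn) : RawBags D.n D.F D.bag := by
  have hmono : ∀ {i j}, i ≤ j → D.fc i ≤ D.fc j := fun h => Nat.div_le_div_right h
  have hmono' : ∀ {i j}, i ≤ j → D.fc i / D.J ≤ D.fc j / D.J := fun h =>
    Nat.div_le_div_right (hmono h)
  refine ⟨fun f hf v hv => ?_, fun f hf => ?_, fun v hv => ?_, fun i j l hij hjl hl v hi hl' => ?_⟩
  · have h1 := fc_lt hf
    have h2 := window_lt h1
    rcases mem_bag.1 hv with h | ⟨r, hr, rfl⟩ | rfl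
    · simp only [n, M]; omega
    · simp only [n, xv]; omega
    · simp only [n, wv]; omega
  · refine List.Nodup.map_on ?_ List.nodup_range
    have h1 := fc_lt hf
    have h2 := window_lt h1
    intro i hi j hj hij
    have hi := List.mem_range.1 hi
    have hj := List.mem_range.1 hj
    simp only [bagv, xv, wv, M] at hij
    split_ifs at hij <;> omega
  · have hc : ∀ s < D.Sn, s * D.J < D.Cn ∧ s * D.J / D.J = s := fun s hs =>
      ⟨Nat.mul_lt_mul_of_pos_right hs hJ, Nat.mul_div_cancel _ hJ⟩
    rcases lt_or_ge v D.M with h | h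
    · rcases lt_or_ge v D.Sn with h' | h'
      · obtain ⟨f, hf, h1, -⟩ := exists_test (hc v h').1 (by omega : 0 < 3 * D.q + 1)
        refine ⟨f, hf, mem_bag.2 (Or.inl ?_)⟩
        rw [h1, (hc v h').2]
        omega
      · obtain ⟨f, hf, h1, -⟩ := exists_test (hc (D.Sn - 1) (by omega)).1
          (by omega : 0 < 3 * D.q + 1)
        refine ⟨f, hf, mem_bag.2 (Or.inl ?_)⟩
        rw [h1, (hc (D.Sn - 1) (by omega)).2]
        rw [M] at h
        omega
    · rcases lt_or_ge v (D.M + 3 * D.Cn) with h' | h'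
      · obtain ⟨f, hf, h1, -⟩ := exists_test (c := (v - D.M) / 3) (D := D) (by omega)
          (by omega : 0 < 3 * D.q + 1)
        refine ⟨f, hf, mem_bag.2 (Or.inr (Or.inl ⟨(v - D.M) % 3, by omega, ?_⟩))⟩
        rw [h1, xv]
        omega
      · rw [n] at hv
        exact ⟨v - (D.M + 3 * D.Cn), by omega, mem_bag.2 (Or.inr (Or.inr (by rw [wv]; omega)))⟩
  · have a1 := fc_lt (hij.trans_lt (hjl.trans_lt hl))
    have a2 := fc_lt hl
    have a3 := window_lt a1
    have a4 := window_lt a2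
    have b1 := hmono hij
    have b2 := hmono hjl
    have b3 := hmono' hij
    have b4 := hmono' hjl
    rw [mem_bag] at hi hl' ⊢
    simp only [xv, wv, M] at hi hl' ⊢
    rcases hi with h1 | ⟨r, hr, h1⟩ | h1 <;> rcases hl' with h2 | ⟨r', hr', h2⟩ | h2 <;>
      first
        | (left; omega)
        | (right; left; exact ⟨v - (D.Sn + D.k + 3 * D.fc j), by omega, by omega⟩)
        | (right; right; omega)

lemma length_bag (f : ℕ) : (D.bag f).length = D.k + 5 := by simp [bag]

lemma nb_zero_lt (hδ : ∀ c < D.Cn, ∀ r, D.δ c r ≤ D.k) {f : ℕ} (hf : f < D.F) : D.nb f 0 < D.M := by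
  have h2 := window_lt (fc_lt hf)
  have := hδ _ (fc_lt hf) (D.fe f / D.q)
  rw [nb, if_pos rfl, M]
  omega

lemma nb_succ (f r : ℕ) : D.nb f (r + 1) = D.xv (D.fc f) r := by
  rw [nb, if_neg (by omega), Nat.add_sub_cancel]

lemma nodup_edges (hδ : ∀ c < D.Cn, ∀ r, D.δ c r ≤ D.k) : D.edges.Nodup := by
  refine List.Nodup.map_on ?_ List.nodup_range
  intro g hg g' _ h
  have hg := List.mem_range.1 hg
  obtain ⟨h1, h2⟩ := Prod.ext_iff.1 h
  simp only [wv] at h1 h2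
  have hd : g / 4 = g' / 4 := by omega
  rw [← hd] at h1
  have h0 := nb_zero_lt hδ (f := g / 4) (by omega)
  rcases hi : g % 4 with - | i <;> rcases hj : g' % 4 with - | j
  · omega
  · rw [hi, hj, nb_succ, xv] at h1; omega
  · rw [hi, hj, nb_succ, xv] at h1; omega
  · rw [hi, hj, nb_succ, nb_succ, xv, xv] at h1; omega

lemma nodup_colors (hq : 0 < D.q) (v : ℕ) : (D.colors v).Nodup := by
  refine List.Nodup.map_on ?_ List.nodup_range
  intro i hi j hj hij
  have hi := List.mem_range.1 hi
  have hj := List.mem_range.1 hj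
  have := Nat.mod_lt (D.fe (v - (D.M + 3 * D.Cn))) hq
  have := Nat.zero_le (D.fe (v - (D.M + 3 * D.Cn)) / D.q)
  simp only [len, col] at hi hj hij
  split_ifs at hi hj hij <;> omega

lemma mem_colors_state {v x : ℕ} (hv : v < D.M) : x ∈ D.colors v ↔ x < D.q := by
  simp [colors, len, col, hv]

lemma mem_colors_xv {c r x : ℕ} (hc : c < D.Cn) (hr : r < 3) :
    x ∈ D.colors (D.xv c r) ↔ x = D.q + r ∨ x = D.q + 3 + r := by
  have h1 : ¬ D.xv c r < D.M := by rw [xv]; omega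
  have h2 : D.xv c r < D.M + 3 * D.Cn := by rw [xv]; omega
  have h3 : (D.xv c r - D.M) % 3 = r := by rw [xv]; omega
  simp only [colors, len, col, h1, h2, h3, if_true, if_false, List.mem_map, List.mem_range]
  constructor
  · rintro ⟨i, hi, rfl⟩
    omega
  · rintro (rfl | rfl)
    · exact ⟨0, by omega, by omega⟩
    · exact ⟨1, by omega, by omega⟩

lemma mem_colors_wv {f x : ℕ} : x ∈ D.colors (D.wv f) ↔
    if D.fe f < 3 * D.q then x = D.fe f % D.q ∨
      x = if D.tr (D.fc f) (D.fe f / D.q) (D.fe f % D.q) then D.q + 6 else D.q + 3 + D.fe f / D.q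
    else D.q ≤ x ∧ x < D.q + 3 := by
  have h1 : ¬ D.wv f < D.M := by rw [wv]; omega
  have h2 : ¬ D.wv f < D.M + 3 * D.Cn := by rw [wv]; omega
  have h3 : D.wv f - (D.M + 3 * D.Cn) = f := by rw [wv]; omega
  simp only [colors, len, col, h1, h2, h3, if_false, List.mem_map, List.mem_range]
  split_ifs with h
  · constructor
    · rintro ⟨i, hi, rfl⟩
      rcases i with - | i <;> simp
    · rintro (rfl | rfl)
      · exact ⟨0, by omega, by simp⟩
      · exact ⟨1, by omega, by simp⟩
  · constructor
    · rintro ⟨i, hi, rfl⟩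
      rcases i with - | i <;> simp
    · rintro (rfl | rfl)
      · exact ⟨0, by omega, by simp⟩
      · exact ⟨1, by omega, by simp⟩
  · constructor
    · rintro ⟨i, hi, rfl⟩
      omega
    · rintro ⟨h1, h2⟩
      exact ⟨x - D.q, by omega, by omega⟩

lemma literal_lt {q r z : ℕ} (hr : r < 3) (hz : z < q) : r * q + z < 3 * q := by
  have : r * q + q ≤ 3 * q := by
    rw [← Nat.succ_mul]
    exact Nat.mul_le_mul_right q hr
  omega

/-- The colorings correspond to the solutions of the constraints. -/
theorem colorable_iff (hδ : ∀ c < D.Cn, ∀ r, D.δ c r ≤ D.k) (hq : 0 < D.q) :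
    (∃ g : ℕ → ℕ, (∀ v < D.n, g v ∈ D.colors v) ∧ ∀ e ∈ D.edges, g e.1 ≠ g e.2) ↔
      D.Solvable := by
  have hsv : ∀ c < D.Cn, ∀ r, c / D.J + D.δ c r < D.M := fun c hc r => by
    have := window_lt hc
    have := hδ c hc r
    rw [M]
    omega
  constructor
  · rintro ⟨g, hg, he⟩
    have hedge : ∀ f < D.F, ∀ i < 4, g (D.nb f i) ≠ g (D.wv f) := fun f hf i hi =>
      he _ (mem_edges.2 ⟨f, hf, i, hi, rfl⟩)
    have hw : ∀ f < D.F, g (D.wv f) ∈ D.colors (D.wv f) := fun f hf =>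
      hg _ (by rw [wv, n]; omega)
    have hs : ∀ s < D.M, g s < D.q := fun s hs =>
      (mem_colors_state hs).1 (hg s (by rw [n]; omega))
    refine ⟨g, hs, fun c hc => ?_⟩
    -- the last test vertex forces a claim
    obtain ⟨f, hf, rfl, h2⟩ := exists_test hc (by omega : 3 * D.q < 3 * D.q + 1)
    have h3 := hw f hf
    rw [mem_colors_wv, if_neg (by omega)] at h3
    set r := g (D.wv f) - D.q with hr
    have hr3 : r < 3 := by omega
    have h4 := hedge f hf (r + 1) (by omega)
    rw [nb_succ] at h4
    have h5 := (mem_colors_xv hc hr3).1 (hg _ (by rw [xv, n]; omega))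
    have h6 : g (D.xv (D.fc f) r) = D.q + 3 + r := by omega
    refine ⟨r, hr3, ?_⟩
    -- and the claim is true
    set z := g (D.fc f / D.J + D.δ (D.fc f) r) with hz
    have hzq : z < D.q := hs _ (hsv _ hc r)
    obtain ⟨f', hf', e1, e2⟩ := exists_test hc (by have := literal_lt hr3 hzq; omega :
      r * D.q + z < 3 * D.q + 1)
    have h7 := hw f' hf'
    rw [mem_colors_wv, if_pos (e2 ▸ literal_lt hr3 hzq), e1, e2, mul_add_div_of_lt _ hzq,
      mul_add_mod_of_lt _ hzq] at h7
    have h8 := hedge f' hf' 0 (by omega)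
    rw [nb, if_pos rfl, e1, e2, mul_add_div_of_lt _ hzq] at h8
    have h9 := hedge f' hf' (r + 1) (by omega)
    rw [nb_succ, e1, h6] at h9
    by_contra htr
    rw [if_neg htr] at h7
    omega
  · rintro ⟨a, ha, hc⟩
    choose! ch hch3 hch using hc
    -- true literals are claimed to be true, and a test vertex takes the color that its variable or
    -- its literal leaves free
    let y : ℕ → ℕ → ℕ := fun c r =>
      if D.tr c r (a (c / D.J + D.δ c r)) then D.q + 3 + r else D.q + r
    let wc : ℕ → ℕ := fun f =>
      if D.fe f < 3 * D.q then
        if a (D.fc f / D.J + D.δ (D.fc f) (D.fe f / D.q)) = D.fe f % D.q then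
          if D.tr (D.fc f) (D.fe f / D.q) (D.fe f % D.q) then D.q + 6
            else D.q + 3 + D.fe f / D.q
        else D.fe f % D.q
      else D.q + ch (D.fc f)
    let g : ℕ → ℕ := fun v => if v < D.M then a v else
      if v < D.M + 3 * D.Cn then y ((v - D.M) / 3) ((v - D.M) % 3) else wc (v - (D.M + 3 * D.Cn))
    have g1 : ∀ v < D.M, g v = a v := fun v hv => if_pos hv
    have g2 : ∀ c < D.Cn, ∀ r < 3, g (D.xv c r) = y c r := by
      intro c hc r hr
      have h1 : ¬ D.xv c r < D.M := by rw [xv]; omega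
      have h2 : D.xv c r < D.M + 3 * D.Cn := by rw [xv]; omega
      have h3 : (D.xv c r - D.M) % 3 = r := by rw [xv]; omega
      have h4 : (D.xv c r - D.M) / 3 = c := by rw [xv]; omega
      simp only [g, h1, h2, h3, h4, if_true, if_false]
    have g3 : ∀ f, g (D.wv f) = wc f := by
      intro f
      have h1 : ¬ D.wv f < D.M := by rw [wv]; omega
      have h2 : ¬ D.wv f < D.M + 3 * D.Cn := by rw [wv]; omega
      have h3 : D.wv f - (D.M + 3 * D.Cn) = f := by rw [wv]; omega
      simp only [g, h1, h2, h3, if_false]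
    refine ⟨g, fun v hv => ?_, fun e he => ?_⟩
    · rcases lt_or_ge v D.M with h | h
      · rw [mem_colors_state h, g1 v h]
        exact ha v h
      · rcases lt_or_ge v (D.M + 3 * D.Cn) with h' | h'
        · have hv' : v = D.xv ((v - D.M) / 3) ((v - D.M) % 3) := by rw [xv]; omega
          have hc' : (v - D.M) / 3 < D.Cn := by omega
          have hr' : (v - D.M) % 3 < 3 := Nat.mod_lt _ (by norm_num)
          rw [hv', mem_colors_xv hc' hr', g2 _ hc' _ hr']
          simp only [y]
          split_ifs
          · exact Or.inr rfl
          · exact Or.inl rfl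
        · have hf : v - (D.M + 3 * D.Cn) < D.F := by rw [n] at hv; omega
          have hv' : v = D.wv (v - (D.M + 3 * D.Cn)) := by rw [wv]; omega
          rw [hv', mem_colors_wv, g3]
          have := hch3 _ (fc_lt hf)
          simp only [wc]
          split_ifs
          · exact Or.inr rfl
          · exact Or.inr rfl
          · exact Or.inl rfl
          · exact Or.inl rfl
          · exact ⟨Nat.le_add_right _ _, by omega⟩
    · obtain ⟨f, hf, i, hi, rfl⟩ := mem_edges.1 he
      have hcf := fc_lt hf
      have hmod := Nat.mod_lt (D.fe f) hq
      have hdiv := Nat.zero_le (D.fe f / D.q)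
      simp only
      rw [g3]
      rcases i with - | r
      · have h0 := nb_zero_lt hδ hf
        have h1 := ha _ h0
        rw [g1 _ h0]
        rw [nb, if_pos rfl] at h1 ⊢
        simp only [wc]
        split_ifs <;> omega
      · rw [nb_succ, g2 _ hcf _ (by omega)]
        simp only [wc]
        split_ifs with h1 h2 h3
        · simp only [y]
          split_ifs <;> omega
        · have hr : D.fe f / D.q < 3 := Nat.div_lt_of_lt_mul (by rwa [mul_comm])
          simp only [y]
          split_ifs with h4
          · intro h5
            have h6 : D.fe f / D.q = r := by omega
            rw [h6] at h2 h3
            rw [h2] at h4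
            exact h3 h4
          · omega
        · simp only [y]
          split_ifs <;> omega
        · have h4 := hch _ hcf
          have h5 := hch3 _ hcf
          simp only [y]
          split_ifs with h6
          · omega
          · intro h7
            have h8 : ch (D.fc f) = r := by omega
            rw [h8] at h4
            exact h6 h4

end WindowData

/-! ### From satisfiability to window constraints -/

/-- A formula with bags, as functions on natural numbers: `nv` variables, `m` clauses with
literals `cll c 0, …, cll c (cln c - 1)`, which are codes of literals, and `T` bags
`bg t 0, …, bg t (bl t - 1)`. -/
structure SatData where
  nv : ℕ
  m : ℕ
  T : ℕ
  cln : ℕ → ℕ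
  cll : ℕ → ℕ → ℕ
  bl : ℕ → ℕ
  bg : ℕ → ℕ → ℕ

lemma RawBags.length_le {n F f : ℕ} {bag : ℕ → List ℕ} (h : RawBags n F bag) (hf : f < F) :
    (bag f).length ≤ n := by
  have := ((h.nodup f hf).subperm fun x hx => List.mem_range.2 (h.lt f hf x hx)).length_le
  simpa using this

namespace SatData

variable (D : SatData)

/-- The variable `x` lies in the bag `t`. -/
def In (t x : ℕ) : Prop := ∃ y < D.bl t, D.bg t y = x

/-- The bags form a path decomposition of the primal graph of a 3-CNF formula. -/
structure Valid : Prop where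
  bags : RawBags D.nv D.T fun t => (List.range (D.bl t)).map (D.bg t)
  pos : 0 < D.T
  len : ∀ c < D.m, D.cln c ≤ 3
  lt : ∀ c < D.m, ∀ i < D.cln c, D.cll c i / 2 < D.nv
  edge : ∀ c < D.m, ∀ i < D.cln c, ∀ j < D.cln c,
    ∃ t < D.T, D.In t (D.cll c i / 2) ∧ D.In t (D.cll c j / 2)

/-- There is a satisfying assignment. The literal with the odd code `2 x + 1` is `x`, and `2 x` is
its negation. -/
def Satisfiable : Prop :=
  ∃ α : ℕ → Bool, ∀ c < D.m, ∃ i < D.cln c, α (D.cll c i / 2) = decide (D.cll c i % 2 = 1)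

open Classical in
/-- The first bag in which a variable occurs. -/
noncomputable def first (x : ℕ) : ℕ := if h : ∃ t < D.T, D.In t x then Nat.find h else D.T

/-- A linear order on the variables in which the first occurrences are monotone. -/
noncomputable def key (x : ℕ) : ℕ := D.first x * D.nv + x

open Classical in
/-- The number of variables of the bag `t` that come before `x`. -/
noncomputable def rank (t x : ℕ) : ℕ :=
  ((Finset.range D.nv).filter fun y => D.In t y ∧ D.key y < D.key x).card

variable {D}

lemma in_iff {t x : ℕ} : D.In t x ↔ x ∈ (List.range (D.bl t)).map (D.bg t) := by simp [In]

lemma first_le (x : ℕ) : D.first x ≤ D.T := by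
  classical
  unfold first
  split_ifs with h
  · exact (Nat.find_spec h).1.le
  · exact le_rfl

lemma lt_first_iff {t x : ℕ} (ht : t < D.T) : t < D.first x ↔ ∀ t' ≤ t, ¬ D.In t' x := by
  classical
  unfold first
  split_ifs with h
  · rw [Nat.lt_find_iff]
    exact ⟨fun h' t' ht' hin => h' t' ht' ⟨by omega, hin⟩, fun h' t' ht' hin => h' t' ht' hin.2⟩
  · exact ⟨fun _ t' ht' hin => h ⟨t', by omega, hin⟩, fun _ => ht⟩

lemma first_le_of_in {t x : ℕ} (ht : t < D.T) (h : D.In t x) : D.first x ≤ t := by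
  by_contra hc
  exact (lt_first_iff ht).1 (not_le.1 hc) t le_rfl h

lemma Valid.in_first (hv : D.Valid) {x : ℕ} (hx : x < D.nv) :
    D.first x < D.T ∧ D.In (D.first x) x := by
  classical
  obtain ⟨t, ht, hin⟩ := hv.bags.cover x hx
  have h : ∃ t < D.T, D.In t x := ⟨t, ht, in_iff.2 hin⟩
  unfold first
  rw [dif_pos h]
  exact Nat.find_spec h

lemma Valid.in_lt (hv : D.Valid) {t x : ℕ} (ht : t < D.T) (h : D.In t x) : x < D.nv :=
  hv.bags.lt t ht x (in_iff.1 h)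

lemma Valid.interval (hv : D.Valid) {i j l x : ℕ} (hij : i ≤ j) (hjl : j ≤ l) (hl : l < D.T) (h : D.In i x)
    (h' : D.In l x) : D.In j x :=
  in_iff.2 (hv.bags.interval i j l hij hjl hl x (in_iff.1 h) (in_iff.1 h'))

/-- Intervals that meet pairwise have a common point: the last of the first occurrences. -/
lemma Valid.exists_bag (hv : D.Valid) {c : ℕ} (hc : c < D.m) :
    ∃ t < D.T, ∀ i < D.cln c, D.In t (D.cll c i / 2) := by
  rcases Nat.eq_zero_or_pos (D.cln c) with h0 | h0
  · exact ⟨0, hv.pos, by omega⟩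
  obtain ⟨i, hi, hmax⟩ := Finset.exists_max_image (Finset.range (D.cln c))
    (fun i => D.first (D.cll c i / 2)) ⟨0, Finset.mem_range.2 h0⟩
  have hi := Finset.mem_range.1 hi
  refine ⟨D.first (D.cll c i / 2), (hv.in_first (hv.lt c hc i hi)).1, fun j hj => ?_⟩
  obtain ⟨t, ht, h1, h2⟩ := hv.edge c hc i hi j hj
  exact hv.interval (hmax j (Finset.mem_range.2 hj)) (first_le_of_in ht h1) ht
    (hv.in_first (hv.lt c hc j hj)).2 h2

lemma key_injective {x y : ℕ} (hx : x < D.nv) (hy : y < D.nv) (h : D.key x = D.key y) : x = y := by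
  have := congrArg (· % D.nv) h
  simpa only [key, mul_add_mod_of_lt _ hx, mul_add_mod_of_lt _ hy] using this

lemma first_le_of_key {x y : ℕ} (hx : x < D.nv) (hy : y < D.nv) (h : D.key x < D.key y) :
    D.first x ≤ D.first y := by
  have := Nat.div_le_div_right (c := D.nv) h.le
  simpa only [key, mul_add_div_of_lt _ hx, mul_add_div_of_lt _ hy] using this

lemma rank_lt {t x : ℕ} (h : D.In t x) : D.rank t x < D.bl t := by
  classical
  have h1 : (Finset.range D.nv).filter (fun y => D.In t y ∧ D.key y < D.key x) ⊂
      (Finset.range (D.bl t)).image (D.bg t) := by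
    refine Finset.ssubset_iff_of_subset (fun y hy => ?_) |>.2 ⟨x, ?_, ?_⟩
    · obtain ⟨z, hz, rfl⟩ := (Finset.mem_filter.1 hy).2.1
      exact Finset.mem_image_of_mem _ (Finset.mem_range.2 hz)
    · obtain ⟨z, hz, rfl⟩ := h
      exact Finset.mem_image_of_mem _ (Finset.mem_range.2 hz)
    · simp
  calc D.rank t x < ((Finset.range (D.bl t)).image (D.bg t)).card := by
        unfold rank
        convert Finset.card_lt_card h1
    _ ≤ (Finset.range (D.bl t)).card := Finset.card_image_le
    _ = D.bl t := Finset.card_range _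

lemma rank_lt_of_key {t x y : ℕ} (hx : x < D.nv) (hin : D.In t x) (h : D.key x < D.key y) :
    D.rank t x < D.rank t y := by
  classical
  unfold rank
  refine Finset.card_lt_card ?_
  refine Finset.ssubset_iff_of_subset (fun z hz => ?_) |>.2 ⟨x, ?_, ?_⟩
  · simp only [Finset.mem_filter] at hz ⊢
    exact ⟨hz.1, hz.2.1, hz.2.2.trans h⟩
  · simp [hx, hin, h]
  · simp

lemma Valid.rank_injective (hv : D.Valid) {t x y : ℕ} (ht : t < D.T) (hx : D.In t x) (hy : D.In t y)
    (h : D.rank t x = D.rank t y) : x = y := by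
  have hx' := hv.in_lt ht hx
  have hy' := hv.in_lt ht hy
  rcases lt_trichotomy (D.key x) (D.key y) with h1 | h1 | h1
  · have := rank_lt_of_key hx' hx h1
    omega
  · exact key_injective hx' hy' h1
  · have := rank_lt_of_key hy' hy h1
    omega

/-- A variable of the bag `t + 1` that comes before `x` occurs first no later than `x` does, so it
lies in the bag `t` as well. Hence the rank of `x` does not increase. -/
lemma Valid.rank_succ_le (hv : D.Valid) {t x : ℕ} (ht : t + 1 < D.T) (h : D.In t x) :
    D.rank (t + 1) x ≤ D.rank t x := by
  classical
  unfold rank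
  refine Finset.card_le_card fun y hy => ?_
  simp only [Finset.mem_filter, Finset.mem_range] at hy ⊢
  obtain ⟨h1, h2, h3⟩ := hy
  have h4 := first_le_of_key h1 (hv.in_lt (by omega) h) h3
  have h5 := first_le_of_in (by omega) h
  exact ⟨h1, hv.interval (h4.trans h5) (by omega) ht (hv.in_first h1).2 h2, h3⟩

variable (D) (k b : ℕ)

/-! The `i`-th group of `b` variables of the bag `t`, in the order of their ranks, is spelled by
variable `t k + i` of the window constraints. For each window there are `m + 2 nv` constraints:
one for each clause, and two that equate the bits of a variable in the bags `t` and `t + 1`. -/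

/-- The number of constraints per window. -/
def J : ℕ := D.m + 2 * D.nv
/-- The bag to which a constraint belongs. -/
def ct (c : ℕ) : ℕ := c / D.J / k
/-- The group of the bag at which the window of a constraint starts. -/
def ci (c : ℕ) : ℕ := c / D.J % k
/-- The number of a constraint among those of its window. -/
def cj (c : ℕ) : ℕ := c % D.J
/-- The variable whose bits in consecutive bags are compared by a constraint. -/
def cx (c : ℕ) : ℕ := D.bg (D.ct k c) ((D.cj c - D.m) / 2)

/-- The constraint is not void: either it is a clause all of whose variables lie in the bag, and the
window starts at the first group of the bag, or it compares a variable of the first group of the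
window with the same variable in the next bag. -/
def Act (c : ℕ) : Prop :=
  if D.cj c < D.m then
    D.ci k c = 0 ∧ ∀ i < D.cln (D.cj c), D.In (D.ct k c) (D.cll (D.cj c) i / 2)
  else (D.cj c - D.m) / 2 < D.bl (D.ct k c) ∧ D.rank (D.ct k c) (D.cx k c) / b = D.ci k c ∧
    D.ct k c + 1 < D.T ∧ D.In (D.ct k c + 1) (D.cx k c)

open Classical in
/-- The variable of a literal, relative to the window. In the next bag, the variable `x` is in a
group that is at most `k` further on, because ranks do not increase. -/
noncomputable def δ (c r : ℕ) : ℕ :=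
  if D.Act k b c then
    if D.cj c < D.m then
      if r < D.cln (D.cj c) then D.rank (D.ct k c) (D.cll (D.cj c) r / 2) / b else 0
    else if r = 1 then k + D.rank (D.ct k c + 1) (D.cx k c) / b - D.ci k c else 0
  else 0

open Classical in
/-- The bit on which a literal depends. For void constraints this is bit `b`, which is always zero,
so that their literals are true. -/
noncomputable def β (c r : ℕ) : ℕ :=
  if D.Act k b c then
    if D.cj c < D.m then
      if r < D.cln (D.cj c) then D.rank (D.ct k c) (D.cll (D.cj c) r / 2) % b else 0
    else if r = 1 then D.rank (D.ct k c + 1) (D.cx k c) % b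
      else D.rank (D.ct k c) (D.cx k c) % b
  else b

open Classical in
/-- The value of the bit that makes the literal true, or `2` if the literal is always false. -/
noncomputable def sg (c r : ℕ) : ℕ :=
  if D.Act k b c then
    if D.cj c < D.m then if r < D.cln (D.cj c) then D.cll (D.cj c) r % 2 else 2
    else if r = 0 then (D.cj c - D.m) % 2 else if r = 1 then 1 - (D.cj c - D.m) % 2 else 2
  else 0

/-- The window constraints that say that the formula is satisfiable. -/
noncomputable def window : WindowData where
  k := k
  Sn := D.T * k
  J := D.J
  q := 2 ^ b
  δ := D.δ k b
  tr c r a := decide (a / 2 ^ D.β k b c r % 2 = D.sg k b c r)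

variable {D} {k b}

lemma ct_lt {c : ℕ} (hc : c < (D.window k b).Cn) : D.ct k c < D.T :=
  div_lt_of_lt_mul_right (div_lt_of_lt_mul_right hc)

lemma Valid.δ_le (hv : D.Valid) (hb : ∀ t < D.T, D.bl t < k * b) :
    ∀ c < (D.window k b).Cn, ∀ r, D.δ k b c r ≤ k := by
  intro c hc r
  have ht := ct_lt hc
  unfold δ
  split_ifs with h1 h2 h3 h4
  · rw [Act, if_pos h2] at h1
    have h4 := rank_lt (h1.2 r h3)
    exact (div_lt_of_lt_mul_right (h4.trans (hb _ ht))).le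
  · exact Nat.zero_le _
  · rw [Act, if_neg h2] at h1
    obtain ⟨h5, h6, h7, h8⟩ := h1
    have h9 := hv.rank_succ_le h7 (x := D.cx k c) ⟨_, h5, rfl⟩
    have := Nat.div_le_div_right (c := b) h9
    omega
  · exact Nat.zero_le _
  · exact Nat.zero_le _

lemma div_mod_two (n i : ℕ) : n / 2 ^ i % 2 = if n.testBit i then 1 else 0 := by
  rw [Nat.testBit_eq_decide_div_mod_eq]
  rcases Nat.mod_two_eq_zero_or_one (n / 2 ^ i) with h | h <;> simp [h]

lemma window_pos {c s j : ℕ} (hj : j < D.J) (hc : c = s * D.J + j) (hs : s < D.T * k) :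
    c < (D.window k b).Cn ∧ c / D.J = s ∧ D.cj c = j ∧ D.ct k c = s / k ∧ D.ci k c = s % k := by
  subst hc
  refine ⟨?_, mul_add_div_of_lt _ hj, mul_add_mod_of_lt _ hj, ?_, ?_⟩
  · change s * D.J + j < D.T * k * D.J
    nlinarith
  · rw [ct, mul_add_div_of_lt _ hj]
  · rw [ci, mul_add_div_of_lt _ hj]

/-- A solution assigns to each variable one bit per bag that contains it. The constraints that
compare bits make all these bits equal, and each clause is checked in a bag that contains its
variables. -/
theorem Valid.solvable_iff (hv : D.Valid) (hb : ∀ t < D.T, D.bl t < k * b) :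
    (D.window k b).Solvable ↔ D.Satisfiable := by
  have hkb : 0 < k * b := (Nat.zero_le _).trans_lt (hb 0 hv.pos)
  have hk : 0 < k := Nat.pos_of_mul_pos_right hkb
  have hb0 : 0 < b := Nat.pos_of_mul_pos_left hkb
  have hdiv : ∀ {t x}, t < D.T → D.In t x → D.rank t x / b < k := fun ht hx =>
    div_lt_of_lt_mul_right ((rank_lt hx).trans (hb _ ht))
  constructor
  · rintro ⟨a, -, ha⟩
    have ha : ∀ c < (D.window k b).Cn, ∃ r < 3,
        a (c / D.J + D.δ k b c r) / 2 ^ D.β k b c r % 2 = D.sg k b c r := fun c hc => by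
      obtain ⟨r, hr, h⟩ := ha c hc
      exact ⟨r, hr, of_decide_eq_true h⟩
    let bit : ℕ → ℕ → Bool := fun t x => (a (t * k + D.rank t x / b)).testBit (D.rank t x % b)
    have hbit : ∀ t x, a (t * k + D.rank t x / b) / 2 ^ (D.rank t x % b) % 2 =
        if bit t x then 1 else 0 := fun t x => div_mod_two _ _
    -- the bits of a variable in consecutive bags agree
    have hstep : ∀ t x, t + 1 < D.T → D.In t x → D.In (t + 1) x → bit (t + 1) x = bit t x := by
      intro t x ht hx hx'
      obtain ⟨h, hh, hhx⟩ := hx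
      have hin : D.In t x := ⟨h, hh, hhx⟩
      have hi := hdiv (by omega) hin
      have hbl : D.bl t ≤ D.nv := by
        simpa using hv.bags.length_le (f := t) (by omega)
      -- the two constraints are the two implications between the bits
      have key : ∀ o < 2,
          (if bit t x then 1 else 0) = o ∨ (if bit (t + 1) x then 1 else 0) = 1 - o := by
        intro o ho
        obtain ⟨h1, h2, h3, h4, h5⟩ := window_pos (D := D) (k := k) (b := b)
          (s := t * k + D.rank t x / b) (j := D.m + (2 * h + o)) (by rw [J]; omega) rfl
          (by nlinarith)
        rw [mul_add_div_of_lt _ hi] at h4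
        rw [mul_add_mod_of_lt _ hi] at h5
        set c := (t * k + D.rank t x / b) * D.J + (D.m + (2 * h + o)) with hc
        have hj : D.cj c - D.m = 2 * h + o := by omega
        have hj2 : (2 * h + o) / 2 = h := by omega
        have hjm : ¬ D.cj c < D.m := by omega
        have hcx : D.cx k c = x := by rw [cx, hj, hj2, h4, hhx]
        have hact : D.Act k b c := by
          rw [Act, if_neg hjm, hj, hj2, h4, hcx, h5]
          exact ⟨hh, rfl, ht, hx'⟩
        obtain ⟨r, hr, hr'⟩ := ha c h1
        rw [δ, β, sg, if_pos hact, if_pos hact, if_pos hact, if_neg hjm, if_neg hjm, if_neg hjm,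
          h2, h4, hcx, hj, h5] at hr'
        interval_cases r
        · left
          simp only [zero_ne_one, if_true, if_false, add_zero, hbit] at hr'
          omega
        · right
          have e : t * k + D.rank t x / b + (k + D.rank (t + 1) x / b - D.rank t x / b) =
              (t + 1) * k + D.rank (t + 1) x / b := by
            have := Nat.zero_le (D.rank (t + 1) x / b)
            rw [add_mul]
            omega
          simp only [one_ne_zero, if_true, if_false, e, hbit] at hr'
          omega
        · simp only [OfNat.ofNat_ne_zero, if_false, OfNat.ofNat_ne_one] at hr'
          omega
      have k0 := key 0 (by norm_num)
      have k1 := key 1 (by norm_num)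
      revert k0 k1
      cases bit t x <;> cases bit (t + 1) x <;> simp
    have hconst : ∀ x < D.nv, ∀ t, D.first x ≤ t → t < D.T → D.In t x →
        bit t x = bit (D.first x) x := by
      intro x hx t ht
      induction t, ht using Nat.le_induction with
      | base => intro _ _; rfl
      | succ t ht ih =>
        intro htT hin
        have hin' := hv.interval ht (by omega) htT (hv.in_first hx).2 hin
        rw [hstep t x htT hin' hin, ih (by omega) hin']
    refine ⟨fun x => bit (D.first x) x, fun j hj => ?_⟩
    obtain ⟨t, ht, hin⟩ := hv.exists_bag hj
    obtain ⟨h1, h2, h3, h4, h5⟩ := window_pos (D := D) (k := k) (b := b) (s := t * k) (j := j)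
      (by rw [J]; omega) rfl (by nlinarith)
    rw [Nat.mul_div_cancel _ hk] at h4
    rw [Nat.mul_mod_left] at h5
    set c := t * k * D.J + j with hc
    have hact : D.Act k b c := by
      rw [Act, h3, if_pos hj, h4, h5]
      exact ⟨rfl, hin⟩
    obtain ⟨r, hr, hr'⟩ := ha c h1
    rw [δ, β, sg, if_pos hact, if_pos hact, if_pos hact, h3, if_pos hj, if_pos hj, if_pos hj,
      h2, h4] at hr'
    by_cases hrl : r < D.cln j
    · rw [if_pos hrl, if_pos hrl, if_pos hrl, hbit] at hr'
      refine ⟨r, hrl, ?_⟩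
      have hin' := hin r hrl
      beta_reduce
      rw [← hconst _ (hv.lt j hj r hrl) t (first_le_of_in ht hin') ht hin', ← hr']
      cases bit t (D.cll j r / 2) <;> simp
    · rw [if_neg hrl, if_neg hrl, if_neg hrl] at hr'
      omega
  · rintro ⟨α, hα⟩
    classical
    let a : ℕ → ℕ := fun s => Nat.ofBits fun z : Fin b =>
      decide (∃ x, D.In (s / k) x ∧ D.rank (s / k) x = s % k * b + z ∧ α x = true)
    have ha : ∀ s, a s < 2 ^ b := fun s => Nat.ofBits_lt_two_pow _
    have hbit : ∀ t x, t < D.T → D.In t x →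
        a (t * k + D.rank t x / b) / 2 ^ (D.rank t x % b) % 2 = if α x then 1 else 0 := by
      intro t x ht hx
      have hi := hdiv ht hx
      have hm := Nat.mod_lt (D.rank t x) hb0
      rw [div_mod_two]
      congr 1
      simp only [a]
      rw [Nat.testBit_ofBits_lt _ _ hm, mul_add_div_of_lt _ hi, mul_add_mod_of_lt _ hi,
        Nat.div_add_mod', eq_iff_iff, decide_eq_true_iff]
      constructor
      · rintro ⟨y, hy, hxy, h⟩
        rwa [← hv.rank_injective ht hy hx hxy]
      · intro h
        exact ⟨x, hx, rfl, h⟩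
    refine ⟨a, fun s _ => ha s, fun c hc => ?_⟩
    suffices H : ∃ r < 3, a (c / D.J + D.δ k b c r) / 2 ^ D.β k b c r % 2 = D.sg k b c r by
      obtain ⟨r, hr, h⟩ := H
      exact ⟨r, hr, decide_eq_true h⟩
    have ht := ct_lt hc
    have hs : c / D.J = D.ct k c * k + D.ci k c := (Nat.div_add_mod' _ _).symm
    by_cases hact : D.Act k b c
    · have hact' := hact
      simp only [δ, β, sg, if_pos hact]
      rw [Act] at hact'
      split_ifs at hact' with hj
      · obtain ⟨h1, h2⟩ := hact'
        obtain ⟨r, hr, hr'⟩ := hα _ hj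
        refine ⟨r, hr.trans_le (hv.len _ hj), ?_⟩
        simp only [if_pos hj]
        rw [if_pos hr, if_pos hr, if_pos hr, hs, h1, add_zero, hbit _ _ ht (h2 r hr), hr']
        rcases Nat.mod_two_eq_zero_or_one (D.cll (D.cj c) r) with h | h <;> simp [h]
      · obtain ⟨h1, h2, h3, h4⟩ := hact'
        have hin : D.In (D.ct k c) (D.cx k c) := ⟨_, h1, rfl⟩
        have b0 := hbit _ _ ht hin
        have b1 := hbit _ _ h3 h4
        have ho := Nat.mod_two_eq_zero_or_one (D.cj c - D.m)
        have hlt := hdiv ht hin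
        have e : c / D.J + (k + D.rank (D.ct k c + 1) (D.cx k c) / b - D.ci k c) =
            (D.ct k c + 1) * k + D.rank (D.ct k c + 1) (D.cx k c) / b := by
          have := Nat.zero_le (D.rank (D.ct k c + 1) (D.cx k c) / b)
          rw [add_mul]
          omega
        by_cases hα' : (if α (D.cx k c) then 1 else 0) = (D.cj c - D.m) % 2
        · refine ⟨0, by norm_num, ?_⟩
          simp only [zero_ne_one, if_true, if_false, if_neg hj]
          rw [add_zero, hs, ← h2, b0, hα']
        · refine ⟨1, by norm_num, ?_⟩
          simp only [one_ne_zero, if_true, if_false, if_neg hj]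
          rw [e, b1]
          split_ifs at hα' ⊢ <;> omega
    · refine ⟨0, by norm_num, ?_⟩
      simp only [β, sg, if_neg hact]
      rw [Nat.div_eq_of_lt (ha _)]

end SatData

/-! ### The program that produces the constraints -/

namespace SatData

/-- The data of a formula, read from a word with tables of block positions as they are left by
`RAM.setup`. -/
def ofWord (ρ : ℕ → ℕ) (w : List ℕ) : SatData where
  nv := w.getD 0 0
  m := ρ 3
  T := ρ 2
  cln c := w.getD (w.getD (ρ 0 + c) 0) 0
  cll c i := w.getD (w.getD (ρ 0 + c) 0 + 1 + i) 0
  bl t := w.getD (w.getD (ρ 1 + t) 0) 0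
  bg t x := w.getD (w.getD (ρ 1 + t) 0 + 1 + x) 0

open Ex ColData.Prog

namespace Prog

/-! Global variables: `5` the number `b` of bits of a group, `6` the number `J`, `7` the number of
constraints, `8` the table of literals, `9` the table of powers of two, `10` the number `q`, `11`
the start of the output, `12` to `15` the numbers `M`, `M + 3 Cn`, `F` and `n`. -/

/-- Nonzero if and only if `x` lies in the bag `t`. -/
def inE (t x : Ex) : Ex := sum 62 (blE t) ((bgE t (v 62)).eq x)

/-- The first bag of the variable `x`: the number of `t` such that `x` is in no bag up to `t`. -/
def firstE (x : ℕ) : Ex :=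
  sum 60 (v 2) ((sum 61 ((v 60).add (c 1)) (inE (v 61) (v x))).eq (c 0))

/-- The key of the variable `x`. -/
def keyE (x : ℕ) : Ex := ((firstE x).mul (mem (c 0))).add (v x)

/-- The rank of the variable `x` in the bag `t`. -/
def rankE (t x : ℕ) : Ex :=
  sum 63 (mem (c 0)) (ite (inE (v t) (v 63)) ((keyE 63).lt (keyE x)) (c 0))

/-! Local variables of the next command: `40` the literal, `41` its constraint, `42` its position
in the constraint, `43` the window, `44`, `45`, `46` the numbers `t`, `i`, `j`, `47` the variable
that is compared with itself, `48` the number `t + 1`, `49` whether the constraint is not void,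
`50` and `51` the bag and the variable of the literal, `52` the rank. -/

variable (k : ℕ)

/-- Nonzero if and only if the constraint is not void. -/
def actE : Ex :=
  ite ((v 46).lt (v 3))
    (((v 45).eq (c 0)).mul ((sum 53 (lenE (v 46))
      ((inE (v 44) ((colE (v 46) (v 53)).div (c 2))).eq (c 0))).eq (c 0)))
    (((((v 46).sub (v 3)).div (c 2)).lt (blE (v 44))).mul
      ((((rankE 44 47).div (v 5)).eq (v 45)).mul (((v 48).lt (v 2)).mul (inE (v 48) (v 47)))))

/-- The variable of the literal, relative to the window. -/
def deltaE : Ex :=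
  ite (v 49) (ite ((v 46).lt (v 3)) (ite ((v 42).lt (lenE (v 46))) ((v 52).div (v 5)) (c 0))
    (ite ((v 42).eq (c 1)) (((c k).add ((v 52).div (v 5))).sub (v 45)) (c 0))) (c 0)

/-- The bit on which the literal depends. -/
def betaE : Ex :=
  ite (v 49) (ite ((v 46).lt (v 3)) (ite ((v 42).lt (lenE (v 46))) ((v 52).mod (v 5)) (c 0))
    ((v 52).mod (v 5))) (v 5)

/-- The value of the bit that makes the literal true. -/
def signE : Ex :=
  ite (v 49) (ite ((v 46).lt (v 3))
    (ite ((v 42).lt (lenE (v 46))) ((colE (v 46) (v 42)).mod (c 2)) (c 2))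
    (ite ((v 42).eq (c 0)) (((v 46).sub (v 3)).mod (c 2))
      (ite ((v 42).eq (c 1)) ((c 1).sub (((v 46).sub (v 3)).mod (c 2))) (c 2)))) (c 0)

/-- Appends the three numbers that describe a literal. The table has four entries per constraint;
the fourth is read only for the last test vertex, where it does not matter. -/
def literalCmd : Cmd :=
  .bind 41 ((v 40).div (c 4)) (.bind 42 ((v 40).mod (c 4)) (.bind 43 ((v 41).div (v 6))
  (.bind 44 ((v 43).div (c k)) (.bind 45 ((v 43).mod (c k)) (.bind 46 ((v 41).mod (v 6))
  (.bind 47 (bgE (v 44) (((v 46).sub (v 3)).div (c 2))) (.bind 48 ((v 44).add (c 1))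
  (.bind 49 actE
  (.bind 50 (ite ((v 46).lt (v 3)) (v 44) (ite ((v 42).eq (c 1)) (v 48) (v 44)))
  (.bind 51 (ite ((v 46).lt (v 3)) ((colE (v 46) (v 42)).div (c 2)) (v 47))
  (.bind 52 (rankE 50 51) (.emits (deltaE k) [betaE, signE]))))))))))))

variable {k} {w : List ℕ} {σ : ℕ → ℕ}

/-- What the expressions for bags and clauses read does not depend on local variables. -/
lemma ofWord_update {x i : ℕ} (hx : 40 ≤ x) : ofWord (Function.update σ x i) w = ofWord σ w := by
  have h0 : (0 : ℕ) ≠ x := by omega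
  have h1 : 1 ≠ x := by omega
  have h2 : 2 ≠ x := by omega
  have h3 : 3 ≠ x := by omega
  simp [ofWord, h0, h1, h2, h3]

lemma eval_blE (t : Ex) : (blE t).eval σ w = (ofWord σ w).bl (t.eval σ w) := rfl
lemma eval_bgE (t x : Ex) :
    (bgE t x).eval σ w = (ofWord σ w).bg (t.eval σ w) (x.eval σ w) := rfl
lemma eval_lenE (j : Ex) : (lenE j).eval σ w = (ofWord σ w).cln (j.eval σ w) := rfl
lemma eval_colE (j i : Ex) :
    (colE j i).eval σ w = (ofWord σ w).cll (j.eval σ w) (i.eval σ w) := rfl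

lemma eval_inE {t x : Ex} (ht : ∀ i, t.eval (Function.update σ 62 i) w = t.eval σ w)
    (hx : ∀ i, x.eval (Function.update σ 62 i) w = x.eval σ w) :
    (inE t x).eval σ w = 0 ↔ ¬ (ofWord σ w).In (t.eval σ w) (x.eval σ w) := by
  rw [In, ← sum_indicator_eq_zero_iff, inE, eval_sum, eval_blE]
  simp only [eval_eq, eval_bgE, ofWord_update (by norm_num : 40 ≤ 62), ht, hx, eval_v,
    Function.update_self]

lemma eval_firstE {x : ℕ} (h60 : x ≠ 60) (h61 : x ≠ 61) (h62 : x ≠ 62) :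
    (firstE x).eval σ w = (ofWord σ w).first (σ x) := by
  have hle : (ofWord σ w).first (σ x) ≤ σ 2 := first_le _
  rw [firstE, eval_sum, eval_v, ← ColData.Prog.sum_lt_eq hle]
  refine Finset.sum_congr rfl fun t ht => ?_
  have ht := Finset.mem_range.1 ht
  rw [eval_eq, eval_sum, eval_c]
  refine if_congr ?_ rfl rfl
  rw [lt_first_iff (D := ofWord σ w) ht, Finset.sum_eq_zero_iff]
  have key : ∀ t', (inE (v 61) (v x)).eval
      (Function.update (Function.update σ 60 t) 61 t') w = 0 ↔ ¬ (ofWord σ w).In t' (σ x) := by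
    intro t'
    rw [eval_inE (by simp) (by simp [h62]), ofWord_update (by norm_num), ofWord_update (by norm_num)]
    simp [h60, h61]
  simp only [key, Finset.mem_range, eval_add, eval_v, eval_c, Function.update_self,
    Nat.lt_succ_iff]

lemma eval_keyE {x : ℕ} (h60 : x ≠ 60) (h61 : x ≠ 61) (h62 : x ≠ 62) :
    (keyE x).eval σ w = (ofWord σ w).key (σ x) := by
  rw [keyE, eval_add, eval_mul, eval_firstE h60 h61 h62]
  rfl

lemma eval_rankE {t x : ℕ} (ht : t < 60) (hx : x < 60) :
    (rankE t x).eval σ w = (ofWord σ w).rank (σ t) (σ x) := by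
  classical
  rw [rankE, eval_sum, rank, Finset.card_filter]
  refine Finset.sum_congr rfl fun y _ => ?_
  have h1 : t ≠ 63 := by omega
  have h2 : x ≠ 63 := by omega
  have h3 : t ≠ 62 := by omega
  have hin : (inE (v t) (v 63)).eval (Function.update σ 63 y) w = 0 ↔
      ¬ (ofWord σ w).In (σ t) y := by
    rw [eval_inE (by simp [h3]) (by simp), ofWord_update (by norm_num)]
    simp [h1]
  rw [eval_ite, eval_lt, eval_keyE (by norm_num) (by norm_num) (by norm_num),
    eval_keyE (by omega) (by omega) (by omega), ofWord_update (by norm_num)]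
  simp only [hin, Function.update_self, Function.update_of_ne h2, eval_c]
  by_cases h : (ofWord σ w).In (σ t) y <;> simp [h]

lemma eval_actE : actE.eval σ w ≠ 0 ↔
    if σ 46 < (ofWord σ w).m then σ 45 = 0 ∧ ∀ i < (ofWord σ w).cln (σ 46),
      (ofWord σ w).In (σ 44) ((ofWord σ w).cll (σ 46) i / 2)
    else (σ 46 - (ofWord σ w).m) / 2 < (ofWord σ w).bl (σ 44) ∧
      (ofWord σ w).rank (σ 44) (σ 47) / σ 5 = σ 45 ∧ σ 48 < (ofWord σ w).T ∧
      (ofWord σ w).In (σ 48) (σ 47) := by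
  have hm : (ofWord σ w).m = σ 3 := rfl
  have hT : (ofWord σ w).T = σ 2 := rfl
  have key : ∀ i, (inE (v 44) ((colE (v 46) (v 53)).div (c 2))).eval (Function.update σ 53 i) w = 0
      ↔ ¬ (ofWord σ w).In (σ 44) ((ofWord σ w).cll (σ 46) i / 2) := by
    intro i
    rw [eval_inE (by simp) (by simp [colE]), ofWord_update (by norm_num)]
    simp only [eval_div, eval_colE, ofWord_update (by norm_num : 40 ≤ 53)]
    simp
  have elt : ∀ (a b : Ex), (a.lt b).eval σ w = 0 ↔ ¬ a.eval σ w < b.eval σ w := by simp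
  have eeq : ∀ (a b : Ex) (σ : ℕ → ℕ), (a.eq b).eval σ w = 0 ↔ ¬ a.eval σ w = b.eval σ w := by simp
  have key2 : (inE (v 48) (v 47)).eval σ w = 0 ↔ ¬ (ofWord σ w).In (σ 48) (σ 47) :=
    eval_inE (by simp) (by simp)
  rw [actE, eval_ite, hm, hT]
  by_cases h : σ 46 < σ 3
  · simp only [eval_lt, eval_v, h, if_true, one_ne_zero, if_false]
    simp only [eval_mul, eeq, eval_sum, key, eval_c, eval_v, eval_lenE, mul_ne_zero_iff,
      Finset.sum_eq_zero_iff, Finset.mem_range, ne_eq, not_not]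
  · simp only [eval_lt, eval_v, h, if_true, if_false]
    simp only [eval_mul, eeq, elt, eval_div, eval_sub, eval_c, eval_v, eval_blE,
      eval_rankE (by norm_num : 44 < 60) (by norm_num : 47 < 60), mul_ne_zero_iff, ne_eq, key2,
      not_not]

lemma out_literalCmd {b : ℕ} (h5 : σ 5 = b) (h6 : σ 6 = (ofWord σ w).J) (g : ℕ) :
    (literalCmd k).out (Function.update σ 40 g) w =
      [(ofWord σ w).δ k b (g / 4) (g % 4), (ofWord σ w).β k b (g / 4) (g % 4),
        (ofWord σ w).sg k b (g / 4) (g % 4)] := by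
  set D := ofWord σ w with hD
  set C := g / 4 with hC
  set r := g % 4 with hr
  have ev : ∀ {x k : ℕ} {e : Ex} {c : Cmd} {l : List ℕ} {σ : ℕ → ℕ}, e.eval σ w = k →
      c.out (Function.update σ x k) w = l → (Cmd.bind x e c).out σ w = l := by
    rintro x k e c l σ rfl h
    exact h
  let σ' : ℕ → ℕ := Function.update (Function.update (Function.update (Function.update
    (Function.update (Function.update (Function.update (Function.update (Function.update σ
    40 g) 41 C) 42 r) 43 (C / D.J)) 44 (D.ct k C)) 45 (D.ci k C)) 46 (D.cj C)) 47 (D.cx k C))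
    48 (D.ct k C + 1)
  have hact : actE.eval σ' w ≠ 0 ↔ D.Act k b C := by
    rw [eval_actE]
    simp only [σ', Function.update_apply, Nat.reduceEqDiff, reduceIte, h5, Act]
    rfl
  let tt : ℕ := if D.cj C < D.m then D.ct k C else if r = 1 then D.ct k C + 1 else D.ct k C
  let xx : ℕ := if D.cj C < D.m then D.cll (D.cj C) r / 2 else D.cx k C
  have hm : σ 3 = D.m := rfl
  refine ev (k := C) (by simp [hC]) ?_
  refine ev (k := r) (by simp [hr]) ?_
  refine ev (k := C / D.J) (by simp [h6]) ?_
  refine ev (k := D.ct k C) (by simp [ct]) ?_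
  refine ev (k := D.ci k C) (by simp [ci]) ?_
  refine ev (k := D.cj C) (by simp [cj, h6]) ?_
  refine ev (k := D.cx k C) (by simp [bgE, cx, hD, ofWord]) ?_
  refine ev (k := D.ct k C + 1) (by simp) ?_
  refine ev (k := actE.eval σ' w) rfl ?_
  generalize actE.eval σ' w = y at hact ⊢
  refine ev (k := tt) ?_ ?_
  · by_cases h : D.cj C < D.m <;> by_cases h1 : r = 1 <;> simp [h, h1, hm, tt]
  refine ev (k := xx) ?_ ?_
  · simp only [eval_ite, eval_lt, eval_div, eval_colE, eval_v, Function.update_apply,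
      Nat.reduceEqDiff, reduceIte, hm, xx]
    by_cases h : D.cj C < D.m
    · simp only [h, if_true, one_ne_zero, if_false]
      rfl
    · simp [h]
  refine ev (k := D.rank tt xx) ?_ ?_
  · rw [eval_rankE (by norm_num) (by norm_num)]
    rfl
  rw [Cmd.out_emits]
  have hcl : ∀ c, D.cln c = w.getD (w.getD (σ 0 + c) 0) 0 := fun _ => rfl
  have hcll : ∀ c i, D.cll c i = w.getD (w.getD (σ 0 + c) 0 + 1 + i) 0 := fun _ _ => rfl
  by_cases ha : D.Act k b C
  · have hy : y ≠ 0 := hact.2 ha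
    simp only [δ, β, sg, if_pos ha, tt, xx]
    by_cases h : D.cj C < D.m
    · by_cases h1 : r < D.cln (D.cj C)
      · have h1' := h1
        rw [hcl] at h1'
        simp [deltaE, betaE, signE, lenE, colE, hy, hm, h, h1, h5, hcll, -List.getD_eq_getElem?_getD, h1']
      · have h1' := h1
        rw [hcl] at h1'
        simp [deltaE, betaE, signE, lenE, colE, hy, hm, h, h1, -List.getD_eq_getElem?_getD, h1']
    · by_cases h1 : r = 1
      · simp [deltaE, betaE, signE, hy, hm, h, h1, h5]
      · by_cases h2 : r = 0 <;> simp [deltaE, betaE, signE, hy, hm, h, h1, h5, h2]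
  · have hy : y = 0 := not_not.1 (mt hact.1 ha)
    simp [deltaE, betaE, signE, δ, β, sg, ha, hy, h5]

end Prog

end SatData

/-! ### The program that produces the list coloring instance -/

namespace RAM.Ex

variable {a b t : Ex}

lemma SumFree.mod (ha : a.SumFree) (hb : b.SumFree) : (a.mod b).SumFree := ⟨ha, ⟨ha, hb⟩, hb⟩

lemma SumFree.lt (ha : a.SumFree) (hb : b.SumFree) : (a.lt b).SumFree :=
  ⟨trivial, trivial, hb, ha⟩

lemma SumFree.eq (ha : a.SumFree) (hb : b.SumFree) : (a.eq b).SumFree :=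
  ⟨trivial, ⟨ha, hb⟩, hb, ha⟩

lemma SumFree.ite (ht : t.SumFree) (ha : a.SumFree) (hb : b.SumFree) : (ite t a b).SumFree :=
  ⟨⟨⟨trivial, trivial, ht⟩, ha⟩, ⟨trivial, ht⟩, hb⟩

end RAM.Ex

namespace SatData

open Ex

namespace Prog

variable (k : ℕ)

/-- The number of values of a variable. -/
def qE : Ex := mem ((v 9).add (v 5))
/-- The number of test vertices of a constraint. -/
def testsE : Ex := ((c 3).mul qE).add (c 1)
/-- The number of variables of the window constraints. -/
def stateE : Ex := ((v 2).mul (c k)).add (c k)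
/-- The first test vertex. -/
def baseE : Ex := (stateE k).add ((c 3).mul (v 7))
/-- The number of test vertices. -/
def numTestsE : Ex := (v 7).mul testsE
/-- The number of vertices. -/
def numE : Ex := (baseE k).add numTestsE
/-- The constraint of a test vertex. -/
def fcE (f : Ex) : Ex := f.div testsE
/-- The number of a test vertex among those of its constraint. -/
def feE (f : Ex) : Ex := f.mod testsE

/-- An entry of the table of literals. -/
def tabE (j r : Ex) (i : ℕ) : Ex :=
  mem ((v 8).add (((c 3).mul (((c 4).mul j).add r)).add (c i)))

/-- The vertex of a literal. -/
def xvE (j r : Ex) : Ex := ((stateE k).add ((c 3).mul j)).add r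
/-- A test vertex. -/
def wvE (f : Ex) : Ex := (baseE k).add f

/-- The neighbors of a test vertex. -/
def nbE (f i : Ex) : Ex :=
  ite (i.eq (c 0)) (((fcE f).div (v 6)).add (tabE (fcE f) ((feE f).div qE) 0))
    (xvE k (fcE f) (i.sub (c 1)))

/-- Nonzero if and only if the value `a` makes the literal true. -/
def trE (j r a : Ex) : Ex :=
  ((a.div (mem ((v 9).add (tabE j r 1)))).mod (c 2)).eq (tabE j r 2)

/-- The size of the list of a vertex. -/
def sizeE (u : Ex) : Ex :=
  ite (u.lt (stateE k)) qE (ite (u.lt (baseE k)) (c 2)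
    (ite ((feE (u.sub (baseE k))).lt ((c 3).mul qE)) (c 2) (c 3)))

/-- The colors of a vertex. -/
def colorE (u i : Ex) : Ex :=
  ite (u.lt (stateE k)) i (ite (u.lt (baseE k))
    ((qE.add ((u.sub (stateE k)).mod (c 3))).add ((c 3).mul i))
    (ite ((feE (u.sub (baseE k))).lt ((c 3).mul qE))
      (ite (i.eq (c 0)) ((feE (u.sub (baseE k))).mod qE)
        (ite (trE (fcE (u.sub (baseE k))) ((feE (u.sub (baseE k))).div qE)
            ((feE (u.sub (baseE k))).mod qE)) (qE.add (c 6))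
          ((qE.add (c 3)).add ((feE (u.sub (baseE k))).div qE))))
      (qE.add i)))

/-- The elements of a bag. -/
def bagvE (f i : Ex) : Ex :=
  ite (i.lt (c (k + 1))) (((fcE f).div (v 6)).add i)
    (ite (i.lt (c (k + 4))) (xvE k (fcE f) (i.sub (c (k + 1)))) (wvE k f))

/-- Appends the list coloring instance with its path decomposition. -/
def coloringCmd : Cmd :=
  .seq (.emits (numE k) [(c 4).mul numTestsE])
  (.seq (.for' 40 ((c 4).mul numTestsE)
    (.emits (nbE k ((v 40).div (c 4)) ((v 40).mod (c 4))) [wvE k ((v 40).div (c 4))]))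
  (.seq (.for' 40 (numE k) (.seq (.emit (sizeE k (v 40)))
    (.for' 41 (sizeE k (v 40)) (.emit (colorE k (v 40) (v 41))))))
  (.seq (.emit numTestsE) (.for' 40 numTestsE (.seq (.emit (c (k + 5)))
    (.for' 41 (c (k + 5)) (.emit (bagvE k (v 40) (v 41)))))))))

lemma productive_coloringCmd : (coloringCmd k).Productive :=
  ⟨Cmd.productive_emits _ _, ⟨Cmd.emits_emits _ _, Cmd.productive_emits _ _⟩,
    ⟨Or.inl trivial, trivial, trivial, trivial⟩, trivial, Or.inl trivial, trivial, trivial, trivial⟩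

/-- Every entry of the output takes only logarithmic time, since all quantities with sums come from
the table of literals. Hence the reduction is almost linear in the size of its output. -/
lemma sumFree_coloringCmd : (coloringCmd k).SumFree := by
  have hq : qE.SumFree := ⟨trivial, trivial⟩
  have ht : testsE.SumFree := ⟨⟨trivial, hq⟩, trivial⟩
  have hs : (stateE k).SumFree := ⟨⟨trivial, trivial⟩, trivial⟩
  have hb : (baseE k).SumFree := ⟨hs, trivial, trivial⟩
  have hF : numTestsE.SumFree := ⟨trivial, ht⟩
  have hn : (numE k).SumFree := ⟨hb, hF⟩
  have hfc : ∀ {f : Ex}, f.SumFree → (fcE f).SumFree := fun h => ⟨h, ht⟩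
  have hfe : ∀ {f : Ex}, f.SumFree → (feE f).SumFree := fun h => h.mod ht
  have htab : ∀ {j r : Ex} {i}, j.SumFree → r.SumFree → (tabE j r i).SumFree := fun h h' =>
    ⟨trivial, ⟨trivial, ⟨trivial, h⟩, h'⟩, trivial⟩
  have hx : ∀ {j r : Ex}, j.SumFree → r.SumFree → (xvE k j r).SumFree := fun h h' =>
    ⟨⟨hs, trivial, h⟩, h'⟩
  have hw : ∀ {f : Ex}, f.SumFree → (wvE k f).SumFree := fun h => ⟨hb, h⟩
  have h40 : (v 40).SumFree := trivial
  have h41 : (v 41).SumFree := trivial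
  have hu : ((v 40).sub (baseE k)).SumFree := ⟨trivial, hb⟩
  have hd : ((v 40).div (c 4)).SumFree := ⟨trivial, trivial⟩
  have hr : ((feE ((v 40).sub (baseE k))).div qE).SumFree := ⟨hfe hu, hq⟩
  have h3q : ((c 3).mul qE).SumFree := ⟨trivial, hq⟩
  have hnb : (nbE k ((v 40).div (c 4)) ((v 40).mod (c 4))).SumFree :=
    .ite (.eq (.mod trivial trivial) trivial) ⟨⟨hfc hd, trivial⟩, htab (hfc hd) ⟨hfe hd, hq⟩⟩
      (hx (hfc hd) ⟨.mod trivial trivial, trivial⟩)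
  have hsz : (sizeE k (v 40)).SumFree :=
    .ite (.lt h40 hs) hq (.ite (.lt h40 hb) trivial (.ite (.lt (hfe hu) h3q) trivial trivial))
  have htr : (trE (fcE ((v 40).sub (baseE k))) ((feE ((v 40).sub (baseE k))).div qE)
      ((feE ((v 40).sub (baseE k))).mod qE)).SumFree :=
    .eq (.mod ⟨(hfe hu).mod hq, trivial, htab (hfc hu) hr⟩ trivial) (htab (hfc hu) hr)
  have hcol : (colorE k (v 40) (v 41)).SumFree :=
    .ite (.lt h40 hs) h41 (.ite (.lt h40 hb)
      ⟨⟨hq, .mod ⟨h40, hs⟩ trivial⟩, trivial, h41⟩ (.ite (.lt (hfe hu) h3q)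
        (.ite (.eq h41 trivial) ((hfe hu).mod hq) (.ite htr ⟨hq, trivial⟩
          ⟨⟨hq, trivial⟩, hr⟩)) ⟨hq, h41⟩))
  have hbag : (bagvE k (v 40) (v 41)).SumFree :=
    .ite (.lt h41 trivial) ⟨⟨hfc h40, trivial⟩, h41⟩ (.ite (.lt h41 trivial)
      (hx (hfc h40) ⟨h41, trivial⟩) (hw h40))
  exact ⟨⟨hn, trivial, hF⟩, ⟨⟨trivial, hF⟩, hnb, hw hd⟩, ⟨hn, hsz, hsz, hcol⟩, hF, hF, trivial,
    trivial, hbag⟩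

/-- The global variables and the tables describe the window constraints of `D`. -/
structure Tables (D : SatData) (k b : ℕ) (σ : ℕ → ℕ) (w : List ℕ) : Prop where
  var_T : σ 2 = D.T
  var_b : σ 5 = b
  var_J : σ 6 = D.J
  var_Cn : σ 7 = (D.window k b).Cn
  lit : ∀ j < (D.window k b).Cn, ∀ r < 4,
    w.getD (σ 8 + (3 * (4 * j + r) + 0)) 0 = D.δ k b j r ∧
      w.getD (σ 8 + (3 * (4 * j + r) + 1)) 0 = D.β k b j r ∧
      w.getD (σ 8 + (3 * (4 * j + r) + 2)) 0 = D.sg k b j r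
  pow : ∀ i ≤ b, w.getD (σ 9 + i) 0 = 2 ^ i

variable {k} {b : ℕ} {D : SatData} {σ : ℕ → ℕ} {w : List ℕ}

lemma Tables.update (h : Tables D k b σ w) {x : ℕ} (hx : 40 ≤ x) (i : ℕ) :
    Tables D k b (Function.update σ x i) w := by
  have e : ∀ y < 40, Function.update σ x i y = σ y := fun y hy =>
    Function.update_of_ne (by omega) _ _
  refine ⟨?_, ?_, ?_, ?_, ?_, ?_⟩ <;>
    simp only [e 2 (by norm_num), e 5 (by norm_num), e 6 (by norm_num), e 7 (by norm_num),
      e 8 (by norm_num), e 9 (by norm_num)]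
  exacts [h.var_T, h.var_b, h.var_J, h.var_Cn, h.lit, h.pow]

lemma Tables.qE (h : Tables D k b σ w) : qE.eval σ w = (D.window k b).q := by
  rw [Prog.qE, eval_mem, eval_add, eval_v, eval_v, h.var_b]
  exact h.pow b le_rfl

lemma Tables.testsE (h : Tables D k b σ w) : testsE.eval σ w = 3 * (D.window k b).q + 1 := by
  rw [Prog.testsE, eval_add, eval_mul, h.qE, eval_c, eval_c]

lemma Tables.stateE (h : Tables D k b σ w) : (stateE k).eval σ w = (D.window k b).M := by
  rw [Prog.stateE, eval_add, eval_mul, eval_v, h.var_T, eval_c]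
  rfl

lemma Tables.baseE (h : Tables D k b σ w) :
    (baseE k).eval σ w = (D.window k b).M + 3 * (D.window k b).Cn := by
  rw [Prog.baseE, eval_add, eval_mul, eval_v, h.var_Cn, eval_c, h.stateE]

lemma Tables.numTestsE (h : Tables D k b σ w) : numTestsE.eval σ w = (D.window k b).F := by
  rw [Prog.numTestsE, eval_mul, eval_v, h.var_Cn, h.testsE]
  rfl

lemma Tables.numE (h : Tables D k b σ w) : (numE k).eval σ w = (D.window k b).n := by
  rw [Prog.numE, eval_add, h.baseE, h.numTestsE]
  rfl

lemma Tables.fcE (h : Tables D k b σ w) (f : Ex) :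
    (fcE f).eval σ w = (D.window k b).fc (f.eval σ w) := by
  rw [Prog.fcE, eval_div, h.testsE]
  rfl

lemma Tables.feE (h : Tables D k b σ w) (f : Ex) :
    (feE f).eval σ w = (D.window k b).fe (f.eval σ w) := by
  rw [Prog.feE, eval_mod, h.testsE]
  rfl

lemma Tables.xvE (h : Tables D k b σ w) (j r : Ex) :
    (xvE k j r).eval σ w = (D.window k b).xv (j.eval σ w) (r.eval σ w) := by
  rw [Prog.xvE, eval_add, eval_add, h.stateE]
  rfl

lemma Tables.wvE (h : Tables D k b σ w) (f : Ex) :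
    (wvE k f).eval σ w = (D.window k b).wv (f.eval σ w) := by
  rw [Prog.wvE, eval_add, h.baseE]
  rfl

lemma fe_div_lt (f : ℕ) : (D.window k b).fe f / (D.window k b).q < 4 := by
  have h : (D.window k b).fe f < 3 * (D.window k b).q + 1 := Nat.mod_lt _ (by omega)
  have hq : 0 < (D.window k b).q := Nat.two_pow_pos b
  exact div_lt_of_lt_mul_right (by omega)

lemma Tables.nbE (h : Tables D k b σ w) (f i : Ex) (hf : f.eval σ w < (D.window k b).F) :
    (nbE k f i).eval σ w = (D.window k b).nb (f.eval σ w) (i.eval σ w) := by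
  have hl := (h.lit _ (WindowData.fc_lt hf) _
    (fe_div_lt (D := D) (k := k) (b := b) (f.eval σ w))).1
  have ht : (tabE (Prog.fcE f) ((Prog.feE f).div Prog.qE) 0).eval σ w =
      D.δ k b ((D.window k b).fc (f.eval σ w))
        ((D.window k b).fe (f.eval σ w) / (D.window k b).q) := by
    rw [← hl, tabE, eval_mem, eval_add, eval_add, eval_mul, eval_add, eval_mul, eval_div, h.fcE,
      h.feE, h.qE]
    rfl
  rw [Prog.nbE, eval_ite, eval_eq, eval_add, eval_div, ht, h.fcE, h.xvE, h.fcE, eval_sub, eval_v,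
    h.var_J, eval_c, eval_c, WindowData.nb]
  by_cases hi : i.eval σ w = 0 <;> simp [hi]
  rfl

lemma β_le (hb : 0 < b) (j r : ℕ) : D.β k b j r ≤ b := by
  unfold β
  split_ifs <;> first | exact (Nat.mod_lt _ hb).le | omega

lemma Tables.trE (h : Tables D k b σ w) (hb : 0 < b) (j r a : Ex)
    (hj : j.eval σ w < (D.window k b).Cn) (hr : r.eval σ w < 4) : (trE j r a).eval σ w =
      if (D.window k b).tr (j.eval σ w) (r.eval σ w) (a.eval σ w) then 1 else 0 := by
  obtain ⟨-, h1, h2⟩ := h.lit _ hj _ hr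
  have e : ∀ i, (tabE j r i).eval σ w =
      w.getD (σ 8 + (3 * (4 * j.eval σ w + r.eval σ w) + i)) 0 := fun i => rfl
  rw [Prog.trE, eval_eq, eval_mod, eval_div, eval_mem, eval_add, eval_v, e, e, h1, h2,
    h.pow _ (β_le hb _ _)]
  simp only [window, decide_eq_true_eq, eval_c]
  rfl

lemma Tables.sizeE (h : Tables D k b σ w) (u : Ex) :
    (sizeE k u).eval σ w = (D.window k b).len (u.eval σ w) := by
  rw [Prog.sizeE, eval_ite, eval_ite, eval_ite, eval_lt, eval_lt, eval_lt, eval_mul, h.qE, h.feE,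
    eval_sub, h.baseE, h.stateE, WindowData.len]
  simp only [eval_c]
  by_cases h1 : u.eval σ w < (D.window k b).M
  · simp only [h1, if_true, one_ne_zero, if_false]
  by_cases h2 : u.eval σ w < (D.window k b).M + 3 * (D.window k b).Cn
  · simp only [h1, h2, if_true, one_ne_zero, if_false]
  simp only [h1, h2, if_true, if_false]
  by_cases h3 : (D.window k b).fe (u.eval σ w - ((D.window k b).M + 3 * (D.window k b).Cn)) <
      3 * (D.window k b).q
  · simp only [h3, if_true, one_ne_zero, if_false]
  · simp only [h3, if_true, if_false]

lemma Tables.colorE (h : Tables D k b σ w) (hb : 0 < b) (u i : Ex)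
    (hu : u.eval σ w < (D.window k b).n) :
    (colorE k u i).eval σ w = (D.window k b).col (u.eval σ w) (i.eval σ w) := by
  rw [Prog.colorE, eval_ite, eval_ite, eval_ite, eval_lt, eval_lt, eval_lt, eval_mul, h.qE, h.feE,
    eval_sub, h.baseE, h.stateE, WindowData.col, eval_c]
  by_cases h1 : u.eval σ w < (D.window k b).M
  · simp only [h1, if_true, one_ne_zero, if_false]
  by_cases h2 : u.eval σ w < (D.window k b).M + 3 * (D.window k b).Cn
  · simp only [h1, h2, if_true, one_ne_zero, if_false, eval_add, eval_mod, eval_mul, h.qE, eval_c,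
      eval_sub, h.stateE]
  simp only [h1, h2, if_true, if_false]
  by_cases h3 : (D.window k b).fe (u.eval σ w - ((D.window k b).M + 3 * (D.window k b).Cn)) <
      3 * (D.window k b).q
  · have hf : u.eval σ w - ((D.window k b).M + 3 * (D.window k b).Cn) < (D.window k b).F := by
      rw [WindowData.n] at hu
      omega
    have hub : (u.sub (Prog.baseE k)).eval σ w =
        u.eval σ w - ((D.window k b).M + 3 * (D.window k b).Cn) := by rw [eval_sub, h.baseE]
    rw [eval_ite, eval_ite, h.trE hb _ _ _ (by rw [h.fcE, hub]; exact WindowData.fc_lt hf)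
      (by rw [eval_div, h.feE, h.qE]; exact fe_div_lt _)]
    simp only [h3, if_true, one_ne_zero, if_false, eval_eq, eval_c, eval_mod, eval_add, eval_div,
      h.feE, h.fcE, h.qE, hub]
    by_cases h4 : i.eval σ w = 0
    · simp [h4]
    · simp only [h4, if_true, if_false]
      split_ifs <;> simp_all
  · simp only [h3, if_true, if_false, eval_add, h.qE]

lemma Tables.bagvE (h : Tables D k b σ w) (f i : Ex) :
    (bagvE k f i).eval σ w = (D.window k b).bagv (f.eval σ w) (i.eval σ w) := by
  rw [Prog.bagvE, eval_ite, eval_ite, eval_lt, eval_lt, eval_add, eval_div, h.fcE, h.xvE, h.wvE,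
    h.fcE, eval_v, h.var_J, eval_sub, WindowData.bagv]
  simp only [eval_c]
  have hk : (D.window k b).k = k := rfl
  by_cases h1 : i.eval σ w < k + 1
  · simp only [hk, h1, if_true, one_ne_zero, if_false]
    rfl
  by_cases h2 : i.eval σ w < k + 4
  · simp only [hk, h1, h2, if_true, one_ne_zero, if_false]
  · simp only [hk, h1, h2, if_true, if_false]

lemma out_coloringCmd (h : Tables D k b σ w) (hb : 0 < b) : (coloringCmd k).out σ w =
    [(D.window k b).n, (D.window k b).edges.length] ++
    ((D.window k b).edges.flatMap fun e => [e.1, e.2]) ++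
    ((List.range (D.window k b).n).flatMap fun u =>
      ((D.window k b).colors u).length :: (D.window k b).colors u) ++
    ((D.window k b).F :: (List.range (D.window k b).F).flatMap fun f =>
      ((D.window k b).bag f).length :: (D.window k b).bag f) := by
  have e1 : (D.window k b).edges.length = 4 * (D.window k b).F := by simp [WindowData.edges]
  have e2 : ((D.window k b).edges.flatMap fun e => [e.1, e.2]) =
      (List.range (4 * (D.window k b).F)).flatMap fun g =>
        (Cmd.emits (nbE k ((v 40).div (c 4)) ((v 40).mod (c 4))) [wvE k ((v 40).div (c 4))]).out
          (Function.update σ 40 g) w := by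
    rw [WindowData.edges, List.flatMap_map, List.flatMap_def, List.flatMap_def]
    congr 1
    refine List.map_congr_left fun g hg => ?_
    have hg := List.mem_range.1 hg
    have h' := h.update (x := 40) le_rfl g
    have hd : ((v 40).div (c 4)).eval (Function.update σ 40 g) w = g / 4 := by simp
    rw [Cmd.out_emits, List.map_cons, List.map_cons, List.map_nil, h'.wvE,
      h'.nbE _ _ (by rw [hd]; omega), hd]
    simp
  have e3 : ((List.range (D.window k b).n).flatMap fun u =>
      ((D.window k b).colors u).length :: (D.window k b).colors u) =
      (List.range (D.window k b).n).flatMap fun u => (Cmd.seq (.emit (sizeE k (v 40)))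
        (.for' 41 (sizeE k (v 40)) (.emit (colorE k (v 40) (v 41))))).out
          (Function.update σ 40 u) w := by
    rw [List.flatMap_def, List.flatMap_def]
    congr 1
    refine List.map_congr_left fun u hu => ?_
    have hu := List.mem_range.1 hu
    have h' := h.update (x := 40) le_rfl u
    rw [Cmd.out, Cmd.out, Cmd.out, h'.sizeE, eval_v, Function.update_self, WindowData.colors,
      List.length_map, List.length_range, List.singleton_append, List.map_eq_flatMap]
    congr 2
    funext i
    have h'' := h'.update (x := 41) (by norm_num) i
    rw [Cmd.out, h''.colorE hb _ _ (by simpa using hu)]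
    simp
  have e4 : ((List.range (D.window k b).F).flatMap fun f =>
      ((D.window k b).bag f).length :: (D.window k b).bag f) =
      (List.range (D.window k b).F).flatMap fun f => (Cmd.seq (.emit (c (k + 5)))
        (.for' 41 (c (k + 5)) (.emit (bagvE k (v 40) (v 41))))).out
          (Function.update σ 40 f) w := by
    rw [List.flatMap_def, List.flatMap_def]
    congr 1
    refine List.map_congr_left fun f _ => ?_
    have h' := h.update (x := 40) le_rfl f
    rw [Cmd.out, Cmd.out, Cmd.out, WindowData.length_bag, WindowData.bag, eval_c,
      List.singleton_append, List.map_eq_flatMap]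
    congr 2
    funext i
    have h'' := h'.update (x := 41) (by norm_num) i
    rw [Cmd.out, h''.bagvE]
    simp
  rw [e2, e3, e4, e1, coloringCmd, Cmd.out, Cmd.out, Cmd.out, Cmd.out, Cmd.out_emits, Cmd.out,
    Cmd.out, Cmd.out, Cmd.out, eval_mul, h.numTestsE, eval_c, h.numE]
  simp [h.numE, h.numTestsE]

end Prog

end SatData

/-! ### The size of the list coloring instance -/

namespace WindowData

variable {D : WindowData}

lemma le_of_mem_colors (hq : 0 < D.q) {u y : ℕ} (hy : y ∈ D.colors u) : y ≤ D.q + 6 := by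
  obtain ⟨i, hi, rfl⟩ := List.mem_map.1 hy
  have hi := List.mem_range.1 hi
  have h1 := Nat.mod_lt (D.fe (u - (D.M + 3 * D.Cn))) hq
  have h2 : D.fe (u - (D.M + 3 * D.Cn)) / D.q < 4 := by
    have h : D.fe (u - (D.M + 3 * D.Cn)) < 3 * D.q + 1 := Nat.mod_lt _ (by omega)
    exact div_lt_of_lt_mul_right (by omega)
  simp only [len, col] at hi ⊢
  split_ifs at hi ⊢ <;> omega

/-- The word that encodes the list coloring instance. -/
def word (D : WindowData) : List ℕ :=
  [D.n, D.edges.length] ++ (D.edges.flatMap fun e => [e.1, e.2]) ++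
    ((List.range D.n).flatMap fun u => (D.colors u).length :: D.colors u) ++
    (D.F :: (List.range D.F).flatMap fun f => (D.bag f).length :: D.bag f)

lemma length_edges : D.edges.length = 4 * D.F := by simp [edges]

/-- The first `M` lists have `q` colors, all others at most three. -/
lemma length_word_le (hq : 0 < D.q) : D.word.length ≤ D.q * (60 * (D.k + 6) * (D.M + D.Cn + 1)) := by
  have h1 : (D.edges.flatMap fun e => [e.1, e.2]).length ≤ 4 * D.F * 2 := by
    rw [edges, List.flatMap_map]
    exact Cmd.length_flatMap_range_le fun i _ => by simp
  have h2 : ((List.range D.n).flatMap fun u => (D.colors u).length :: D.colors u).length ≤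
      D.M * (D.q + 1) + (3 * D.Cn + D.F) * 4 := by
    rw [show D.n = D.M + (3 * D.Cn + D.F) by rw [n]; omega, List.range_add, List.flatMap_append,
      List.length_append, List.flatMap_map]
    refine Nat.add_le_add (Cmd.length_flatMap_range_le fun u hu => ?_)
      (Cmd.length_flatMap_range_le fun u hu => ?_)
    · simp [colors, len, hu]
    · simp only [colors, len, List.length_map, List.length_range, List.length_cons]
      split_ifs <;> omega
  have h3 : ((List.range D.F).flatMap fun f => (D.bag f).length :: D.bag f).length ≤
      D.F * (D.k + 6) := Cmd.length_flatMap_range_le fun f _ => by simp [length_bag]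
  have hF : D.F ≤ D.q * (4 * D.Cn) := by
    rw [F]
    nlinarith [Nat.mul_le_mul_left D.Cn hq]
  have hF' := Nat.mul_le_mul_right (D.k + 6) hF
  have hC : D.Cn ≤ D.q * D.Cn := Nat.le_mul_of_pos_left _ hq
  have hM : D.M ≤ D.q * D.M := Nat.le_mul_of_pos_left _ hq
  have hk : D.q * (D.M + D.Cn + 1) * 6 ≤ D.q * (D.M + D.Cn + 1) * (D.k + 6) :=
    Nat.mul_le_mul_left _ (by omega)
  have hk' : D.q * D.Cn * (D.k + 6) ≤ D.q * (D.M + D.Cn + 1) * (D.k + 6) :=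
    Nat.mul_le_mul_right _ (Nat.mul_le_mul_left _ (by omega))
  rw [word]
  simp only [List.length_append, List.length_cons, List.length_nil]
  nlinarith

lemma n_le (hq : 0 < D.q) : D.n ≤ D.q * (8 * (D.M + D.Cn)) := by
  rw [n, F]
  nlinarith [Nat.mul_le_mul_left D.Cn hq, Nat.mul_le_mul_left D.M hq]

lemma le_of_mem_word (hq : 0 < D.q) (hδ : ∀ c < D.Cn, ∀ r, D.δ c r ≤ D.k) (hJ : 0 < D.J)
    (hS : 0 < D.Sn) {y : ℕ} (hy : y ∈ D.word) :
    y ≤ D.q * (60 * (D.k + 6) * (D.M + D.Cn + 1)) := by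
  have hF : D.F ≤ D.n := by rw [n]; omega
  have hn := n_le hq
  have hC : 1 ≤ D.Cn := Nat.mul_pos hS hJ
  have h0 : 4 * D.n + D.q + 6 + D.k ≤ D.q * (60 * (D.k + 6) * (D.M + D.Cn + 1)) := by
    have hk : D.q * (D.M + D.Cn + 1) * 6 ≤ D.q * (D.M + D.Cn + 1) * (D.k + 6) :=
      Nat.mul_le_mul_left _ (by omega)
    have hk' : 1 * (D.k + 6) ≤ D.q * (D.M + D.Cn + 1) * (D.k + 6) :=
      Nat.mul_le_mul_right _ (by nlinarith)
    nlinarith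
  refine le_trans ?_ h0
  simp only [word, List.mem_append, List.mem_cons, List.not_mem_nil, or_false, List.mem_flatMap,
    length_edges] at hy
  rcases hy with (((rfl | rfl) | ⟨e, he, rfl | rfl⟩) | ⟨u, -, rfl | hu⟩) | (rfl | ⟨f, hf, rfl | hu⟩)
  · omega
  · omega
  · obtain ⟨f, hf, i, hi, rfl⟩ := mem_edges.1 he
    have := nb_lt hδ hf hi
    rw [n]
    dsimp only
    omega
  · obtain ⟨f, hf, i, hi, rfl⟩ := mem_edges.1 he
    dsimp only
    rw [wv, n]
    omega
  · simp only [colors, len, List.length_map, List.length_range]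
    split_ifs <;> omega
  · have := le_of_mem_colors hq hu
    omega
  · omega
  · rw [length_bag]
    omega
  · have := (rawBags hJ hS).lt f (List.mem_range.1 hf) y hu
    omega

theorem exists_instance (hq : 2 ≤ D.q) (hδ : ∀ c < D.Cn, ∀ r, D.δ c r ≤ D.k) (hJ : 0 < D.J)
    (hS : 0 < D.Sn) : ∃ I : ListColoringInstance, I.encode = D.word ∧
      (I.Colorable ↔ D.Solvable) ∧ I.numVertices = D.n ∧ (∀ d, 1 ≤ d → I.PolySize d) ∧
      HasWidth (bagSets I.bags) (D.k + 4) := by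
  have hC : 1 ≤ D.Cn := Nat.mul_pos hS hJ
  obtain ⟨I, h1, h2, h3, h4, h5⟩ := exists_listColoringInstance (colors := D.colors)
    (edges := D.edges) (rawBags hJ hS)
    (fun e he => by
      obtain ⟨f, hf, i, hi, rfl⟩ := mem_edges.1 he
      have := nb_lt hδ hf hi
      simp only [wv]
      omega)
    (nodup_edges hδ) (fun u _ => nodup_colors (by omega) u)
    (fun e he => by
      obtain ⟨f, hf, i, hi, rfl⟩ := mem_edges.1 he
      exact ⟨f, hf, nb_mem_bag hδ hf hi, mem_bag.2 (Or.inr (Or.inr rfl))⟩)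
  have hF : D.F = D.Cn * (3 * D.q + 1) := rfl
  have hF' : 3 * D.q + 1 ≤ D.F := by nlinarith
  have hn : D.q + 6 < D.n := by
    rw [n]
    omega
  refine ⟨I, h1, h2.trans (colorable_iff hδ (by omega)), h3, fun d hd => ?_, ?_⟩
  · have hp : D.n ≤ D.n ^ d := Nat.le_self_pow (by omega) _
    refine h4 d (fun u _ y hy => ?_) ?_
    · have := le_of_mem_colors (by omega) hy
      omega
    · rw [n] at hp ⊢
      omega
  · refine h5 _ (fun f _ => ?_) ⟨0, by omega, ?_⟩ <;> rw [length_bag]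

end WindowData

/-! ### The formula in memory -/

lemma getD_flatMap_triple {α : Type*} (a b c : α → ℕ) (l : List α) (i : ℕ) (hi : i < l.length) :
    (l.flatMap fun e => [a e, b e, c e]).getD (3 * i + 0) 0 = a l[i] ∧
      (l.flatMap fun e => [a e, b e, c e]).getD (3 * i + 1) 0 = b l[i] ∧
      (l.flatMap fun e => [a e, b e, c e]).getD (3 * i + 2) 0 = c l[i] := by
  induction l generalizing i with
  | nil => simp at hi
  | cons x l ih =>
    cases i with
    | zero => simp
    | succ i =>
      have := ih i (by simpa using hi)
      simpa [mul_add] using this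

namespace ThreeSATInstance

variable (I : ThreeSATInstance)

/-- The clauses as lists of codes of literals. -/
def codeLists : List (List ℕ) :=
  I.clauses.map fun c => c.map fun l => 2 * (l.1 : ℕ) + (if l.2 then 1 else 0)

@[simp] lemma length_codeLists : I.codeLists.length = I.clauses.length := by simp [codeLists]

lemma encode_eq : I.encode =
    twoBlocks [I.numVars, I.clauses.length] I.codeLists (natBags I.bags) := by
  simp [encode, twoBlocks, codeLists, blocks, encodeBags_eq, List.flatMap_map]

end ThreeSATInstance

namespace SatData

open ThreeSATInstance

/-- The data that are read from the word with tables are those of the formula. -/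
theorem ofWord_spec {I : ThreeSATInstance} {ρ : ℕ → ℕ} {w : List ℕ}
    (hw : setupWord [I.numVars, I.clauses.length] I.codeLists (natBags I.bags) <+: w)
    (h0 : ρ 0 = I.encode.length) (h1 : ρ 1 = I.encode.length + (I.clauses.length + 1))
    (h2 : ρ 2 = I.bags.length) (h3 : ρ 3 = I.clauses.length) (hT : 0 < I.bags.length) :
    (ofWord ρ w).Valid ∧ ((ofWord ρ w).Satisfiable ↔ I.Satisfiable) ∧
      (ofWord ρ w).nv = I.numVars ∧ ∀ t (ht : t < I.bags.length),
        (ofWord ρ w).bl t = I.bags[t].length := by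
  obtain ⟨g0, g1, g2, g3, g4⟩ := getD_setupWord hw
  rw [← I.encode_eq, length_codeLists] at *
  have hnb : (natBags I.bags).length = I.bags.length := by simp [natBags]
  rw [hnb] at g3 g4
  rw [← h1] at g3 g4
  rw [← h0] at g1 g2
  set D := ofWord ρ w with hD
  have hnv : D.nv = I.numVars := by
    change w.getD 0 0 = _
    rw [g0 0 (by rw [encode_eq, twoBlocks]; simp)]
    simp [encode]
  have hgd : ∀ c (hc : c < I.clauses.length), I.codeLists.getD c [] =
      I.clauses[c].map fun l => 2 * (l.1 : ℕ) + (if l.2 then 1 else 0) := by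
    intro c hc
    rw [List.getD_eq_getElem _ _ (by simpa using hc)]
    simp [codeLists]
  have hcln : ∀ c (hc : c < I.clauses.length), D.cln c = I.clauses[c].length := by
    intro c hc
    have := g1 c hc
    rw [hgd c hc, List.length_map] at this
    exact this
  have hcll : ∀ c (hc : c < I.clauses.length) i (hi : i < I.clauses[c].length),
      D.cll c i / 2 = I.clauses[c][i].1 ∧ decide (D.cll c i % 2 = 1) = I.clauses[c][i].2 := by
    intro c hc i hi
    have := g2 c hc i (by rw [hgd c hc]; simpa using hi)
    change D.cll c i = _ at this
    rw [hgd c hc, List.getD_eq_getElem _ _ (by simpa using hi), List.getElem_map] at this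
    rw [this]
    cases I.clauses[c][i].2
    · simp
    · simp only [if_true]
      constructor
      · omega
      · rw [decide_eq_true_iff]
        omega
  have hbl : ∀ t (ht : t < I.bags.length), D.bl t = I.bags[t].length := by
    intro t ht
    rw [← length_natBags_getD ht]
    exact g3 t ht
  have hbg : ∀ t < I.bags.length, (List.range (D.bl t)).map (D.bg t) =
      (natBags I.bags).getD t [] := by
    intro t ht
    refine List.ext_getElem (by simp [hbl t ht, ht, natBags]) ?_
    intro x hx hx'
    rw [List.getElem_map, List.getElem_range, ← List.getD_eq_getElem _ 0 hx']
    exact g4 t ht x hx'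
  obtain ⟨hraw, hE⟩ := I.isPathDecomposition.rawBags I.bags_nodup
  have em : D.m = I.clauses.length := h3
  have eT : D.T = I.bags.length := h2
  have hraw' : RawBags D.nv D.T fun t => (List.range (D.bl t)).map (D.bg t) := by
    rw [hnv, eT]
    exact hraw.congr hbg
  have hin : ∀ t < I.bags.length, ∀ x, D.In t x ↔ x ∈ (natBags I.bags).getD t [] := by
    intro t ht x
    rw [← hbg t ht, in_iff]
  refine ⟨⟨hraw', eT ▸ hT, fun c hc => ?_, fun c hc i hi => ?_, fun c hc i hi j hj => ?_⟩, ?_, hnv,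
    hbl⟩
  · rw [em] at hc
    rw [hcln c hc]
    exact I.clauses_length _ (List.getElem_mem hc)
  · rw [em] at hc
    rw [hcln c hc] at hi
    rw [(hcll c hc i hi).1, hnv]
    exact Fin.is_lt _
  · rw [em] at hc
    rw [hcln c hc] at hi hj
    rw [(hcll c hc i hi).1, (hcll c hc j hj).1, eT]
    by_cases hne : I.clauses[c][i].1 = I.clauses[c][j].1
    · obtain ⟨t, ht, hx⟩ := hraw.cover _ (I.clauses[c][i].1).is_lt
      rw [← hin t ht] at hx
      exact ⟨t, ht, hx, hne ▸ hx⟩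
    · obtain ⟨t, ht, hx, hy⟩ := hE I.clauses[c][i].1 I.clauses[c][j].1 (by
        rw [primalGraph, SimpleGraph.fromRel_adj]
        exact ⟨hne, Or.inl ⟨_, List.getElem_mem hc, List.mem_map.2 ⟨_, List.getElem_mem hi, rfl⟩,
          List.mem_map.2 ⟨_, List.getElem_mem hj, rfl⟩⟩⟩)
      rw [← hin t ht] at hx hy
      exact ⟨t, ht, hx, hy⟩
  · constructor
    · rintro ⟨α, hα⟩
      refine ⟨fun x => α x, fun c hc => ?_⟩
      obtain ⟨j, hj, rfl⟩ := List.mem_iff_getElem.1 hc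
      obtain ⟨i, hi, h⟩ := hα j (em ▸ hj)
      rw [hcln j hj] at hi
      rw [(hcll j hj i hi).1, (hcll j hj i hi).2] at h
      exact ⟨_, List.getElem_mem hi, h⟩
    · rintro ⟨α, hα⟩
      refine ⟨fun x => if h : x < I.numVars then α ⟨x, h⟩ else false, fun c hc => ?_⟩
      rw [em] at hc
      obtain ⟨l, hl, h⟩ := hα _ (List.getElem_mem hc)
      obtain ⟨i, hi, rfl⟩ := List.mem_iff_getElem.1 hl
      refine ⟨i, by rwa [hcln c hc], ?_⟩
      beta_reduce
      rw [(hcll c hc i hi).1, (hcll c hc i hi).2, dif_pos (Fin.is_lt _)]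
      exact h

end SatData

/-! ### The reduction from satisfiability to list coloring -/

namespace SatData

open Ex ColData.Prog

namespace Prog

variable (k : ℕ)

/-- The number of bits of a group, from the size of the largest bag. -/
def bitsE : Ex :=
  ((sum 40 (mem (c 0)) ((c 0).lt (sum 41 (v 2) ((v 40).lt (blE (v 41)))))).div (c k)).add (c 1)

/-- Computes the parameters and appends the table of literals. -/
def tables : RAMProg :=
  .seq (assign 5 (bitsE k)) (.seq (assign 6 ((v 3).add ((c 2).mul (mem (c 0)))))
    (.seq (assign 7 (((v 2).mul (c k)).mul (v 6))) (.seq (assign 8 lim)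
      (pass (.for' 40 ((c 4).mul (v 7)) (literalCmd k))))))

/-- Appends the powers of two and the list coloring instance. -/
def finish : RAMProg :=
  .seq (assign 9 lim) (.seq (pass (.emit (c 1))) (.seq (emitAll 40 (v 5) ((c 2).mul last))
    (.seq (assign 11 lim) (pass (coloringCmd k)))))

/-- Loads the number of clauses and the length of the header. -/
def head : RAMProg := .seq (.const 62 1) (.seq (.load 60 62) (.const 61 2))

lemma run_head (w : List ℕ) {V : ℕ} (h : ∀ y ∈ w, y ≤ V) : ∃ s,
    Run head (RAMState.init w) (30 + Nat.size V) s ∧ s.mem = (RAMState.init w).mem ∧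
      (∀ r < 60, s.reg r = 0) ∧ s.reg 60 = w.getD 1 0 ∧ s.reg 61 = 2 := by
  have s1 := size_le (getD_le_iff.2 h 1)
  have e1 : Nat.size 1 = 1 := by decide
  have e2 : Nat.size 2 = 2 := by decide
  refine ⟨_, ((Run.const _ 62 1).seq ((Run.load _ 60 62).seq (Run.const _ 61 2))).mono ?_, rfl,
    fun r hr => ?_, ?_, ?_⟩
  · simp [RAMState.init, e1, e2, -List.getD_eq_getElem?_getD]
    omega
  · have a : r ≠ 60 := by omega
    have b : r ≠ 61 := by omega
    have c : r ≠ 62 := by omega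
    simp [a, b, c, RAMState.init]
  · simp [RAMState.init]
  · simp

lemma eval_bitsE {ρ : ℕ → ℕ} {w : List ℕ} {W : ℕ} (hW : ∀ t < ρ 2, (ofWord ρ w).bl t ≤ W)
    (hW' : ∃ t < ρ 2, (ofWord ρ w).bl t = W) (hn : W ≤ (ofWord ρ w).nv) :
    (bitsE k).eval ρ w = W / k + 1 := by
  have hnv : w.getD 0 0 = (ofWord ρ w).nv := rfl
  rw [bitsE, eval_add, eval_div, eval_c, eval_c, eval_sum, eval_mem, eval_c, hnv,
    ← ColData.Prog.sum_lt_eq hn]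
  congr 2
  refine Finset.sum_congr rfl fun x _ => ?_
  rw [eval_lt, eval_c]
  refine if_congr ?_ rfl rfl
  rw [Nat.pos_iff_ne_zero, eval_sum, ne_eq, Finset.sum_eq_zero_iff]
  have e : ∀ t, ((v 40).lt (blE (v 41))).eval
      (Function.update (Function.update ρ 40 x) 41 t) w = 0 ↔ ¬ x < (ofWord ρ w).bl t := by
    intro t
    rw [eval_lt, eval_blE, ofWord_update (by norm_num), ofWord_update (by norm_num)]
    simp
  simp only [e, Finset.mem_range, eval_v, Function.update_of_ne (by norm_num : (2 : ℕ) ≠ 40)]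
  constructor
  · intro h
    by_contra hc
    exact h fun t ht hx => hc (hx.trans_le (hW t ht))
  · obtain ⟨t, ht, h⟩ := hW'
    exact fun hx hc => hc t ht (h ▸ hx)

/-- After the tables, and once the powers of two are appended, everything is in place that the
command for the list coloring instance reads. -/
lemma tables_spec : ∃ τ, PolyBounded τ ∧ ∀ V ρ w W, Bounds V ρ w →
    (∀ t < ρ 2, (ofWord ρ w).bl t ≤ W) → (∃ t < ρ 2, (ofWord ρ w).bl t = W) →
    W ≤ (ofWord ρ w).nv → ∃ ρ' w', ρ' 5 = W / k + 1 ∧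
      (∀ ρ'' p, w' <+: p → (∀ x < 9, ρ'' x = ρ' x) →
        (∀ i ≤ W / k + 1, p.getD (ρ'' 9 + i) 0 = 2 ^ i) →
          Tables (ofWord ρ w) k (W / k + 1) ρ'' p) ∧
      Tr (tables k) ρ w (τ V) ρ' w' ∧ Bounds (τ V) ρ' w' := by
  obtain ⟨τ, hτ, H⟩ := (does_assign (x := 5) (by norm_num) (bitsE k)).seq
    ((does_assign (x := 6) (by norm_num) ((v 3).add ((c 2).mul (mem (c 0))))).seq
    ((does_assign (x := 7) (by norm_num) (((v 2).mul (c k)).mul (v 6))).seq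
    ((does_assign (x := 8) (by norm_num) lim).seq
    (does_pass (c := .for' 40 ((c 4).mul (v 7)) (literalCmd k))
      ⟨Cmd.emits_emits _ _, Cmd.productive_emits _ _⟩))))
  refine ⟨τ, hτ, fun V ρ w W hb h1 h2 h3 => ?_⟩
  set D := ofWord ρ w with hD
  set b := W / k + 1 with hbdef
  let ρ₁ : ℕ → ℕ := Function.update ρ 5 b
  let ρ₂ : ℕ → ℕ := Function.update ρ₁ 6 D.J
  let ρ₃ : ℕ → ℕ := Function.update ρ₂ 7 (D.window k b).Cn
  let ρ₄ : ℕ → ℕ := Function.update ρ₃ 8 w.length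
  let u : List ℕ := (List.range (4 * (D.window k b).Cn)).flatMap fun g =>
    [D.δ k b (g / 4) (g % 4), D.β k b (g / 4) (g % 4), D.sg k b (g / 4) (g % 4)]
  have e2 : ρ₄ 2 = D.T := by simp [ρ₄, ρ₃, ρ₂, ρ₁, hD, ofWord]
  have e5 : ρ₄ 5 = b := by simp [ρ₄, ρ₃, ρ₂, ρ₁]
  have e6 : ρ₄ 6 = D.J := by simp [ρ₄, ρ₃, ρ₂, ρ₁]
  have e7 : ρ₄ 7 = (D.window k b).Cn := by simp [ρ₄, ρ₃, ρ₂, ρ₁]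
  have e8 : ρ₄ 8 = w.length := by simp [ρ₄, ρ₃, ρ₂, ρ₁]
  have hD4 : ofWord ρ₄ w = D := rfl
  refine ⟨ρ₄, w ++ u, e5, fun ρ' p hp hρ hpow => ?_, H V ρ w ρ₄ (w ++ u) hb
    ⟨ρ₁, w, ⟨?_, rfl⟩, ρ₂, w, ⟨?_, rfl⟩, ρ₃, w, ⟨?_, rfl⟩, ρ₄, w, ⟨?_, rfl⟩, rfl, ?_⟩⟩
  · have hlen : u.length = 4 * (D.window k b).Cn * 3 := by
      simp [u, List.length_flatMap]
    refine ⟨(hρ _ (by norm_num)).trans e2, (hρ _ (by norm_num)).trans e5,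
      (hρ _ (by norm_num)).trans e6, (hρ _ (by norm_num)).trans e7, fun j hj r hr => ?_, hpow⟩
    have hg : 4 * j + r < (List.range (4 * (D.window k b).Cn)).length := by
      rw [List.length_range]
      omega
    have ht := getD_flatMap_triple (fun g => D.δ k b (g / 4) (g % 4))
      (fun g => D.β k b (g / 4) (g % 4)) (fun g => D.sg k b (g / 4) (g % 4)) _ _ hg
    rw [List.getElem_range, (by omega : (4 * j + r) / 4 = j), (by omega : (4 * j + r) % 4 = r)] at ht
    have key : ∀ i < 3, p.getD (ρ' 8 + (3 * (4 * j + r) + i)) 0 = u.getD (3 * (4 * j + r) + i) 0 := by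
      intro i hi
      rw [hρ _ (by norm_num), e8, getD_prefix hp (by rw [List.length_append, hlen]; omega),
        List.getD_append_right _ _ _ _ (by omega), Nat.add_sub_cancel_left]
    exact ⟨(key 0 (by norm_num)).trans ht.1, (key 1 (by norm_num)).trans ht.2.1,
      (key 2 (by norm_num)).trans ht.2.2⟩
  · rw [eval_bitsE k h1 h2 h3]
  · rw [eval_add, eval_mul, eval_mem, eval_c, eval_c, eval_v]
    rfl
  · rw [eval_mul, eval_mul, eval_c, eval_v, eval_v, (by simp [ρ₂] : ρ₂ 6 = D.J)]
    rfl
  · rfl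
  · rw [Cmd.out, eval_mul, eval_c, eval_v, e7]
    simp only [out_literalCmd (σ := ρ₄) (w := w) e5 (e6.trans (by rw [hD4]))]
    rfl

/-- The last part of the program runs in almost linear time. -/
lemma finish_spec : ∃ τ, LogBounded τ ∧ ∀ U ρ w b p, ρ 5 = b →
    p = w ++ [1] ++ (List.range b).map (fun i => 2 ^ (i + 1)) → ∀ ρ',
    ρ' = Function.update (Function.update ρ 9 w.length) 11 p.length → Bounds U ρ w →
    Bounds U ρ' (p ++ (coloringCmd k).out ρ' p) →
    Tr (finish k) ρ w ((1 + U) * τ U) ρ' (p ++ (coloringCmd k).out ρ' p) := by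
  have hl : LogBounded (lim.ct) := Ex.SumFree.logBounded_ct (e := lim) trivial
  have hsz := PolyBounded.id.logBounded_size
  have hv := (Ex.polyBounded_vb lim).logBounded_size
  have hA : LogBounded fun U => lim.ct U + 2 + Nat.size U + Nat.size (lim.vb U) :=
    ((hl.add (.const 2)).add hsz).add hv
  have hlast : ((c 2).mul last).SumFree := ⟨trivial, trivial, trivial⟩
  refine ⟨fun U => (lim.ct U + 2 + Nat.size U + Nat.size (lim.vb U)) +
    ((Cmd.emit (c 1)).ct U + 1 + Nat.size U + (emitAllCt (v 5) ((c 2).mul last) U +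
    ((lim.ct U + 2 + Nat.size U + Nat.size (lim.vb U)) +
      ((coloringCmd k).ct U + 1 + Nat.size U)))),
    hA.add (((((Cmd.SumFree.logBounded_ct (a := .emit (c 1)) trivial)).add (.const 1)).add hsz).add
      ((logBounded_emitAllCt (n := v 5) trivial hlast).add (hA.add
        (((sumFree_coloringCmd k).logBounded_ct.add (.const 1)).add hsz)))), ?_⟩
  rintro U ρ w b p h5 hp ρ' hρ' hb hb'
  have hpre : ∀ i ≤ b, w ++ [1] ++ (List.range i).map (fun i => 2 ^ (i + 1)) <+: p := by
    intro i hi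
    rw [hp]
    refine (List.prefix_append_right_inj _).2 ?_
    obtain ⟨d, hd⟩ := Nat.exists_eq_add_of_le hi
    rw [hd, List.range_add, List.map_append]
    exact List.prefix_append _ _
  have bp : ∀ {w' : List ℕ}, w' <+: p → ∀ {σ : ℕ → ℕ}, (∀ x, σ x ≤ U) → Bounds U σ w' := by
    intro w' h σ hσ
    have h' := h.trans (List.prefix_append p ((coloringCmd k).out ρ' p))
    exact ⟨hσ, getD_le_iff.2 fun y hy => getD_le_iff.1 hb'.entry y (h'.subset hy),
      h'.length_le.trans hb'.length⟩
  have hw : w <+: p := by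
    rw [hp, List.append_assoc]
    exact List.prefix_append _ _
  set ρ₁ : ℕ → ℕ := Function.update ρ 9 w.length with hρ₁
  have b1 : ∀ x, ρ₁ x ≤ U := (hb.update hb.length 9).var
  have h51 : ρ₁ 5 = b := by simp [hρ₁, h5]
  have t1 : Tr (assign 9 lim) ρ w _ ρ₁ w := Tr.assign (by norm_num) hb
  have t2 : Tr (pass (.emit (c 1))) ρ₁ w _ ρ₁ (w ++ [1]) := Tr.pass (c := .emit (c 1))
    (bp hw b1) trivial (by simpa [Cmd.out] using (bp (hpre 0 (Nat.zero_le _)) b1).length)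
  have t3 : Tr (emitAll 40 (v 5) ((c 2).mul last)) ρ₁ (w ++ [1]) _ ρ₁
      (w ++ [1] ++ (List.range b).map fun i => 2 ^ (i + 1)) := Tr.emitAll (V := U) h51
    (bp (hpre b le_rfl) b1) fun i hi => by
      have hl : (w ++ [1] ++ (List.range i).map fun i => 2 ^ (i + 1)).length = w.length + 1 + i := by
        simp
        omega
      rw [eval_mul, eval_c, last, eval_mem, eval_sub, eval_lim, eval_c, hl]
      cases i with
      | zero => simp
      | succ i =>
        rw [List.getD_append_right _ _ _ _ (by simp), List.getD_eq_getElem _ _ (by simp)]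
        simp only [List.getElem_map, List.getElem_range, List.length_append, List.length_cons,
          List.length_nil]
        rw [show w.length + 1 + (i + 1) - 1 - (w.length + (0 + 1)) = i by omega, pow_succ 2 (i + 1),
          mul_comm]
  rw [← hp] at t3
  have t4 := Tr.assign (x := 11) (by norm_num) (e := lim) (bp List.prefix_rfl b1)
  rw [eval_lim, ← hρ'] at t4
  have t5 := Tr.pass (bp List.prefix_rfl hb'.var) (productive_coloringCmd k) hb'.length
  refine (t1.seq (t2.seq (t3.seq (t4.seq t5)))).mono ?_
  have l1 : 1 + ((Cmd.emit (c 1)).out ρ₁ w).length ≤ 1 + U := by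
    have h := (bp (hpre 0 (Nat.zero_le _)) b1).length
    simp only [Cmd.out, List.length_append, List.length_cons, List.length_nil] at h ⊢
    omega
  have l2 : 1 + b ≤ 1 + U := by
    have := b1 5
    omega
  have l3 : 1 + ((coloringCmd k).out ρ' p).length ≤ 1 + U := by
    have := hb'.length
    rw [List.length_append] at this
    omega
  have hone : ∀ x : ℕ, x ≤ (1 + U) * x := fun x => Nat.le_mul_of_pos_left _ (by omega)
  simp only [mul_add (1 + U)] at *
  have a1 := hone (lim.ct U + 2 + Nat.size U + Nat.size (lim.vb U))
  have a2 := Nat.mul_le_mul_right ((Cmd.emit (c 1)).ct U + 1 + Nat.size U) l1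
  have a3 := Nat.mul_le_mul_right (emitAllCt (v 5) ((c 2).mul last) U) l2
  have a4 := Nat.mul_le_mul_right ((coloringCmd k).ct U + 1 + Nat.size U) l3
  simp only [mul_add] at a1 a2 a3 a4 ⊢
  omega

end Prog

end SatData

namespace SatData

open Ex ColData.Prog

lemma size_two_pow_mul_le (b x : ℕ) : Nat.size (2 ^ b * x) ≤ b + Nat.size x := by
  rw [Nat.size_le, pow_add]
  exact Nat.mul_lt_mul_of_pos_left (Nat.lt_size_self x) (by positivity)

/-- A formula with a path decomposition whose largest bag has `pw + 1` variables is turned into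
an instance of list coloring of width `k + 4`. The size of this instance and the time that it
takes to compute it are `2 ^ ((pw + 1) / k + 1)` times a polynomial. -/
theorem exists_reduction {k : ℕ} (hk : 1 ≤ k) : ∃ R τ, PolyBounded τ ∧
    ∀ (J : ThreeSATInstance) (V pw : ℕ), HasWidth (bagSets J.bags) pw → J.encode.length ≤ V →
    (∀ y ∈ J.encode, y ≤ V) → ∃ s ρ p, ∃ I : ListColoringInstance,
      Run R (RAMState.init J.encode) (2 ^ ((pw + 1) / k + 1) * τ V) s ∧
      Rep ρ (p ++ I.encode) s ∧ ρ 11 = p.length ∧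
      (p ++ I.encode).length ≤ 2 ^ ((pw + 1) / k + 1) * τ V ∧
      (∀ a, (p ++ I.encode).getD a 0 ≤ 2 ^ ((pw + 1) / k + 1) * τ V) ∧
      (I.Colorable ↔ J.Satisfiable) ∧ I.numVertices ≤ 2 ^ ((pw + 1) / k + 1) * τ V ∧
      (∀ d, 1 ≤ d → I.PolySize d) ∧ HasWidth (bagSets I.bags) (k + 4) := by
  obtain ⟨τ₁, hτ₁, H₁⟩ := run_setup (c 2) (mem (c 1))
  obtain ⟨τ₂, hτ₂, H₂⟩ := Prog.tables_spec k
  obtain ⟨τ₃, ⟨E, hE⟩, H₃⟩ := Prog.finish_spec k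
  have hV3 : PolyBounded fun V => 3 * V + 2 := ((PolyBounded.const 3).mul .id).add (.const 2)
  let g : ℕ → ℕ := fun V => τ₂ (3 * V + 2) + 2 +
    60 * (k + 6) * ((V * k + k) + V * k * (V + 2 * V) + 1)
  have hg : PolyBounded g := ((hτ₂.comp hV3).add (.const 2)).add ((PolyBounded.const _).mul
    ((((PolyBounded.id.mul (.const k)).add (.const k)).add ((PolyBounded.id.mul (.const k)).mul
      (PolyBounded.id.add ((PolyBounded.const 2).mul .id)))).add (.const 1)))
  let τ : ℕ → ℕ := fun V => 30 + Nat.size V + τ₁ V + τ₂ (3 * V + 2) +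
    (1 + g V) * (E * (1 + (V + 1 + Nat.size (g V)))) + g V
  refine ⟨.seq (setup Prog.head (c 2) (mem (c 1))) (.seq (Prog.tables k) (Prog.finish k)), τ, ?_, ?_⟩
  · exact (((((PolyBounded.const 30).add PolyBounded.id.size).add hτ₁).add (hτ₂.comp hV3)).add
      (((PolyBounded.const 1).add hg).mul ((PolyBounded.const E).mul ((PolyBounded.const 1).add
        ((PolyBounded.id.add (.const 1)).add hg.size))))).add hg
  intro J V pw hw hl hy
  obtain ⟨s, r, hm, hr, h60, h61⟩ := Prog.run_head J.encode hy
  have g1 : J.encode.getD 1 0 = J.clauses.length := by simp [ThreeSATInstance.encode]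
  rw [g1] at h60
  have hJE := J.encode_eq
  obtain ⟨s1, ρ, r1, R1, b1, p0, p1, p2, p3⟩ := H₁ Prog.head [J.numVars, J.clauses.length]
    J.codeLists (natBags J.bags) (30 + Nat.size V) V s (hJE ▸ r) (hJE ▸ hm) hr (by simpa using h60)
    (by simpa using h61) (hJE ▸ hl) (hJE ▸ hy) (fun ρ => by simp) (fun ρ => by
      rw [← hJE, eval_mem, eval_c, g1, J.length_codeLists])
  rw [← hJE] at r1 p0 p1
  rw [J.length_codeLists] at p1 p3
  have hbl : (natBags J.bags).length = J.bags.length := by simp [natBags]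
  rw [hbl] at p2
  obtain ⟨hw1, t₀, ht₀, hw2⟩ := hw.raw J.bags_nodup
  have hT : 0 < J.bags.length := by omega
  set w₁ := setupWord [J.numVars, J.clauses.length] J.codeLists (natBags J.bags) with hw₁
  obtain ⟨hval, hsat, hnv, hbag⟩ := ofWord_spec (ρ := ρ) (List.prefix_refl w₁) p0 p1 p2 p3 hT
  set D := ofWord ρ w₁ with hD
  have em : D.m = J.clauses.length := p3
  have eT : D.T = J.bags.length := p2
  set W := pw + 1 with hW
  have hle : ∀ t < ρ 2, D.bl t ≤ W := fun t ht => by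
    rw [p2] at ht
    rw [hbag t ht, ← length_natBags_getD ht]
    exact hw1 t ht
  have heq : D.bl t₀ = W := by
    rw [hbag t₀ ht₀, ← length_natBags_getD ht₀]
    exact hw2
  have hWn : W ≤ D.nv := by
    have := hval.bags.length_le (f := t₀) (eT ▸ ht₀)
    rwa [List.length_map, List.length_range, heq] at this
  obtain ⟨ρ₁, w₂, h5, htab, htr, hbd⟩ := H₂ _ ρ w₁ W b1 hle ⟨t₀, p2 ▸ ht₀, heq⟩ hWn
  obtain ⟨s2, r2, R2⟩ := htr s1 R1
  set b := W / k + 1 with hb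
  have hb0 : 0 < b := Nat.succ_pos _
  let p := w₂ ++ [1] ++ (List.range b).map fun i => 2 ^ (i + 1)
  let ρ₂ := Function.update (Function.update ρ₁ 9 w₂.length) 11 p.length
  have hpow : ∀ i ≤ b, p.getD (w₂.length + i) 0 = 2 ^ i := by
    intro i hi
    cases i with
    | zero => simp [p]
    | succ i =>
      have hi' : i < b := hi
      have hl' : w₂.length + (i + 1) - (w₂ ++ [1]).length = i := by
        rw [List.length_append, List.length_singleton]
        omega
      simp only [p]
      rw [List.getD_append_right _ _ _ _ (by simp), hl', List.getD_eq_getElem _ _ (by simpa using hi')]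
      simp
  have htabs := htab ρ₂ p (by simp only [p, List.append_assoc]; exact List.prefix_append _ _)
    (fun x hx => by
      have h9 : x ≠ 9 := by omega
      have h11 : x ≠ 11 := by omega
      simp [ρ₂, h9, h11]) (fun i hi => by simpa [ρ₂] using hpow i hi)
  have hword : (Prog.coloringCmd k).out ρ₂ p = (D.window k b).word :=
    Prog.out_coloringCmd htabs hb0
  have hblt : ∀ t < D.T, D.bl t < k * b := fun t ht =>
    (hle t (p2 ▸ eT ▸ ht)).trans_lt (Nat.lt_mul_div_succ W hk)
  have hδ := hval.δ_le hblt
  have hq2 : 2 ≤ (D.window k b).q := by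
    have : 2 ^ 1 ≤ 2 ^ b := Nat.pow_le_pow_right (by norm_num) hb0
    exact this
  have hJ0 : 0 < (D.window k b).J := by
    change 0 < D.m + 2 * D.nv
    omega
  have hS0 : 0 < (D.window k b).Sn := Nat.mul_pos (eT ▸ hT) hk
  obtain ⟨I, hI, hcol, hn, hpoly, hwid⟩ := WindowData.exists_instance hq2 hδ hJ0 hS0
  have hq : (D.window k b).q = 2 ^ b := rfl
  -- all numbers are bounded by `2 ^ b` times a polynomial
  have hencl : 2 + J.clauses.length + J.bags.length ≤ V := by
    have h1 := length_le_blocks J.codeLists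
    have h2 := length_le_blocks (natBags J.bags)
    rw [hJE, twoBlocks] at hl
    simp only [List.length_append, List.length_cons, List.length_nil, J.length_codeLists, hbl]
      at h1 h2 hl
    omega
  have hnV : D.nv ≤ V := hnv ▸ hy _ (by simp [ThreeSATInstance.encode])
  have hpar : (D.window k b).M + (D.window k b).Cn + 1 ≤
      (V * k + k) + V * k * (V + 2 * V) + 1 := by
    have hTV : D.T ≤ V := by omega
    have hJV : D.m + 2 * D.nv ≤ V + 2 * V := by omega
    have h1 : D.T * k ≤ V * k := Nat.mul_le_mul_right _ hTV
    have h2 : D.T * k * (D.m + 2 * D.nv) ≤ V * k * (V + 2 * V) := Nat.mul_le_mul h1 hJV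
    change D.T * k + k + D.T * k * (D.m + 2 * D.nv) + 1 ≤ _
    omega
  set B := (D.window k b).q * (60 * ((D.window k b).k + 6) * ((D.window k b).M + (D.window k b).Cn + 1))
    with hB
  have hBle : ∀ y ∈ I.encode, y ≤ B := fun y hy => by
    rw [hI] at hy
    exact WindowData.le_of_mem_word (by omega) hδ hJ0 hS0 hy
  have hBlen : I.encode.length ≤ B := by
    rw [hI]
    exact WindowData.length_word_le (by omega)
  set U := 2 ^ b * g V with hU
  have hq1 : 1 ≤ 2 ^ b := Nat.one_le_two_pow
  have hbq : b < 2 ^ b := Nat.lt_two_pow_self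
  have hBU : τ₂ (3 * V + 2) + 2 ^ b + 2 ^ b + B ≤ U := by
    have h1 : B ≤ 2 ^ b * (60 * (k + 6) * ((V * k + k) + V * k * (V + 2 * V) + 1)) :=
      Nat.mul_le_mul_left _ (Nat.mul_le_mul_left _ hpar)
    have h2 : 1 * τ₂ (3 * V + 2) ≤ 2 ^ b * τ₂ (3 * V + 2) := Nat.mul_le_mul_right _ hq1
    simp only [hU, g, mul_add (2 ^ b)] at h1 h2 ⊢
    omega
  have hUτ : U ≤ 2 ^ b * τ V := Nat.mul_le_mul_left _ (Nat.le_add_left _ _)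
  clear_value B U
  have hplen : p.length = w₂.length + 1 + b := by simp [p]; omega
  have hw2l := hbd.length
  have hbdU : Bounds U ρ₁ w₂ := hbd.mono (by omega)
  have hbdF : Bounds U ρ₂ (p ++ (D.window k b).word) := by
    have h1 : ∀ x, ρ₂ x ≤ U := by
      intro x
      have := hbdU.var x
      simp only [ρ₂, Function.update_apply]
      split_ifs <;> omega
    have h2 : Bounds U ρ₂ p := by
      refine ⟨h1, getD_le_iff.2 fun y hy => ?_, by omega⟩
      simp only [p, List.mem_append, List.mem_singleton, List.mem_map, List.mem_range] at hy
      rcases hy with (hy | rfl) | ⟨i, hi, rfl⟩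
      · exact getD_le_iff.1 hbdU.entry y hy
      · omega
      · have : 2 ^ (i + 1) ≤ 2 ^ b := Nat.pow_le_pow_right (by norm_num) hi
        omega
    rw [← hI]
    refine h2.append (fun y hy => ?_) ?_
    · have := hBle y hy
      omega
    · rw [List.length_append]
      omega
  obtain ⟨s3, r3, R3⟩ := H₃ U ρ₁ w₂ b p h5 rfl ρ₂ rfl hbdU (hword ▸ hbdF) s2 R2
  rw [hword, ← hI] at R3
  rw [← hI] at hbdF
  refine ⟨s3, ρ₂, p, I, (r1.seq (r2.seq r3)).mono ?_, R3, by simp [ρ₂], hbdF.length.trans hUτ,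
    fun a => (hbdF.entry a).trans hUτ, hcol.trans ((hval.solvable_iff hblt).trans hsat), ?_, hpoly,
    hwid⟩
  · have hbV : b ≤ V + 1 := by
      have : b ≤ W + 1 := Nat.succ_le_succ (Nat.div_le_self W k)
      omega
    have h1 : τ₃ U ≤ E * (1 + (V + 1 + Nat.size (g V))) := by
      refine (hE U).trans (Nat.mul_le_mul_left _ ?_)
      have := size_two_pow_mul_le b (g V)
      rw [← hU] at this
      omega
    have h2 : 1 + U ≤ 2 ^ b * (1 + g V) := by
      rw [mul_add, ← hU]
      omega
    have h3 := Nat.mul_le_mul h2 h1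
    have h4 := Nat.mul_le_mul_right (30 + Nat.size V + τ₁ V + τ₂ (3 * V + 2)) hq1
    simp only [τ]
    rw [mul_add (2 ^ b), mul_add (2 ^ b), ← mul_assoc (2 ^ b) (1 + g V)]
    omega
  · have := hBle I.numVertices (by simp [ListColoringInstance.encode])
    omega

end SatData

/-! ### Sublinear running times -/

/-- A computation reads few memory cells, and it does not depend on the others. -/
lemma RAMExec.exists_read {P : RAMProg} {s s' : RAMState} {t : ℕ} (h : RAMExec P s t s') :
    ∃ A : Finset ℕ, A.card ≤ t ∧ ∀ (r : RAMState) (u : ℕ) (r' : RAMState), r.reg = s.reg →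
      (∀ a ∈ A, r.mem a = s.mem a) → RAMExec P r u r' →
        r'.reg = s'.reg ∧ ∀ a, r.mem a = s.mem a → r'.mem a = s'.mem a := by
  induction h with
  | const s d k =>
    refine ⟨∅, by simp, ?_⟩
    rintro r u r' hr - ⟨⟩
    exact ⟨by simp only [RAMState.setReg, hr], fun a ha => ha⟩
  | arith s op d a b =>
    refine ⟨∅, by simp, ?_⟩
    rintro r u r' hr - ⟨⟩
    exact ⟨by simp only [RAMState.setReg, hr], fun a ha => ha⟩
  | load s d a =>
    refine ⟨{s.reg a}, by rw [Finset.card_singleton]; omega, ?_⟩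
    rintro r u r' hr hm ⟨⟩
    refine ⟨?_, fun a ha => ha⟩
    simp only [RAMState.setReg, hr, hm _ (Finset.mem_singleton_self _)]
  | store s a b =>
    refine ⟨∅, by simp, ?_⟩
    rintro r u r' hr - ⟨⟩
    refine ⟨hr, fun x hx => ?_⟩
    simp only [RAMState.setMem, hr, Function.update_apply, hx]
  | seq _ _ ih1 ih2 =>
    obtain ⟨A, hA, H⟩ := ih1
    obtain ⟨B, hB, K⟩ := ih2
    refine ⟨A ∪ B, (Finset.card_union_le _ _).trans (by omega), ?_⟩
    rintro r u r' hr hm (⟨⟩ | ⟨⟩ | ⟨⟩ | ⟨⟩ | ⟨h1, h2⟩)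
    obtain ⟨a1, a2⟩ := H _ _ _ hr (fun a ha => hm a (Finset.mem_union_left _ ha)) h1
    obtain ⟨b1, b2⟩ := K _ _ _ a1 (fun a ha => a2 a (hm a (Finset.mem_union_right _ ha))) h2
    exact ⟨b1, fun a ha => b2 a (a2 a ha)⟩
  | cond_true h0 _ ih =>
    obtain ⟨A, hA, H⟩ := ih
    refine ⟨A, by omega, ?_⟩
    rintro r u r' hr hm h
    cases h with
    | cond_true _ h => exact H _ _ _ hr hm h
    | cond_false h1 _ => exact absurd (hr ▸ h1) h0
  | cond_false h0 _ ih =>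
    obtain ⟨A, hA, H⟩ := ih
    refine ⟨A, by omega, ?_⟩
    rintro r u r' hr hm h
    cases h with
    | cond_true h1 _ => exact absurd h0 (hr ▸ h1)
    | cond_false _ h => exact H _ _ _ hr hm h
  | loop_true h0 _ _ ih1 ih2 =>
    obtain ⟨A, hA, H⟩ := ih1
    obtain ⟨B, hB, K⟩ := ih2
    refine ⟨A ∪ B, (Finset.card_union_le _ _).trans (by omega), ?_⟩
    rintro r u r' hr hm h
    cases h with
    | loop_true _ h1 h2 =>
      obtain ⟨a1, a2⟩ := H _ _ _ hr (fun a ha => hm a (Finset.mem_union_left _ ha)) h1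
      obtain ⟨b1, b2⟩ := K _ _ _ a1 (fun a ha => a2 a (hm a (Finset.mem_union_right _ ha))) h2
      exact ⟨b1, fun a ha => b2 a (a2 a ha)⟩
    | loop_false h1 => exact absurd (hr ▸ h1) h0
  | loop_false h0 =>
    refine ⟨∅, by simp, ?_⟩
    rintro r u r' hr - h
    cases h with
    | loop_true h1 _ _ => exact absurd h0 (hr ▸ h1)
    | loop_false _ => exact ⟨hr, fun a ha => ha⟩

lemma getD_append_congr {u m m' l : List ℕ} {a : ℕ} (hl : m.length = m'.length)
    (h : ∀ b, a = u.length + b → b < m.length → m.getD b 0 = m'.getD b 0) :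
    (u ++ m ++ l).getD a 0 = (u ++ m' ++ l).getD a 0 := by
  rw [List.append_assoc, List.append_assoc]
  rcases lt_or_ge a u.length with h1 | h1
  · rw [List.getD_append u _ _ _ h1, List.getD_append u _ _ _ h1]
  rw [List.getD_append_right u _ _ _ h1, List.getD_append_right u _ _ _ h1]
  rcases lt_or_ge (a - u.length) m.length with h2 | h2
  · rw [List.getD_append m _ _ _ h2, List.getD_append m' _ _ _ (hl ▸ h2)]
    exact h _ (by omega) h2
  · rw [List.getD_append_right m _ _ _ h2, List.getD_append_right m' _ _ _ (hl ▸ h2), hl]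

namespace ListColoringInstance

/-- Blocks of six vertices, each of them with one edge. Every list has one color; if `x = 6 j + 1`,
then the endpoints of the edge of block `j` have the same color, and if `x = 0`, there is no such
edge. -/
lemma exists_blocks {h : ℕ} (hh : 0 < h) (x : ℕ) : ∃ I : ListColoringInstance,
    I.encode = ([6 * h, h] ++ (List.range h).flatMap fun i => [6 * i, 6 * i + 1]) ++
      ((List.range (6 * h)).flatMap fun u => [1, if u = x then 0 else u % 2]) ++
      (h :: (List.range h).flatMap fun f => 6 :: (List.range 6).map fun i => 6 * f + i) ∧
    (x = 0 → I.Colorable) ∧ ((∃ j < h, x = 6 * j + 1) → ¬ I.Colorable) ∧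
    I.numVertices = 6 * h ∧ (∀ d, 1 ≤ d → I.PolySize d) ∧ HasWidth (bagSets I.bags) 5 := by
  have hb : RawBags (6 * h) h fun f => (List.range 6).map fun i => 6 * f + i := by
    refine ⟨fun f hf y hy => ?_, fun f _ => ?_, fun y hy => ⟨y / 6, by omega, ?_⟩,
      fun i j k hij hjk hk y hi hk' => ?_⟩
    · obtain ⟨i, hi, rfl⟩ := List.mem_map.1 hy
      have := List.mem_range.1 hi
      omega
    · exact List.Nodup.map_on (fun a _ b _ hab => by omega) List.nodup_range
    · exact List.mem_map.2 ⟨y % 6, List.mem_range.2 (by omega), by omega⟩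
    · obtain ⟨a, ha, rfl⟩ := List.mem_map.1 hi
      obtain ⟨b, hb, hab⟩ := List.mem_map.1 hk'
      have ha := List.mem_range.1 ha
      have hb := List.mem_range.1 hb
      exact List.mem_map.2 ⟨a, List.mem_range.2 ha, by omega⟩
  obtain ⟨I, h1, h2, h3, h4, h5⟩ := exists_listColoringInstance
    (edges := (List.range h).map fun i => (6 * i, 6 * i + 1))
    (colors := fun u => [if u = x then 0 else u % 2]) hb
    (fun e he => by
      obtain ⟨i, hi, rfl⟩ := List.mem_map.1 he
      have := List.mem_range.1 hi
      dsimp only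
      omega)
    (List.Nodup.map_on (fun a _ b _ hab => by have := (Prod.ext_iff.1 hab).1; dsimp only at this; omega)
      List.nodup_range) (by simp)
    (fun e he => by
      obtain ⟨i, hi, rfl⟩ := List.mem_map.1 he
      exact ⟨i, List.mem_range.1 hi, List.mem_map.2 ⟨0, by simp, rfl⟩,
        List.mem_map.2 ⟨1, by simp, rfl⟩⟩)
  refine ⟨I, ?_, fun hx => h2.2 ⟨fun u => u % 2, fun u _ => ?_, fun e he => ?_⟩, ?_, h3,
    fun d hd => h4 d (fun u hu y hy => ?_) ?_, h5 5 (by simp) ⟨0, hh, by simp⟩⟩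
  · rw [h1]
    simp [List.flatMap_map]
  · subst hx
    by_cases hu : u = 0 <;> simp [hu]
  · obtain ⟨i, hi, rfl⟩ := List.mem_map.1 he
    dsimp only
    omega
  · rintro ⟨j, hj, rfl⟩ hc
    obtain ⟨f, hf, hf'⟩ := h2.1 hc
    have e1 := hf' (6 * j, 6 * j + 1) (List.mem_map.2 ⟨j, List.mem_range.2 hj, rfl⟩)
    have e2 := hf (6 * j) (by omega)
    have e3 := hf (6 * j + 1) (by omega)
    rw [List.mem_singleton] at e2 e3
    rw [if_neg (by omega)] at e2
    rw [if_pos rfl] at e3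
    exact e1 (by dsimp only; omega)
  · have : 6 * h ≤ (6 * h) ^ d := Nat.le_self_pow (by omega) _
    rw [List.mem_singleton.1 hy]
    split_ifs <;> omega
  · have : 6 * h ≤ (6 * h) ^ d := Nat.le_self_pow (by omega) _
    omega

/-- On inputs of width five, no algorithm for list coloring runs in sublinear time. -/
theorem not_sublinear {d : ℕ} (hd : 1 ≤ d) {ε : ℝ} (hε : 0 < ε) (P : RAMProg) (C : ℝ)
    (H : ∀ I : ListColoringInstance, I.PolySize d → HasWidth (bagSets I.bags) 5 →
      P.DecidesWithin I.encode I.Colorable (C * (I.numVertices : ℝ) ^ (1 - ε))) : False := by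
  -- with `h` blocks there are fewer than `h` steps
  obtain ⟨h, hh, hlt⟩ : ∃ h : ℕ, 0 < h ∧ C * ((6 * h : ℕ) : ℝ) ^ (1 - ε) < h := by
    have h1 : Filter.Tendsto (fun h : ℕ => C * ((6 * h : ℕ) : ℝ) ^ (-ε)) Filter.atTop (nhds (C * 0)) :=
      ((tendsto_rpow_neg_atTop hε).comp (tendsto_natCast_atTop_atTop.comp
        (Filter.tendsto_id.const_mul_atTop' (by norm_num : 0 < 6)))).const_mul C
    rw [mul_zero] at h1
    obtain ⟨h, h2, h3⟩ := ((h1.eventually_lt_const (by norm_num : (0 : ℝ) < 1 / 6)).and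
      (Filter.eventually_gt_atTop 0)).exists
    refine ⟨h, h3, ?_⟩
    have hpos : (0 : ℝ) < ((6 * h : ℕ) : ℝ) := by exact_mod_cast (by omega : 0 < 6 * h)
    rw [sub_eq_add_neg, Real.rpow_add hpos, Real.rpow_one]
    have h4 := mul_lt_mul_of_pos_right h2 hpos
    push_cast at h4 ⊢
    linarith
  obtain ⟨I, hI, hc, -, hn, hp, hw⟩ := exists_blocks hh 0
  obtain ⟨t, s, r, ht, ha⟩ := H I (hp d hd) hw
  obtain ⟨A, hA, hread⟩ := r.exists_read
  have hAh : A.card < h := by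
    rw [hn] at ht
    have : (A.card : ℝ) < h := lt_of_le_of_lt (by exact_mod_cast hA) (ht.trans_lt hlt)
    exact_mod_cast this
  -- the position of the color of the second vertex of a block
  let pos : ℕ → ℕ := fun j => 2 + 2 * h + (2 * (6 * j + 1) + 1)
  obtain ⟨j, hj, hjA⟩ : ∃ j < h, pos j ∉ A := by
    by_contra! hall
    have h1 : (Finset.range h).image pos ⊆ A := by
      intro a ha
      obtain ⟨j, hj, rfl⟩ := Finset.mem_image.1 ha
      exact hall j (Finset.mem_range.1 hj)
    have h2 := Finset.card_le_card h1
    rw [Finset.card_image_of_injective _ (fun a b hab => by simp only [pos] at hab; omega),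
      Finset.card_range] at h2
    omega
  -- the color that is not read is changed so that the answer changes
  obtain ⟨I', hI', -, hc', hn', hp', hw'⟩ := exists_blocks hh (6 * j + 1)
  obtain ⟨t', s', r', ht', ha'⟩ := H I' (hp' d hd) hw'
  have hmem : ∀ a ∈ A, (RAMState.init I'.encode).mem a = (RAMState.init I.encode).mem a := by
    intro a haA
    have hne : a ≠ pos j := fun hc => hjA (hc ▸ haA)
    change I'.encode.getD a 0 = I.encode.getD a 0
    rw [hI, hI']
    have l1 : ([6 * h, h] ++ (List.range h).flatMap fun i => [6 * i, 6 * i + 1]).length =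
        2 + 2 * h := by
      simp [List.length_flatMap]
      omega
    have l2 : ∀ x, ((List.range (6 * h)).flatMap fun u => [1, if u = x then 0 else u % 2]).length =
        6 * h * 2 := by
      intro x
      simp [List.length_flatMap]
    refine getD_append_congr (by rw [l2, l2]) fun b hb hb2 => ?_
    rw [l1] at hb
    rw [l2] at hb2
    have hb' : b / 2 < (List.range (6 * h)).length := by
      rw [List.length_range]
      omega
    have g := fun x => getD_flatMap_pair (fun _ => 1) (fun u => if u = x then 0 else u % 2) _ _ hb'
    rcases Nat.mod_two_eq_zero_or_one b with hb3 | hb3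
    · rw [show b = 2 * (b / 2) by omega, (g _).1, (g _).1]
    · rw [show b = 2 * (b / 2) + 1 by omega, (g _).2, (g _).2, List.getElem_range, if_neg, eq_comm]
      · by_cases hb0 : b / 2 = 0 <;> simp [hb0]
      · simp only [pos] at hne
        omega
  have hreg := (hread (RAMState.init I'.encode) _ _ rfl hmem r').1
  rw [hreg] at ha'
  exact hc' ⟨j, hj, rfl⟩ (ha'.1 (ha.2 (hc rfl)))

end ListColoringInstance

/-! ### Lower bound and equivalence -/

lemma ThreeSATInstance.lt_of_hasWidth {J : ThreeSATInstance} {p : ℕ}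
    (h : HasWidth (bagSets J.bags) p) : p + 1 ≤ J.numVars := by
  obtain ⟨b, -, hb⟩ := h.2
  simpa [hb] using Finset.card_le_univ b

lemma ThreeSATInstance.two_le_size {J : ThreeSATInstance} {p : ℕ}
    (h : HasWidth (bagSets J.bags) p) : 2 ≤ J.size := by
  have h1 := lt_of_hasWidth h
  obtain ⟨b, hb, -⟩ := h.2
  have h2 : 0 < J.bags.length := by
    have := List.length_pos_of_mem hb
    simpa [bagSets] using this
  rw [size]
  omega

lemma ThreeSATInstance.encode_le (J : ThreeSATInstance) (h : 2 ≤ J.size) :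
    J.encode.length ≤ J.size ^ 5 ∧ ∀ y ∈ J.encode, y ≤ J.size ^ 5 := by
  have hbl : ∀ b ∈ J.bags, b.length ≤ J.numVars := fun b hb =>
    ListColoringInstance.length_le_of_nodup (J.bags_nodup b hb)
  have hN : J.size = J.numVars + J.clauses.length + J.bags.length := rfl
  set N := J.size with hNN
  have h5 : N * N * 8 ≤ N ^ 5 := by
    have : 2 ^ 3 ≤ N ^ 3 := Nat.pow_le_pow_left h 3
    calc N * N * 8 ≤ N * N * N ^ 3 := Nat.mul_le_mul_left _ this
      _ = N ^ 5 := by ring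
  have h2 : 2 * N ≤ N * N := Nat.mul_le_mul_right _ h
  constructor
  · have l1 := ListColoringInstance.length_flatMap_le (l := J.clauses)
      (f := fun c => c.length :: c.map fun l => 2 * (l.1 : ℕ) + (if l.2 then 1 else 0)) (B := 4)
      (by intro c hc; simpa [Nat.lt_succ_iff] using J.clauses_length c hc)
    have l3 := ListColoringInstance.length_flatMap_le (l := J.bags)
      (f := fun b => b.length :: b.map Fin.val) (B := J.numVars + 1) (by
        intro b hb; simpa using hbl b hb)
    have e1 : J.encode.length = 2 + (J.clauses.flatMap fun c =>
          c.length :: c.map fun l => 2 * (l.1 : ℕ) + (if l.2 then 1 else 0)).length +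
        (1 + (J.bags.flatMap fun b => b.length :: b.map Fin.val).length) := by
      rw [encode, encodeBags_eq_flatMap]
      simp only [List.length_append, List.length_cons, List.length_nil]
      omega
    have l4 : J.bags.length * (J.numVars + 1) ≤ N * (N + 1) := Nat.mul_le_mul (by omega) (by omega)
    have e2 : N * (N + 1) = N * N + N := by ring
    omega
  · intro y hy
    rw [encode, encodeBags_eq_flatMap] at hy
    simp only [List.mem_append, List.mem_cons, List.not_mem_nil, or_false, List.mem_flatMap,
      List.mem_map] at hy
    rcases hy with (hy | ⟨c, hc, hy⟩) | hy | ⟨b, hb, hy⟩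
    · omega
    · have := J.clauses_length c hc
      rcases hy with hy | ⟨l, -, hy⟩
      · omega
      · have := l.1.2
        split_ifs at hy <;> omega
    · omega
    · have := hbl b hb
      rcases hy with hy | ⟨v, -, hy⟩
      · omega
      · have := v.2
        omega

/-- For `p = k + 4` with `k ≥ 2`, an algorithm for List Coloring in time `O(n ^ (k - ε))` is run
on the instance with `q ≈ 2 ^ (pw / k)` values per group of variables, so `n ^ (k - ε)` is about
`2 ^ (pw * (1 - ε / k))`. Since `k - ε ≥ 1`, the time for the reduction is no larger. -/
theorem not_PPSETH_of_two_le {d k : ℕ} (hd : 1 ≤ d) (hk : 2 ≤ k) {ε : ℝ} (hε : 0 < ε)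
    (P : RAMProg) (C : ℝ)
    (hP : ∀ I : ListColoringInstance, I.PolySize d → HasWidth (bagSets I.bags) (k + 4) →
      P.DecidesWithin I.encode I.Colorable (C * (I.numVertices : ℝ) ^ ((k : ℝ) - ε))) :
    ¬ PPSETH := by
  obtain ⟨R, τ, hτ, hR⟩ := SatData.exists_reduction (by omega : 1 ≤ k)
  obtain ⟨Q, K, hQ⟩ := decidesWithin_comp R P (x := 11) (by norm_num)
  have hσ : PolyBounded fun V => τ V + (1 + τ V) * (K * (1 + (V + 1 + Nat.size (τ V)))) :=
    hτ.add (((PolyBounded.const 1).add hτ).mul ((PolyBounded.const K).mul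
      ((PolyBounded.const 1).add ((PolyBounded.id.add (PolyBounded.const 1)).add hτ.size))))
  obtain ⟨D, hD⟩ := hσ
  set E := (5 + 2) * D with hE
  set δ := min ε 1 with hδ
  have hδ0 : 0 < δ := lt_min hε one_pos
  have hδ1 : δ ≤ 1 := min_le_right _ _
  have hk2 : (2 : ℝ) ≤ k := by exact_mod_cast hk
  set β : ℝ := 2 ^ (1 - δ / k) with hβ
  have hβ0 : 0 < β := by positivity
  have hβ2 : β < 2 := by
    have : 0 < δ / k := by positivity
    calc β < 2 ^ (1 : ℝ) := Real.rpow_lt_rpow_of_exponent_lt (by norm_num) (by linarith)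
      _ = 2 := Real.rpow_one _
  intro hS
  refine hS (2 - β) (by linarith) ⟨Q, (1 + |C|) * 2 ^ k * β, E * k, fun J pw hw => ?_⟩
  have hpn := ThreeSATInstance.lt_of_hasWidth hw
  have hN := ThreeSATInstance.two_le_size hw
  have hnN : J.numVars ≤ J.size := by rw [ThreeSATInstance.size]; omega
  obtain ⟨hl, hy⟩ := J.encode_le hN
  set N := J.size with hNN
  set V := N ^ 5 with hV
  have hNV : N ≤ V := Nat.le_self_pow (by norm_num) N
  obtain ⟨s, ρ, p, I, hs, hrep, h11, hlen, hent, hcol, hnum, hpoly, hwI⟩ := hR J V pw hw hl hy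
  set b := (pw + 1) / k + 1 with hb
  have hbV : b ≤ V + 1 := by
    have := Nat.div_le_self (pw + 1) k
    omega
  refine ((hQ _ _ _ s ρ _ _ _ _ hs hrep h11 hlen hent
    ((hP I (hpoly d hd) hwI).congr hcol))).mono ?_
  have hn1 : (1 : ℝ) ≤ I.numVertices := by
    have := ListColoringInstance.lt_of_hasWidth hwI
    exact_mod_cast (by omega : 1 ≤ I.numVertices)
  have hN1 : (1 : ℝ) ≤ N := by exact_mod_cast (by omega : 1 ≤ N)
  have hVE : ∀ x, x ≤ τ V + (1 + τ V) * (K * (1 + (V + 1 + Nat.size (τ V)))) → x ≤ N ^ E :=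
    fun x hx => hx.trans ((hD _).trans (pow_add_le hN))
  have hτE : τ V ≤ N ^ E := hVE _ (Nat.le_add_right _ _)
  have hq1 : 1 ≤ 2 ^ b := Nat.one_le_two_pow
  have s1 : 2 ^ b * τ V + (1 + (p ++ I.encode).length) * (K * (1 + Nat.size (2 ^ b * τ V))) ≤
      2 ^ b * N ^ E := by
    have e1 : Nat.size (2 ^ b * τ V) ≤ V + 1 + Nat.size (τ V) :=
      (SatData.size_two_pow_mul_le _ _).trans (by omega)
    have e2 : 1 + (p ++ I.encode).length ≤ 2 ^ b * (1 + τ V) := by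
      rw [mul_add]
      omega
    calc _ ≤ 2 ^ b * τ V + 2 ^ b * (1 + τ V) * (K * (1 + (V + 1 + Nat.size (τ V)))) := by
          gcongr
      _ = 2 ^ b * (τ V + (1 + τ V) * (K * (1 + (V + 1 + Nat.size (τ V))))) := by ring
      _ ≤ _ := Nat.mul_le_mul_left _ (hVE _ le_rfl)
  have hqk : ((2 : ℝ) ^ b) ^ ((k : ℝ) - δ) ≤ 2 ^ k * β * β ^ pw := by
    have hbr : (b : ℝ) ≤ (pw + 1) / k + 1 := by
      have := Nat.cast_div_le (α := ℝ) (m := pw + 1) (n := k)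
      rw [hb]
      push_cast at this ⊢
      linarith
    calc ((2 : ℝ) ^ b) ^ ((k : ℝ) - δ) = 2 ^ ((b : ℝ) * (k - δ)) := by
          rw [← Real.rpow_natCast, ← Real.rpow_mul (by norm_num)]
      _ ≤ 2 ^ ((k : ℝ) + (1 - δ / k) * (pw + 1 : ℕ)) := by
          refine Real.rpow_le_rpow_of_exponent_le (by norm_num) ?_
          calc (b : ℝ) * (k - δ) ≤ ((pw + 1) / k + 1) * (k - δ) := by
                gcongr
                linarith
            _ = k + (1 - δ / k) * (pw + 1) - δ := by
                have : (k : ℝ) ≠ 0 := by linarith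
                field_simp
                ring
            _ ≤ _ := by
                push_cast
                linarith
      _ = 2 ^ k * β * β ^ pw := by
          rw [Real.rpow_add (by norm_num), Real.rpow_natCast, Real.rpow_mul_natCast (by norm_num),
            ← hβ, pow_succ]
          ring
  have hA : ((2 : ℝ) ^ b) ^ ((k : ℝ) - δ) * (N : ℝ) ^ (E * k) ≤
      2 ^ k * β * β ^ pw * (N : ℝ) ^ (E * k) := by gcongr
  have t1 : ((2 ^ b * τ V + (1 + (p ++ I.encode).length) *
      (K * (1 + Nat.size (2 ^ b * τ V))) : ℕ) : ℝ) ≤ 2 ^ k * β * β ^ pw * (N : ℝ) ^ (E * k) := by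
    refine le_trans ?_ hA
    calc _ ≤ ((2 ^ b * N ^ E : ℕ) : ℝ) := by exact_mod_cast s1
      _ = (2 : ℝ) ^ b * (N : ℝ) ^ E := by push_cast; rfl
      _ ≤ _ := by
        have e1 : (1 : ℝ) ≤ 2 ^ b := one_le_pow₀ (by norm_num)
        gcongr
        · calc (2 : ℝ) ^ b = ((2 : ℝ) ^ b) ^ (1 : ℝ) := (Real.rpow_one _).symm
            _ ≤ _ := Real.rpow_le_rpow_of_exponent_le e1 (by linarith)
        · exact Nat.le_mul_of_pos_right E (by omega)
  have t2 : C * (I.numVertices : ℝ) ^ ((k : ℝ) - ε) ≤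
      |C| * (2 ^ k * β * β ^ pw * (N : ℝ) ^ (E * k)) := by
    have e1 : (I.numVertices : ℝ) ≤ 2 ^ b * (N : ℝ) ^ E := by
      exact_mod_cast hnum.trans (Nat.mul_le_mul_left _ hτE)
    calc C * (I.numVertices : ℝ) ^ ((k : ℝ) - ε) ≤ |C| * (I.numVertices : ℝ) ^ ((k : ℝ) - δ) := by
          gcongr
          · exact le_abs_self C
          · exact min_le_left _ _
      _ ≤ |C| * (2 ^ b * (N : ℝ) ^ E) ^ ((k : ℝ) - δ) := by
          gcongr
          linarith
      _ = |C| * (((2 : ℝ) ^ b) ^ ((k : ℝ) - δ) * ((N : ℝ) ^ E) ^ ((k : ℝ) - δ)) := by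
          rw [Real.mul_rpow (by positivity) (by positivity)]
      _ ≤ |C| * (((2 : ℝ) ^ b) ^ ((k : ℝ) - δ) * (N : ℝ) ^ (E * k)) := by
          gcongr
          rw [pow_mul (N : ℝ) E k, ← Real.rpow_natCast ((N : ℝ) ^ E) k]
          exact Real.rpow_le_rpow_of_exponent_le (one_le_pow₀ hN1) (by linarith)
      _ ≤ _ := by gcongr
  calc _ ≤ _ := add_le_add t1 t2
    _ = (1 + |C|) * 2 ^ k * β * (2 - (2 - β)) ^ pw * (N : ℝ) ^ (E * k) := by ring

/-- A single width `p` suffices if it is so large that `ε * p ≥ 5`. -/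
theorem exists_width_of_forall_width {d : ℕ}
    (h : ∃ ε : ℝ, 0 < ε ∧ ∃ p₀ : ℕ, 0 < p₀ ∧ ∃ (P : RAMProg) (C : ℝ),
      ∀ p : ℕ, p₀ < p →
        ∀ I : ListColoringInstance, I.PolySize d → HasWidth (bagSets I.bags) p →
          P.DecidesWithin I.encode I.Colorable
            (C * (I.numVertices : ℝ) ^ ((1 - ε) * (p : ℝ)))) :
    ∃ ε : ℝ, 0 < ε ∧ ∃ p : ℕ, 4 < p ∧ ∃ (P : RAMProg) (C : ℝ),
      ∀ I : ListColoringInstance, I.PolySize d → HasWidth (bagSets I.bags) p →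
        P.DecidesWithin I.encode I.Colorable
          (C * (I.numVertices : ℝ) ^ ((p : ℝ) - 4 - ε)) := by
  obtain ⟨ε, hε, p₀, -, P, C, hP⟩ := h
  refine ⟨1, one_pos, p₀ + 5 + ⌈5 / ε⌉₊, by omega, P, |C|, fun I hI hw =>
    (hP _ (by omega) I hI hw).mono ?_⟩
  have hn1 : (1 : ℝ) ≤ I.numVertices := by
    have := ListColoringInstance.lt_of_hasWidth hw
    exact_mod_cast (by omega : 1 ≤ I.numVertices)
  have h5 : 5 ≤ ε * ((p₀ + 5 + ⌈5 / ε⌉₊ : ℕ) : ℝ) := by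
    have h1 := Nat.le_ceil (5 / ε)
    rw [div_le_iff₀ hε] at h1
    push_cast
    have : 0 ≤ ε * (p₀ + 5) := by positivity
    nlinarith
  refine mul_le_mul (le_abs_self C) (Real.rpow_le_rpow_of_exponent_le hn1 ?_)
    (by positivity) (abs_nonneg C)
  linarith

theorem mainTheorem3 (d : ℕ) (hd : 1 ≤ d) :
    List.TFAE [
      ¬ PPSETH,
      ∃ ε : ℝ, 0 < ε ∧ ∃ p : ℕ, 4 < p ∧ ∃ (P : RAMProg) (C : ℝ),
        ∀ I : ListColoringInstance, I.PolySize d → HasWidth (bagSets I.bags) p →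
          P.DecidesWithin I.encode I.Colorable
            (C * (I.numVertices : ℝ) ^ ((p : ℝ) - 4 - ε)),
      ∃ ε : ℝ, 0 < ε ∧ ∃ p₀ : ℕ, 0 < p₀ ∧ ∃ (P : RAMProg) (C : ℝ),
        ∀ p : ℕ, p₀ < p →
          ∀ I : ListColoringInstance, I.PolySize d → HasWidth (bagSets I.bags) p →
            P.DecidesWithin I.encode I.Colorable
              (C * (I.numVertices : ℝ) ^ ((1 - ε) * (p : ℝ)))] := by
  tfae_have 1 → 3 := listColoring_of_not_PPSETH hd
  tfae_have 3 → 2 := exists_width_of_forall_width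
  tfae_have 2 → 1 := by
    rintro ⟨ε, hε, p, hp, P, C, hP⟩
    obtain ⟨k, rfl⟩ := Nat.exists_eq_add_of_lt hp
    rcases Nat.eq_zero_or_pos k with rfl | hk
    · refine (ListColoringInstance.not_sublinear hd hε P C fun I hI hw => ?_).elim
      have := hP I hI hw
      norm_num at this
      exact this
    · have e : 4 + k + 1 = (k + 1) + 4 := by ring
      rw [e] at hP
      refine not_PPSETH_of_two_le hd (k := k + 1) (by omega) hε P C fun I hI hw => ?_
      have := hP I hI hw
      rwa [Nat.cast_add (k + 1) 4, Nat.cast_ofNat, add_sub_cancel_right] at this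
  tfae_finish
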